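/- Let $k$ be a commutative ring. All differential graded $k$-modules are homologically graded by $\mathbb{Z}$, with differential of degree $-1$, and tensor products and $\mathrm{Hom}$-complexes carry the usual Koszul signs; in particular $\partial f = d\circ f-(-1)^{|f|}f\circ d$. For a differential graded module $C$, the prop $\mathrm{End}(C)$ has $\mathrm{End}(C)(n,m)=\mathrm{Hom}(C^{\otimes n},C^{\otimes m})$. The operads $\mathrm{End}(C)$ and $\mathrm{End}^{\mathrm{op}}(C)$ have $\mathrm{End}(C)(m)=\mathrm{Hom}(C,C^{\otimes m})$ and $\mathrm{End}^{\mathrm{op}}(C)(m)=\mathrm{Hom}(C^{\otimes m},C)$. For a prop $\mathcal P$, let $U(\mathcal P)$ be the operad with $U(\mathcal P)(m)=\mathcal P(1,m)$. An operad $\mathcal O$ is an $E_\infty$-operad if each $\mathcal O(m)$ is a free $k[\Sigma_m]$-module in each degree, there is an operad morphism $\mathcal O\to\mathrm{End}(k)$ inducing an isomorphism in homology in each arity, and $\mathcal O(0)=k$. Let $\mathcal S$ be the differential graded prop generated by $\epsilon\in\mathcal S(1,0)_0$, $\Delta\in\mathcal S(1,2)_0$ and $\mu\in\mathcal S(2,1)_1$,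 with differential $$\partial\epsilon=0,\qquad \partial\Delta=0,\qquad \partial\mu=\epsilon\odot\mathrm{id}-\mathrm{id}\odot\epsilon,$$ and with relations $$\epsilon\circ\mu=0,\qquad (\epsilon\odot\mathrm{id})\circ\Delta=\mathrm{id},\qquad (\mathrm{id}\odot\epsilon)\circ\Delta=\mathrm{id},$$ where $\odot$ and $\circ$ are the horizontal and the vertical composition. For a simplicial set $X$ let $\mathrm C_\bullet(X)$ be its normalized chains with coefficients in $k$, and let $\mathrm C^\bullet(X)$ be the normalized cochains, i.e. the graded dual of $\mathrm C_\bullet(X)$, with cochains of dimension $n$ in degree $-n$ and differential $\alpha\mapsto-(-1)^{|\alpha|}\alpha\circ d$. Then the following hold. 1. $U(\mathcal S)$ is an $E_\infty$-operad. 2. For every $d\ge 0$ there is exactly one prop morphism $\varphi_d:\mathcal S\to\mathrm{End}(\mathrm C_\bullet(\Delta^d))$ that sends $\epsilon$ to the augmentation ($[v_0,\dots,v_q]\mapsto 1$ if $q=0$ and $\mapsto 0$ if $q>0$), $\Delta$ to the Alexander–Whitney map $$[v_0,\dots,v_q]\mapsto\sum_{i=0}^q[v_0,\dots,v_i]\otimes[v_i,\dots,v_q],$$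 and $\mu$ to the join map $$[v_0,\dots,v_p]\otimes[v_{p+1},\dots,v_q]\mapsto\begin{cases}(-1)^p\,\mathrm{sign}(\pi)\,[v_{\pi(0)},\dots,v_{\pi(q)}]&\text{if the } v_i \text{ are pairwise distinct,}\\0&\text{otherwise,}\end{cases}$$ where $\pi$ is the permutation that puts the vertices in order. The family $(\varphi_d)_d$ is natural with respect to simplicial maps $\Delta^d\to\Delta^e$. 3. The restricted family $U(\varphi_d):U(\mathcal S)\to\mathrm{End}(\mathrm C_\bullet(\Delta^d))$ extends (by Kan extension from the standard simplices) in exactly one way to a family of operad morphisms $$\Phi_X: U(\mathcal S)\to\mathrm{End}(\mathrm C_\bullet(X)),$$ one for every simplicial set $X$, that is natural in $X$ and satisfies $\Phi_{\Delta^d}=U(\varphi_d)$ for all $d$. Hence the normalized chains of every simplicial set carry a natural $E_\infty$-coalgebra structure. 4. For every simplicial set $X$ there is exactly one operad morphism $$\Psi_X: U(\mathcal S)\to\mathrm{End}^{\mathrm{op}}(\mathrm C^\bullet(X))$$ that is dual to $\Phi_X$, i.e. satisfies, for all homogeneous $a\in U(\mathcal S)(m)$, $\alpha_1,\dots,\alpha_m\in\mathrm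 C^\bullet(X)$ and all $c\in\mathrm C_\bullet(X)$, $$\Psi_X(a)(\alpha_1\otimes\cdots\otimes\alpha_m)(c)=(-1)^{|a|(|\alpha_1|+\cdots+|\alpha_m|)}(\alpha_1\otimes\cdots\otimes\alpha_m)\bigl(\Phi_X(a)(c)\bigr),$$ where $(\alpha_1\otimes\cdots\otimes\alpha_m)(c_1\otimes\cdots\otimes c_m)=(-1)^{\sum_{s<r}|\alpha_r||c_s|}\alpha_1(c_1)\cdots\alpha_m(c_m)$ for homogeneous $c_1,\dots,c_m$. The family $(\Psi_X)_X$ is natural in $X$. Hence the normalized cochains of every simplicial set carry a natural $E_\infty$-algebra structure. -/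

import Mathlib

open CategoryTheory
open scoped TensorProduct DirectSum

universe u v w w'

noncomputable section

namespace DGAlg


/-- A differential graded `k`-module, homologically graded by `ℤ`: a module which is the direct
sum of its homogeneous parts `gr i`, with a differential of degree `-1`. -/
structure DGMod (k : Type u) [CommRing k] where
  carrier : Type w
  [addCommGroup : AddCommGroup carrier]
  [module : Module k carrier]
  gr : ℤ → Submodule k carrier
  isInternal : DirectSum.IsInternal gr
  d : carrier →ₗ[k] carrier
  d_mem : ∀ {i : ℤ} {x : carrier}, x ∈ gr i → d x ∈ gr (i - 1)
  d_d : ∀ x : carrier, d (d x) = 0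

attribute [instance] DGMod.addCommGroup DGMod.module

/-- The sign `(-1) ^ i` in `k`. -/
def sgn (k : Type u) [CommRing k] (i : ℤ) : k := ((i.negOnePow : ℤ) : k)

theorem sgn_odd (k : Type u) [CommRing k] {i : ℤ} (h : Odd i) : sgn k i = -1 := by
  simp [sgn, Int.negOnePow_odd i h]

theorem sgn_even (k : Type u) [CommRing k] {i : ℤ} (h : Even i) : sgn k i = 1 := by
  simp [sgn, Int.negOnePow_even i h]

theorem sgn_add (k : Type u) [CommRing k] (i j : ℤ) : sgn k (i + j) = sgn k i * sgn k j := by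
  simp only [sgn, Int.negOnePow_add, Units.val_mul, Int.cast_mul]

theorem sgn_sum (k : Type u) [CommRing k] {ι : Type*} (s : Finset ι) (e : ι → ℤ) :
    sgn k (∑ r ∈ s, e r) = ∏ r ∈ s, sgn k (e r) := by
  classical
  induction s using Finset.induction_on with
  | empty => simp [sgn_even k Even.zero]
  | insert a s ha ih => rw [Finset.sum_insert ha, Finset.prod_insert ha, sgn_add, ih]

theorem isInternal_of_ker {k : Type u} [CommRing k] {M : Type w} [AddCommGroup M] [Module k M]
    (gr : ℤ → Submodule k M) (htop : ⨆ i, gr i = ⊤) (K : ℤ → Submodule k M)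
    (h1 : ∀ i, ∀ x ∈ gr i, x ∈ K i → x = 0)
    (h2 : ∀ i j, j ≠ i → gr j ≤ K i) : DirectSum.IsInternal gr := by
  refine DirectSum.isInternal_submodule_of_iSupIndep_of_iSup_eq_top ?_ htop
  intro i
  rw [Submodule.disjoint_def]
  intro x hx hx'
  exact h1 i x hx ((iSup₂_le fun j hj => h2 i j hj : (⨆ j, ⨆ (_ : j ≠ i), gr j) ≤ K i) hx')

theorem isInternal_comap {k : Type u} [CommRing k] {M : Type w} [AddCommGroup M] [Module k M]
    (A : ℤ → Submodule k M) (P : Submodule k M) (hP : P = ⨆ i, A i) (K : ℤ → Submodule k M)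
    (h1 : ∀ i, ∀ x ∈ A i, x ∈ K i → x = 0) (h2 : ∀ i j, j ≠ i → A j ≤ K i) :
    DirectSum.IsInternal fun i => (A i).comap P.subtype := by
  refine isInternal_of_ker _ ?_ (fun i => (K i).comap P.subtype) ?_ ?_
  · apply Submodule.map_injective_of_injective P.injective_subtype
    rw [Submodule.map_iSup, Submodule.map_top, Submodule.range_subtype]
    conv_rhs => rw [hP]
    refine iSup_congr fun i => ?_
    rw [Submodule.map_comap_subtype, inf_eq_right, hP]
    exact le_iSup A i
  · exact fun i x hx h => Subtype.ext (h1 i x hx h)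
  · exact fun i j hij x hx => h2 i j hij hx

namespace DGMod

variable {k : Type u} [CommRing k]

/-- The projection of `C` onto the sum of its homogeneous parts of odd degree (`b = true`) or of
even degree (`b = false`). -/
def par (C : DGMod.{u, w} k) (b : Bool) : C.carrier →ₗ[k] C.carrier :=
  (DirectSum.toModule k ℤ C.carrier
      fun i => if decide (Odd i) = b then (C.gr i).subtype else 0) ∘ₗ
    (LinearEquiv.ofBijective (DirectSum.coeLinearMap C.gr) C.isInternal).symm.toLinearMap

theorem par_of_mem (C : DGMod.{u, w} k) (b : Bool) {i : ℤ} {x : C.carrier} (hx : x ∈ C.gr i) :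
    C.par b x = if decide (Odd i) = b then x else 0 := by
  have h : (LinearEquiv.ofBijective (DirectSum.coeLinearMap C.gr) C.isInternal).symm x =
      DirectSum.lof k ℤ (fun i => C.gr i) i ⟨x, hx⟩ := by
    rw [LinearEquiv.symm_apply_eq]
    exact (DirectSum.coeLinearMap_lof C.gr i ⟨x, hx⟩).symm
  simp only [par, LinearMap.comp_apply, LinearEquiv.coe_coe, h, DirectSum.toModule_lof]
  split_ifs <;> rfl

/-- The involution `x ↦ (-1) ^ |x| x`. -/
def tau (C : DGMod.{u, w} k) : C.carrier →ₗ[k] C.carrier := C.par false - C.par true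

theorem tau_of_mem (C : DGMod.{u, w} k) {i : ℤ} {x : C.carrier} (hx : x ∈ C.gr i) :
    C.tau x = sgn k i • x := by
  simp only [tau, LinearMap.sub_apply, C.par_of_mem _ hx]
  by_cases h : Odd i
  · simp [h, sgn_odd k h]
  · simp [h, sgn_even k (Int.not_odd_iff_even.mp h)]

theorem tau_mem (C : DGMod.{u, w} k) {i : ℤ} {x : C.carrier} (hx : x ∈ C.gr i) :
    C.tau x ∈ C.gr i := by
  rw [C.tau_of_mem hx]
  exact (C.gr i).smul_mem _ hx

theorem ext_gr (C : DGMod.{u, w} k) {M : Type w'} [AddCommGroup M] [Module k M]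
    {f g : C.carrier →ₗ[k] M} (h : ∀ i, ∀ x ∈ C.gr i, f x = g x) : f = g := by
  rw [← sub_eq_zero, ← LinearMap.ker_eq_top, eq_top_iff,
    ← C.isInternal.submodule_iSup_eq_top]
  exact iSup_le fun i x hx => by simp [h i x hx]

/-- The base ring, concentrated in degree `0`. -/
def unit (k : Type u) [CommRing k] : DGMod.{u, u} k where
  carrier := k
  gr i := if i = 0 then ⊤ else ⊥
  isInternal := by
    refine isInternal_of_ker _ ?_ (fun i => if i = 0 then ⊥ else ⊤) ?_ ?_
    · exact eq_top_iff.mpr (le_iSup_of_le 0 (by simp))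
    · intro i x hx h
      split_ifs at hx h <;> simp_all
    · intro i j hij
      by_cases hj : j = 0
      · subst hj
        simp [hij.symm]
      · simp [hj]
  d := 0
  d_mem _ := by simp
  d_d _ := rfl

/-- A chain map, i.e. a linear map of degree `0` commuting with the differentials. -/
structure Hom (C : DGMod.{u, w} k) (D : DGMod.{u, w'} k) where
  toLin : C.carrier →ₗ[k] D.carrier
  map_mem : ∀ {i : ℤ} {x : C.carrier}, x ∈ C.gr i → toLin x ∈ D.gr i
  map_d : ∀ x : C.carrier, toLin (C.d x) = D.d (toLin x)

/-- The graded module of the finite sums of elements of the submodules `A i` of `M`, with the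
differential induced by `D`. -/
def ofTotal {M : Type w} [AddCommGroup M] [Module k M] (A : ℤ → Submodule k M)
    (K : ℤ → Submodule k M) (h1 : ∀ i, ∀ x ∈ A i, x ∈ K i → x = 0)
    (h2 : ∀ i j, j ≠ i → A j ≤ K i) (D : M →ₗ[k] M)
    (hD : ∀ x ∈ ⨆ i, A i, D x ∈ ⨆ i, A i) (hA : ∀ i, ∀ x ∈ A i, D x ∈ A (i - 1))
    (hDD : ∀ x, D (D x) = 0) : DGMod.{u, w} k where
  carrier := ↥(⨆ i, A i)
  gr i := (A i).comap (⨆ i, A i).subtype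
  isInternal := isInternal_comap A _ rfl K h1 h2
  d := D.restrict hD
  d_mem h := hA _ _ h
  d_d x := Subtype.ext (hDD x)

/-! ### The graded dual -/

/-- The linear functionals of degree `i`: those that vanish on `C.gr j` for `j ≠ -i`. -/
def dualGr (C : DGMod.{u, w} k) (i : ℤ) : Submodule k ((C.carrier →ₗ[k] k)) where
  carrier := {α | ∀ j, j ≠ -i → ∀ x ∈ C.gr j, α x = 0}
  add_mem' ha hb j hj x hx := by simp [ha j hj x hx, hb j hj x hx]
  zero_mem' _ _ _ _ := rfl
  smul_mem' c α ha j hj x hx := by simp [ha j hj x hx]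

/-- The finite sums of homogeneous linear functionals. -/
def dualTot (C : DGMod.{u, w} k) : Submodule k ((C.carrier →ₗ[k] k)) := ⨆ i, C.dualGr i

theorem dualGr_le (C : DGMod.{u, w} k) (i : ℤ) : C.dualGr i ≤ C.dualTot := le_iSup C.dualGr i

/-- The differential on functionals: `α ↦ -(-1) ^ |α| α ∘ d`. -/
def dualD (C : DGMod.{u, w} k) : (C.carrier →ₗ[k] k) →ₗ[k] (C.carrier →ₗ[k] k) :=
  -(LinearMap.lcomp k k (C.tau ∘ₗ C.d))

theorem dualD_apply (C : DGMod.{u, w} k) (α : (C.carrier →ₗ[k] k)) (x : C.carrier) :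
    C.dualD α x = -α (C.tau (C.d x)) := rfl

theorem dualD_of_mem (C : DGMod.{u, w} k) {i : ℤ} {α : C.carrier →ₗ[k] k}
    (hα : α ∈ C.dualGr i) (x : C.carrier) : C.dualD α x = -(sgn k i * α (C.d x)) := by
  have : C.dualD α = -(sgn k i • (α ∘ₗ C.d)) := by
    refine C.ext_gr fun j y hy => ?_
    rw [dualD_apply, C.tau_of_mem (C.d_mem hy), map_smul]
    by_cases hj : j - 1 = -i
    · simp [hj, sgn]
    · simp [hα _ hj _ (C.d_mem hy)]
  rw [this]
  rfl

theorem dualD_mem (C : DGMod.{u, w} k) {i : ℤ} {α : C.carrier →ₗ[k] k}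
    (hα : α ∈ C.dualGr i) : C.dualD α ∈ C.dualGr (i - 1) := by
  intro j hj x hx
  rw [dualD_apply, hα (j - 1) (by omega) _ (C.tau_mem (C.d_mem hx)), neg_zero]

theorem dualD_mem_tot (C : DGMod.{u, w} k) {α : C.carrier →ₗ[k] k}
    (hα : α ∈ C.dualTot) : C.dualD α ∈ C.dualTot := by
  have : C.dualTot ≤ C.dualTot.comap C.dualD :=
    iSup_le fun i β hβ => C.dualGr_le (i - 1) (C.dualD_mem hβ)
  exact this hα

theorem dualD_dualD (C : DGMod.{u, w} k) (α : C.carrier →ₗ[k] k) : C.dualD (C.dualD α) = 0 := by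
  refine C.ext_gr fun j y hy => ?_
  rw [dualD_apply, dualD_apply, C.tau_of_mem (C.d_mem hy), map_smul, C.d_d]
  simp

/-- The graded dual `Hom(C, k)`: in degree `i` it consists of the functionals on the part of `C` of
degree `-i`, and the differential is `α ↦ -(-1) ^ |α| α ∘ d`. -/
def dual (C : DGMod.{u, w} k) : DGMod.{u, max u w} k :=
  ofTotal C.dualGr (fun i => LinearMap.ker (LinearMap.lcomp k k (C.gr (-i)).subtype))
    (fun i x hx h => C.ext_gr fun j y hy => by
      by_cases hj : j = -i
      · subst hj
        exact LinearMap.congr_fun h ⟨y, hy⟩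
      · exact hx j hj y hy)
    (fun i j hij x hx => LinearMap.ext fun y => hx (-i) (by omega) y.1 y.2)
    C.dualD (fun _ h => C.dualD_mem_tot h) (fun _ _ h => C.dualD_mem h) C.dualD_dualD

/-- The functional underlying an element of the graded dual. -/
def dualVal (C : DGMod.{u, w} k) : C.dual.carrier →ₗ[k] (C.carrier →ₗ[k] k) :=
  C.dualTot.subtype

theorem dual_map_mem {C : DGMod.{u, w} k} {D : DGMod.{u, w'} k} (f : C.Hom D)
    {i : ℤ} {α : D.carrier →ₗ[k] k} (hα : α ∈ D.dualGr i) :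
    LinearMap.lcomp k k f.toLin α ∈ C.dualGr i :=
  fun j hj _ hx => hα j hj _ (f.map_mem hx)

theorem dual_map_mem_tot {C : DGMod.{u, w} k} {D : DGMod.{u, w'} k} (f : C.Hom D)
    {α : D.carrier →ₗ[k] k} (hα : α ∈ D.dualTot) :
    LinearMap.lcomp k k f.toLin α ∈ C.dualTot := by
  have : D.dualTot ≤ C.dualTot.comap (LinearMap.lcomp k k f.toLin) :=
    iSup_le fun i β hβ => C.dualGr_le i (dual_map_mem f hβ)
  exact this hα

/-- The chain map `α ↦ α ∘ f` induced on graded duals by a chain map `f`. -/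
def Hom.dual {C : DGMod.{u, w} k} {D : DGMod.{u, w'} k} (f : C.Hom D) : D.dual.Hom C.dual where
  toLin := (LinearMap.lcomp k k f.toLin).restrict fun _ hα => dual_map_mem_tot f hα
  map_mem {i α} (hα : α.1 ∈ D.dualGr i) := dual_map_mem f hα
  map_d α := by
    refine Subtype.ext (C.ext_gr fun j y hy => ?_)
    change D.dualD α.1 (f.toLin y) = C.dualD (LinearMap.lcomp k k f.toLin α.1) y
    rw [dualD_apply, dualD_apply, C.tau_of_mem (C.d_mem hy),
      D.tau_of_mem (D.d_mem (f.map_mem hy)), map_smul, map_smul, ← f.map_d]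
    rfl

/-! ### Tensor powers and their homomorphisms -/

/-- The tensor power `C^{⊗ n}`. -/
abbrev TPow (C : DGMod.{u, w} k) (n : ℕ) : Type (max u w) := ⨂[k] _ : Fin n, C.carrier

/-- The part of degree `i` of `C^{⊗ n}`. -/
def tgr (C : DGMod.{u, w} k) (n : ℕ) (i : ℤ) : Submodule k (C.TPow n) :=
  Submodule.span k {y | ∃ (e : Fin n → ℤ) (x : Fin n → C.carrier),
    (∀ r, x r ∈ C.gr (e r)) ∧ ∑ r, e r = i ∧ y = PiTensorProduct.tprod k x}

theorem tprod_mem_tgr (C : DGMod.{u, w} k) {n : ℕ} {e : Fin n → ℤ} {x : Fin n → C.carrier}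
    (hx : ∀ r, x r ∈ C.gr (e r)) {i : ℤ} (hi : ∑ r, e r = i) :
    PiTensorProduct.tprod k x ∈ C.tgr n i :=
  Submodule.subset_span ⟨e, x, hx, hi, rfl⟩

/-- The differential of `C^{⊗ n}`:
`d (x₁ ⊗ ⋯ ⊗ xₙ) = ∑ r, (-1) ^ (|x₁| + ⋯ + |xᵣ₋₁|) x₁ ⊗ ⋯ ⊗ d xᵣ ⊗ ⋯ ⊗ xₙ`. -/
def td (C : DGMod.{u, w} k) (n : ℕ) : C.TPow n →ₗ[k] C.TPow n :=
  ∑ r : Fin n, PiTensorProduct.map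
    fun s => if s < r then C.tau else if s = r then C.d else LinearMap.id

/-- The involution `x ↦ (-1) ^ |x| x` of `C^{⊗ n}`. -/
def ttau (C : DGMod.{u, w} k) (n : ℕ) : C.TPow n →ₗ[k] C.TPow n :=
  PiTensorProduct.map fun _ => C.tau

theorem td_mem (C : DGMod.{u, w} k) {n : ℕ} {i : ℤ} {x : C.TPow n} (hx : x ∈ C.tgr n i) :
    C.td n x ∈ C.tgr n (i - 1) := by
  have : C.tgr n i ≤ (C.tgr n (i - 1)).comap (C.td n) := by
    refine Submodule.span_le.mpr ?_
    rintro _ ⟨e, x, he, rfl, rfl⟩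
    simp only [td, Submodule.comap_coe, Set.mem_preimage, SetLike.mem_coe, LinearMap.sum_apply,
      PiTensorProduct.map_tprod]
    refine Submodule.sum_mem _ fun r _ => ?_
    refine C.tprod_mem_tgr (e := fun s => if s = r then e s - 1 else e s) (fun s => ?_) ?_
    · by_cases h : s = r
      · subst h
        simpa using C.d_mem (he s)
      · simp only [h, if_false]
        split_ifs
        · exact C.tau_mem (he s)
        · exact he s
    · have : ∀ s, (if s = r then e s - 1 else e s) = e s - if s = r then 1 else 0 := by
        intro s; split_ifs <;> simp
      simp [this, Finset.sum_sub_distrib]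
  exact this hx

theorem ttau_of_mem (C : DGMod.{u, w} k) {n : ℕ} {i : ℤ} {x : C.TPow n} (hx : x ∈ C.tgr n i) :
    C.ttau n x = sgn k i • x := by
  have : C.tgr n i ≤ LinearMap.ker (C.ttau n - sgn k i • LinearMap.id) := by
    refine Submodule.span_le.mpr ?_
    rintro _ ⟨e, x, he, rfl, rfl⟩
    have h : ∀ r, C.tau (x r) = sgn k (e r) • x r := fun r => C.tau_of_mem (he r)
    simp only [SetLike.mem_coe, LinearMap.mem_ker, LinearMap.sub_apply, ttau,
      PiTensorProduct.map_tprod, h, MultilinearMap.map_smul_univ, ← sgn_sum]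
    simp
  have h := this hx
  rw [LinearMap.mem_ker, LinearMap.sub_apply, sub_eq_zero] at h
  simpa using h

/-- The linear maps `C^{⊗ n} → C^{⊗ m}` of degree `i`. -/
def homDeg (C : DGMod.{u, w} k) (n m : ℕ) (i : ℤ) : Submodule k (C.TPow n →ₗ[k] C.TPow m) where
  carrier := {f | ∀ j, ∀ x ∈ C.tgr n j, f x ∈ C.tgr m (i + j)}
  add_mem' hf hg j x hx := Submodule.add_mem _ (hf j x hx) (hg j x hx)
  zero_mem' _ _ _ := Submodule.zero_mem _
  smul_mem' c _ hf j x hx := Submodule.smul_mem _ c (hf j x hx)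

/-- The map `f^{⊗ n}`. -/
def tmap {C : DGMod.{u, w} k} {D : DGMod.{u, w'} k} (f : C.Hom D) (n : ℕ) :
    C.TPow n →ₗ[k] D.TPow n :=
  PiTensorProduct.map fun _ => f.toLin

/-- The differential of the complex of homomorphisms: `∂ f = d ∘ f - (-1) ^ |f| f ∘ d`. -/
def homD (C : DGMod.{u, w} k) (n m : ℕ) {i j : ℤ} (h : j + 1 = i) :
    C.homDeg n m i →ₗ[k] C.homDeg n m j :=
  LinearMap.restrict
    (LinearMap.llcomp k (C.TPow n) (C.TPow m) (C.TPow m) (C.td m) -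
      sgn k i • LinearMap.lcomp k (C.TPow m) (C.td n))
    fun f hf l x hx => by
      have h1 := C.td_mem (hf l x hx)
      have h2 := hf _ _ (C.td_mem hx)
      rw [show i + l - 1 = j + l by omega] at h1
      rw [show i + (l - 1) = j + l by omega] at h2
      exact Submodule.sub_mem _ h1 (Submodule.smul_mem _ _ h2)

theorem homD_apply (C : DGMod.{u, w} k) (n m : ℕ) {i j : ℤ} (h : j + 1 = i)
    (f : C.homDeg n m i) (x : C.TPow n) :
    (C.homD n m h f).1 x = C.td m (f.1 x) - sgn k i • f.1 (C.td n x) := rfl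

/-- Composition of homogeneous homomorphisms. -/
def homComp (C : DGMod.{u, w} k) {n r m : ℕ} {i j l : ℤ} (h : i + j = l) :
    C.homDeg r m i →ₗ[k] C.homDeg n r j →ₗ[k] C.homDeg n m l :=
  LinearMap.mk₂ k (fun f g => ⟨f.1 ∘ₗ g.1, fun t x hx => by
      have := f.2 _ _ (g.2 t x hx)
      rwa [← add_assoc, h] at this⟩)
    (fun _ _ _ => Subtype.ext (LinearMap.add_comp _ _ _))
    (fun _ _ _ => Subtype.ext (LinearMap.smul_comp _ _ _))
    (fun _ _ _ => Subtype.ext (LinearMap.comp_add _ _ _))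
    (fun _ _ _ => Subtype.ext (LinearMap.comp_smul _ _ _))

/-- The identification `C^{⊗ n₁} ⊗ C^{⊗ n₂} = C^{⊗ (n₁ + n₂)}` by concatenation. -/
def tcat (C : DGMod.{u, w} k) {n₁ n₂ n : ℕ} (h : n₁ + n₂ = n) :
    (C.TPow n₁ ⊗[k] C.TPow n₂) ≃ₗ[k] C.TPow n :=
  PiTensorProduct.tmulEquiv k C.carrier ≪≫ₗ
    PiTensorProduct.reindex k (fun _ => C.carrier) (finSumFinEquiv.trans (finCongr h))

theorem tcat_tprod (C : DGMod.{u, w} k) {n₁ n₂ n : ℕ} (h : n₁ + n₂ = n)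
    (x : Fin n₁ → C.carrier) (y : Fin n₂ → C.carrier) :
    C.tcat h (PiTensorProduct.tprod k x ⊗ₜ[k] PiTensorProduct.tprod k y) =
      PiTensorProduct.tprod k (Fin.append x y ∘ Fin.cast h.symm) := by
  subst h
  simp only [tcat, LinearEquiv.trans_apply, PiTensorProduct.tmulEquiv_apply]
  rw [PiTensorProduct.reindex_tprod]
  congr 1
  ext i
  induction i using Fin.addCases <;> simp

theorem tcat_mem (C : DGMod.{u, w} k) {n₁ n₂ n : ℕ} (h : n₁ + n₂ = n) {i j l : ℤ}
    (hl : i + j = l) {x : C.TPow n₁} {y : C.TPow n₂} (hx : x ∈ C.tgr n₁ i) (hy : y ∈ C.tgr n₂ j) :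
    C.tcat h (x ⊗ₜ[k] y) ∈ C.tgr n l := by
  refine Submodule.span_induction (p := fun x _ => C.tcat h (x ⊗ₜ[k] y) ∈ C.tgr n l)
    ?_ (by simp) (fun a b _ _ ha hb => ?_) (fun c a _ ha => ?_) hx
  · rintro _ ⟨e, x, he, rfl, rfl⟩
    refine Submodule.span_induction
      (p := fun y _ => C.tcat h (PiTensorProduct.tprod k x ⊗ₜ[k] y) ∈ C.tgr n l)
      ?_ (by simp) (fun a b _ _ ha hb => ?_) (fun c a _ ha => ?_) hy
    · rintro _ ⟨e', y, he', rfl, rfl⟩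
      rw [tcat_tprod]
      subst h
      refine C.tprod_mem_tgr (e := Fin.append e e') (fun r => ?_) ?_
      · induction r using Fin.addCases with
        | left r => simpa using he r
        | right r => simpa using he' r
      · rw [Fin.sum_univ_add]
        simpa using hl
    · rw [TensorProduct.tmul_add, map_add]
      exact Submodule.add_mem _ ha hb
    · rw [TensorProduct.tmul_smul, map_smul]
      exact Submodule.smul_mem _ _ ha
  · rw [TensorProduct.add_tmul, map_add]
    exact Submodule.add_mem _ ha hb
  · rw [← TensorProduct.smul_tmul', map_smul]
    exact Submodule.smul_mem _ _ ha

/-- The tensor product of homogeneous homomorphisms, with the Koszul sign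
`(f ⊗ g) (x ⊗ y) = (-1) ^ (|g| |x|) f x ⊗ g y`. -/
def homTensor (C : DGMod.{u, w} k) {n₁ n₂ n m₁ m₂ m : ℕ} (hn : n₁ + n₂ = n) (hm : m₁ + m₂ = m)
    {i j l : ℤ} (h : i + j = l) :
    C.homDeg n₁ m₁ i →ₗ[k] C.homDeg n₂ m₂ j →ₗ[k] C.homDeg n m l :=
  LinearMap.mk₂ k (fun f g => ⟨(C.tcat hm).toLinearMap ∘ₗ
      TensorProduct.map (if Odd j then f.1 ∘ₗ C.ttau n₁ else f.1) g.1 ∘ₗ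
        (C.tcat hn).symm.toLinearMap, by
      intro t x hx
      refine Submodule.span_induction (p := fun x _ => ((C.tcat hm).toLinearMap ∘ₗ
        TensorProduct.map (if Odd j then f.1 ∘ₗ C.ttau n₁ else f.1) g.1 ∘ₗ
        (C.tcat hn).symm.toLinearMap) x ∈ C.tgr m (l + t))
        ?_ (by simp) (fun a b _ _ ha hb => ?_) (fun c a _ ha => ?_) hx
      · rintro _ ⟨e, x, he, rfl, rfl⟩
        subst hn
        have hx' : PiTensorProduct.tprod k x = C.tcat rfl
            (PiTensorProduct.tprod k (fun r => x (Fin.castAdd n₂ r)) ⊗ₜ[k]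
              PiTensorProduct.tprod k (fun r => x (Fin.natAdd n₁ r))) := by
          rw [tcat_tprod]
          congr 1
          ext r
          induction r using Fin.addCases <;> simp
        rw [hx']
        simp only [LinearMap.comp_apply, LinearEquiv.coe_coe, LinearEquiv.symm_apply_apply,
          TensorProduct.map_tmul]
        have h1 := C.tprod_mem_tgr (fun r => he (Fin.castAdd n₂ r)) rfl
        have h2 := C.tprod_mem_tgr (fun r => he (Fin.natAdd n₁ r)) rfl
        refine C.tcat_mem hm ?_ (i := i + ∑ r, e (Fin.castAdd n₂ r)) ?_ (g.2 _ _ h2)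
        · rw [Fin.sum_univ_add]
          omega
        · split_ifs
          · rw [LinearMap.comp_apply, C.ttau_of_mem h1]
            exact f.2 _ _ (Submodule.smul_mem _ _ h1)
          · exact f.2 _ _ h1
      · rw [map_add]
        exact Submodule.add_mem _ ha hb
      · rw [map_smul]
        exact Submodule.smul_mem _ _ ha⟩)
    (fun _ _ _ => Subtype.ext (by
      split_ifs <;> simp [LinearMap.add_comp, TensorProduct.map_add_left, LinearMap.comp_add]))
    (fun _ _ _ => Subtype.ext (by
      split_ifs <;> simp [LinearMap.smul_comp, TensorProduct.map_smul_left, LinearMap.comp_smul]))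
    (fun _ _ _ => Subtype.ext (by
      simp [LinearMap.add_comp, TensorProduct.map_add_right, LinearMap.comp_add]))
    (fun _ _ _ => Subtype.ext (by
      simp [LinearMap.smul_comp, TensorProduct.map_smul_right, LinearMap.comp_smul]))

/-- The Koszul sign of a permutation of homogeneous elements, `s r` telling whether the `r`-th
element has odd degree: a factor `-1` for each inversion between two odd elements. -/
def permSign (k : Type u) [CommRing k] {n : ℕ} (σ : Equiv.Perm (Fin n)) (s : Fin n → Bool) : k :=
  ∏ p : Fin n × Fin n,
    if p.1 < p.2 ∧ σ p.2 < σ p.1 ∧ s p.1 = true ∧ s p.2 = true then -1 else 1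

/-- The action of a permutation on `C^{⊗ n}`: the `r`-th factor is moved to the place `σ r`, with
the Koszul sign. -/
def tperm (C : DGMod.{u, w} k) {n : ℕ} (σ : Equiv.Perm (Fin n)) : C.TPow n →ₗ[k] C.TPow n :=
  ∑ s : Fin n → Bool, permSign k σ s •
    ((PiTensorProduct.reindex k (fun _ => C.carrier) σ).toLinearMap ∘ₗ
      PiTensorProduct.map fun r => C.par (s r))

theorem tperm_tprod (C : DGMod.{u, w} k) {n : ℕ} (σ : Equiv.Perm (Fin n)) {e : Fin n → ℤ}
    {x : Fin n → C.carrier} (hx : ∀ r, x r ∈ C.gr (e r)) :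
    C.tperm σ (PiTensorProduct.tprod k x) =
      permSign k σ (fun r => decide (Odd (e r))) • PiTensorProduct.tprod k (x ∘ σ.symm) := by
  simp only [tperm, LinearMap.sum_apply, LinearMap.smul_apply, LinearMap.comp_apply,
    PiTensorProduct.map_tprod, LinearEquiv.coe_coe]
  rw [Finset.sum_eq_single fun r => decide (Odd (e r))]
  · have : (fun r => C.par (decide (Odd (e r))) (x r)) = x := by
      ext r
      simp [C.par_of_mem _ (hx r)]
    simp only [this, PiTensorProduct.reindex_tprod]
    rfl
  · intro s _ hs
    obtain ⟨r, hr⟩ := Function.ne_iff.mp hs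
    have h0 : PiTensorProduct.tprod k (fun r => C.par (s r) (x r)) = 0 :=
      MultilinearMap.map_coord_zero _ r (by rw [C.par_of_mem _ (hx r), if_neg hr.symm])
    rw [h0]
    simp
  · simp

theorem tperm_mem (C : DGMod.{u, w} k) {n : ℕ} (σ : Equiv.Perm (Fin n)) :
    C.tperm σ ∈ C.homDeg n n 0 := by
  intro i x hx
  have : C.tgr n i ≤ (C.tgr n (0 + i)).comap (C.tperm σ) := by
    refine Submodule.span_le.mpr ?_
    rintro _ ⟨e, x, he, rfl, rfl⟩
    simp only [Submodule.comap_coe, Set.mem_preimage, SetLike.mem_coe, C.tperm_tprod σ he]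
    refine Submodule.smul_mem _ _
      (C.tprod_mem_tgr (e := e ∘ σ.symm) (fun r => he _) ?_)
    rw [zero_add]
    exact Equiv.sum_comp σ.symm e
  exact this hx

end DGMod

/-! ### Props and operads -/

/-- The data underlying a prop `P` in differential graded `k`-modules: the homogeneous parts
`obj n m i = P(n, m)_i`, the differentials, the vertical compositions
`P(r, m) ⊗ P(n, r) → P(n, m)`, the horizontal compositions
`P(n₁, m₁) ⊗ P(n₂, m₂) → P(n₁ + n₂, m₁ + m₂)`, and the morphisms `perm σ ∈ P(n, n)₀` given by the
permutations `σ`, of which `perm 1` is the identity. The right action of `σ` on `P(n, m)` is vertical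
composition with `perm σ` on the input side, the left one on the output side.
All equations between arities and degrees are explicit arguments. The axioms of a prop play no role
in the notion of a morphism of props, so they are not part of the data. -/
structure DGProp (k : Type u) [CommRing k] where
  obj : ℕ → ℕ → ℤ → Type w
  [addCommGroup : ∀ n m i, AddCommGroup (obj n m i)]
  [module : ∀ n m i, Module k (obj n m i)]
  d : ∀ {n m : ℕ} {i j : ℤ}, j + 1 = i → obj n m i →ₗ[k] obj n m j
  vcomp : ∀ {n r m : ℕ} {i j l : ℤ}, i + j = l → obj r m i →ₗ[k] obj n r j →ₗ[k] obj n m l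
  hcomp : ∀ {n₁ n₂ n m₁ m₂ m : ℕ} {i j l : ℤ}, n₁ + n₂ = n → m₁ + m₂ = m → i + j = l →
    obj n₁ m₁ i →ₗ[k] obj n₂ m₂ j →ₗ[k] obj n m l
  perm : ∀ {n : ℕ}, Equiv.Perm (Fin n) → obj n n 0

attribute [instance] DGProp.addCommGroup DGProp.module

/-- The data underlying an operad `O` in differential graded `k`-modules: the homogeneous parts
`obj m i = O(m)_i`, the differentials, the unit, the partial compositions
`comp p q a b = a ∘_{p + 1} b` for `a ∈ O(p + 1 + q)`, and the left actions of the symmetric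
groups. -/
structure DGOperad (k : Type u) [CommRing k] where
  obj : ℕ → ℤ → Type w
  [addCommGroup : ∀ m i, AddCommGroup (obj m i)]
  [module : ∀ m i, Module k (obj m i)]
  d : ∀ {m : ℕ} {i j : ℤ}, j + 1 = i → obj m i →ₗ[k] obj m j
  one : obj 1 0
  comp : ∀ (p q : ℕ) {m n l : ℕ} {i j t : ℤ}, p + 1 + q = m → p + n + q = l → i + j = t →
    obj m i →ₗ[k] obj n j →ₗ[k] obj l t
  act : ∀ {m : ℕ} {i : ℤ}, Equiv.Perm (Fin m) → obj m i →ₗ[k] obj m i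

attribute [instance] DGOperad.addCommGroup DGOperad.module

/-- Morphisms of props. -/
@[ext]
structure DGProp.Hom {k : Type u} [CommRing k] (P : DGProp.{u, w} k) (Q : DGProp.{u, w'} k) where
  map : ∀ {n m : ℕ} {i : ℤ}, P.obj n m i →ₗ[k] Q.obj n m i
  map_d : ∀ {n m : ℕ} {i j : ℤ} (h : j + 1 = i) (a : P.obj n m i), map (P.d h a) = Q.d h (map a)
  map_vcomp : ∀ {n r m : ℕ} {i j l : ℤ} (h : i + j = l) (a : P.obj r m i) (b : P.obj n r j),
    map (P.vcomp h a b) = Q.vcomp h (map a) (map b)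
  map_hcomp : ∀ {n₁ n₂ n m₁ m₂ m : ℕ} {i j l : ℤ} (hn : n₁ + n₂ = n) (hm : m₁ + m₂ = m)
    (h : i + j = l) (a : P.obj n₁ m₁ i) (b : P.obj n₂ m₂ j),
    map (P.hcomp hn hm h a b) = Q.hcomp hn hm h (map a) (map b)
  map_perm : ∀ {n : ℕ} (σ : Equiv.Perm (Fin n)), map (P.perm σ) = Q.perm σ

/-- Morphisms of operads. -/
@[ext]
structure DGOperad.Hom {k : Type u} [CommRing k] (O : DGOperad.{u, w} k) (O' : DGOperad.{u, w'} k)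
    where
  map : ∀ {m : ℕ} {i : ℤ}, O.obj m i →ₗ[k] O'.obj m i
  map_d : ∀ {m : ℕ} {i j : ℤ} (h : j + 1 = i) (a : O.obj m i), map (O.d h a) = O'.d h (map a)
  map_one : map O.one = O'.one
  map_comp : ∀ (p q : ℕ) {m n l : ℕ} {i j t : ℤ} (hm : p + 1 + q = m) (hl : p + n + q = l)
    (h : i + j = t) (a : O.obj m i) (b : O.obj n j),
    map (O.comp p q hm hl h a b) = O'.comp p q hm hl h (map a) (map b)
  map_act : ∀ {m : ℕ} {i : ℤ} (σ : Equiv.Perm (Fin m)) (a : O.obj m i),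
    map (O.act σ a) = O'.act σ (map a)

namespace DGProp

variable {k : Type u} [CommRing k]

/-- The operad `U(P)` of a prop `P`: `U(P)(m) = P(1, m)`, with the partial compositions
`a ∘_{p + 1} b = (-1) ^ (|a| |b|) (id_p ⊙ b ⊙ id_q) ∘ a`. -/
abbrev U (P : DGProp.{u, w} k) : DGOperad.{u, w} k where
  obj m i := P.obj 1 m i
  d h := P.d h
  one := P.perm 1
  comp p q {m n l i j t} hm hl h :=
    sgn k (i * j) • (((P.vcomp (by omega : j + i = t)).flip).compl₂
      ((P.hcomp (by omega : p + 1 + q = m) hl (by omega : j + 0 = j)).flip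
        (P.perm (1 : Equiv.Perm (Fin q))) ∘ₗ
      P.hcomp rfl rfl (by omega : 0 + j = j) (P.perm (1 : Equiv.Perm (Fin p)))))
  act σ := P.vcomp (zero_add _) (P.perm σ)

theorem U_comp (P : DGProp.{u, w} k) (p q : ℕ) {m n l : ℕ} {i j t : ℤ} (hm : p + 1 + q = m)
    (hl : p + n + q = l) (h : i + j = t) (a : P.obj 1 m i) (b : P.obj 1 n j) :
    P.U.comp p q hm hl h a b = sgn k (i * j) • P.vcomp (by omega : j + i = t)
      (P.hcomp hm hl (by omega : j + 0 = j)
        (P.hcomp rfl rfl (by omega : 0 + j = j) (P.perm (1 : Equiv.Perm (Fin p))) b)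
        (P.perm (1 : Equiv.Perm (Fin q)))) a := rfl

theorem U_act (P : DGProp.{u, w} k) {m : ℕ} {i : ℤ} (σ : Equiv.Perm (Fin m)) (a : P.obj 1 m i) :
    P.U.act σ a = P.vcomp (zero_add i) (P.perm σ) a := rfl

/-- The operad morphism `U(P) → U(Q)` induced by a prop morphism `P → Q`. -/
def Hom.U {P : DGProp.{u, w} k} {Q : DGProp.{u, w'} k} (f : P.Hom Q) : P.U.Hom Q.U where
  map {m i} := f.map (n := 1) (m := m) (i := i)
  map_d h a := f.map_d h a
  map_one := f.map_perm 1
  map_comp p q {m n l i j t} hm hl h a b := by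
    refine (congrArg f.map (U_comp P p q hm hl h a b)).trans (Eq.trans ?_
      (U_comp Q p q hm hl h (f.map a) (f.map b)).symm)
    rw [map_smul, f.map_vcomp, f.map_hcomp, f.map_hcomp, f.map_perm, f.map_perm]
  map_act σ a := by
    refine (congrArg f.map (U_act P σ a)).trans (Eq.trans ?_ (U_act Q σ (f.map a)).symm)
    rw [f.map_vcomp, f.map_perm]

/-- The opposite of a prop: `P^op(n, m) = P(m, n)`, with the vertical composition
`a ∘^op b = (-1) ^ (|a| |b|) b ∘ a`. -/
abbrev op (P : DGProp.{u, w} k) : DGProp.{u, w} k where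
  obj n m i := P.obj m n i
  d h := P.d h
  vcomp {n r m i j l} h := sgn k (i * j) • (P.vcomp (by omega : j + i = l)).flip
  hcomp hn hm h := P.hcomp hm hn h
  perm σ := P.perm σ⁻¹

end DGProp

namespace DGMod

variable {k : Type u} [CommRing k]

/-- The prop `End(C)(n, m) = Hom(C^{⊗ n}, C^{⊗ m})`. -/
abbrev endProp (C : DGMod.{u, w} k) : DGProp.{u, max u w} k where
  obj n m i := C.homDeg n m i
  d h := C.homD _ _ h
  vcomp h := C.homComp h
  hcomp hn hm h := C.homTensor hn hm h
  perm σ := ⟨C.tperm σ, C.tperm_mem σ⟩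

/-- The linear map underlying an element of `End(C)(n, m)`. -/
def endVal (C : DGMod.{u, w} k) {n m : ℕ} {i : ℤ} (f : C.endProp.obj n m i) :
    C.TPow n →ₗ[k] C.TPow m := f.1

/-- The prop `End^op(C)(n, m) = Hom(C^{⊗ m}, C^{⊗ n})`. -/
abbrev endOpProp (C : DGMod.{u, w} k) : DGProp.{u, max u w} k := C.endProp.op

/-- The operad `End(C)(m) = Hom(C, C^{⊗ m})`. An operad morphism `O → End(C)` is an `O`-coalgebra
structure on `C`. -/
abbrev endOperad (C : DGMod.{u, w} k) : DGOperad.{u, max u w} k := C.endProp.U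

/-- The operad `End^op(C)(m) = Hom(C^{⊗ m}, C)`. An operad morphism `O → End^op(C)` is an `O`-algebra
structure on `C`. -/
abbrev endOpOperad (C : DGMod.{u, w} k) : DGOperad.{u, max u w} k := C.endOpProp.U

/-- The linear map `C → C^{⊗ m}` underlying an element of `End(C)(m)`. -/
def coopVal (C : DGMod.{u, w} k) {m : ℕ} {i : ℤ} (f : C.endOperad.obj m i) :
    C.carrier →ₗ[k] C.TPow m :=
  C.endVal f ∘ₗ (PiTensorProduct.subsingletonEquiv (s := fun _ : Fin 1 => C.carrier) 0).symm.toLinearMap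

/-- The linear map `C^{⊗ m} → C` underlying an element of `End^op(C)(m)`. -/
def opVal (C : DGMod.{u, w} k) {m : ℕ} {i : ℤ} (f : C.endOpOperad.obj m i) :
    C.TPow m →ₗ[k] C.carrier :=
  (PiTensorProduct.subsingletonEquiv (s := fun _ : Fin 1 => C.carrier) 0).toLinearMap ∘ₗ C.endVal f

/-- The functional `α₁ ⊗ ⋯ ⊗ αₘ` on `C^{⊗ m}` given by functionals `αᵣ` of degree `e r`:
`(α₁ ⊗ ⋯ ⊗ αₘ) (c₁ ⊗ ⋯ ⊗ cₘ) = ± α₁(c₁) ⋯ αₘ(cₘ)`, where the Koszul sign has the exponent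
`∑ s < r, |αᵣ| |cₛ|`, which is `∑ s < r, |αᵣ| |αₛ|` modulo `2` unless the product vanishes. -/
def tensorPairing (C : DGMod.{u, w} k) {m : ℕ} (e : Fin m → ℤ) (α : Fin m → C.dual.carrier) :
    C.TPow m →ₗ[k] k :=
  (∏ r : Fin m, ∏ s : Fin m, if s < r then sgn k (e r * e s) else 1) •
    PiTensorProduct.lift
      ((MultilinearMap.mkPiAlgebra k (Fin m) k).compLinearMap fun r => C.dualVal (α r))

/-- An `O`-algebra structure on the graded dual of `C` is dual to an `O`-coalgebra structure on `C`
if the operation `(C^*)^{⊗ m} → C^*` given by `a ∈ O(m)` is the composite of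
`(C^*)^{⊗ m} → (C^{⊗ m})^*` with the transpose of the cooperation `C → C^{⊗ m}` given by `a`. -/
def IsDual {O : DGOperad.{u, w'} k} {C : DGMod.{u, w} k} (Φ : O.Hom C.endOperad)
    (Ψ : O.Hom C.dual.endOpOperad) : Prop :=
  ∀ (m : ℕ) (i : ℤ) (a : O.obj m i) (e : Fin m → ℤ) (α : Fin m → C.dual.carrier),
    (∀ r, α r ∈ C.dual.gr (e r)) → ∀ c : C.carrier,
      C.dualVal (C.dual.opVal (Ψ.map a) (PiTensorProduct.tprod k α)) c =
        sgn k (i * ∑ r, e r) * C.tensorPairing e α (C.coopVal (Φ.map a) c)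

end DGMod

/-! ### `E_∞`-operads -/

namespace DGOperad

variable {k : Type u} [CommRing k]

/-- `O` is `Σ`-free: each `O(m)_i` is a free `k[Σ_m]`-module, i.e. it has a `k`-basis on which the
symmetric group acts freely by permutations. -/
def IsSigmaFree (O : DGOperad.{u, w} k) : Prop :=
  ∀ (m : ℕ) (i : ℤ), ∃ (ι : Type w) (b : Module.Basis (Equiv.Perm (Fin m) × ι) k (O.obj m i)),
    ∀ (σ τ : Equiv.Perm (Fin m)) (x : ι), O.act σ (b (τ, x)) = b (σ * τ, x)

/-- A morphism of operads induces an isomorphism in homology in each arity and degree. -/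
def Hom.IsHomologyIso {O : DGOperad.{u, w} k} {O' : DGOperad.{u, w'} k} (f : O.Hom O') : Prop :=
  ∀ (m : ℕ) {i₁ i i₀ : ℤ} (h₁ : i + 1 = i₁) (h₀ : i₀ + 1 = i),
    (∀ a : O.obj m i, O.d h₀ a = 0 → (∃ c : O'.obj m i₁, O'.d h₁ c = f.map a) →
      ∃ c : O.obj m i₁, O.d h₁ c = a) ∧
    (∀ b : O'.obj m i, O'.d h₀ b = 0 → ∃ a : O.obj m i, O.d h₀ a = 0 ∧
      ∃ c : O'.obj m i₁, O'.d h₁ c = f.map a - b)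

/-- `O` is an `E_∞`-operad: it is a `Σ`-free resolution of the operad `End(k)`, and `O(0) = k`. -/
def IsEInfinity (O : DGOperad.{u, w} k) : Prop :=
  O.IsSigmaFree ∧ (∃ f : O.Hom (DGMod.unit k).endOperad, f.IsHomologyIso) ∧
    Nonempty (O.obj 0 0 ≃ₗ[k] k) ∧ ∀ i : ℤ, i ≠ 0 → Subsingleton (O.obj 0 i)

end DGOperad

/-! ### The prop `S` -/

namespace PropS

/-- Formal composites of the generators `counit ∈ S(1, 0)₀`, `coproduct ∈ S(1, 2)₀`,
`product ∈ S(2, 1)₁` and of permutations, by biarity and degree. -/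
inductive Term : ℕ → ℕ → ℤ → Type
  | counit : Term 1 0 0
  | coproduct : Term 1 2 0
  | product : Term 2 1 1
  | perm {n : ℕ} (σ : Equiv.Perm (Fin n)) : Term n n 0
  | vcomp {n r m : ℕ} {i j l : ℤ} (h : i + j = l) (a : Term r m i) (b : Term n r j) : Term n m l
  | hcomp {n₁ n₂ n m₁ m₂ m : ℕ} {i j l : ℤ} (hn : n₁ + n₂ = n) (hm : m₁ + m₂ = m) (h : i + j = l)
      (a : Term n₁ m₁ i) (b : Term n₂ m₂ j) : Term n m l

variable (k : Type u) [CommRing k]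

/-- Linear combinations of formal composites. -/
abbrev Free (n m : ℕ) (i : ℤ) : Type u := Term n m i →₀ k

/-- A formal composite as a linear combination. -/
abbrev of {n m : ℕ} {i : ℤ} (t : Term n m i) : Free k n m i := Finsupp.single t 1

/-- The bilinear extension of the formal vertical composition. -/
def vcompF {n r m : ℕ} {i j l : ℤ} (h : i + j = l) :
    Free k r m i →ₗ[k] Free k n r j →ₗ[k] Free k n m l :=
  Finsupp.linearCombination k fun a => Finsupp.linearCombination k fun b => of k (Term.vcomp h a b)

/-- The bilinear extension of the formal horizontal composition. -/
def hcompF {n₁ n₂ n m₁ m₂ m : ℕ} {i j l : ℤ} (hn : n₁ + n₂ = n) (hm : m₁ + m₂ = m)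
    (h : i + j = l) : Free k n₁ m₁ i →ₗ[k] Free k n₂ m₂ j →ₗ[k] Free k n m l :=
  Finsupp.linearCombination k fun a =>
    Finsupp.linearCombination k fun b => of k (Term.hcomp hn hm h a b)

/-- The boundary of a formal composite: the derivation with `∂ counit = 0`, `∂ coproduct = 0` and
`∂ product = counit ⊙ id - id ⊙ counit`. -/
def bd : {n m : ℕ} → {i : ℤ} → Term n m i → (j : ℤ) → j + 1 = i → Free k n m j
  | _, _, _, .counit, _, _ => 0
  | _, _, _, .coproduct, _, _ => 0
  | _, _, _, .product, _, h =>
      of k (.hcomp rfl rfl (by omega) .counit (.perm (1 : Equiv.Perm (Fin 1)))) -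
        of k (.hcomp rfl rfl (by omega) (.perm (1 : Equiv.Perm (Fin 1))) .counit)
  | _, _, _, .perm _, _, _ => 0
  | _, _, _, .vcomp (i := i) (j := j) _ a b, _, _ =>
      vcompF k (by omega) (bd a (i - 1) (by omega)) (of k b) +
        sgn k i • vcompF k (by omega) (of k a) (bd b (j - 1) (by omega))
  | _, _, _, .hcomp (i := i) (j := j) hn hm _ a b, _, _ =>
      hcompF k hn hm (by omega) (bd a (i - 1) (by omega)) (of k b) +
        sgn k i • hcompF k hn hm (by omega) (of k a) (bd b (j - 1) (by omega))

/-- The linear extension of the boundary. -/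
def bdF {n m : ℕ} {i j : ℤ} (h : j + 1 = i) : Free k n m i →ₗ[k] Free k n m j :=
  Finsupp.linearCombination k fun t => bd k t j h

/-- The permutation of `n = n₁ + n₂` letters acting by `σ` on the first `n₁` and by `τ` on the last
`n₂`. -/
def blockSum {n₁ n₂ n : ℕ} (h : n₁ + n₂ = n) (σ : Equiv.Perm (Fin n₁)) (τ : Equiv.Perm (Fin n₂)) :
    Equiv.Perm (Fin n) :=
  (finSumFinEquiv.trans (finCongr h)).permCongr (Equiv.sumCongr σ τ)

/-- The permutation of `n = n₁ + n₂` letters moving the block of the first `n₁` letters past that of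
the last `n₂`. -/
def blockSwap {n₁ n₂ n : ℕ} (h : n₁ + n₂ = n) : Equiv.Perm (Fin n) :=
  (finCongr h.symm).trans (finAddFlip.trans (finCongr ((Nat.add_comm n₂ n₁).trans h)))

variable {k} in
/-- The linear combinations of formal composites that vanish in `S`: the smallest family of
submodules that is closed under composition with arbitrary elements and under the boundary, and
that contains the differences of the two sides of the axioms of a prop and of the three relations
of `S`. -/
inductive IsNull : {n m : ℕ} → {i : ℤ} → Free k n m i → Prop
  | zero {n m : ℕ} {i : ℤ} : IsNull (0 : Free k n m i)
  | add {n m : ℕ} {i : ℤ} {x y : Free k n m i} : IsNull x → IsNull y → IsNull (x + y)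
  | smul {n m : ℕ} {i : ℤ} (c : k) {x : Free k n m i} : IsNull x → IsNull (c • x)
  | vcomp_left {n r m : ℕ} {i j l : ℤ} (h : i + j = l) {x : Free k r m i} (y : Free k n r j) :
      IsNull x → IsNull (vcompF k h x y)
  | vcomp_right {n r m : ℕ} {i j l : ℤ} (h : i + j = l) (x : Free k r m i) {y : Free k n r j} :
      IsNull y → IsNull (vcompF k h x y)
  | hcomp_left {n₁ n₂ n m₁ m₂ m : ℕ} {i j l : ℤ} (hn : n₁ + n₂ = n) (hm : m₁ + m₂ = m)
      (h : i + j = l) {x : Free k n₁ m₁ i} (y : Free k n₂ m₂ j) :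
      IsNull x → IsNull (hcompF k hn hm h x y)
  | hcomp_right {n₁ n₂ n m₁ m₂ m : ℕ} {i j l : ℤ} (hn : n₁ + n₂ = n) (hm : m₁ + m₂ = m)
      (h : i + j = l) (x : Free k n₁ m₁ i) {y : Free k n₂ m₂ j} :
      IsNull y → IsNull (hcompF k hn hm h x y)
  | boundary {n m : ℕ} {i j : ℤ} (h : j + 1 = i) {x : Free k n m i} : IsNull x → IsNull (bdF k h x)
  -- associativity and units of the vertical composition
  | vcomp_assoc {n r s m : ℕ} {i j l ij jl t : ℤ} (h₁ : i + j = ij) (h₂ : ij + l = t)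
      (h₃ : j + l = jl) (h₄ : i + jl = t) (a : Term s m i) (b : Term r s j) (c : Term n r l) :
      IsNull (of k (.vcomp h₂ (.vcomp h₁ a b) c) - of k (.vcomp h₄ a (.vcomp h₃ b c)))
  | id_vcomp {n m : ℕ} {i : ℤ} (h : 0 + i = i) (a : Term n m i) :
      IsNull (of k (.vcomp h (.perm 1) a) - of k a)
  | vcomp_id {n m : ℕ} {i : ℤ} (h : i + 0 = i) (a : Term n m i) :
      IsNull (of k (.vcomp h a (.perm 1)) - of k a)
  -- associativity and unit of the horizontal composition
  | hcomp_assoc {n₁ n₂ n₃ n₁₂ n₂₃ n m₁ m₂ m₃ m₁₂ m₂₃ m : ℕ} {i j l ij jl t : ℤ}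
      (hn₁ : n₁ + n₂ = n₁₂) (hn₂ : n₁₂ + n₃ = n) (hn₃ : n₂ + n₃ = n₂₃) (hn₄ : n₁ + n₂₃ = n)
      (hm₁ : m₁ + m₂ = m₁₂) (hm₂ : m₁₂ + m₃ = m) (hm₃ : m₂ + m₃ = m₂₃) (hm₄ : m₁ + m₂₃ = m)
      (h₁ : i + j = ij) (h₂ : ij + l = t) (h₃ : j + l = jl) (h₄ : i + jl = t)
      (a : Term n₁ m₁ i) (b : Term n₂ m₂ j) (c : Term n₃ m₃ l) :
      IsNull (of k (.hcomp hn₂ hm₂ h₂ (.hcomp hn₁ hm₁ h₁ a b) c) -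
        of k (.hcomp hn₄ hm₄ h₄ a (.hcomp hn₃ hm₃ h₃ b c)))
  | id_hcomp {n m : ℕ} {i : ℤ} (hn : 0 + n = n) (hm : 0 + m = m) (h : 0 + i = i) (a : Term n m i) :
      IsNull (of k (.hcomp hn hm h (.perm (1 : Equiv.Perm (Fin 0))) a) - of k a)
  | hcomp_id {n m : ℕ} {i : ℤ} (hn : n + 0 = n) (hm : m + 0 = m) (h : i + 0 = i) (a : Term n m i) :
      IsNull (of k (.hcomp hn hm h a (.perm (1 : Equiv.Perm (Fin 0)))) - of k a)
  -- the interchange law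
  | interchange {n₁ n₂ n r₁ r₂ r m₁ m₂ m : ℕ} {i₁ i₂ j₁ j₂ i j l₁ l₂ l : ℤ}
      (hn : n₁ + n₂ = n) (hr : r₁ + r₂ = r) (hm : m₁ + m₂ = m) (hi : i₁ + i₂ = i) (hj : j₁ + j₂ = j)
      (h : i + j = l) (h₁ : i₁ + j₁ = l₁) (h₂ : i₂ + j₂ = l₂) (h' : l₁ + l₂ = l)
      (a₁ : Term r₁ m₁ i₁) (a₂ : Term r₂ m₂ i₂) (b₁ : Term n₁ r₁ j₁) (b₂ : Term n₂ r₂ j₂) :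
      IsNull (of k (.vcomp h (.hcomp hr hm hi a₁ a₂) (.hcomp hn hr hj b₁ b₂)) -
        sgn k (i₂ * j₁) • of k (.hcomp hn hm h' (.vcomp h₁ a₁ b₁) (.vcomp h₂ a₂ b₂)))
  -- the permutations form a symmetric monoidal subcategory, in which the block transpositions
  -- are the symmetry
  | perm_vcomp {n : ℕ} (h : (0 : ℤ) + 0 = 0) (σ τ : Equiv.Perm (Fin n)) :
      IsNull (of k (.vcomp h (.perm σ) (.perm τ)) - of k (.perm (σ * τ)))
  | perm_hcomp {n₁ n₂ n : ℕ} (hn hn' : n₁ + n₂ = n) (h : (0 : ℤ) + 0 = 0)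
      (σ : Equiv.Perm (Fin n₁)) (τ : Equiv.Perm (Fin n₂)) :
      IsNull (of k (.hcomp hn hn' h (.perm σ) (.perm τ)) - of k (.perm (blockSum hn σ τ)))
  | symmetry {n₁ n₂ n m₁ m₂ m : ℕ} {i j l : ℤ} (hn : n₁ + n₂ = n) (hm : m₁ + m₂ = m)
      (hn' : n₂ + n₁ = n) (hm' : m₂ + m₁ = m) (h : i + j = l) (h' : j + i = l)
      (h₀ : 0 + l = l) (h₁ : l + 0 = l) (a : Term n₁ m₁ i) (b : Term n₂ m₂ j) :
      IsNull (of k (.vcomp h₀ (.perm (blockSwap hm)) (.hcomp hn hm h a b)) -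
        sgn k (i * j) • of k (.vcomp h₁ (.hcomp hn' hm' h' b a) (.perm (blockSwap hn))))
  -- the relations of `S`
  | counit_product (h : (0 : ℤ) + 1 = 1) : IsNull (of k (.vcomp h .counit .product))
  | left_counit (hn : 1 + 1 = 2) (hm : 0 + 1 = 1) (h : (0 : ℤ) + 0 = 0) :
      IsNull (of k (.vcomp h (.hcomp hn hm h .counit (.perm (1 : Equiv.Perm (Fin 1))))
        .coproduct) - of k (.perm 1))
  | right_counit (hn : 1 + 1 = 2) (hm : 1 + 0 = 1) (h : (0 : ℤ) + 0 = 0) :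
      IsNull (of k (.vcomp h (.hcomp hn hm h (.perm (1 : Equiv.Perm (Fin 1))) .counit)
        .coproduct) - of k (.perm 1))

/-- The elements that vanish in `S`, as a submodule. -/
def null (n m : ℕ) (i : ℤ) : Submodule k (Free k n m i) where
  carrier := {x | IsNull x}
  add_mem' := .add
  zero_mem' := .zero
  smul_mem' c _ := .smul c

theorem null_le_comap {n m : ℕ} {i j : ℤ} (h : j + 1 = i) :
    null k n m i ≤ (null k n m j).comap (bdF k h) := fun _ hx => IsNull.boundary h hx

/-- A bilinear map induced on quotients. -/
def mapQ₂ {k : Type u} [CommRing k] {M N L : Type u} [AddCommGroup M] [AddCommGroup N]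
    [AddCommGroup L] [Module k M] [Module k N] [Module k L] {p : Submodule k M} {q : Submodule k N}
    {r : Submodule k L} (B : M →ₗ[k] N →ₗ[k] L) (hp : ∀ x ∈ p, ∀ y, B x y ∈ r)
    (hq : ∀ x, ∀ y ∈ q, B x y ∈ r) : M ⧸ p →ₗ[k] N ⧸ q →ₗ[k] L ⧸ r :=
  p.liftQ
    { toFun := fun x => q.mapQ r (B x) (hq x)
      map_add' := fun x y => by ext; simp
      map_smul' := fun c x => by ext; simp }
    (fun x hx => LinearMap.mem_ker.mpr (by
      ext y
      simpa using hp x hx y))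

end PropS

/-- The prop `S` generated by `counit ∈ S(1, 0)₀`, `coproduct ∈ S(1, 2)₀` and `product ∈ S(2, 1)₁`,
with `∂ counit = 0`, `∂ coproduct = 0` and `∂ product = counit ⊙ id - id ⊙ counit`, and with the
relations `counit ∘ product = 0` and `(counit ⊙ id) ∘ coproduct = id = (id ⊙ counit) ∘ coproduct`. -/
abbrev propS (k : Type u) [CommRing k] : DGProp.{u, u} k where
  obj n m i := PropS.Free k n m i ⧸ PropS.null k n m i
  d h := Submodule.mapQ _ _ (PropS.bdF k h) (PropS.null_le_comap k h)
  vcomp h := PropS.mapQ₂ (PropS.vcompF k h) (fun _ hx y => PropS.IsNull.vcomp_left h y hx)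
    (fun x _ hy => PropS.IsNull.vcomp_right h x hy)
  hcomp hn hm h := PropS.mapQ₂ (PropS.hcompF k hn hm h) (fun _ hx y => PropS.IsNull.hcomp_left hn hm h y hx)
    (fun x _ hy => PropS.IsNull.hcomp_right hn hm h x hy)
  perm σ := Submodule.Quotient.mk (PropS.of k (.perm σ))

/-- The class in `S(n, m)_i` of a formal composite. -/
def PropS.mk (k : Type u) [CommRing k] {n m : ℕ} {i : ℤ} (t : PropS.Term n m i) :
    (propS k).obj n m i :=
  Submodule.Quotient.mk (PropS.of k t)

/-! ### Normalized chains -/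

section Chains

open Simplicial

variable (k : Type u) [CommRing k]

/-- Linear combinations of the simplices of `X`, of all dimensions. -/
abbrev FreeChains (X : SSet.{v}) : Type (max u v) := (Σ n : ℕ, X _⦋n⦌) →₀ k

/-- The submodule spanned by the degenerate simplices. -/
def degChains (X : SSet.{v}) : Submodule k (FreeChains k X) :=
  Submodule.span k {y | ∃ (n : ℕ) (x : X _⦋n⦌), x ∈ X.degenerate n ∧ y = Finsupp.single ⟨n, x⟩ 1}

/-- The class of a simplex in the quotient by the degenerate simplices. -/
def cls (X : SSet.{v}) {n : ℕ} (x : X _⦋n⦌) : FreeChains k X ⧸ degChains k X :=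
  (degChains k X).mkQ (Finsupp.single ⟨n, x⟩ 1)

theorem cls_eq_zero {X : SSet.{v}} {n : ℕ} {x : X _⦋n⦌} (hx : x ∈ X.degenerate n) :
    cls k X x = 0 :=
  (Submodule.Quotient.mk_eq_zero _).mpr (Submodule.subset_span ⟨n, x, hx, rfl⟩)

/-- The linear map on normalized chains that takes given values on simplices, `0` on the degenerate
ones. -/
def chainLift {X : SSet.{v}} {M : Type w} [AddCommGroup M] [Module k M]
    (f : ∀ n : ℕ, X _⦋n⦌ → M) (hf : ∀ n, ∀ x ∈ X.degenerate n, f n x = 0) :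
    (FreeChains k X ⧸ degChains k X) →ₗ[k] M :=
  (degChains k X).liftQ (Finsupp.linearCombination k fun s => f s.1 s.2) (by
    refine Submodule.span_le.mpr ?_
    rintro _ ⟨n, x, hx, rfl⟩
    simp [hf n x hx])

@[simp]
theorem chainLift_cls {X : SSet.{v}} {M : Type w} [AddCommGroup M] [Module k M]
    (f : ∀ n : ℕ, X _⦋n⦌ → M) (hf : ∀ n, ∀ x ∈ X.degenerate n, f n x = 0) {n : ℕ} (x : X _⦋n⦌) :
    chainLift k f hf (cls k X x) = f n x := by
  change Finsupp.linearCombination k (fun s : Σ n : ℕ, X _⦋n⦌ => f s.1 s.2) _ = _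
  simp

theorem span_cls (X : SSet.{v}) :
    Submodule.span k {y | ∃ (n : ℕ) (x : X _⦋n⦌), y = cls k X x} = ⊤ := by
  rw [eq_top_iff]
  rintro y -
  obtain ⟨y, rfl⟩ := (degChains k X).mkQ_surjective y
  induction y using Finsupp.induction_linear with
  | zero => simp
  | add a b ha hb =>
    rw [map_add]
    exact Submodule.add_mem _ ha hb
  | single s c =>
    rw [← mul_one c, ← smul_eq_mul, ← Finsupp.smul_single, map_smul]
    exact Submodule.smul_mem _ _ (Submodule.subset_span ⟨s.1, s.2, rfl⟩)

theorem chain_ext {X : SSet.{v}} {M : Type w} [AddCommGroup M] [Module k M]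
    {f g : (FreeChains k X ⧸ degChains k X) →ₗ[k] M}
    (h : ∀ (n : ℕ) (x : X _⦋n⦌), f (cls k X x) = g (cls k X x)) : f = g :=
  LinearMap.ext_on (span_cls k X) (by rintro _ ⟨n, x, rfl⟩; exact h n x)

/-- The alternating sum of the faces of a simplex. -/
def faceSum (X : SSet.{v}) (n : ℕ) (x : X _⦋n⦌) : FreeChains k X ⧸ degChains k X :=
  n.casesOn (motive := fun n => X _⦋n⦌ → FreeChains k X ⧸ degChains k X) (fun _ => 0)
    (fun n x => ∑ i : Fin (n + 2), (-1 : k) ^ (i : ℕ) • cls k X (X.δ i x)) x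

theorem faceSum_zero (X : SSet.{v}) (x : X _⦋0⦌) : faceSum k X 0 x = 0 := rfl

theorem faceSum_succ (X : SSet.{v}) (n : ℕ) (x : X _⦋n + 1⦌) :
    faceSum k X (n + 1) x = ∑ i : Fin (n + 2), (-1 : k) ^ (i : ℕ) • cls k X (X.δ i x) := rfl

theorem δ_σ_mem_degenerate (X : SSet.{v}) {n : ℕ} (i : Fin (n + 2)) (j : Fin (n + 1))
    (h₁ : i ≠ j.castSucc) (h₂ : i ≠ j.succ) (y : X _⦋n⦌) :
    X.δ i (X.σ j y) ∈ X.degenerate n := by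
  have hy : X.δ i (X.σ j y) = X.map (SimplexCategory.δ i ≫ SimplexCategory.σ j).op y := by
    simp [SimplicialObject.δ, SimplicialObject.σ]
  rw [hy]
  obtain _ | n := n
  · exfalso
    fin_cases j
    fin_cases i <;> simp_all
  · have hni : ¬ Function.Injective
        (SimplexCategory.δ i ≫ SimplexCategory.σ j).toOrderHom := by
      intro hinj
      obtain ⟨a, ha⟩ := Fin.exists_succAbove_eq h₁.symm
      obtain ⟨b, hb⟩ := Fin.exists_succAbove_eq h₂.symm
      have hab : a = b := by
        apply hinj
        change Fin.predAbove j (i.succAbove a) = Fin.predAbove j (i.succAbove b)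
        rw [ha, hb]
        simp
      rw [hab, hb] at ha
      exact absurd ha (by simp [Fin.ext_iff])
    obtain ⟨l, θ, hθ⟩ := SimplexCategory.eq_σ_comp_of_not_injective _ hni
    rw [hθ]
    exact ⟨n, by omega, SimplexCategory.σ l, X.map θ.op y, by simp⟩

theorem faceSum_degenerate (X : SSet.{v}) (n : ℕ) (x : X _⦋n⦌) (hx : x ∈ X.degenerate n) :
    faceSum k X n x = 0 := by
  obtain _ | n := n
  · rfl
  rw [SSet.degenerate_eq_iUnion_range_σ] at hx
  simp only [Set.mem_iUnion, Set.mem_range] at hx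
  obtain ⟨j, y, rfl⟩ := hx
  have h0 : ∀ i : Fin (n + 2), i ∉ ({j.castSucc, j.succ} : Finset (Fin (n + 2))) →
      (-1 : k) ^ (i : ℕ) • cls k X (X.δ i (X.σ j y)) = 0 := by
    intro i hi
    simp only [Finset.mem_insert, Finset.mem_singleton, not_or] at hi
    rw [cls_eq_zero k (δ_σ_mem_degenerate X i j hi.1 hi.2 y), smul_zero]
  have h1 : X.δ j.castSucc (X.σ j y) = y := by
    rw [← CategoryTheory.comp_apply, SimplicialObject.δ_comp_σ_self]
    rfl
  have h2 : X.δ j.succ (X.σ j y) = y := by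
    rw [← CategoryTheory.comp_apply, SimplicialObject.δ_comp_σ_succ]
    rfl
  rw [faceSum_succ, ← Finset.sum_subset (Finset.subset_univ {j.castSucc, j.succ}) fun i _ hi => h0 i hi,
    Finset.sum_pair (by simp [Fin.ext_iff]), h1, h2]
  simp [pow_succ]

/-- The differential of normalized chains. -/
def chainD (X : SSet.{v}) :
    (FreeChains k X ⧸ degChains k X) →ₗ[k] (FreeChains k X ⧸ degChains k X) :=
  chainLift k (faceSum k X) (faceSum_degenerate k X)

theorem chainD_chainD (X : SSet.{v}) : chainD k X ∘ₗ chainD k X = 0 := by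
  refine chain_ext k fun n x => ?_
  simp only [LinearMap.comp_apply, chainD, chainLift_cls, LinearMap.zero_apply]
  obtain _ | _ | n := n
  · simp [faceSum_zero]
  · simp [faceSum_succ, faceSum_zero]
  · simp only [faceSum_succ, map_sum, map_smul, chainLift_cls, Finset.smul_sum, smul_smul,
      ← Finset.sum_product']
    let P := Fin (n + 3) × Fin (n + 2)
    let S : Finset P := Finset.univ.filter fun ij : P => (ij.1 : ℕ) ≤ (ij.2 : ℕ)
    rw [Finset.univ_product_univ, ← Finset.sum_add_sum_compl S, ← eq_neg_iff_add_eq_zero,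
      ← Finset.sum_neg_distrib]
    let φ : ∀ ij : P, ij ∈ S → P := fun ij hij =>
      (ij.2.succ, Fin.castLT ij.1 (lt_of_le_of_lt (Finset.mem_filter.mp hij).right ij.2.is_lt))
    apply Finset.sum_bij φ
    · intro ij hij
      simp_rw [S, φ, Finset.compl_filter, Finset.mem_filter_univ, Fin.val_succ,
        Fin.val_castLT] at hij ⊢
      omega
    · rintro ⟨i, j⟩ hij ⟨i', j'⟩ hij' h
      obtain ⟨h₁, h₂⟩ := Prod.mk.inj h
      exact Prod.ext (Fin.ext (congrArg Fin.val h₂ :)) (Fin.succ_injective _ h₁)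
    · rintro ⟨i', j'⟩ hij'
      simp_rw [S, Finset.compl_filter, Finset.mem_filter_univ, not_le] at hij'
      refine ⟨(Fin.castSucc j', i'.pred ?_), ?_, ?_⟩
      · rintro rfl
        simp only [Fin.val_zero, not_lt_zero] at hij'
      · simpa [S] using Nat.le_sub_one_of_lt hij'
      · simp only [φ, Fin.castLT_castSucc, Fin.succ_pred]
    · rintro ⟨i, j⟩ hij
      have hij' : (i : ℕ) ≤ j := by simpa [S] using hij
      have hx : X.δ (i.castLT (lt_of_le_of_lt hij' j.is_lt)) (X.δ j.succ x) =
          X.δ j (X.δ i x) := by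
        have h := SimplicialObject.δ_comp_δ'' X (i := i) (j := j) (by simpa [Fin.le_def] using hij')
        rw [← CategoryTheory.comp_apply, h, CategoryTheory.comp_apply]
      simp only [φ, hx, Fin.val_succ, Fin.val_castLT]
      rw [← neg_smul]
      congr 1
      ring

/-- The part of degree `i` of normalized chains. -/
def chainGr (X : SSet.{v}) (i : ℤ) : Submodule k (FreeChains k X ⧸ degChains k X) :=
  Submodule.span k {y | ∃ (n : ℕ) (x : X _⦋n⦌), (n : ℤ) = i ∧ y = cls k X x}

/-- The normalized chains `C_•(X)` of a simplicial set: the complex of all simplices modulo the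
degenerate ones, with the alternating sum of the faces as differential. -/
def chains (X : SSet.{v}) : DGMod.{u, max u v} k where
  carrier := FreeChains k X ⧸ degChains k X
  gr := chainGr k X
  isInternal := by
    let π (i : ℤ) : (FreeChains k X ⧸ degChains k X) →ₗ[k] (FreeChains k X ⧸ degChains k X) :=
      chainLift k (fun n x => if (n : ℤ) = i then cls k X x else 0)
        (fun n x hx => by simp [cls_eq_zero k hx])
    have h1 : ∀ i, chainGr k X i ≤ LinearMap.ker (π i - LinearMap.id) := fun i => by
      refine Submodule.span_le.mpr ?_
      rintro _ ⟨n, x, hn, rfl⟩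
      simp [π, hn]
    refine isInternal_of_ker _ ?_ (fun i => LinearMap.ker (π i)) ?_ ?_
    · rw [eq_top_iff, ← span_cls k X]
      refine Submodule.span_le.mpr ?_
      rintro _ ⟨n, x, rfl⟩
      exact Submodule.mem_iSup_of_mem (n : ℤ) (Submodule.subset_span ⟨n, x, rfl, rfl⟩)
    · intro i x hx h
      have := h1 i hx
      rw [LinearMap.mem_ker, LinearMap.sub_apply, LinearMap.mem_ker.mp h] at this
      simpa using this
    · intro i j hij
      refine Submodule.span_le.mpr ?_
      rintro _ ⟨n, x, rfl, rfl⟩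
      simp [π, hij]
  d := chainD k X
  d_mem {i x} hx := by
    have : chainGr k X i ≤ (chainGr k X (i - 1)).comap (chainD k X) := by
      refine Submodule.span_le.mpr ?_
      rintro _ ⟨n, x, rfl, rfl⟩
      simp only [Submodule.comap_coe, Set.mem_preimage, SetLike.mem_coe, chainD, chainLift_cls]
      obtain _ | n := n
      · exact Submodule.zero_mem _
      · exact Submodule.sum_mem _ fun r _ => Submodule.smul_mem _ _
          (Submodule.subset_span ⟨n, X.δ r x, by push_cast; ring, rfl⟩)
    exact this hx
  d_d x := LinearMap.congr_fun (chainD_chainD k X) x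

/-- The chain of a simplex of `X`. -/
def chain {X : SSet.{v}} {n : ℕ} (x : X _⦋n⦌) : (chains k X).carrier := cls k X x

theorem map_degenerate {X Y : SSet.{v}} (f : X ⟶ Y) {n : ℕ} {x : X _⦋n⦌}
    (hx : x ∈ X.degenerate n) : f.app _ x ∈ Y.degenerate n := by
  obtain ⟨m, hm, g, y, rfl⟩ := hx
  exact ⟨m, hm, g, f.app _ y, by
    rw [← CategoryTheory.comp_apply, ← CategoryTheory.comp_apply, f.naturality]⟩

/-- The chain map `C_•(X) → C_•(Y)` induced by a map of simplicial sets. -/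
def chainsMap {X Y : SSet.{v}} (f : X ⟶ Y) : (chains k X).Hom (chains k Y) where
  toLin := chainLift k (fun n x => cls k Y (f.app _ x))
    fun n x hx => cls_eq_zero k (map_degenerate f hx)
  map_mem {i x} hx := by
    have : chainGr k X i ≤ (chainGr k Y i).comap (chainLift k (fun n x => cls k Y (f.app _ x))
        fun n x hx => cls_eq_zero k (map_degenerate f hx)) := by
      refine Submodule.span_le.mpr ?_
      rintro _ ⟨n, x, hn, rfl⟩
      simp only [Submodule.comap_coe, Set.mem_preimage, SetLike.mem_coe, chainLift_cls]
      exact Submodule.subset_span ⟨n, _, hn, rfl⟩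
    exact this hx
  map_d x := by
    suffices h : chainLift k (fun n x => cls k Y (f.app _ x))
          (fun n x hx => cls_eq_zero k (map_degenerate f hx)) ∘ₗ chainD k X =
        chainD k Y ∘ₗ chainLift k (fun n x => cls k Y (f.app _ x))
          (fun n x hx => cls_eq_zero k (map_degenerate f hx)) from
      LinearMap.congr_fun h x
    refine chain_ext k fun n x => ?_
    simp only [LinearMap.comp_apply, chainD, chainLift_cls]
    obtain _ | n := n
    · simp [faceSum_zero]
    · simp only [faceSum_succ, map_sum, map_smul, chainLift_cls]
      refine Finset.sum_congr rfl fun i _ => ?_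
      congr 2
      exact NatTrans.naturality_apply f (SimplexCategory.δ i).op x

/-- The normalized cochains `C^•(X)`: the graded dual of the normalized chains, cochains of
dimension `n` being in degree `-n`. -/
abbrev cochains (X : SSet.{v}) : DGMod.{u, max u v} k := (chains k X).dual

/-- The chain map `C^•(Y) → C^•(X)` induced by a map of simplicial sets. -/
abbrev cochainsMap {X Y : SSet.{v}} (f : X ⟶ Y) : (cochains k Y).Hom (cochains k X) :=
  (chainsMap k f).dual

/-! ### Standard simplices -/

/-- The chain `[v₀, …, v_q]` of the standard simplex `Δ^d` given by vertices `v₀ ≤ ⋯ ≤ v_q`. It is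
`0` if two of the vertices are equal. -/
def simplexChain {d q : ℕ} (v : Fin (q + 1) →o Fin (d + 1)) :
    (chains k (Δ[d] : SSet.{v})).carrier :=
  chain k (X := Δ[d]) (n := q) (SSet.stdSimplex.objMk v)

/-- The vertices `v₀, …, vᵢ`. -/
def frontFace {d q : ℕ} (v : Fin (q + 1) →o Fin (d + 1)) (i : Fin (q + 1)) :
    Fin ((i : ℕ) + 1) →o Fin (d + 1) where
  toFun r := v ⟨r, by omega⟩
  monotone' _ _ h := v.monotone h

/-- The vertices `vᵢ, …, v_q`. -/
def backFace {d q : ℕ} (v : Fin (q + 1) →o Fin (d + 1)) (i : Fin (q + 1)) :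
    Fin (q - (i : ℕ) + 1) →o Fin (d + 1) where
  toFun r := v ⟨(i : ℕ) + r, by omega⟩
  monotone' _ _ h := v.monotone (Nat.add_le_add_left h _)

/-- The sequence of vertices `v₀, …, v_p, w₀, …, w_q`. -/
def joinSeq {d p q : ℕ} (v : Fin (p + 1) →o Fin (d + 1)) (w : Fin (q + 1) →o Fin (d + 1)) :
    Fin (p + q + 1 + 1) → Fin (d + 1) :=
  Fin.append v w ∘ Fin.cast (by omega)

/-- The vertices `v₀, …, v_p, w₀, …, w_q` put into order. -/
def joinSorted {d p q : ℕ} (v : Fin (p + 1) →o Fin (d + 1)) (w : Fin (q + 1) →o Fin (d + 1)) :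
    Fin (p + q + 1 + 1) →o Fin (d + 1) where
  toFun := joinSeq v w ∘ Tuple.sort (joinSeq v w)
  monotone' := Tuple.monotone_sort _

/-- A prop morphism `S → End(C_•(Δ^d))` that sends the counit to the augmentation, the coproduct to
the Alexander-Whitney map, and the product to the join map. -/
structure IsJoinBialgebra {d : ℕ} (φ : (propS k).Hom (chains k (Δ[d] : SSet.{v})).endProp) :
    Prop where
  counit : ∀ (q : ℕ) (v : Fin (q + 1) →o Fin (d + 1)),
    DGMod.endVal _ (φ.map (PropS.mk k .counit)) (PiTensorProduct.tprod k ![simplexChain k v]) =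
      if q = 0 then PiTensorProduct.tprod k ![] else 0
  coproduct : ∀ (q : ℕ) (v : Fin (q + 1) →o Fin (d + 1)),
    DGMod.endVal _ (φ.map (PropS.mk k .coproduct)) (PiTensorProduct.tprod k ![simplexChain k v]) =
      ∑ i : Fin (q + 1),
        PiTensorProduct.tprod k ![simplexChain k (frontFace v i), simplexChain k (backFace v i)]
  product : ∀ (p q : ℕ) (v : Fin (p + 1) →o Fin (d + 1)) (w : Fin (q + 1) →o Fin (d + 1)),
    DGMod.endVal _ (φ.map (PropS.mk k .product)) (PiTensorProduct.tprod k ![simplexChain k v, simplexChain k w]) =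
      if Function.Injective (joinSeq v w) then
        ((-1 : k) ^ p * ((Equiv.Perm.sign (Tuple.sort (joinSeq v w)) : ℤ) : k)) •
          PiTensorProduct.tprod k ![simplexChain k (joinSorted v w)]
      else 0

/-- Naturality of a family of prop morphisms `S → End(C_•(Δ^d))` with respect to simplicial maps. -/
def IsNaturalBialgebra (φ : ∀ d : ℕ, (propS k).Hom (chains k (Δ[d] : SSet.{v})).endProp) : Prop :=
  ∀ {d e : ℕ} (f : ⦋d⦌ ⟶ ⦋e⦌) {n m : ℕ} {i : ℤ} (a : (propS k).obj n m i),
    DGMod.tmap (chainsMap k (SSet.stdSimplex.{v}.map f)) m ∘ₗ DGMod.endVal _ ((φ d).map a) =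
      DGMod.endVal _ ((φ e).map a) ∘ₗ DGMod.tmap (chainsMap k (SSet.stdSimplex.{v}.map f)) n

/-- Naturality in `X` of a family of coalgebra structures `O → End(C_•(X))`. -/
def IsNaturalCoalgebra {O : DGOperad.{u, w} k}
    (Φ : ∀ X : SSet.{v}, O.Hom (chains k X).endOperad) : Prop :=
  ∀ {X Y : SSet.{v}} (f : X ⟶ Y) {m : ℕ} {i : ℤ} (a : O.obj m i),
    DGMod.tmap (chainsMap k f) m ∘ₗ DGMod.coopVal _ ((Φ X).map a) =
      DGMod.coopVal _ ((Φ Y).map a) ∘ₗ (chainsMap k f).toLin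

/-- Naturality in `X` of a family of algebra structures `O → End^op(C^•(X))`. -/
def IsNaturalAlgebra {O : DGOperad.{u, w} k}
    (Ψ : ∀ X : SSet.{v}, O.Hom (cochains k X).endOpOperad) : Prop :=
  ∀ {X Y : SSet.{v}} (f : X ⟶ Y) {m : ℕ} {i : ℤ} (a : O.obj m i),
    (cochainsMap k f).toLin ∘ₗ DGMod.opVal _ ((Ψ Y).map a) =
      DGMod.opVal _ ((Ψ X).map a) ∘ₗ DGMod.tmap (cochainsMap k f) m

end Chains

end DGAlg
end

open DGAlg

noncomputable section

namespace DGAlg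

/-! Everything rests on the presentation of $\mathcal S$. A morphism of props out of $\mathcal S$ is
the same as a choice of values for the three generators that satisfies the three relations and the
three differential conditions (`Gens.hom`, `hom_ext`), as soon as the target obeys the axioms of a
prop. Endomorphism props do (`endProp_laws`, `endProp_dLaws`); this is where the Koszul signs are
checked. Without the differential conditions one still gets a morphism of graded props, `Gens.ev`,
and this weaker version is what controls the size of $\mathcal S$.

For the first claim, $\mathcal S(1,m)$ is given a basis. A word is a composite, with one input, of
coproducts, products and permutations, or the counit alone. Words span: a counit put on a strand of
a word either commutes past the last operation, or meets a coproduct and cancels, or meets a product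
and gives zero (`IsWord.erase`, `words_eq_top`). The strands of a word are labelled by terms in
`var`, `left`, `right`, `join`. These labels determine the word up to sign: a label of maximal size
shows an operation that can be commuted to the end (`IsWord.exists_out`, `IsWord.peel`), and one
inducts on the total size of the labels (`IsWord.eq_or_eq_neg`). Conversely the word determines its
labels: the free module on terms, enlarged by a grouplike element, is an algebra over the graded
prop $\mathcal S$, and a word evaluated there yields the tensor of its labels up to sign (`tmGens`,
`IsWord.tm`). No label is a subterm of another (`IsWord.antichain`), so the labels are distinct and
$\Sigma_m$ acts freely. Hence words up to sign, one for each orbit, form a $k[\Sigma_m]$-basis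
(`isSigmaFree`).

For the homology, $a\mapsto(\mathrm{id}\odot\mu)\circ(a\odot\mathrm{id})\circ\Delta$ contracts
$\mathcal S(1,m+1)$ onto $\mathcal S(1,m)$, because
$\partial\mu=\epsilon\odot\mathrm{id}-\mathrm{id}\odot\epsilon$. By induction on $m$ every cycle is
homologous to a multiple of the iterated coproduct (`Gens.exists_cycle_eq`), and $\mathrm{End}(k)$
detects that multiple (`unitHom_isHomologyIso`).

For the second claim, chains of $\Delta^d$ are written as values of an alternating function
`altChain` of lists of vertices. The boundary is then alternating deletion, the Alexander–Whitney
map is the sum over cuts with a common vertex, and the join is concatenation. The conditions on the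
generators become identities about lists (`del_cut`, `del_append`), collected in `stdGens` and
`stdGens_dLaws`. Uniqueness and naturality need checking on generators only.

For the third claim, a simplex $x$ of $X$ is the image of the top simplex of $\Delta^n$ under its
characteristic map, so naturality dictates the value of a cooperation at $x$. Naturality on the
standard simplices shows that this prescription vanishes on degenerate simplices. Two cooperations
compatible with the characteristic maps agree (`Kan.hom_ext`), which gives all operad axioms and
uniqueness at once.

For the fourth claim, tensor powers of a complex and of its graded dual are paired with the Koszul
sign. Transposition with respect to this pairing respects all the structure of a prop
(`IsTranspose`), and a transpose into the dual is unique, so transposing $\Phi_X$ gives $\Psi_X$. -/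

/-- The axioms of a prop, apart from those about the differential. -/
structure DGProp.Laws {k : Type u} [CommRing k] (P : DGProp.{u, w} k) : Prop where
  vcomp_assoc : ∀ {n r s m : ℕ} {i j l ij jl t : ℤ} (h₁ : i + j = ij) (h₂ : ij + l = t)
    (h₃ : j + l = jl) (h₄ : i + jl = t) (a : P.obj s m i) (b : P.obj r s j) (c : P.obj n r l),
    P.vcomp h₂ (P.vcomp h₁ a b) c = P.vcomp h₄ a (P.vcomp h₃ b c)
  id_vcomp : ∀ {n m : ℕ} {i : ℤ} (h : 0 + i = i) (a : P.obj n m i), P.vcomp h (P.perm 1) a = a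
  vcomp_id : ∀ {n m : ℕ} {i : ℤ} (h : i + 0 = i) (a : P.obj n m i), P.vcomp h a (P.perm 1) = a
  hcomp_assoc : ∀ {n₁ n₂ n₃ n₁₂ n₂₃ n m₁ m₂ m₃ m₁₂ m₂₃ m : ℕ} {i j l ij jl t : ℤ}
    (hn₁ : n₁ + n₂ = n₁₂) (hn₂ : n₁₂ + n₃ = n) (hn₃ : n₂ + n₃ = n₂₃) (hn₄ : n₁ + n₂₃ = n)
    (hm₁ : m₁ + m₂ = m₁₂) (hm₂ : m₁₂ + m₃ = m) (hm₃ : m₂ + m₃ = m₂₃) (hm₄ : m₁ + m₂₃ = m)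
    (h₁ : i + j = ij) (h₂ : ij + l = t) (h₃ : j + l = jl) (h₄ : i + jl = t)
    (a : P.obj n₁ m₁ i) (b : P.obj n₂ m₂ j) (c : P.obj n₃ m₃ l),
    P.hcomp hn₂ hm₂ h₂ (P.hcomp hn₁ hm₁ h₁ a b) c = P.hcomp hn₄ hm₄ h₄ a (P.hcomp hn₃ hm₃ h₃ b c)
  id_hcomp : ∀ {n m : ℕ} {i : ℤ} (hn : 0 + n = n) (hm : 0 + m = m) (h : 0 + i = i)
    (a : P.obj n m i), P.hcomp hn hm h (P.perm (1 : Equiv.Perm (Fin 0))) a = a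
  hcomp_id : ∀ {n m : ℕ} {i : ℤ} (hn : n + 0 = n) (hm : m + 0 = m) (h : i + 0 = i)
    (a : P.obj n m i), P.hcomp hn hm h a (P.perm (1 : Equiv.Perm (Fin 0))) = a
  interchange : ∀ {n₁ n₂ n r₁ r₂ r m₁ m₂ m : ℕ} {i₁ i₂ j₁ j₂ i j l₁ l₂ l : ℤ}
    (hn : n₁ + n₂ = n) (hr : r₁ + r₂ = r) (hm : m₁ + m₂ = m) (hi : i₁ + i₂ = i) (hj : j₁ + j₂ = j)
    (h : i + j = l) (h₁ : i₁ + j₁ = l₁) (h₂ : i₂ + j₂ = l₂) (h' : l₁ + l₂ = l)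
    (a₁ : P.obj r₁ m₁ i₁) (a₂ : P.obj r₂ m₂ i₂) (b₁ : P.obj n₁ r₁ j₁) (b₂ : P.obj n₂ r₂ j₂),
    P.vcomp h (P.hcomp hr hm hi a₁ a₂) (P.hcomp hn hr hj b₁ b₂) =
      sgn k (i₂ * j₁) • P.hcomp hn hm h' (P.vcomp h₁ a₁ b₁) (P.vcomp h₂ a₂ b₂)
  perm_vcomp : ∀ {n : ℕ} (h : (0 : ℤ) + 0 = 0) (σ τ : Equiv.Perm (Fin n)),
    P.vcomp h (P.perm σ) (P.perm τ) = P.perm (σ * τ)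
  perm_hcomp : ∀ {n₁ n₂ n : ℕ} (hn hn' : n₁ + n₂ = n) (h : (0 : ℤ) + 0 = 0)
    (σ : Equiv.Perm (Fin n₁)) (τ : Equiv.Perm (Fin n₂)),
    P.hcomp hn hn' h (P.perm σ) (P.perm τ) = P.perm (PropS.blockSum hn σ τ)
  symmetry : ∀ {n₁ n₂ n m₁ m₂ m : ℕ} {i j l : ℤ} (hn : n₁ + n₂ = n) (hm : m₁ + m₂ = m)
    (hn' : n₂ + n₁ = n) (hm' : m₂ + m₁ = m) (h : i + j = l) (h' : j + i = l)
    (h₀ : 0 + l = l) (h₁ : l + 0 = l) (a : P.obj n₁ m₁ i) (b : P.obj n₂ m₂ j),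
    P.vcomp h₀ (P.perm (PropS.blockSwap hm)) (P.hcomp hn hm h a b) =
      sgn k (i * j) • P.vcomp h₁ (P.hcomp hn' hm' h' b a) (P.perm (PropS.blockSwap hn))

theorem sgn_congr (k : Type u) [CommRing k] {i j : ℤ} (h : Even (i - j)) : sgn k i = sgn k j := by
  rw [show i = (i - j) + j by ring, sgn_add, sgn_even k h, one_mul]

theorem sgn_mul_self (k : Type u) [CommRing k] (i : ℤ) : sgn k i * sgn k i = 1 := by
  rw [← sgn_add, sgn_even k ⟨i, rfl⟩]

theorem sgn_zero (k : Type u) [CommRing k] : sgn k 0 = 1 := sgn_even k Even.zero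

theorem sgn_one (k : Type u) [CommRing k] : sgn k 1 = -1 := sgn_odd k odd_one

theorem sgn_neg (k : Type u) [CommRing k] (i : ℤ) : sgn k (-i) = sgn k i :=
  sgn_congr k ⟨-i, by ring⟩

theorem sgn_sub_one (k : Type u) [CommRing k] (i : ℤ) : sgn k (i - 1) = -sgn k i := by
  rw [sub_eq_add_neg, sgn_add, sgn_neg, sgn_one, mul_neg, mul_one]

/-! ### Evaluation of formal composites in a prop -/

namespace PropS

variable {k : Type u} [CommRing k]

@[simp]
theorem vcompF_of {n r m : ℕ} {i j l : ℤ} (h : i + j = l) (a : Term r m i) (b : Term n r j) :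
    vcompF k h (of k a) (of k b) = of k (.vcomp h a b) := by
  simp [vcompF, of]

@[simp]
theorem hcompF_of {n₁ n₂ n m₁ m₂ m : ℕ} {i j l : ℤ} (hn : n₁ + n₂ = n) (hm : m₁ + m₂ = m)
    (h : i + j = l) (a : Term n₁ m₁ i) (b : Term n₂ m₂ j) :
    hcompF k hn hm h (of k a) (of k b) = of k (.hcomp hn hm h a b) := by
  simp [hcompF, of]

@[simp]
theorem bdF_of {n m : ℕ} {i j : ℤ} (h : j + 1 = i) (t : Term n m i) :
    bdF k h (of k t) = bd k t j h := by
  simp [bdF, of]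

/-- An induction principle for linear combinations of formal composites. -/
theorem Free.induct {n m : ℕ} {i : ℤ} {p : Free k n m i → Prop} (h0 : p 0)
    (hadd : ∀ x y, p x → p y → p (x + y)) (hsmul : ∀ (c : k) x, p x → p (c • x))
    (hof : ∀ t, p (of k t)) (x : Free k n m i) : p x := by
  induction x using Finsupp.induction_linear with
  | zero => exact h0
  | add x y hx hy => exact hadd x y hx hy
  | single t c =>
    have := hsmul c _ (hof t)
    simpa [of] using this

/-- Both sides are bilinear, and on formal composites this is the clause of `bd` for `Term.vcomp`.
The degrees `i'` and `j'` are free variables, so that the rule can be used without transport along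
equations of integers. -/
theorem bdF_vcompF {n r m : ℕ} {i j l l' : ℤ} (h : i + j = l) (hl : l' + 1 = l)
    (x : Free k r m i) (y : Free k n r j) {i' j' : ℤ} (hi : i' + 1 = i) (hj : j' + 1 = j)
    (h₁ : i' + j = l') (h₂ : i + j' = l') :
    bdF k hl (vcompF k h x y) =
      vcompF k h₁ (bdF k hi x) y + sgn k i • vcompF k h₂ x (bdF k hj y) := by
  obtain rfl : i' = i - 1 := by omega
  obtain rfl : j' = j - 1 := by omega
  induction x using Free.induct with
  | h0 => simp
  | hadd a b ha hb => simp only [map_add, LinearMap.add_apply, ha, hb, smul_add]; abel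
  | hsmul c a ha =>
    simp only [map_smul, LinearMap.smul_apply, ha, smul_add, smul_comm c]
  | hof t =>
    induction y using Free.induct with
    | h0 => simp
    | hadd a b ha hb => simp only [map_add, ha, hb, smul_add]; abel
    | hsmul c a ha => simp only [map_smul, ha, smul_add, smul_comm c]
    | hof s => simp only [vcompF_of, bdF_of, bd]

theorem bdF_hcompF {n₁ n₂ n m₁ m₂ m : ℕ} {i j l l' : ℤ} (hn : n₁ + n₂ = n) (hm : m₁ + m₂ = m)
    (h : i + j = l) (hl : l' + 1 = l) (x : Free k n₁ m₁ i) (y : Free k n₂ m₂ j) {i' j' : ℤ}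
    (hi : i' + 1 = i) (hj : j' + 1 = j) (h₁ : i' + j = l') (h₂ : i + j' = l') :
    bdF k hl (hcompF k hn hm h x y) =
      hcompF k hn hm h₁ (bdF k hi x) y + sgn k i • hcompF k hn hm h₂ x (bdF k hj y) := by
  obtain rfl : i' = i - 1 := by omega
  obtain rfl : j' = j - 1 := by omega
  induction x using Free.induct with
  | h0 => simp
  | hadd a b ha hb => simp only [map_add, LinearMap.add_apply, ha, hb, smul_add]; abel
  | hsmul c a ha =>
    simp only [map_smul, LinearMap.smul_apply, ha, smul_add, smul_comm c]
  | hof t =>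
    induction y using Free.induct with
    | h0 => simp
    | hadd a b ha hb => simp only [map_add, ha, hb, smul_add]; abel
    | hsmul c a ha => simp only [map_smul, ha, smul_add, smul_comm c]
    | hof s => simp only [hcompF_of, bdF_of, bd]

/-- In the Leibniz rule applied twice, the two mixed terms cancel because lowering the degree of the
first factor by one changes the sign. For the product, the boundary is built from cycles. -/
theorem bdF_bdF {n m : ℕ} {i j l : ℤ} (h : j + 1 = i) (h' : l + 1 = j) (x : Free k n m i) :
    bdF k h' (bdF k h x) = 0 := by
  induction x using Free.induct with
  | h0 => simp
  | hadd a b ha hb => simp [ha, hb]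
  | hsmul c a ha => simp [ha]
  | hof t =>
    rw [bdF_of]
    induction t generalizing j l with
    | counit => simp [bd]
    | coproduct => simp [bd]
    | product => simp [bd]
    | perm => simp [bd]
    | @vcomp _ _ _ i i' _ _ a b iha ihb =>
      simp only [bd]
      rw [map_add, map_smul,
        bdF_vcompF _ _ _ _ (i' := i - 1 - 1) (j' := i' - 1) (by omega) (by omega) (by omega) (by omega),
        bdF_vcompF _ _ _ _ (i' := i - 1) (j' := i' - 1 - 1) (by omega) (by omega) (by omega) (by omega),
        iha, ihb, bdF_of, bdF_of, sgn_sub_one]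
      simp
    | @hcomp _ _ _ _ _ _ i i' _ _ _ _ a b iha ihb =>
      simp only [bd]
      rw [map_add, map_smul,
        bdF_hcompF _ _ _ _ _ _ (i' := i - 1 - 1) (j' := i' - 1) (by omega) (by omega) (by omega) (by omega),
        bdF_hcompF _ _ _ _ _ _ (i' := i - 1) (j' := i' - 1 - 1) (by omega) (by omega) (by omega) (by omega),
        iha, ihb, bdF_of, bdF_of, sgn_sub_one]
      simp

/-- Values for the generators of `S` in a prop `Q` that satisfy the relations of `S`. -/
structure Gens (Q : DGProp.{u, w} k) where
  counit : Q.obj 1 0 0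
  coproduct : Q.obj 1 2 0
  product : Q.obj 2 1 1
  counit_product : Q.vcomp (zero_add 1) counit product = 0
  left_counit : Q.vcomp (add_zero 0)
    (Q.hcomp rfl rfl (add_zero 0) counit (Q.perm (1 : Equiv.Perm (Fin 1)))) coproduct = Q.perm 1
  right_counit : Q.vcomp (add_zero 0)
    (Q.hcomp rfl rfl (add_zero 0) (Q.perm (1 : Equiv.Perm (Fin 1))) counit) coproduct = Q.perm 1

namespace Gens

variable {Q : DGProp.{u, w} k} (g : Gens Q)

/-- The value of a formal composite. -/
def evT : {n m : ℕ} → {i : ℤ} → Term n m i → Q.obj n m i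
  | _, _, _, .counit => g.counit
  | _, _, _, .coproduct => g.coproduct
  | _, _, _, .product => g.product
  | _, _, _, .perm σ => Q.perm σ
  | _, _, _, .vcomp h a b => Q.vcomp h (evT a) (evT b)
  | _, _, _, .hcomp hn hm h a b => Q.hcomp hn hm h (evT a) (evT b)

/-- The linear extension of `evT`. -/
def evF {n m : ℕ} {i : ℤ} : Free k n m i →ₗ[k] Q.obj n m i :=
  Finsupp.linearCombination k g.evT

@[simp]
theorem evF_of {n m : ℕ} {i : ℤ} (t : Term n m i) : g.evF (of k t) = g.evT t := by
  simp [evF, of]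

theorem evF_vcompF {n r m : ℕ} {i j l : ℤ} (h : i + j = l) (x : Free k r m i) (y : Free k n r j) :
    g.evF (vcompF k h x y) = Q.vcomp h (g.evF x) (g.evF y) := by
  induction x using Free.induct with
  | h0 => simp
  | hadd a b ha hb => simp only [map_add, LinearMap.add_apply, ha, hb]
  | hsmul c a ha => simp only [map_smul, LinearMap.smul_apply, ha]
  | hof t =>
    induction y using Free.induct with
    | h0 => simp
    | hadd a b ha hb => simp only [map_add, ha, hb]
    | hsmul c a ha => simp only [map_smul, ha]
    | hof s => simp only [vcompF_of, evF_of, evT]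

theorem evF_hcompF {n₁ n₂ n m₁ m₂ m : ℕ} {i j l : ℤ} (hn : n₁ + n₂ = n) (hm : m₁ + m₂ = m)
    (h : i + j = l) (x : Free k n₁ m₁ i) (y : Free k n₂ m₂ j) :
    g.evF (hcompF k hn hm h x y) = Q.hcomp hn hm h (g.evF x) (g.evF y) := by
  induction x using Free.induct with
  | h0 => simp
  | hadd a b ha hb => simp only [map_add, LinearMap.add_apply, ha, hb]
  | hsmul c a ha => simp only [map_smul, LinearMap.smul_apply, ha]
  | hof t =>
    induction y using Free.induct with
    | h0 => simp
    | hadd a b ha hb => simp only [map_add, ha, hb]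
    | hsmul c a ha => simp only [map_smul, ha]
    | hof s => simp only [hcompF_of, evF_of, evT]

/-- The value of the boundary of a formal composite. -/
def evD {n m : ℕ} {i : ℤ} (t : Term n m i) (j : ℤ) (h : j + 1 = i) : Q.obj n m j :=
  g.evF (bd k t j h)

theorem evD_perm {n : ℕ} (σ : Equiv.Perm (Fin n)) (j : ℤ) (h : j + 1 = 0) :
    g.evD (.perm σ) j h = 0 := by simp [evD, bd]

theorem evD_vcomp {n r m : ℕ} {i j l l' : ℤ} (h : i + j = l) (hl : l' + 1 = l)
    (a : Term r m i) (b : Term n r j) {i' j' : ℤ} (hi : i' + 1 = i) (hj : j' + 1 = j)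
    (h₁ : i' + j = l') (h₂ : i + j' = l') :
    g.evD (.vcomp h a b) l' hl = Q.vcomp h₁ (g.evD a i' hi) (g.evT b) +
      sgn k i • Q.vcomp h₂ (g.evT a) (g.evD b j' hj) := by
  rw [evD, ← bdF_of, ← vcompF_of, bdF_vcompF h hl _ _ hi hj h₁ h₂, map_add, map_smul, evF_vcompF,
    evF_vcompF, bdF_of, bdF_of, evF_of, evF_of]
  rfl

theorem evD_hcomp {n₁ n₂ n m₁ m₂ m : ℕ} {i j l l' : ℤ} (hn : n₁ + n₂ = n) (hm : m₁ + m₂ = m)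
    (h : i + j = l) (hl : l' + 1 = l)
    (a : Term n₁ m₁ i) (b : Term n₂ m₂ j) {i' j' : ℤ} (hi : i' + 1 = i) (hj : j' + 1 = j)
    (h₁ : i' + j = l') (h₂ : i + j' = l') :
    g.evD (.hcomp hn hm h a b) l' hl = Q.hcomp hn hm h₁ (g.evD a i' hi) (g.evT b) +
      sgn k i • Q.hcomp hn hm h₂ (g.evT a) (g.evD b j' hj) := by
  rw [evD, ← bdF_of, ← hcompF_of, bdF_hcompF hn hm h hl _ _ hi hj h₁ h₂, map_add, map_smul,
    evF_hcompF, evF_hcompF, bdF_of, bdF_of, evF_of, evF_of]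
  rfl

end Gens
end PropS
namespace PropS
variable {k : Type u} [CommRing k]
namespace Gens

variable {Q : DGProp.{u, w} k} (g : Gens Q)

theorem evD_product (j : ℤ) (h : j + 1 = 1) : g.evD .product j h =
    Q.hcomp rfl rfl (by omega) g.counit (Q.perm (1 : Equiv.Perm (Fin 1))) -
      Q.hcomp rfl rfl (by omega) (Q.perm (1 : Equiv.Perm (Fin 1))) g.counit := by
  rw [evD, bd, map_sub, evF_of, evF_of]; rfl

theorem evD_counit (j : ℤ) (h : j + 1 = 0) : g.evD .counit j h = 0 := by simp [evD, bd]

theorem evD_coproduct (j : ℤ) (h : j + 1 = 0) : g.evD .coproduct j h = 0 := by simp [evD, bd]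

/-- A linear combination is annihilated by the evaluation, and so is its boundary. -/
def Kills {n m : ℕ} {i : ℤ} (x : Free k n m i) : Prop :=
  g.evF x = 0 ∧ ∀ (j : ℤ) (h : j + 1 = i), g.evF (bdF k h x) = 0

theorem kills_sub {n m : ℕ} {i : ℤ} (s t : Term n m i) (c : k) (h₀ : g.evT s = c • g.evT t)
    (h₁ : ∀ (j : ℤ) (h : j + 1 = i), g.evD s j h = c • g.evD t j h) :
    g.Kills (of k s - c • of k t) := by
  refine ⟨by rw [map_sub, map_smul, evF_of, evF_of, h₀, sub_self], fun j h => ?_⟩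
  rw [map_sub, map_smul, bdF_of, bdF_of, map_sub, map_smul, sub_eq_zero]
  exact h₁ j h

theorem kills_sub' {n m : ℕ} {i : ℤ} (s t : Term n m i) (h₀ : g.evT s = g.evT t)
    (h₁ : ∀ (j : ℤ) (h : j + 1 = i), g.evD s j h = g.evD t j h) :
    g.Kills (of k s - of k t) := by
  have := g.kills_sub s t 1 (by simpa using h₀) (by simpa using h₁)
  simpa using this

variable (L : Q.Laws)
include L

/-- The second half of `Kills` is what lets the induction pass the closure of `IsNull` under the
boundary, where `bdF_bdF` supplies the new second half. For each axiom the formal boundaries of the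
two sides are expanded by the Leibniz rule and compared by the same axiom in lower degrees. The
differential of `Q` never enters, since `evD` is the value of the formal boundary; so the result
also applies to props in which the generators do not respect the differential, such as that of
`tmGens`. -/
theorem kills {n m : ℕ} {i : ℤ} {x : Free k n m i} (hx : IsNull x) : g.Kills x := by
  induction hx with
  | zero => exact ⟨by simp, fun _ _ => by simp⟩
  | add _ _ hx hy => exact ⟨by simp [hx.1, hy.1], fun j h => by simp [hx.2 j h, hy.2 j h]⟩
  | smul c _ hx => exact ⟨by simp [hx.1], fun j h => by simp [hx.2 j h]⟩
  | @vcomp_left _ _ _ i j _ h x y _ hx =>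
    refine ⟨by rw [evF_vcompF, hx.1]; simp, fun t ht => ?_⟩
    rw [bdF_vcompF h ht _ _ (i' := i - 1) (j' := j - 1) (by omega) (by omega) (by omega) (by omega),
      map_add, map_smul, evF_vcompF, evF_vcompF, hx.1, hx.2]
    simp
  | @vcomp_right _ _ _ i j _ h x y _ hx =>
    refine ⟨by rw [evF_vcompF, hx.1]; simp, fun t ht => ?_⟩
    rw [bdF_vcompF h ht _ _ (i' := i - 1) (j' := j - 1) (by omega) (by omega) (by omega) (by omega),
      map_add, map_smul, evF_vcompF, evF_vcompF, hx.1, hx.2]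
    simp
  | @hcomp_left _ _ _ _ _ _ i j _ hn hm h x y _ hx =>
    refine ⟨by rw [evF_hcompF, hx.1]; simp, fun t ht => ?_⟩
    rw [bdF_hcompF hn hm h ht _ _ (i' := i - 1) (j' := j - 1) (by omega) (by omega) (by omega)
      (by omega), map_add, map_smul, evF_hcompF, evF_hcompF, hx.1, hx.2]
    simp
  | @hcomp_right _ _ _ _ _ _ i j _ hn hm h x y _ hx =>
    refine ⟨by rw [evF_hcompF, hx.1]; simp, fun t ht => ?_⟩
    rw [bdF_hcompF hn hm h ht _ _ (i' := i - 1) (j' := j - 1) (by omega) (by omega) (by omega)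
      (by omega), map_add, map_smul, evF_hcompF, evF_hcompF, hx.1, hx.2]
    simp
  | boundary h _ hx =>
    exact ⟨hx.2 _ _, fun j h' => by rw [bdF_bdF]; simp⟩
  | @vcomp_assoc _ _ _ _ i j l ij jl t h₁ h₂ h₃ h₄ a b c =>
    refine g.kills_sub' _ _ (by simp only [evT]; exact L.vcomp_assoc ..) fun r hr => ?_
    rw [g.evD_vcomp h₂ hr (i' := ij - 1) (j' := l - 1) _ _ (by omega) (by omega) (by omega) (by omega),
      g.evD_vcomp h₄ hr (i' := i - 1) (j' := jl - 1) _ _ (by omega) (by omega) (by omega) (by omega),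
      g.evD_vcomp h₁ _ (i' := i - 1) (j' := j - 1) _ _ (by omega) (by omega) (by omega) (by omega),
      g.evD_vcomp h₃ _ (i' := j - 1) (j' := l - 1) _ _ (by omega) (by omega) (by omega) (by omega)]
    simp only [evT, map_add, map_smul, LinearMap.add_apply, LinearMap.smul_apply, smul_add, smul_smul]
    rw [L.vcomp_assoc (jl := jl) (i := i - 1) _ _ (by omega) (by omega),
      L.vcomp_assoc (jl := jl - 1) (j := j - 1) _ _ (by omega) (by omega),
      L.vcomp_assoc (jl := jl - 1) (l := l - 1) _ _ (by omega) (by omega), ← sgn_add, h₁, add_assoc]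
  | @id_vcomp _ _ i h a =>
    refine g.kills_sub' _ _ (by simp only [evT]; exact L.id_vcomp ..) fun r hr => ?_
    rw [g.evD_vcomp h hr (i' := 0 - 1) (j' := r) _ _ (by omega) (by omega) (by omega) (by omega),
      evD_perm, evT, L.id_vcomp, sgn_zero]
    simp
  | @vcomp_id _ _ i h a =>
    refine g.kills_sub' _ _ (by simp only [evT]; exact L.vcomp_id ..) fun r hr => ?_
    rw [g.evD_vcomp h hr (i' := r) (j' := 0 - 1) _ _ (by omega) (by omega) (by omega) (by omega),
      evD_perm, evT, L.vcomp_id]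
    simp
  | @hcomp_assoc _ _ _ _ _ _ _ _ _ _ _ _ i j l ij jl t hn₁ hn₂ hn₃ hn₄ hm₁ hm₂ hm₃ hm₄ h₁ h₂ h₃ h₄ a b c =>
    refine g.kills_sub' _ _ (by simp only [evT]; exact L.hcomp_assoc ..) fun r hr => ?_
    rw [g.evD_hcomp hn₂ hm₂ h₂ hr (i' := ij - 1) (j' := l - 1) _ _ (by omega) (by omega) (by omega) (by omega),
      g.evD_hcomp hn₄ hm₄ h₄ hr (i' := i - 1) (j' := jl - 1) _ _ (by omega) (by omega) (by omega) (by omega),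
      g.evD_hcomp hn₁ hm₁ h₁ _ (i' := i - 1) (j' := j - 1) _ _ (by omega) (by omega) (by omega) (by omega),
      g.evD_hcomp hn₃ hm₃ h₃ _ (i' := j - 1) (j' := l - 1) _ _ (by omega) (by omega) (by omega) (by omega)]
    simp only [evT, map_add, map_smul, LinearMap.add_apply, LinearMap.smul_apply, smul_add, smul_smul]
    rw [L.hcomp_assoc (jl := jl) (i := i - 1) _ _ hn₃ hn₄ _ _ hm₃ hm₄ _ _ (by omega) (by omega),
      L.hcomp_assoc (jl := jl - 1) (j := j - 1) _ _ hn₃ hn₄ _ _ hm₃ hm₄ _ _ (by omega) (by omega),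
      L.hcomp_assoc (jl := jl - 1) (l := l - 1) _ _ hn₃ hn₄ _ _ hm₃ hm₄ _ _ (by omega) (by omega),
      ← sgn_add, h₁, add_assoc]
  | @id_hcomp _ _ i hn hm h a =>
    refine g.kills_sub' _ _ (by simp only [evT]; exact L.id_hcomp ..) fun r hr => ?_
    rw [g.evD_hcomp hn hm h hr (i' := 0 - 1) (j' := r) _ _ (by omega) (by omega) (by omega) (by omega),
      evD_perm, evT, L.id_hcomp, sgn_zero]
    simp
  | @hcomp_id _ _ i hn hm h a =>
    refine g.kills_sub' _ _ (by simp only [evT]; exact L.hcomp_id ..) fun r hr => ?_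
    rw [g.evD_hcomp hn hm h hr (i' := r) (j' := 0 - 1) _ _ (by omega) (by omega) (by omega) (by omega),
      evD_perm, evT, L.hcomp_id]
    simp
  | @interchange _ _ _ _ _ _ _ _ _ i₁ i₂ j₁ j₂ i j l₁ l₂ l hn hr hm hi hj h h₁ h₂ h' a₁ a₂ b₁ b₂ =>
    refine g.kills_sub _ _ _ (by simp only [evT]; exact L.interchange ..) fun r hr' => ?_
    rw [g.evD_vcomp h hr' (i' := i - 1) (j' := j - 1) _ _ (by omega) (by omega) (by omega) (by omega),
      g.evD_hcomp hr hm hi _ (i' := i₁ - 1) (j' := i₂ - 1) _ _ (by omega) (by omega) (by omega) (by omega),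
      g.evD_hcomp hn hr hj _ (i' := j₁ - 1) (j' := j₂ - 1) _ _ (by omega) (by omega) (by omega) (by omega),
      g.evD_hcomp hn hm h' hr' (i' := l₁ - 1) (j' := l₂ - 1) _ _ (by omega) (by omega) (by omega) (by omega),
      g.evD_vcomp h₁ _ (i' := i₁ - 1) (j' := j₁ - 1) _ _ (by omega) (by omega) (by omega) (by omega),
      g.evD_vcomp h₂ _ (i' := i₂ - 1) (j' := j₂ - 1) _ _ (by omega) (by omega) (by omega) (by omega)]
    simp only [evT, map_add, map_smul, LinearMap.add_apply, LinearMap.smul_apply, smul_add, smul_smul]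
    -- One interchange law for each of the four factors that can be differentiated; the remaining
    -- task is to compare parities.
    rw [L.interchange (i₁ := i₁ - 1) (l₁ := l₁ - 1) (l₂ := l₂) (h₁ := by omega) (h₂ := by omega)
        (h' := by omega),
      L.interchange (i₂ := i₂ - 1) (l₁ := l₁) (l₂ := l₂ - 1) (h₁ := by omega) (h₂ := by omega)
        (h' := by omega),
      L.interchange (j₁ := j₁ - 1) (l₁ := l₁ - 1) (l₂ := l₂) (h₁ := by omega) (h₂ := by omega)
        (h' := by omega),
      L.interchange (j₂ := j₂ - 1) (l₁ := l₁) (l₂ := l₂ - 1) (h₁ := by omega) (h₂ := by omega)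
        (h' := by omega)]
    simp only [smul_smul, ← sgn_add]
    rw [sgn_congr k (i := i₁ + (i₂ - 1) * j₁) (j := i₂ * j₁ + l₁)
        ⟨-j₁, by rw [← h₁]; ring⟩,
      sgn_congr k (i := i + i₂ * (j₁ - 1)) (j := i₂ * j₁ + i₁) ⟨0, by rw [← hi]; ring⟩,
      sgn_congr k (i := i + j₁ + i₂ * j₁) (j := i₂ * j₁ + (l₁ + i₂)) ⟨0, by rw [← hi, ← h₁]; ring⟩]
    abel
  | perm_vcomp h σ τ =>
    refine g.kills_sub' _ _ (by simp only [evT]; exact L.perm_vcomp ..) fun r hr => ?_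
    rw [g.evD_vcomp h hr (i' := 0 - 1) (j' := 0 - 1) _ _ (by omega) (by omega) (by omega) (by omega),
      evD_perm, evD_perm, evD_perm]
    simp
  | perm_hcomp hn hn' h σ τ =>
    refine g.kills_sub' _ _ (by simp only [evT]; exact L.perm_hcomp ..) fun r hr => ?_
    rw [g.evD_hcomp hn hn' h hr (i' := 0 - 1) (j' := 0 - 1) _ _ (by omega) (by omega) (by omega) (by omega),
      evD_perm, evD_perm, evD_perm]
    simp
  | @symmetry _ _ _ _ _ _ i j l hn hm hn' hm' h h' h₀ h₁ a b =>
    refine g.kills_sub _ _ _ (by simp only [evT]; exact L.symmetry ..) fun r hr => ?_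
    rw [g.evD_vcomp h₀ hr (i' := 0 - 1) (j' := r) _ _ (by omega) (by omega) (by omega) (by omega),
      g.evD_vcomp h₁ hr (i' := r) (j' := 0 - 1) _ _ (by omega) (by omega) (by omega) (by omega),
      evD_perm, evD_perm, 
      g.evD_hcomp hn hm h _ (i' := i - 1) (j' := j - 1) _ _ (by omega) (by omega) (by omega) (by omega),
      g.evD_hcomp hn' hm' h' _ (i' := j - 1) (j' := i - 1) _ _ (by omega) (by omega) (by omega) (by omega)]
    simp only [evT, map_add, map_smul, map_zero, LinearMap.zero_apply, LinearMap.add_apply, LinearMap.smul_apply, smul_add, smul_smul,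
      sgn_zero, one_smul, zero_add, smul_zero, add_zero]
    rw [L.symmetry hn hm hn' hm' _ (by omega) _ (by omega), L.symmetry hn hm hn' hm' _ (by omega) _ (by omega)]
    simp only [smul_smul, one_mul, ← sgn_add]
    rw [sgn_congr k (i := (i - 1) * j) (j := i * j + j) ⟨-j, by ring⟩,
      sgn_congr k (i := i + i * (j - 1)) (j := i * j) ⟨0, by ring⟩, add_comm]
  | counit_product h =>
    refine ⟨by rw [evF_of]; simpa only [evT] using g.counit_product, fun r hr => ?_⟩
    obtain rfl : r = 0 := by omega
    rw [bdF_of]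
    change g.evD _ _ _ = 0
    rw [g.evD_vcomp h hr (i' := 0 - 1) (j' := 0) _ _ (by omega) (by omega) (by omega) (by omega),
      evD_counit, evD_product, map_sub]
    simp only [evT, map_zero, LinearMap.zero_apply, zero_add, sgn_zero, one_smul]
    -- The boundary of $\epsilon\circ\mu$ is
    -- $\epsilon\circ(\epsilon\odot\mathrm{id})-\epsilon\circ(\mathrm{id}\odot\epsilon)$. With the
    -- identity of arity zero inserted on either side, the interchange law turns both terms into
    -- $\epsilon\odot\epsilon$.
    have e₁ := L.interchange (rfl : 1 + 1 = 2) (zero_add 1) (zero_add 0) (zero_add 0) (zero_add 0)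
      (zero_add 0) (zero_add 0) (zero_add 0) (zero_add 0) (Q.perm (1 : Equiv.Perm (Fin 0))) g.counit
      g.counit (Q.perm (1 : Equiv.Perm (Fin 1)))
    have e₂ := L.interchange (rfl : 1 + 1 = 2) (add_zero 1) (zero_add 0) (zero_add 0) (zero_add 0)
      (zero_add 0) (zero_add 0) (zero_add 0) (zero_add 0) g.counit (Q.perm (1 : Equiv.Perm (Fin 0)))
      (Q.perm (1 : Equiv.Perm (Fin 1))) g.counit
    rw [L.id_hcomp] at e₁
    rw [L.hcomp_id] at e₂
    rw [e₁, e₂, L.vcomp_id, L.id_vcomp, sub_self]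
  | left_counit hn hm h =>
    refine g.kills_sub' _ _ (by simp only [evT]; exact g.left_counit) fun r hr => ?_
    rw [g.evD_vcomp h hr (i' := 0 - 1) (j' := 0 - 1) _ _ (by omega) (by omega) (by omega) (by omega),
      g.evD_hcomp hn hm h _ (i' := 0 - 1) (j' := 0 - 1) _ _ (by omega) (by omega) (by omega) (by omega),
      evD_perm, evD_perm, evD_counit, evD_coproduct]
    simp
  | right_counit hn hm h =>
    refine g.kills_sub' _ _ (by simp only [evT]; exact g.right_counit) fun r hr => ?_
    rw [g.evD_vcomp h hr (i' := 0 - 1) (j' := 0 - 1) _ _ (by omega) (by omega) (by omega) (by omega),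
      g.evD_hcomp hn hm h _ (i' := 0 - 1) (j' := 0 - 1) _ _ (by omega) (by omega) (by omega) (by omega),
      evD_perm, evD_perm, evD_counit, evD_coproduct]
    simp

/-- The evaluation on `S`. -/
def ev {n m : ℕ} {i : ℤ} : (propS k).obj n m i →ₗ[k] Q.obj n m i :=
  (null k n m i).liftQ g.evF fun _ hx => (g.kills L hx).1

@[simp]
theorem ev_mk {n m : ℕ} {i : ℤ} (t : Term n m i) : g.ev L (PropS.mk k t) = g.evT t := by
  rw [← g.evF_of]; rfl

theorem ev_vcomp {n r m : ℕ} {i j l : ℤ} (h : i + j = l) (a : (propS k).obj r m i)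
    (b : (propS k).obj n r j) :
    g.ev L ((propS k).vcomp h a b) = Q.vcomp h (g.ev L a) (g.ev L b) := by
  obtain ⟨x, rfl⟩ := Submodule.Quotient.mk_surjective _ a
  obtain ⟨y, rfl⟩ := Submodule.Quotient.mk_surjective _ b
  exact g.evF_vcompF h x y

theorem ev_hcomp {n₁ n₂ n m₁ m₂ m : ℕ} {i j l : ℤ} (hn : n₁ + n₂ = n) (hm : m₁ + m₂ = m)
    (h : i + j = l) (a : (propS k).obj n₁ m₁ i) (b : (propS k).obj n₂ m₂ j) :
    g.ev L ((propS k).hcomp hn hm h a b) = Q.hcomp hn hm h (g.ev L a) (g.ev L b) := by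
  obtain ⟨x, rfl⟩ := Submodule.Quotient.mk_surjective _ a
  obtain ⟨y, rfl⟩ := Submodule.Quotient.mk_surjective _ b
  exact g.evF_hcompF hn hm h x y

theorem ev_perm {n : ℕ} (σ : Equiv.Perm (Fin n)) : g.ev L ((propS k).perm σ) = Q.perm σ :=
  g.ev_mk L (.perm σ)

end Gens
end PropS

/-! ### Morphisms out of the prop, and its own axioms -/

/-- The compatibility of the differential of a prop with the compositions. -/
structure DGProp.DLaws {k : Type u} [CommRing k] (P : DGProp.{u, w} k) : Prop where
  d_vcomp : ∀ {n r m : ℕ} {i j l l' : ℤ} (h : i + j = l) (hl : l' + 1 = l) (a : P.obj r m i)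
    (b : P.obj n r j) {i' j' : ℤ} (hi : i' + 1 = i) (hj : j' + 1 = j) (h₁ : i' + j = l')
    (h₂ : i + j' = l'),
    P.d hl (P.vcomp h a b) = P.vcomp h₁ (P.d hi a) b + sgn k i • P.vcomp h₂ a (P.d hj b)
  d_hcomp : ∀ {n₁ n₂ n m₁ m₂ m : ℕ} {i j l l' : ℤ} (hn : n₁ + n₂ = n) (hm : m₁ + m₂ = m)
    (h : i + j = l) (hl : l' + 1 = l) (a : P.obj n₁ m₁ i) (b : P.obj n₂ m₂ j) {i' j' : ℤ}
    (hi : i' + 1 = i) (hj : j' + 1 = j) (h₁ : i' + j = l') (h₂ : i + j' = l'),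
    P.d hl (P.hcomp hn hm h a b) =
      P.hcomp hn hm h₁ (P.d hi a) b + sgn k i • P.hcomp hn hm h₂ a (P.d hj b)
  d_perm : ∀ {n : ℕ} {j : ℤ} (h : j + 1 = 0) (σ : Equiv.Perm (Fin n)), P.d h (P.perm σ) = 0

namespace PropS

variable {k : Type u} [CommRing k]

theorem obj_induct {n m : ℕ} {i : ℤ} {p : (propS k).obj n m i → Prop} (h0 : p 0)
    (hadd : ∀ x y, p x → p y → p (x + y)) (hsmul : ∀ (c : k) x, p x → p (c • x))
    (hof : ∀ t, p (mk k t)) (x : (propS k).obj n m i) : p x := by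
  obtain ⟨x, rfl⟩ := Submodule.Quotient.mk_surjective _ x
  induction x using Free.induct with
  | h0 => exact h0
  | hadd a b ha hb => exact hadd _ _ ha hb
  | hsmul c a ha => exact hsmul _ _ ha
  | hof t => exact hof t

/-- A prop morphism out of `S` from values of the generators. -/
def Gens.hom {Q : DGProp.{u, w} k} (g : Gens Q) (L : Q.Laws) (D : Q.DLaws)
    (h₁ : ∀ (j : ℤ) (h : j + 1 = 0), Q.d h g.counit = 0)
    (h₂ : ∀ (j : ℤ) (h : j + 1 = 0), Q.d h g.coproduct = 0)
    (h₃ : Q.d (zero_add 1) g.product =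
      Q.hcomp rfl rfl (add_zero 0) g.counit (Q.perm (1 : Equiv.Perm (Fin 1))) -
        Q.hcomp rfl rfl (add_zero 0) (Q.perm (1 : Equiv.Perm (Fin 1))) g.counit) :
    (propS k).Hom Q where
  map := g.ev L
  map_d {n m i j} h a := by
    induction a using obj_induct with
    | h0 => simp
    | hadd a b ha hb => simp only [map_add, ha, hb]
    | hsmul c a ha => simp only [map_smul, ha]
    | hof t =>
      rw [ev_mk]
      change g.evF (bdF k h (of k t)) = _
      rw [bdF_of]
      change g.evD t j h = _
      induction t generalizing j with
      | counit => rw [evD_counit]; exact (h₁ _ _).symm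
      | coproduct => rw [evD_coproduct]; exact (h₂ _ _).symm
      | product =>
        obtain rfl : j = 0 := by omega
        rw [evD_product]
        exact h₃.symm
      | perm σ => rw [evD_perm, evT, D.d_perm]
      | @vcomp _ _ _ p q _ h a b iha ihb =>
        rw [g.evD_vcomp _ _ a b (i' := p - 1) (j' := q - 1) (by omega) (by omega) (by omega) (by omega),
          evT, D.d_vcomp _ _ _ _ (i' := p - 1) (j' := q - 1) (by omega) (by omega) (by omega) (by omega),
          iha, ihb]
      | @hcomp _ _ _ _ _ _ p q _ hn hm h a b iha ihb =>
        rw [g.evD_hcomp _ _ _ _ a b (i' := p - 1) (j' := q - 1) (by omega) (by omega) (by omega) (by omega),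
          evT, D.d_hcomp _ _ _ _ _ _ (i' := p - 1) (j' := q - 1) (by omega) (by omega) (by omega) (by omega),
          iha, ihb]
  map_vcomp h a b := g.ev_vcomp L h a b
  map_hcomp hn hm h a b := g.ev_hcomp L hn hm h a b
  map_perm σ := g.ev_perm L σ

theorem hom_ext {Q : DGProp.{u, w} k} {f f' : (propS k).Hom Q}
    (h₁ : f.map (mk k .counit) = f'.map (mk k .counit))
    (h₂ : f.map (mk k .coproduct) = f'.map (mk k .coproduct))
    (h₃ : f.map (mk k .product) = f'.map (mk k .product)) : f = f' := by
  have h : ∀ {n m : ℕ} {i : ℤ} (a : (propS k).obj n m i), f.map a = f'.map a := by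
    intro n m i a
    induction a using obj_induct with
    | h0 => simp
    | hadd a b ha hb => simp only [map_add, ha, hb]
    | hsmul c a ha => simp only [map_smul, ha]
    | hof t =>
      induction t with
      | counit => exact h₁
      | coproduct => exact h₂
      | product => exact h₃
      | perm σ => exact (f.map_perm σ).trans (f'.map_perm σ).symm
      | vcomp h a b iha ihb =>
        have e : mk k (.vcomp h a b) = (propS k).vcomp h (mk k a) (mk k b) :=
          congrArg Submodule.Quotient.mk (vcompF_of h a b).symm
        rw [e, f.map_vcomp, f'.map_vcomp, iha, ihb]
      | hcomp hn hm h a b iha ihb =>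
        have e : mk k (.hcomp hn hm h a b) = (propS k).hcomp hn hm h (mk k a) (mk k b) :=
          congrArg Submodule.Quotient.mk (hcompF_of hn hm h a b).symm
        rw [e, f.map_hcomp, f'.map_hcomp, iha, ihb]
  ext
  exact h _

theorem mk_vcomp {n r m : ℕ} {i j l : ℤ} (h : i + j = l) (a : Term r m i) (b : Term n r j) :
    mk k (.vcomp h a b) = (propS k).vcomp h (mk k a) (mk k b) :=
  congrArg Submodule.Quotient.mk (vcompF_of h a b).symm

theorem mk_hcomp {n₁ n₂ n m₁ m₂ m : ℕ} {i j l : ℤ} (hn : n₁ + n₂ = n) (hm : m₁ + m₂ = m)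
    (h : i + j = l) (a : Term n₁ m₁ i) (b : Term n₂ m₂ j) :
    mk k (.hcomp hn hm h a b) = (propS k).hcomp hn hm h (mk k a) (mk k b) :=
  congrArg Submodule.Quotient.mk (hcompF_of hn hm h a b).symm

theorem mk_eq {n m : ℕ} {i : ℤ} {s t : Term n m i} (h : IsNull (of k s - of k t)) :
    mk k s = mk k t :=
  (Submodule.Quotient.eq _).mpr h

theorem mk_eq_smul {n m : ℕ} {i : ℤ} {s t : Term n m i} {c : k}
    (h : IsNull (of k s - c • of k t)) : mk k s = c • mk k t :=
  (Submodule.Quotient.eq _).mpr h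

/-- Each axiom holds for classes of formal composites by a constructor of `IsNull`, and all of them
are multilinear. -/
theorem laws : (propS k).Laws where
  vcomp_assoc h₁ h₂ h₃ h₄ a b c := by
    induction a using obj_induct with
    | h0 => simp only [map_zero, LinearMap.zero_apply]
    | hadd _ _ h h' => simp only [map_add, LinearMap.add_apply, h, h']
    | hsmul _ _ h => simp only [map_smul, LinearMap.smul_apply, h]
    | hof a =>
    induction b using obj_induct with
    | h0 => simp only [map_zero, LinearMap.zero_apply]
    | hadd _ _ h h' => simp only [map_add, LinearMap.add_apply, h, h']
    | hsmul _ _ h => simp only [map_smul, LinearMap.smul_apply, h]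
    | hof b =>
    induction c using obj_induct with
    | h0 => simp only [map_zero]
    | hadd _ _ h h' => simp only [map_add, h, h']
    | hsmul _ _ h => simp only [map_smul, h]
    | hof c =>
    refine Eq.trans (b := mk k _) ?_ ((mk_eq (.vcomp_assoc h₁ h₂ h₃ h₄ a b c)).trans ?_) <;>
      rw [mk_vcomp, mk_vcomp]
  id_vcomp h a := by
    induction a using obj_induct with
    | h0 => simp only [map_zero]
    | hadd _ _ h h' => simp only [map_add, h, h']
    | hsmul _ _ h => simp only [map_smul, h]
    | hof a => exact (mk_vcomp h _ a).symm.trans (mk_eq (.id_vcomp h a))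
  vcomp_id h a := by
    induction a using obj_induct with
    | h0 => simp only [map_zero, LinearMap.zero_apply]
    | hadd _ _ h h' => simp only [map_add, LinearMap.add_apply, h, h']
    | hsmul _ _ h => simp only [map_smul, LinearMap.smul_apply, h]
    | hof a => exact (mk_vcomp h a _).symm.trans (mk_eq (.vcomp_id h a))
  hcomp_assoc hn₁ hn₂ hn₃ hn₄ hm₁ hm₂ hm₃ hm₄ h₁ h₂ h₃ h₄ a b c := by
    induction a using obj_induct with
    | h0 => simp only [map_zero, LinearMap.zero_apply]
    | hadd _ _ h h' => simp only [map_add, LinearMap.add_apply, h, h']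
    | hsmul _ _ h => simp only [map_smul, LinearMap.smul_apply, h]
    | hof a =>
    induction b using obj_induct with
    | h0 => simp only [map_zero, LinearMap.zero_apply]
    | hadd _ _ h h' => simp only [map_add, LinearMap.add_apply, h, h']
    | hsmul _ _ h => simp only [map_smul, LinearMap.smul_apply, h]
    | hof b =>
    induction c using obj_induct with
    | h0 => simp only [map_zero]
    | hadd _ _ h h' => simp only [map_add, h, h']
    | hsmul _ _ h => simp only [map_smul, h]
    | hof c =>
    refine Eq.trans (b := mk k _) ?_
        ((mk_eq (.hcomp_assoc hn₁ hn₂ hn₃ hn₄ hm₁ hm₂ hm₃ hm₄ h₁ h₂ h₃ h₄ a b c)).trans ?_) <;>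
      rw [mk_hcomp, mk_hcomp]
  id_hcomp hn hm h a := by
    induction a using obj_induct with
    | h0 => simp only [map_zero]
    | hadd _ _ h h' => simp only [map_add, h, h']
    | hsmul _ _ h => simp only [map_smul, h]
    | hof a => exact (mk_hcomp hn hm h _ a).symm.trans (mk_eq (.id_hcomp hn hm h a))
  hcomp_id hn hm h a := by
    induction a using obj_induct with
    | h0 => simp only [map_zero, LinearMap.zero_apply]
    | hadd _ _ h h' => simp only [map_add, LinearMap.add_apply, h, h']
    | hsmul _ _ h => simp only [map_smul, LinearMap.smul_apply, h]
    | hof a => exact (mk_hcomp hn hm h a _).symm.trans (mk_eq (.hcomp_id hn hm h a))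
  interchange hn hr hm hi hj h h₁ h₂ h' a₁ a₂ b₁ b₂ := by
    induction a₁ using obj_induct with
    | h0 => simp only [map_zero, LinearMap.zero_apply, smul_zero]
    | hadd _ _ h h' => simp only [map_add, LinearMap.add_apply, smul_add, h, h']
    | hsmul c _ h => simp only [map_smul, LinearMap.smul_apply, smul_comm _ c, h]
    | hof a₁ =>
    induction a₂ using obj_induct with
    | h0 => simp only [map_zero, LinearMap.zero_apply, smul_zero]
    | hadd _ _ h h' => simp only [map_add, LinearMap.add_apply, smul_add, h, h']
    | hsmul c _ h => simp only [map_smul, LinearMap.smul_apply, smul_comm _ c, h]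
    | hof a₂ =>
    induction b₁ using obj_induct with
    | h0 => simp only [map_zero, LinearMap.zero_apply, smul_zero]
    | hadd _ _ h h' => simp only [map_add, LinearMap.add_apply, smul_add, h, h']
    | hsmul c _ h => simp only [map_smul, LinearMap.smul_apply, smul_comm _ c, h]
    | hof b₁ =>
    induction b₂ using obj_induct with
    | h0 => simp only [map_zero, smul_zero]
    | hadd _ _ h h' => simp only [map_add, smul_add, h, h']
    | hsmul c _ h => simp only [map_smul, smul_comm _ c, h]
    | hof b₂ =>
    refine Eq.trans (b := mk k _) ?_
      ((mk_eq_smul (.interchange hn hr hm hi hj h h₁ h₂ h' a₁ a₂ b₁ b₂)).trans ?_)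
    · rw [mk_vcomp, mk_hcomp, mk_hcomp]
    · rw [mk_hcomp, mk_vcomp, mk_vcomp]
  perm_vcomp h σ τ := (mk_vcomp h _ _).symm.trans (mk_eq (.perm_vcomp h σ τ))
  perm_hcomp hn hn' h σ τ := (mk_hcomp hn hn' h _ _).symm.trans (mk_eq (.perm_hcomp hn hn' h σ τ))
  symmetry hn hm hn' hm' h h' h₀ h₁ a b := by
    induction a using obj_induct with
    | h0 => simp only [map_zero, LinearMap.zero_apply, smul_zero]
    | hadd _ _ h h' => simp only [map_add, LinearMap.add_apply, smul_add, h, h']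
    | hsmul c _ h => simp only [map_smul, LinearMap.smul_apply, smul_comm _ c, h]
    | hof a =>
    induction b using obj_induct with
    | h0 => simp only [map_zero, LinearMap.zero_apply, smul_zero]
    | hadd _ _ h h' => simp only [map_add, LinearMap.add_apply, smul_add, h, h']
    | hsmul c _ h => simp only [map_smul, LinearMap.smul_apply, smul_comm _ c, h]
    | hof b =>
    refine Eq.trans (b := mk k _) ?_ ((mk_eq_smul (.symmetry hn hm hn' hm' h h' h₀ h₁ a b)).trans ?_)
    · rw [mk_vcomp, mk_hcomp]; rfl
    · rw [mk_vcomp, mk_hcomp]; rfl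

theorem d_mk {n m : ℕ} {i j : ℤ} (h : j + 1 = i) (t : Term n m i) :
    (propS k).d h (mk k t) = Submodule.Quotient.mk (bd k t j h) := by
  rw [← bdF_of]; rfl

theorem dLaws : (propS k).DLaws where
  d_vcomp h hl a b _ _ hi hj h₁ h₂ := by
    obtain ⟨x, rfl⟩ := Submodule.Quotient.mk_surjective _ a
    obtain ⟨y, rfl⟩ := Submodule.Quotient.mk_surjective _ b
    exact congrArg Submodule.Quotient.mk (bdF_vcompF h hl x y hi hj h₁ h₂)
  d_hcomp hn hm h hl a b _ _ hi hj h₁ h₂ := by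
    obtain ⟨x, rfl⟩ := Submodule.Quotient.mk_surjective _ a
    obtain ⟨y, rfl⟩ := Submodule.Quotient.mk_surjective _ b
    exact congrArg Submodule.Quotient.mk (bdF_hcompF hn hm h hl x y hi hj h₁ h₂)
  d_perm h σ := by
    refine (d_mk h (.perm σ)).trans ?_
    rw [bd]; rfl

/-- The generators of `S`. -/
def gens : Gens (propS k) where
  counit := mk k .counit
  coproduct := mk k .coproduct
  product := mk k .product
  counit_product := (mk_vcomp _ _ _).symm.trans ((Submodule.Quotient.mk_eq_zero _).mpr
    (IsNull.counit_product _))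
  left_counit := by
    refine Eq.trans ?_ (mk_eq (IsNull.left_counit rfl rfl (add_zero 0)))
    rw [mk_vcomp, mk_hcomp]; rfl
  right_counit := by
    refine Eq.trans ?_ (mk_eq (IsNull.right_counit rfl rfl (add_zero 0)))
    rw [mk_vcomp, mk_hcomp]; rfl

theorem d_product (h : (0 : ℤ) + 1 = 1) : (propS k).d h (gens (k := k)).product =
    (propS k).hcomp rfl rfl (add_zero 0) gens.counit ((propS k).perm (1 : Equiv.Perm (Fin 1))) -
      (propS k).hcomp rfl rfl (add_zero 0) ((propS k).perm (1 : Equiv.Perm (Fin 1))) gens.counit := by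
  refine (d_mk h .product).trans ?_
  rw [bd, Submodule.Quotient.mk_sub]
  exact congrArg₂ _ (mk_hcomp _ _ _ _ _) (mk_hcomp _ _ _ _ _)

theorem d_counit {j : ℤ} (h : j + 1 = 0) : (propS k).d h (gens (k := k)).counit = 0 := by
  refine (d_mk h .counit).trans ?_
  rw [bd]; rfl

theorem d_coproduct {j : ℤ} (h : j + 1 = 0) : (propS k).d h (gens (k := k)).coproduct = 0 := by
  refine (d_mk h .coproduct).trans ?_
  rw [bd]; rfl

end PropS
-- Tensor powers, homogeneous elements and Koszul signs
namespace DGMod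

variable {k : Type u} [CommRing k] (C : DGMod.{u, w} k)

/-- A linear map on a tensor power is determined by its values on tensor products of homogeneous
elements. -/
theorem tpow_ext {M : Type w'} [AddCommGroup M] [Module k M] {n : ℕ} {f g : C.TPow n →ₗ[k] M}
    (h : ∀ (e : Fin n → ℤ) (x : Fin n → C.carrier), (∀ r, x r ∈ C.gr (e r)) →
      f (PiTensorProduct.tprod k x) = g (PiTensorProduct.tprod k x)) : f = g := by
  -- Only the factors outside `s` are assumed homogeneous. Enlarging `s` by one index replaces one
  -- homogeneous factor by a sum of such factors, which multilinearity permits.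
  have key : ∀ (s : Finset (Fin n)) (x : Fin n → C.carrier),
      (∀ r, r ∉ s → ∃ i, x r ∈ C.gr i) →
      f (PiTensorProduct.tprod k x) = g (PiTensorProduct.tprod k x) := by
    intro s
    induction s using Finset.induction_on with
    | empty =>
      intro x hx
      choose e he using fun r => hx r (Finset.notMem_empty r)
      exact h e x he
    | insert a s ha ih =>
      intro x hx
      have hmem : x a ∈ ⨆ i, C.gr i := by
        rw [C.isInternal.submodule_iSup_eq_top]; trivial
      have hupd : ∀ y, y ∈ ⨆ i, C.gr i →
          f (PiTensorProduct.tprod k (Function.update x a y)) =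
            g (PiTensorProduct.tprod k (Function.update x a y)) := by
        intro y hy
        induction hy using Submodule.iSup_induction' with
        | mem i y hy =>
          refine ih _ fun r hr => ?_
          by_cases hra : r = a
          · subst hra; exact ⟨i, by simpa using hy⟩
          · rw [Function.update_of_ne hra]
            exact hx r (by simp [hra, hr])
        | zero => simp [MultilinearMap.map_update_zero]
        | add y z _ _ hy hz => simp only [MultilinearMap.map_update_add, map_add, hy, hz]
      simpa using hupd _ hmem
  refine PiTensorProduct.ext (MultilinearMap.ext fun x => ?_)
  exact key Finset.univ x (by simp)

theorem tprod_eq_tcat {n₁ n₂ n : ℕ} (h : n₁ + n₂ = n) (x : Fin n → C.carrier) :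
    PiTensorProduct.tprod k x = C.tcat h
      (PiTensorProduct.tprod k (fun r => x (Fin.cast h (Fin.castAdd n₂ r))) ⊗ₜ[k]
        PiTensorProduct.tprod k (fun r => x (Fin.cast h (Fin.natAdd n₁ r)))) := by
  subst h
  rw [tcat_tprod]
  congr 1
  ext r
  induction r using Fin.addCases <;> simp

theorem tcat_ext {M : Type w'} [AddCommGroup M] [Module k M] {n₁ n₂ n : ℕ} (h : n₁ + n₂ = n)
    {f g : C.TPow n →ₗ[k] M}
    (hfg : ∀ (i j : ℤ), ∀ x ∈ C.tgr n₁ i, ∀ y ∈ C.tgr n₂ j,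
      f (C.tcat h (x ⊗ₜ[k] y)) = g (C.tcat h (x ⊗ₜ[k] y))) : f = g := by
  refine C.tpow_ext fun e x he => ?_
  rw [C.tprod_eq_tcat h]
  exact hfg _ _ _ (C.tprod_mem_tgr (fun r => he _) rfl) _ (C.tprod_mem_tgr (fun r => he _) rfl)

theorem tpow_induct {n : ℕ} {p : C.TPow n → Prop} (hadd : ∀ x y, p x → p y → p (x + y))
    (hsmul : ∀ (c : k) x, p x → p (c • x))
    (ht : ∀ x, p (PiTensorProduct.tprod k x)) (x : C.TPow n) : p x :=
  PiTensorProduct.induction_on x (fun c x => hsmul c _ (ht x)) hadd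

theorem tcat_assoc {n₁ n₂ n₃ n₁₂ n₂₃ n : ℕ} (hn₁ : n₁ + n₂ = n₁₂) (hn₂ : n₁₂ + n₃ = n)
    (hn₃ : n₂ + n₃ = n₂₃) (hn₄ : n₁ + n₂₃ = n) (x : C.TPow n₁) (y : C.TPow n₂) (z : C.TPow n₃) :
    C.tcat hn₂ (C.tcat hn₁ (x ⊗ₜ[k] y) ⊗ₜ[k] z) = C.tcat hn₄ (x ⊗ₜ[k] C.tcat hn₃ (y ⊗ₜ[k] z)) := by
  subst hn₁ hn₃ hn₂
  induction x using tpow_induct with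
  | hadd a b ha hb => simp only [TensorProduct.add_tmul, map_add, ha, hb]
  | hsmul c a ha => simp only [← TensorProduct.smul_tmul', map_smul, ha]
  | ht x =>
  induction y using tpow_induct with
  | hadd a b ha hb => simp only [TensorProduct.add_tmul, TensorProduct.tmul_add, map_add, ha, hb]
  | hsmul c a ha =>
    simp only [← TensorProduct.smul_tmul', TensorProduct.tmul_smul, map_smul, ha]
  | ht y =>
  induction z using tpow_induct with
  | hadd a b ha hb => simp only [TensorProduct.tmul_add, map_add, ha, hb]
  | hsmul c a ha => simp only [TensorProduct.tmul_smul, map_smul, ha]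
  | ht z =>
  rw [tcat_tprod, tcat_tprod, tcat_tprod, tcat_tprod]
  congr 1
  ext r
  simp only [Function.comp_def, Fin.append_assoc, Fin.cast_refl, id]

theorem tcat_zero_left {n : ℕ} (h : 0 + n = n) (x : Fin 0 → C.carrier) (y : C.TPow n) :
    C.tcat h (PiTensorProduct.tprod k x ⊗ₜ[k] y) = y := by
  induction y using tpow_induct with
  | hadd a b ha hb => simp only [TensorProduct.tmul_add, map_add, ha, hb]
  | hsmul c a ha => simp only [TensorProduct.tmul_smul, map_smul, ha]
  | ht y =>
  rw [tcat_tprod]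
  congr 1
  ext r
  rw [Function.comp_apply, show Fin.cast h.symm r = Fin.natAdd 0 r from Fin.ext (by simp),
    Fin.append_right]

theorem tcat_zero_right {n : ℕ} (h : n + 0 = n) (x : Fin 0 → C.carrier) (y : C.TPow n) :
    C.tcat h (y ⊗ₜ[k] PiTensorProduct.tprod k x) = y := by
  induction y using tpow_induct with
  | hadd a b ha hb => simp only [TensorProduct.add_tmul, map_add, ha, hb]
  | hsmul c a ha => simp only [← TensorProduct.smul_tmul', map_smul, ha]
  | ht y =>
  rw [tcat_tprod]
  congr 1
  ext r
  exact Fin.append_left y x r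

theorem tgr_zero_of_ne {i : ℤ} (hi : i ≠ 0) {x : C.TPow 0} (hx : x ∈ C.tgr 0 i) : x = 0 := by
  have : C.tgr 0 i ≤ ⊥ := by
    refine Submodule.span_le.mpr ?_
    rintro _ ⟨e, x, -, h, -⟩
    simp at h
    exact absurd h.symm hi
  exact this hx

theorem ttau_tcat {n₁ n₂ n : ℕ} (h : n₁ + n₂ = n) (x : C.TPow n₁) (y : C.TPow n₂) :
    C.ttau n (C.tcat h (x ⊗ₜ[k] y)) = C.tcat h (C.ttau n₁ x ⊗ₜ[k] C.ttau n₂ y) := by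
  subst h
  induction x using tpow_induct with
  | hadd a b ha hb => simp only [TensorProduct.add_tmul, map_add, ha, hb]
  | hsmul c a ha => simp only [← TensorProduct.smul_tmul', map_smul, ha]
  | ht x =>
  induction y using tpow_induct with
  | hadd a b ha hb => simp only [TensorProduct.tmul_add, map_add, ha, hb]
  | hsmul c a ha => simp only [TensorProduct.tmul_smul, map_smul, ha]
  | ht y =>
  simp only [ttau, PiTensorProduct.map_tprod, tcat_tprod]
  congr 1
  ext r
  induction r using Fin.addCases <;> simp

/-- A summand of `td` that differentiates a factor of the second block has `tau` on every factor of
the first one, which together is `ttau`. -/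
theorem td_tcat {n₁ n₂ n : ℕ} (h : n₁ + n₂ = n) (x : C.TPow n₁) (y : C.TPow n₂) :
    C.td n (C.tcat h (x ⊗ₜ[k] y)) =
      C.tcat h (C.td n₁ x ⊗ₜ[k] y) + C.tcat h (C.ttau n₁ x ⊗ₜ[k] C.td n₂ y) := by
  subst h
  induction x using tpow_induct with
  | hadd a b ha hb => simp only [TensorProduct.add_tmul, map_add, ha, hb]; abel
  | hsmul c a ha => simp only [← TensorProduct.smul_tmul', map_smul, ha, smul_add]
  | ht x =>
  induction y using tpow_induct with
  | hadd a b ha hb => simp only [TensorProduct.tmul_add, map_add, ha, hb]; abel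
  | hsmul c a ha => simp only [TensorProduct.tmul_smul, map_smul, ha, smul_add]
  | ht y =>
  simp only [td, ttau, LinearMap.add_apply, LinearMap.sum_apply, PiTensorProduct.map_tprod, tcat_tprod,
    TensorProduct.sum_tmul, TensorProduct.tmul_sum, map_sum, Fin.sum_univ_add]
  refine congrArg₂ (· + ·) (Finset.sum_congr rfl fun r _ => congrArg _ (funext fun s => ?_))
    (Finset.sum_congr rfl fun r _ => congrArg _ (funext fun s => ?_))
  · induction s using Fin.addCases with
    | left s =>
      have h1 : Fin.castAdd n₂ s < Fin.castAdd n₂ r ↔ s < r := Iff.rfl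
      simp [h1]
    | right s =>
      have h1 : ¬ (Fin.natAdd n₁ s < Fin.castAdd n₂ r) := by rw [Fin.lt_def]; simp; omega
      have h2 : Fin.natAdd n₁ s ≠ Fin.castAdd n₂ r := by rw [Ne, Fin.ext_iff]; simp; omega
      simp [h1, h2]
  · induction s using Fin.addCases with
    | left s =>
      have h1 : Fin.castAdd n₂ s < Fin.natAdd n₁ r := by rw [Fin.lt_def]; simp; omega
      simp [h1]
    | right s => simp

/-- The case distinction on the parity of `j` in `homTensor` becomes a uniform sign on homogeneous
elements; all later sign computations go through this form. -/
theorem homTensor_tcat {n₁ n₂ n m₁ m₂ m : ℕ} (hn : n₁ + n₂ = n) (hm : m₁ + m₂ = m)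
    {i j l : ℤ} (h : i + j = l) (f : C.homDeg n₁ m₁ i) (g : C.homDeg n₂ m₂ j) {a : ℤ}
    {x : C.TPow n₁} (hx : x ∈ C.tgr n₁ a) (y : C.TPow n₂) :
    (C.homTensor hn hm h f g).1 (C.tcat hn (x ⊗ₜ[k] y)) =
      sgn k (j * a) • C.tcat hm (f.1 x ⊗ₜ[k] g.1 y) := by
  simp only [homTensor, LinearMap.mk₂_apply, LinearMap.comp_apply, LinearEquiv.coe_coe,
    LinearEquiv.symm_apply_apply, TensorProduct.map_tmul]
  split_ifs with hj
  · rw [LinearMap.comp_apply, C.ttau_of_mem hx, map_smul, ← TensorProduct.smul_tmul', map_smul]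
    congr 1
    refine sgn_congr k ?_
    obtain ⟨t, rfl⟩ := hj
    exact ⟨-t * a, by ring⟩
  · rw [sgn_even, one_smul]
    exact (Int.not_odd_iff_even.mp hj).mul_right a

theorem homTensor_tcat_even {n₁ n₂ n m₁ m₂ m : ℕ} (hn : n₁ + n₂ = n) (hm : m₁ + m₂ = m)
    {i j l : ℤ} (h : i + j = l) (f : C.homDeg n₁ m₁ i) (g : C.homDeg n₂ m₂ j) (hj : Even j)
    (x : C.TPow n₁) (y : C.TPow n₂) :
    (C.homTensor hn hm h f g).1 (C.tcat hn (x ⊗ₜ[k] y)) = C.tcat hm (f.1 x ⊗ₜ[k] g.1 y) := by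
  simp only [homTensor, LinearMap.mk₂_apply, LinearMap.comp_apply, LinearEquiv.coe_coe,
    LinearEquiv.symm_apply_apply, TensorProduct.map_tmul, if_neg (Int.not_odd_iff_even.mpr hj)]

/-! ### Signs of permutations -/

/-- A permutation permutes the two-element sets of indices, and a symmetric `H` is a function of
those. The bijection puts each image pair into increasing order. -/
theorem prod_lt_comp_perm {M : Type*} [CommMonoid M] {n : ℕ} (τ : Equiv.Perm (Fin n))
    (H : Fin n → Fin n → M) (hH : ∀ a b, H a b = H b a) :
    (∏ p : Fin n × Fin n with p.1 < p.2, H (τ p.1) (τ p.2)) =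
      ∏ p : Fin n × Fin n with p.1 < p.2, H p.1 p.2 := by
  refine Finset.prod_nbij' (fun p => if τ p.1 < τ p.2 then (τ p.1, τ p.2) else (τ p.2, τ p.1))
    (fun p => if τ.symm p.1 < τ.symm p.2 then (τ.symm p.1, τ.symm p.2)
      else (τ.symm p.2, τ.symm p.1)) ?_ ?_ ?_ ?_ ?_
  · rintro ⟨a, b⟩ hab
    simp only [Finset.mem_filter, Finset.mem_univ, true_and] at hab ⊢
    split_ifs with h
    · exact h
    · exact lt_of_le_of_ne (not_lt.mp h) fun e => hab.ne' (τ.injective e)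
  · rintro ⟨a, b⟩ hab
    simp only [Finset.mem_filter, Finset.mem_univ, true_and] at hab ⊢
    split_ifs with h
    · exact h
    · exact lt_of_le_of_ne (not_lt.mp h) fun e => hab.ne' (τ.symm.injective e)
  · rintro ⟨a, b⟩ hab
    simp only [Finset.mem_filter, Finset.mem_univ, true_and] at hab
    by_cases h : τ a < τ b
    · simp [h, hab]
    · simp [h, hab.not_gt]
  · rintro ⟨a, b⟩ hab
    simp only [Finset.mem_filter, Finset.mem_univ, true_and] at hab
    by_cases h : τ.symm a < τ.symm b
    · simp [h, hab]
    · simp [h, hab.not_gt]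
  · rintro ⟨a, b⟩ hab
    dsimp only
    split_ifs
    · rfl
    · exact hH _ _

/-- A pair is inverted by `σ * τ` exactly if it is inverted by one but not both of `τ` on the pair
and `σ` on its image; a pair inverted twice contributes $(-1)^2$. -/
theorem permSign_mul {n : ℕ} (σ τ : Equiv.Perm (Fin n)) (s : Fin n → Bool) :
    permSign k (σ * τ) s = permSign k τ s * permSign k σ (s ∘ τ.symm) := by
  -- The condition of being an inversion is made symmetric in the two indices, as
  -- `prod_lt_comp_perm` requires.
  have hf : ∀ (ρ : Equiv.Perm (Fin n)) (s : Fin n → Bool), permSign k ρ s =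
      ∏ p : Fin n × Fin n with p.1 < p.2,
        if ((p.1 < p.2 ∧ ρ p.2 < ρ p.1) ∨ (p.2 < p.1 ∧ ρ p.1 < ρ p.2)) ∧ s p.1 = true ∧ s p.2 = true
          then (-1 : k) else 1 := by
    intro ρ s
    rw [permSign, Finset.prod_filter]
    refine Finset.prod_congr rfl fun p _ => ?_
    by_cases h : p.1 < p.2
    · simp [h, h.not_gt]
    · simp [h]
  rw [hf, hf, hf, ← prod_lt_comp_perm τ (fun a b => if ((a < b ∧ σ b < σ a) ∨
    (b < a ∧ σ a < σ b)) ∧ (s ∘ τ.symm) a = true ∧ (s ∘ τ.symm) b = true then (-1 : k) else 1),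
    ← Finset.prod_mul_distrib]
  · refine Finset.prod_congr rfl fun p hp => ?_
    simp only [Finset.mem_filter, Finset.mem_univ, true_and] at hp
    have h1 : τ p.1 ≠ τ p.2 := fun e => hp.ne (τ.injective e)
    have h2 : σ (τ p.1) ≠ σ (τ p.2) := fun e => h1 (σ.injective e)
    rcases lt_or_gt_of_ne h1 with h1 | h1 <;> rcases lt_or_gt_of_ne h2 with h2 | h2 <;>
      by_cases hs : s p.1 = true ∧ s p.2 = true <;>
      simp [hp, hp.not_gt, h1, h1.not_gt, h2, h2.not_gt, hs]
  · intro a b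
    congr 1
    apply propext
    tauto

theorem permSign_one {n : ℕ} (s : Fin n → Bool) : permSign k (1 : Equiv.Perm (Fin n)) s = 1 := by
  refine Finset.prod_eq_one fun p _ => if_neg ?_
  rintro ⟨h1, h2, -⟩
  exact h1.asymm h2

theorem tperm_one (n : ℕ) : C.tperm (1 : Equiv.Perm (Fin n)) = LinearMap.id := by
  refine C.tpow_ext fun e x he => ?_
  rw [C.tperm_tprod _ he, permSign_one, one_smul]
  rfl

theorem tperm_mul {n : ℕ} (σ τ : Equiv.Perm (Fin n)) :
    C.tperm (σ * τ) = C.tperm σ ∘ₗ C.tperm τ := by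
  refine C.tpow_ext fun e x he => ?_
  rw [LinearMap.comp_apply, C.tperm_tprod _ he, C.tperm_tprod _ he, map_smul,
    C.tperm_tprod (e := e ∘ τ.symm) (x := x ∘ τ.symm) σ (fun r => he _), smul_smul, permSign_mul]
  rfl

theorem permSign_blockSum {n₁ n₂ : ℕ} (σ : Equiv.Perm (Fin n₁)) (τ : Equiv.Perm (Fin n₂))
    (s : Fin (n₁ + n₂) → Bool) :
    permSign k (PropS.blockSum rfl σ τ) s =
      permSign k σ (fun r => s (Fin.castAdd n₂ r)) * permSign k τ (fun r => s (Fin.natAdd n₁ r)) := by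
  have h1 : ∀ r, PropS.blockSum rfl σ τ (Fin.castAdd n₂ r) = Fin.castAdd n₂ (σ r) := fun r => by
    simp [PropS.blockSum, Equiv.permCongr_apply]
  have h2 : ∀ r, PropS.blockSum rfl σ τ (Fin.natAdd n₁ r) = Fin.natAdd n₁ (τ r) := fun r => by
    simp [PropS.blockSum, Equiv.permCongr_apply]
  simp only [permSign, Fintype.prod_prod_type, Fin.prod_univ_add, h1, h2]
  rw [Finset.prod_mul_distrib, Finset.prod_mul_distrib]
  have e1 : ∀ (a : Fin n₁) (b : Fin n₂), ¬ (Fin.natAdd n₁ b < Fin.castAdd n₂ a) := fun a b => by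
    simp [Fin.lt_def]; omega
  have e2 : ∀ (a b : Fin n₁), Fin.castAdd n₂ a < Fin.castAdd n₂ b ↔ a < b := fun a b => Iff.rfl
  have e3 : ∀ (a b : Fin n₂), Fin.natAdd n₁ a < Fin.natAdd n₁ b ↔ a < b := fun a b => by simp
  simp [e1, e2, e3]

/-- The inversions are precisely the pairs with one letter in each block. -/
theorem permSign_blockSwap {n₁ n₂ : ℕ} (s : Fin (n₁ + n₂) → Bool) :
    permSign k (PropS.blockSwap rfl) s = ∏ a : Fin n₁, ∏ b : Fin n₂,
      if s (Fin.castAdd n₂ a) = true ∧ s (Fin.natAdd n₁ b) = true then -1 else 1 := by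
  have h1 : ∀ r, (PropS.blockSwap rfl (Fin.castAdd n₂ r) : Fin (n₁ + n₂)).val = n₂ + r := fun r => by
    simp [PropS.blockSwap, add_comm]
  have h2 : ∀ r, (PropS.blockSwap rfl (Fin.natAdd n₁ r) : Fin (n₁ + n₂)).val = r := fun r => by
    simp [PropS.blockSwap]
  simp only [permSign, Fintype.prod_prod_type, Fin.prod_univ_add, Fin.lt_def, h1, h2]
  rw [Finset.prod_mul_distrib]
  have e1 : ∀ (a b : Fin n₁), ¬ ((a : ℕ) < b ∧ n₂ + (b : ℕ) < n₂ + a) := by omega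
  have e2 : ∀ (a b : Fin n₂), ¬ (n₁ + (a : ℕ) < n₁ + b ∧ (b : ℕ) < a) := by omega
  have e3 : ∀ (a : Fin n₁) (b : Fin n₂), (a : ℕ) < n₁ + b ∧ (b : ℕ) < n₂ + a := by omega
  have e4 : ∀ (a : Fin n₁) (b : Fin n₂), ¬ (n₁ + (b : ℕ) < a) := by omega
  simp only [← and_assoc, Fin.val_castAdd, Fin.val_natAdd, e1, e2, e3, e4]
  simp

/-- Only pairs containing `r` are affected, and of these only the inversions with an odd partner.
Differentiating the `r`-th factor flips just this parity. -/
theorem permSign_toggle {n : ℕ} (σ : Equiv.Perm (Fin n)) (s s' : Fin n → Bool) (r : Fin n)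
    (h : ∀ t, t ≠ r → s' t = s t) (hr : s' r = !s r) :
    permSign k σ s' = permSign k σ s *
      ∏ t, if ((t < r ∧ σ r < σ t) ∨ (r < t ∧ σ t < σ r)) ∧ s t = true then (-1 : k) else 1 := by
  have h1 : ∀ p q : Fin n,
      (if p < q ∧ σ q < σ p ∧ s' p = true ∧ s' q = true then (-1 : k) else 1) =
      (if p < q ∧ σ q < σ p ∧ s p = true ∧ s q = true then (-1 : k) else 1) *
        ((if p = r then (if r < q ∧ σ q < σ r ∧ s q = true then (-1 : k) else 1) else 1) *
         (if q = r then (if p < r ∧ σ r < σ p ∧ s p = true then (-1 : k) else 1) else 1)) := by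
    intro p q
    by_cases hp : p = r <;> by_cases hq : q = r
    · subst hp hq; simp
    · subst hp
      rw [h q hq, hr]
      cases s p <;> cases s q <;> by_cases hh : p < q ∧ σ q < σ p <;> simp [hq, hh]
    · subst hq
      rw [h p hp, hr]
      cases s p <;> cases s q <;> by_cases hh : p < q ∧ σ q < σ p <;> simp [hp, hh]
    · simp [hp, hq, h p hp, h q hq]
  simp only [permSign, Fintype.prod_prod_type, h1, Finset.prod_mul_distrib]
  congr 1
  simp only [Finset.prod_ite_eq', Finset.mem_univ, if_true]
  rw [Finset.prod_comm]
  simp only [Finset.prod_ite_eq', Finset.mem_univ, if_true]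
  rw [← Finset.prod_mul_distrib]
  refine Finset.prod_congr rfl fun t _ => ?_
  rcases lt_trichotomy t r with ht | ht | ht
  · simp [ht, ht.not_gt]
  · simp [ht]
  · simp [ht, ht.not_gt]

end DGMod
-- The endomorphism prop
namespace DGMod

variable {k : Type u} [CommRing k] (C : DGMod.{u, w} k)

theorem tperm_blockSum {n₁ n₂ n : ℕ} (h : n₁ + n₂ = n) (σ : Equiv.Perm (Fin n₁))
    (τ : Equiv.Perm (Fin n₂)) {i j : ℤ} {x : C.TPow n₁} (hx : x ∈ C.tgr n₁ i) {y : C.TPow n₂}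
    (hy : y ∈ C.tgr n₂ j) :
    C.tperm (PropS.blockSum h σ τ) (C.tcat h (x ⊗ₜ[k] y)) =
      C.tcat h (C.tperm σ x ⊗ₜ[k] C.tperm τ y) := by
  subst h
  induction hx using Submodule.span_induction with
  | zero => simp
  | add a b _ _ ha hb => simp only [TensorProduct.add_tmul, map_add, ha, hb]
  | smul c a _ ha => simp only [← TensorProduct.smul_tmul', map_smul, ha]
  | mem x hx =>
  obtain ⟨e, x, hx, -, rfl⟩ := hx
  induction hy using Submodule.span_induction with
  | zero => simp
  | add a b _ _ ha hb => simp only [TensorProduct.tmul_add, map_add, ha, hb]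
  | smul c a _ ha => simp only [TensorProduct.tmul_smul, map_smul, ha]
  | mem y hy =>
  obtain ⟨e', y, hy, -, rfl⟩ := hy
  have hxy : ∀ r, (Fin.append x y ∘ Fin.cast rfl) r ∈ C.gr ((Fin.append e e' ∘ Fin.cast rfl) r) := by
    intro r
    induction r using Fin.addCases with
    | left r => simpa using hx r
    | right r => simpa using hy r
  rw [tcat_tprod, C.tperm_tprod _ hxy, C.tperm_tprod _ hx, C.tperm_tprod _ hy,
    TensorProduct.smul_tmul_smul, map_smul, tcat_tprod, permSign_blockSum]
  simp only [Function.comp_apply, Fin.cast_refl, id, Fin.append_left, Fin.append_right]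
  congr 2
  ext r
  induction r using Fin.addCases <;> simp [PropS.blockSum, Equiv.permCongr_def]

theorem prod_sgn_blocks {n₁ n₂ : ℕ} (e : Fin n₁ → ℤ) (e' : Fin n₂ → ℤ) :
    (∏ a : Fin n₁, ∏ b : Fin n₂, if Odd (e a) ∧ Odd (e' b) then (-1 : k) else 1) =
      sgn k ((∑ a, e a) * ∑ b, e' b) := by
  rw [Finset.sum_mul_sum, sgn_sum]
  refine Finset.prod_congr rfl fun a _ => ?_
  rw [sgn_sum]
  refine Finset.prod_congr rfl fun b _ => ?_
  split_ifs with h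
  · rw [sgn_odd k (Int.odd_mul.mpr h)]
  · rw [sgn_even k (Int.not_odd_iff_even.mp fun h' => h (Int.odd_mul.mp h'))]

theorem tperm_blockSwap {n₁ n₂ n : ℕ} (h : n₁ + n₂ = n) (h' : n₂ + n₁ = n) {i j : ℤ}
    {x : C.TPow n₁} (hx : x ∈ C.tgr n₁ i) {y : C.TPow n₂} (hy : y ∈ C.tgr n₂ j) :
    C.tperm (PropS.blockSwap h) (C.tcat h (x ⊗ₜ[k] y)) =
      sgn k (i * j) • C.tcat h' (y ⊗ₜ[k] x) := by
  subst h
  induction hx using Submodule.span_induction with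
  | zero => simp
  | add a b _ _ ha hb => simp only [TensorProduct.add_tmul, TensorProduct.tmul_add, map_add, ha, hb, smul_add]
  | smul c a _ ha =>
    simp only [← TensorProduct.smul_tmul', TensorProduct.tmul_smul, map_smul, ha, smul_comm c]
  | mem x hx =>
  obtain ⟨e, x, hx, rfl, rfl⟩ := hx
  induction hy using Submodule.span_induction with
  | zero => simp
  | add a b _ _ ha hb => simp only [TensorProduct.add_tmul, TensorProduct.tmul_add, map_add, ha, hb, smul_add]
  | smul c a _ ha =>
    simp only [← TensorProduct.smul_tmul', TensorProduct.tmul_smul, map_smul, ha, smul_comm c]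
  | mem y hy =>
  obtain ⟨e', y, hy, rfl, rfl⟩ := hy
  have hxy : ∀ r, (Fin.append x y ∘ Fin.cast rfl) r ∈ C.gr ((Fin.append e e' ∘ Fin.cast rfl) r) := by
    intro r
    induction r using Fin.addCases with
    | left r => simpa using hx r
    | right r => simpa using hy r
  rw [tcat_tprod, C.tperm_tprod _ hxy, tcat_tprod, permSign_blockSwap]
  simp only [Function.comp_apply, Fin.cast_refl, id, Fin.append_left, Fin.append_right,
    decide_eq_true_eq, prod_sgn_blocks]
  congr 2
  ext r
  obtain ⟨r, rfl⟩ := (finCongr h').surjective r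
  have h1 : ∀ a : Fin n₂, finAddFlip.symm (Fin.castAdd n₁ a) = Fin.natAdd n₁ a := fun a => by
    rw [Equiv.symm_apply_eq, finAddFlip_apply_natAdd]
  have h2 : ∀ a : Fin n₁, finAddFlip.symm (Fin.natAdd n₂ a) = Fin.castAdd n₂ a := fun a => by
    rw [Equiv.symm_apply_eq, finAddFlip_apply_castAdd]
  induction r using Fin.addCases <;> simp [PropS.blockSwap, h1, h2]

/-- The endomorphism prop satisfies the axioms of a prop. -/
theorem endProp_laws : C.endProp.Laws where
  vcomp_assoc _ _ _ _ _ _ _ := rfl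
  id_vcomp _ a := Subtype.ext (by
    change C.tperm 1 ∘ₗ a.1 = a.1
    rw [tperm_one, LinearMap.id_comp])
  vcomp_id _ a := Subtype.ext (by
    change a.1 ∘ₗ C.tperm 1 = a.1
    rw [tperm_one, LinearMap.comp_id])
  hcomp_assoc {n₁ n₂ n₃ n₁₂ n₂₃ n m₁ m₂ m₃ m₁₂ m₂₃ m i j l ij jl t} hn₁ hn₂ hn₃ hn₄ hm₁ hm₂ hm₃ hm₄
      h₁ h₂ h₃ h₄ a b c := Subtype.ext <| C.tcat_ext hn₂ fun p q xy hxy z hz => by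
    have key : ∀ (p r : ℤ), ∀ x ∈ C.tgr n₁ p, ∀ y ∈ C.tgr n₂ r,
        (C.homTensor hn₂ hm₂ h₂ (C.homTensor hn₁ hm₁ h₁ a b) c).1
          (C.tcat hn₂ (C.tcat hn₁ (x ⊗ₜ[k] y) ⊗ₜ[k] z)) =
        (C.homTensor hn₄ hm₄ h₄ a (C.homTensor hn₃ hm₃ h₃ b c)).1
          (C.tcat hn₂ (C.tcat hn₁ (x ⊗ₜ[k] y) ⊗ₜ[k] z)) := by
      intro p r x hx y hy
      rw [C.homTensor_tcat hn₂ hm₂ h₂ _ _ (C.tcat_mem hn₁ rfl hx hy), C.homTensor_tcat hn₁ hm₁ h₁ _ _ hx,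
        C.tcat_assoc hn₁ hn₂ hn₃ hn₄, C.homTensor_tcat hn₄ hm₄ h₄ _ _ hx,
        C.homTensor_tcat hn₃ hm₃ h₃ _ _ hy, ← TensorProduct.smul_tmul', map_smul,
        C.tcat_assoc hm₁ hm₂ hm₃ hm₄, TensorProduct.tmul_smul, map_smul, smul_smul, smul_smul,
        ← sgn_add, ← sgn_add]
      congr 2
      rw [← h₃]; ring
    have := C.tcat_ext hn₁ (f := (C.homTensor hn₂ hm₂ h₂ (C.homTensor hn₁ hm₁ h₁ a b) c).1 ∘ₗ
        (C.tcat hn₂).toLinearMap ∘ₗ (TensorProduct.mk k _ _).flip z)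
      (g := (C.homTensor hn₄ hm₄ h₄ a (C.homTensor hn₃ hm₃ h₃ b c)).1 ∘ₗ
        (C.tcat hn₂).toLinearMap ∘ₗ (TensorProduct.mk k _ _).flip z) key
    exact LinearMap.congr_fun this xy
  id_hcomp {n m i} hn hm h a := Subtype.ext <| C.tcat_ext hn fun p q x hx y hy => by
    -- The sign `sgn k (i * p)` of the tensor product is trivial because $C^{\otimes 0}$ is
    -- concentrated in degree zero.
    by_cases hp : p = 0
    · subst hp
      change (C.homTensor hn hm h _ a).1 _ = _
      rw [C.homTensor_tcat hn hm h _ _ hx, mul_zero, sgn_zero, one_smul]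
      change C.tcat hm (C.tperm 1 x ⊗ₜ[k] a.1 y) = _
      rw [tperm_one, LinearMap.id_apply]
      clear hx
      induction x using tpow_induct with
      | hadd a b ha hb => simp only [TensorProduct.add_tmul, map_add, ha, hb]
      | hsmul c a ha => simp only [← TensorProduct.smul_tmul', map_smul, ha]
      | ht x => rw [tcat_zero_left, tcat_zero_left]
    · rw [C.tgr_zero_of_ne hp hx]
      simp
  hcomp_id {n m i} hn hm h a := Subtype.ext <| C.tcat_ext hn fun p q x hx y hy => by
    change (C.homTensor hn hm h a _).1 _ = _
    rw [C.homTensor_tcat hn hm h _ _ hx, zero_mul, sgn_zero, one_smul]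
    change C.tcat hm (a.1 x ⊗ₜ[k] C.tperm 1 y) = _
    rw [tperm_one, LinearMap.id_apply]
    clear hy
    induction y using tpow_induct with
    | hadd a b ha hb => simp only [TensorProduct.tmul_add, map_add, ha, hb]
    | hsmul c a ha => simp only [TensorProduct.tmul_smul, map_smul, ha]
    | ht x => rw [tcat_zero_right, tcat_zero_right]
  interchange {n₁ n₂ n r₁ r₂ r m₁ m₂ m i₁ i₂ j₁ j₂ i j l₁ l₂ l} hn hr hm hi hj h h₁ h₂ h' a₁ a₂ b₁ b₂ :=
    Subtype.ext <| C.tcat_ext hn fun p q x hx y hy => by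
    change (C.homTensor hr hm hi a₁ a₂).1 ((C.homTensor hn hr hj b₁ b₂).1 _) = sgn k (i₂ * j₁) •
      (C.homTensor hn hm h' (C.homComp h₁ a₁ b₁) (C.homComp h₂ a₂ b₂)).1 _
    rw [C.homTensor_tcat hn hr hj _ _ hx, map_smul, C.homTensor_tcat hr hm hi _ _ (b₁.2 _ _ hx),
      C.homTensor_tcat hn hm h' _ _ hx, smul_smul, smul_smul, ← sgn_add, ← sgn_add]
    congr 2
    rw [← h₂]; ring
  perm_vcomp h σ τ := Subtype.ext (C.tperm_mul σ τ).symm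
  perm_hcomp hn hn' h σ τ := Subtype.ext <| C.tcat_ext hn fun p q x hx y hy => by
    change (C.homTensor hn hn' h _ _).1 _ = C.tperm _ _
    rw [C.homTensor_tcat hn hn' h _ _ hx, zero_mul, sgn_zero, one_smul, C.tperm_blockSum hn _ _ hx hy]
  symmetry {n₁ n₂ n m₁ m₂ m i j l} hn hm hn' hm' h h' h₀ h₁ a b := Subtype.ext <|
      C.tcat_ext hn fun p q x hx y hy => by
    change C.tperm _ ((C.homTensor hn hm h a b).1 _) =
      sgn k (i * j) • (C.homTensor hn' hm' h' b a).1 (C.tperm _ _)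
    rw [C.homTensor_tcat hn hm h _ _ hx, map_smul,
      C.tperm_blockSwap hm hm' (a.2 _ _ hx) (b.2 _ _ hy), C.tperm_blockSwap hn hn' hx hy, map_smul,
      C.homTensor_tcat hn' hm' h' _ _ hy, smul_smul, smul_smul, smul_smul, ← sgn_add, ← sgn_add,
      ← sgn_add]
    congr 1
    exact sgn_congr k ⟨j * p, by ring⟩

theorem td_tprod {n : ℕ} {e : Fin n → ℤ} {x : Fin n → C.carrier} (hx : ∀ r, x r ∈ C.gr (e r)) :
    C.td n (PiTensorProduct.tprod k x) =
      ∑ r, (∏ s, if s < r then sgn k (e s) else 1) •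
        PiTensorProduct.tprod k (Function.update x r (C.d (x r))) := by
  simp only [td, LinearMap.sum_apply, PiTensorProduct.map_tprod]
  refine Finset.sum_congr rfl fun r _ => ?_
  rw [← MultilinearMap.map_smul_univ]
  congr 1
  ext s
  by_cases hs : s = r
  · subst hs; simp
  · by_cases h : s < r
    · simp [h, hs, C.tau_of_mem (hx s)]
    · simp [h, hs]

theorem update_mem {n : ℕ} {e : Fin n → ℤ} {x : Fin n → C.carrier} (hx : ∀ r, x r ∈ C.gr (e r))
    (r s : Fin n) : Function.update x r (C.d (x r)) s ∈ C.gr (Function.update e r (e r - 1) s) := by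
  by_cases h : s = r
  · subst h; simpa using C.d_mem (hx s)
  · simpa [h] using hx s

/-- For the summand that differentiates `x r`, the differential passes the odd `x t` with `t < r` on
one side and those with `σ t < σ r` on the other. These sets differ by the odd `t` that form an
inversion with `r`, and `permSign_toggle` contributes the sign of exactly those. -/
theorem td_tperm {n : ℕ} (σ : Equiv.Perm (Fin n)) (x : C.TPow n) :
    C.td n (C.tperm σ x) = C.tperm σ (C.td n x) := by
  suffices h : C.td n ∘ₗ C.tperm σ = C.tperm σ ∘ₗ C.td n from LinearMap.congr_fun h x
  refine C.tpow_ext fun e x hx => ?_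
  rw [LinearMap.comp_apply, LinearMap.comp_apply, C.tperm_tprod _ hx, map_smul,
    C.td_tprod (e := e ∘ σ.symm) (x := x ∘ σ.symm) (fun r => hx _), C.td_tprod hx, map_sum, Finset.smul_sum,
    ← Equiv.sum_comp σ]
  refine Finset.sum_congr rfl fun r _ => ?_
  rw [map_smul, C.tperm_tprod σ (C.update_mem hx r), smul_smul, smul_smul,
    permSign_toggle σ (fun r => decide (Odd (e r)))
      (fun s => decide (Odd (Function.update e r (e r - 1) s))) r (fun t ht => by simp [ht])
      (by simp [← Int.not_odd_iff_even])]
  have hup : Function.update (x ∘ σ.symm) (σ r) (C.d ((x ∘ σ.symm) (σ r))) =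
      Function.update x r (C.d (x r)) ∘ σ.symm := by
    simp only [Function.comp_apply, Equiv.symm_apply_apply]
    rw [Function.update_comp_equiv]
    simp
  rw [hup, ← Equiv.prod_comp σ (fun s => if s < σ r then _ else _), mul_left_comm, ← Finset.prod_mul_distrib]
  congr 2
  refine Finset.prod_congr rfl fun t _ => ?_
  simp only [Function.comp_apply, Equiv.symm_apply_apply, decide_eq_true_eq]
  rcases lt_trichotomy t r with ht | rfl | ht
  · have h2 : σ t ≠ σ r := fun e => ht.ne (σ.injective e)
    rcases Int.even_or_odd (e t) with ho | ho
    · simp [sgn_even k ho, Int.not_odd_iff_even.mpr ho]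
    · rcases lt_or_gt_of_ne h2 with h2 | h2 <;> simp [ht, ht.not_gt, ho, h2, h2.not_gt, sgn_odd k ho]
  · simp
  · have h2 : σ t ≠ σ r := fun e => ht.ne' (σ.injective e)
    rcases Int.even_or_odd (e t) with ho | ho
    · simp [sgn_even k ho, Int.not_odd_iff_even.mpr ho]
    · rcases lt_or_gt_of_ne h2 with h2 | h2 <;> simp [ht, ht.not_gt, ho, h2, h2.not_gt, sgn_odd k ho]

theorem endProp_dLaws : C.endProp.DLaws where
  d_vcomp {n r m i j l l'} h hl a b i' j' hi hj h₁ h₂ := Subtype.ext <| LinearMap.ext fun x => by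
    change C.td m (a.1 (b.1 x)) - sgn k l • a.1 (b.1 (C.td n x)) =
      (C.td m (a.1 (b.1 x)) - sgn k i • a.1 (C.td r (b.1 x))) +
        sgn k i • a.1 (C.td r (b.1 x) - sgn k j • b.1 (C.td n x))
    rw [← h, sgn_add, map_sub, map_smul, smul_sub, smul_smul]
    abel
  d_hcomp {n₁ n₂ n m₁ m₂ m i j l l'} hn hm h hl a b i' j' hi hj h₁ h₂ :=
      Subtype.ext <| C.tcat_ext hn fun p q x hx y hy => by
    change C.td m ((C.homTensor hn hm h a b).1 _) - sgn k l • (C.homTensor hn hm h a b).1 (C.td n _) =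
      (C.homTensor hn hm h₁ (C.homD _ _ hi a) b).1 _ +
        sgn k i • (C.homTensor hn hm h₂ a (C.homD _ _ hj b)).1 _
    rw [C.homTensor_tcat hn hm h _ _ hx, C.td_tcat, map_add, C.homTensor_tcat hn hm h _ _ (C.td_mem hx),
      C.ttau_of_mem hx, ← TensorProduct.smul_tmul', map_smul, map_smul, map_smul,
      C.homTensor_tcat hn hm h _ _ hx, C.homTensor_tcat hn hm h₁ _ _ hx,
      C.homTensor_tcat hn hm h₂ _ _ hx, td_tcat, C.ttau_of_mem (a.2 _ _ hx), homD_apply,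
      homD_apply, TensorProduct.sub_tmul, TensorProduct.tmul_sub, map_sub, map_sub,
      ← TensorProduct.smul_tmul', ← TensorProduct.smul_tmul', TensorProduct.tmul_smul, map_smul,
      map_smul, map_smul]
    simp only [smul_add, smul_sub, smul_smul, ← sgn_add]
    rw [sgn_congr k (i := l + j * (p - 1)) (j := j * p + i) ⟨0, by rw [← h]; ring⟩,
      sgn_congr k (i := i + j' * p) (j := j * p + (i + p)) ⟨-p, by rw [← hj]; ring⟩,
      sgn_congr k (i := i + (j' * p + j)) (j := l + (p + j * p))
        ⟨-p, by rw [← h, show j' = j - 1 by omega]; ring⟩]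
    abel
  d_perm h σ := Subtype.ext <| LinearMap.ext fun x => by
    change C.td _ (C.tperm σ x) - sgn k 0 • C.tperm σ (C.td _ x) = 0
    rw [td_tperm, sgn_zero, one_smul, sub_self]

/-! ### Maps compatible with a chain map -/

variable {C} {D : DGMod.{u, w'} k} (f : C.Hom D)

theorem tmap_tcat {n₁ n₂ n : ℕ} (h : n₁ + n₂ = n) (x : C.TPow n₁) (y : C.TPow n₂) :
    tmap f n (C.tcat h (x ⊗ₜ[k] y)) = D.tcat h (tmap f n₁ x ⊗ₜ[k] tmap f n₂ y) := by
  subst h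
  induction x using tpow_induct with
  | hadd a b ha hb => simp only [TensorProduct.add_tmul, map_add, ha, hb]
  | hsmul c a ha => simp only [← TensorProduct.smul_tmul', map_smul, ha]
  | ht x =>
  induction y using tpow_induct with
  | hadd a b ha hb => simp only [TensorProduct.tmul_add, map_add, ha, hb]
  | hsmul c a ha => simp only [TensorProduct.tmul_smul, map_smul, ha]
  | ht y =>
  simp only [tmap, PiTensorProduct.map_tprod, tcat_tprod]
  congr 1
  ext r
  induction r using Fin.addCases <;> simp

theorem tmap_mem {n : ℕ} {i : ℤ} {x : C.TPow n} (hx : x ∈ C.tgr n i) : tmap f n x ∈ D.tgr n i := by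
  have : C.tgr n i ≤ (D.tgr n i).comap (tmap f n) := by
    refine Submodule.span_le.mpr ?_
    rintro _ ⟨e, x, he, hi, rfl⟩
    simp only [Submodule.comap_coe, Set.mem_preimage, tmap, PiTensorProduct.map_tprod]
    exact D.tprod_mem_tgr (fun r => f.map_mem (he r)) hi
  exact this hx

theorem td_tmap {n : ℕ} (x : C.TPow n) : D.td n (tmap f n x) = tmap f n (C.td n x) := by
  suffices h : D.td n ∘ₗ tmap f n = tmap f n ∘ₗ C.td n from LinearMap.congr_fun h x
  refine C.tpow_ext fun e x hx => ?_
  rw [LinearMap.comp_apply, LinearMap.comp_apply, C.td_tprod hx, map_sum, tmap,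
    PiTensorProduct.map_tprod, D.td_tprod (fun r => f.map_mem (hx r))]
  refine Finset.sum_congr rfl fun r _ => ?_
  rw [map_smul, PiTensorProduct.map_tprod]
  congr 2
  ext s
  by_cases h : s = r
  · subst h; simp [f.map_d]
  · simp [h]

theorem tperm_tmap {n : ℕ} (σ : Equiv.Perm (Fin n)) (x : C.TPow n) :
    D.tperm σ (tmap f n x) = tmap f n (C.tperm σ x) := by
  suffices h : D.tperm σ ∘ₗ tmap f n = tmap f n ∘ₗ C.tperm σ from LinearMap.congr_fun h x
  refine C.tpow_ext fun e x hx => ?_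
  rw [LinearMap.comp_apply, LinearMap.comp_apply, C.tperm_tprod _ hx, map_smul, tmap,
    PiTensorProduct.map_tprod, PiTensorProduct.map_tprod, D.tperm_tprod _ (fun r => f.map_mem (hx r))]
  rfl

/-- `a` and `b` are intertwined by the tensor powers of `f`. -/
def Intertwines {n m : ℕ} {i : ℤ} (a : C.endProp.obj n m i) (b : D.endProp.obj n m i) : Prop :=
  tmap f m ∘ₗ C.endVal a = D.endVal b ∘ₗ tmap f n

namespace Intertwines

variable {f}

theorem apply {n m : ℕ} {i : ℤ} {a : C.endProp.obj n m i} {b : D.endProp.obj n m i}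
    (h : Intertwines f a b) (x : C.TPow n) : tmap f m (a.1 x) = b.1 (tmap f n x) :=
  LinearMap.congr_fun h x

theorem zero {n m : ℕ} {i : ℤ} :
    Intertwines f (0 : C.endProp.obj n m i) (0 : D.endProp.obj n m i) :=
  (LinearMap.comp_zero _).trans (LinearMap.zero_comp _).symm

theorem add {n m : ℕ} {i : ℤ} {a a' : C.endProp.obj n m i} {b b' : D.endProp.obj n m i}
    (h : Intertwines f a b) (h' : Intertwines f a' b') : Intertwines f (a + a') (b + b') :=
  LinearMap.ext fun x => (map_add (tmap f m) (a.1 x) (a'.1 x)).trans (by rw [h.apply, h'.apply]; rfl)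

theorem smul {n m : ℕ} {i : ℤ} (c : k) {a : C.endProp.obj n m i} {b : D.endProp.obj n m i}
    (h : Intertwines f a b) : Intertwines f (c • a) (c • b) :=
  LinearMap.ext fun x => (map_smul (tmap f m) c (a.1 x)).trans (by rw [h.apply]; rfl)

theorem d {n m : ℕ} {i j : ℤ} (hj : j + 1 = i) {a : C.endProp.obj n m i} {b : D.endProp.obj n m i}
    (h : Intertwines f a b) : Intertwines f (C.endProp.d hj a) (D.endProp.d hj b) :=
  LinearMap.ext fun x => by
    change tmap f m (C.td m (a.1 x) - sgn k i • a.1 (C.td n x)) =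
      D.td m (b.1 (tmap f n x)) - sgn k i • b.1 (D.td n (tmap f n x))
    rw [map_sub, map_smul, h.apply, ← td_tmap, h.apply, td_tmap f x]

theorem vcomp {n r m : ℕ} {i j l : ℤ} (hl : i + j = l) {a : C.endProp.obj r m i}
    {b : D.endProp.obj r m i} {a' : C.endProp.obj n r j} {b' : D.endProp.obj n r j}
    (h : Intertwines f a b) (h' : Intertwines f a' b') :
    Intertwines f (C.endProp.vcomp hl a a') (D.endProp.vcomp hl b b') :=
  LinearMap.ext fun x => by
    change tmap f m (a.1 (a'.1 x)) = b.1 (b'.1 (tmap f n x))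
    rw [h.apply, h'.apply]

theorem hcomp {n₁ n₂ n m₁ m₂ m : ℕ} {i j l : ℤ} (hn : n₁ + n₂ = n) (hm : m₁ + m₂ = m)
    (hl : i + j = l) {a : C.endProp.obj n₁ m₁ i} {b : D.endProp.obj n₁ m₁ i}
    {a' : C.endProp.obj n₂ m₂ j} {b' : D.endProp.obj n₂ m₂ j}
    (h : Intertwines f a b) (h' : Intertwines f a' b') :
    Intertwines f (C.endProp.hcomp hn hm hl a a') (D.endProp.hcomp hn hm hl b b') :=
  C.tcat_ext hn fun p q x hx y hy => by
    change tmap f m ((C.homTensor hn hm hl a a').1 _) = (D.homTensor hn hm hl b b').1 (tmap f n _)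
    rw [C.homTensor_tcat hn hm hl _ _ hx, map_smul, tmap_tcat, tmap_tcat,
      D.homTensor_tcat hn hm hl _ _ (tmap_mem f hx), h.apply, h'.apply]

theorem perm {n : ℕ} (σ : Equiv.Perm (Fin n)) : Intertwines f (C.endProp.perm σ) (D.endProp.perm σ) :=
  LinearMap.ext fun x => (tperm_tmap f σ x).symm

end Intertwines

end DGMod

/-! ### Block permutations -/

namespace PropS

theorem blockSum_apply_castAdd {n₁ n₂ n : ℕ} (h : n₁ + n₂ = n) (σ : Equiv.Perm (Fin n₁))
    (τ : Equiv.Perm (Fin n₂)) (r : Fin n₁) :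
    blockSum h σ τ (Fin.cast h (Fin.castAdd n₂ r)) = Fin.cast h (Fin.castAdd n₂ (σ r)) := by
  subst h
  simp [blockSum, Equiv.permCongr_apply]

theorem blockSum_apply_natAdd {n₁ n₂ n : ℕ} (h : n₁ + n₂ = n) (σ : Equiv.Perm (Fin n₁))
    (τ : Equiv.Perm (Fin n₂)) (r : Fin n₂) :
    blockSum h σ τ (Fin.cast h (Fin.natAdd n₁ r)) = Fin.cast h (Fin.natAdd n₁ (τ r)) := by
  subst h
  simp [blockSum, Equiv.permCongr_apply]

theorem fin_cases_add {n₁ n₂ n : ℕ} (h : n₁ + n₂ = n) (x : Fin n) :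
    (∃ r : Fin n₁, x = Fin.cast h (Fin.castAdd n₂ r)) ∨
      ∃ r : Fin n₂, x = Fin.cast h (Fin.natAdd n₁ r) := by
  subst h
  induction x using Fin.addCases with
  | left r => exact .inl ⟨r, rfl⟩
  | right r => exact .inr ⟨r, rfl⟩

theorem blockSum_one {n₁ n₂ n : ℕ} (h : n₁ + n₂ = n) :
    blockSum h (1 : Equiv.Perm (Fin n₁)) (1 : Equiv.Perm (Fin n₂)) = 1 := by
  refine Equiv.ext fun x => ?_
  obtain ⟨r, rfl⟩ | ⟨r, rfl⟩ := fin_cases_add h x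
  · rw [blockSum_apply_castAdd]; rfl
  · rw [blockSum_apply_natAdd]; rfl

/-- A permutation that fixes the last letters comes from a permutation of the first ones. -/
theorem exists_blockSum {n₁ n₂ n : ℕ} (h : n₁ + n₂ = n) (σ : Equiv.Perm (Fin n))
    (hσ : ∀ r : Fin n₂, σ (Fin.cast h (Fin.natAdd n₁ r)) = Fin.cast h (Fin.natAdd n₁ r)) :
    ∃ ρ : Equiv.Perm (Fin n₁), σ = blockSum h ρ 1 := by
  subst h
  have h1 : ∀ r : Fin n₁, ∃ s : Fin n₁, σ (Fin.castAdd n₂ r) = Fin.castAdd n₂ s := by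
    intro r
    obtain ⟨s, hs⟩ | ⟨s, hs⟩ := fin_cases_add rfl (σ (Fin.castAdd n₂ r))
    · exact ⟨s, hs⟩
    · have := hs.trans (hσ s).symm
      have := congrArg Fin.val (σ.injective this)
      simp at this
      omega
  choose f hf using h1
  have hinj : Function.Injective f := fun a b hab => by
    have : σ (Fin.castAdd n₂ a) = σ (Fin.castAdd n₂ b) := by rw [hf, hf, hab]
    exact Fin.castAdd_injective _ _ (σ.injective this)
  refine ⟨Equiv.ofBijective f (Finite.injective_iff_bijective.mp hinj), Equiv.ext fun x => ?_⟩
  obtain ⟨r, rfl⟩ | ⟨r, rfl⟩ := fin_cases_add rfl x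
  · rw [blockSum_apply_castAdd]; exact hf r
  · rw [blockSum_apply_natAdd]; exact hσ r

/-- An injection of the last letters extends to a permutation. -/
theorem exists_perm_extend {r q m : ℕ} (h : r + q = m) (π : Fin q → Fin m)
    (hπ : Function.Injective π) :
    ∃ σ : Equiv.Perm (Fin m), ∀ t, σ.symm (Fin.cast h (Fin.natAdd r t)) = π t := by
  have hι : Function.Injective fun t : Fin q => Fin.cast h (Fin.natAdd r t) := fun a b hab => by
    simpa [Fin.ext_iff] using hab
  let e : {x // x ∈ Set.range fun t : Fin q => Fin.cast h (Fin.natAdd r t)} ≃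
      {x // x ∈ Set.range π} :=
    (Equiv.ofInjective _ hι).symm.trans (Equiv.ofInjective _ hπ)
  classical
  refine ⟨(Equiv.extendSubtype e).symm, fun t => ?_⟩
  rw [Equiv.symm_symm, Equiv.extendSubtype_apply_of_mem e _ ⟨t, rfl⟩]
  simp only [e, Equiv.trans_apply]
  have : (⟨Fin.cast h (Fin.natAdd r t), ⟨t, rfl⟩⟩ :
      {x // x ∈ Set.range fun t : Fin q => Fin.cast h (Fin.natAdd r t)}) =
      Equiv.ofInjective _ hι t := rfl
  rw [this, Equiv.symm_apply_apply]
  rfl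

/-- The permutation that exchanges the blocks of length `p` and `q` after the first `r` letters. -/
def bswap {r p q m : ℕ} (h : r + (p + q) = m) : Equiv.Perm (Fin m) :=
  blockSum h (1 : Equiv.Perm (Fin r)) (blockSwap (rfl : p + q = p + q))

theorem bswap_val {r p q m : ℕ} (h : r + (p + q) = m) (x : Fin m) :
    (bswap h x : ℕ) = if (x : ℕ) < r then (x : ℕ) else if (x : ℕ) < r + p then x + q else x - p := by
  obtain ⟨s, rfl⟩ | ⟨s, rfl⟩ := fin_cases_add h x
  · rw [bswap, blockSum_apply_castAdd]
    simp
  · rw [bswap, blockSum_apply_natAdd]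
    obtain ⟨t, rfl⟩ | ⟨t, rfl⟩ := fin_cases_add rfl s
    · simp [blockSwap]; omega
    · simp [blockSwap]
      omega

theorem bswap_symm_val {r p q m : ℕ} (h : r + (p + q) = m) (x : Fin m) :
    ((bswap h).symm x : ℕ) =
      if (x : ℕ) < r then (x : ℕ) else if (x : ℕ) < r + q then x + p else x - q := by
  obtain ⟨y, rfl⟩ := (bswap h).surjective x
  have := y.2
  rw [Equiv.symm_apply_apply, bswap_val]
  split_ifs
  all_goals omega

theorem bswap_symm {r p q m : ℕ} (h : r + (p + q) = m) (h' : r + (q + p) = m) :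
    (bswap h)⁻¹ = bswap h' := by
  refine Equiv.ext fun x => Fin.ext ?_
  rw [bswap_val]
  exact bswap_symm_val h x

end PropS

/-! ### Operations applied to the last strands -/

namespace DGProp

open PropS

variable {k : Type u} [CommRing k] {P : DGProp.{u, w} k}

/-- The left action of a permutation. -/
def lact {n m : ℕ} {i : ℤ} (σ : Equiv.Perm (Fin m)) : P.obj n m i →ₗ[k] P.obj n m i :=
  P.vcomp (zero_add i) (P.perm σ)

/-- The composite `(id_r ⊙ b) ∘ a`. -/
def step {p q r n m m' : ℕ} (hp : r + p = m) (hq : r + q = m') {j i t : ℤ} (h : j + i = t)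
    (b : P.obj p q j) : P.obj n m i →ₗ[k] P.obj n m' t :=
  P.vcomp h (P.hcomp hp hq (zero_add j) (P.perm (1 : Equiv.Perm (Fin r))) b)

/-- The composite `(id_r ⊙ b ⊙ id_s) ∘ a`. -/
def sideStep {p q r s n A B m m' : ℕ} (hA : r + p = A) (hB : r + q = B) (hp : A + s = m)
    (hq : B + s = m') {j i t : ℤ} (h : j + i = t) (b : P.obj p q j) :
    P.obj n m i →ₗ[k] P.obj n m' t :=
  P.vcomp h (P.hcomp hp hq (add_zero j)
    (P.hcomp hA hB (zero_add j) (P.perm (1 : Equiv.Perm (Fin r))) b)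
    (P.perm (1 : Equiv.Perm (Fin s))))

namespace Laws

variable (L : P.Laws)
include L

theorem lact_lact {n m : ℕ} {i : ℤ} (σ τ : Equiv.Perm (Fin m)) (a : P.obj n m i) :
    lact σ (lact τ a) = lact (σ * τ) a := by
  rw [lact, lact, lact, ← L.vcomp_assoc (add_zero 0) (zero_add i) (zero_add i) (zero_add i),
    L.perm_vcomp]

theorem lact_one {n m : ℕ} {i : ℤ} (a : P.obj n m i) : lact 1 a = a := L.id_vcomp _ a

theorem lact_inv_lact {n m : ℕ} {i : ℤ} (σ : Equiv.Perm (Fin m)) (a : P.obj n m i) :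
    lact σ⁻¹ (lact σ a) = a := by
  rw [L.lact_lact, inv_mul_cancel, L.lact_one]

theorem perm_one_hcomp {n₁ n₂ n : ℕ} (h : n₁ + n₂ = n) (h₀ : (0 : ℤ) + 0 = 0) :
    P.hcomp h h h₀ (P.perm (1 : Equiv.Perm (Fin n₁))) (P.perm (1 : Equiv.Perm (Fin n₂))) =
      P.perm 1 := by
  rw [L.perm_hcomp, blockSum_one]

/-- By the interchange law both orders of composition equal $\rho\odot b$ applied to `a`. -/
theorem step_lact {p q r n m m' : ℕ} (hp : r + p = m) (hq : r + q = m') {j i t : ℤ}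
    (h : j + i = t) (b : P.obj p q j) (ρ : Equiv.Perm (Fin r)) (a : P.obj n m i) :
    step hp hq h b (lact (blockSum hp ρ 1) a) = lact (blockSum hq ρ 1) (step hp hq h b a) := by
  have e1 := L.interchange hp hp hq (zero_add j) (zero_add 0) (add_zero j) (zero_add 0) (add_zero j)
    (zero_add j) (P.perm 1) b (P.perm ρ) (P.perm 1)
  have e2 := L.interchange hp hq hq (zero_add 0) (zero_add j) (zero_add j) (zero_add 0) (zero_add j)
    (zero_add j) (P.perm ρ) (P.perm 1) (P.perm 1) b
  rw [L.id_vcomp, L.vcomp_id, L.perm_hcomp, mul_zero, sgn_zero, one_smul] at e1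
  rw [L.vcomp_id, L.id_vcomp, L.perm_hcomp, mul_zero, sgn_zero, one_smul] at e2
  rw [step, lact, lact, ← L.vcomp_assoc (add_zero j) h (zero_add i) h,
    ← L.vcomp_assoc (zero_add j) h h (zero_add t), e1, e2]

/-- This is the symmetry axiom for `b` and the identity of `s` strands, with `r` identity strands
added on the left. It trades an operation on middle strands for one on the last strands, the only
kind that occurs in a word. -/
theorem step_bswap {p q r s n A B R m m' : ℕ} (hA : r + p = A) (hB : r + q = B) (hR : r + s = R)
    (hp : A + s = m) (hq : B + s = m') (hp' : R + p = m) (hq' : R + q = m')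
    (hm : r + (p + s) = m) (hm' : r + (q + s) = m') {j i t : ℤ} (h : j + i = t)
    (b : P.obj p q j) (a : P.obj n m i) :
    step hp' hq' h b (lact (bswap hm) a) = lact (bswap hm') (sideStep hA hB hp hq h b a) := by
  have key : P.vcomp (add_zero j) (P.hcomp hp' hq' (zero_add j) (P.perm (1 : Equiv.Perm (Fin R))) b)
      (P.perm (bswap hm)) = P.vcomp (zero_add j) (P.perm (bswap hm'))
        (P.hcomp hp hq (add_zero j)
          (P.hcomp hA hB (zero_add j) (P.perm (1 : Equiv.Perm (Fin r))) b)
          (P.perm (1 : Equiv.Perm (Fin s)))) := by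
    have e1 := L.symmetry (rfl : p + s = p + s) (rfl : q + s = q + s) (Nat.add_comm s p)
      (Nat.add_comm s q) (add_zero j) (zero_add j) (zero_add j) (add_zero j) b
      (P.perm (1 : Equiv.Perm (Fin s)))
    rw [mul_zero, sgn_zero, one_smul] at e1
    have e2 := L.interchange hm hm hm' (zero_add j) (zero_add 0) (add_zero j) (zero_add 0)
      (add_zero j) (zero_add j) (P.perm (1 : Equiv.Perm (Fin r)))
      (P.hcomp (Nat.add_comm s p) (Nat.add_comm s q) (zero_add j) (P.perm (1 : Equiv.Perm (Fin s))) b)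
      (P.perm (1 : Equiv.Perm (Fin r))) (P.perm (blockSwap rfl))
    have e3 := L.interchange hm hm' hm' (zero_add 0) (zero_add j) (zero_add j) (zero_add 0)
      (zero_add j) (zero_add j) (P.perm (1 : Equiv.Perm (Fin r))) (P.perm (blockSwap rfl))
      (P.perm (1 : Equiv.Perm (Fin r)))
      (P.hcomp rfl rfl (add_zero j) b (P.perm (1 : Equiv.Perm (Fin s))))
    rw [mul_zero, sgn_zero, one_smul, L.vcomp_id] at e2
    rw [mul_zero, sgn_zero, one_smul, L.vcomp_id] at e3
    rw [← L.perm_one_hcomp hR (zero_add 0),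
      L.hcomp_assoc hR hp' (Nat.add_comm s p) hm hR hq' (Nat.add_comm s q) hm'
        (zero_add 0) (zero_add j) (zero_add j) (zero_add j),
      L.hcomp_assoc hA hp rfl hm hB hq rfl hm'
        (zero_add j) (add_zero j) (add_zero j) (zero_add j),
      bswap, bswap, ← L.perm_hcomp hm hm (zero_add 0),
      ← L.perm_hcomp hm' hm' (zero_add 0), e2, e3, e1]
  rw [step, lact, lact, sideStep, ← L.vcomp_assoc (add_zero j) h (zero_add i) h, key,
    L.vcomp_assoc (zero_add j) h h (zero_add t)]

/-- Operations on disjoint strands commute up to sign. -/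
theorem sideStep_step {p q r p' q' n A B m m' l l' : ℕ} (hA : r + p = A) (hB : r + q = B)
    (hm : A + p' = m) (hm' : A + q' = m') (hl : B + p' = l) (hl' : B + q' = l')
    {j j' i s s' t : ℤ} (hs : j' + i = s) (ht : j + s = t) (hs' : j + i = s') (ht' : j' + s' = t)
    (b : P.obj p q j) (c : P.obj p' q' j') (a : P.obj n m i) :
    sideStep hA hB hm' hl' ht b (step hm hm' hs c a) =
      sgn k (j * j') • step hl hl' ht' c (sideStep hA hB hm hl hs' b a) := by
  have e1 := L.interchange hm hm' hl' (add_zero j) (zero_add j') rfl (add_zero j) (zero_add j') rfl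
    (P.hcomp hA hB (zero_add j) (P.perm (1 : Equiv.Perm (Fin r))) b)
    (P.perm (1 : Equiv.Perm (Fin q'))) (P.perm (1 : Equiv.Perm (Fin A))) c
  have e2 := L.interchange hm hl hl' (zero_add j') (add_zero j) (add_comm j' j) (zero_add j)
    (add_zero j') rfl (P.perm (1 : Equiv.Perm (Fin B))) c
    (P.hcomp hA hB (zero_add j) (P.perm (1 : Equiv.Perm (Fin r))) b)
    (P.perm (1 : Equiv.Perm (Fin p')))
  rw [L.vcomp_id, L.id_vcomp, zero_mul, sgn_zero, one_smul] at e1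
  rw [L.vcomp_id, L.id_vcomp] at e2
  rw [step, sideStep, sideStep, step, ← L.vcomp_assoc rfl (by omega) hs ht,
    ← L.vcomp_assoc (add_comm j' j) (by omega) hs' ht', e1, e2, map_smul, LinearMap.smul_apply,
    smul_smul, mul_comm j' j, sgn_mul_self, one_smul]

/-- The composition of two operations on the last strands. -/
theorem step_step {p q s r n m m' m'' : ℕ} (hp : r + p = m) (hq : r + q = m') (hs : r + s = m'')
    {j j' i t l e : ℤ} (h : j + i = t) (h' : j' + t = l) (h₁ : j' + j = e) (h₂ : e + i = l)
    (b : P.obj p q j) (c : P.obj q s j') (a : P.obj n m i) :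
    step hq hs h' c (step hp hq h b a) = step hp hs h₂ (P.vcomp h₁ c b) a := by
  have e1 := L.interchange hp hq hs (zero_add j') (zero_add j) h₁ (zero_add 0) h₁ (zero_add e)
    (P.perm (1 : Equiv.Perm (Fin r))) c (P.perm (1 : Equiv.Perm (Fin r))) b
  rw [L.vcomp_id, mul_zero, sgn_zero, one_smul] at e1
  rw [step, step, step, ← L.vcomp_assoc h₁ h₂ h h', e1]

theorem step_perm {p r n m : ℕ} (hp : r + p = m) {i : ℤ} (h : 0 + i = i) (σ : Equiv.Perm (Fin p))
    (a : P.obj n m i) : step hp hp h (P.perm σ) a = lact (blockSum hp 1 σ) a := by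
  rw [step, lact, L.perm_hcomp]

/-- $b\odot c=(b\odot\mathrm{id})\circ(\mathrm{id}\odot c)$; with `c` applied first the interchange
law produces no sign. -/
theorem step_hcomp {p q p' q' r n A B m m' l : ℕ} (hA : r + p = A) (hB : r + q = B)
    (hm : A + p' = m) (hl : A + q' = l) (hm' : B + q' = m') {s s' : ℕ} (hs : p + p' = s)
    (hs' : q + q' = s') (hp : r + s = m) (hq : r + s' = m')
    {j j' i e t d : ℤ} (h : j' + i = d) (h' : j + d = t) (h₁ : j + j' = e) (h₂ : e + i = t)
    (b : P.obj p q j) (c : P.obj p' q' j') (a : P.obj n m i) :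
    step hp hq h₂ (P.hcomp hs hs' h₁ b c) a =
      sideStep hA hB hl hm' h' b (step hm hl h c a) := by
  have e1 := L.interchange hm hl hm' (add_zero j) (zero_add j') h₁ (add_zero j) (zero_add j') h₁
    (P.hcomp hA hB (zero_add j) (P.perm (1 : Equiv.Perm (Fin r))) b)
    (P.perm (1 : Equiv.Perm (Fin q'))) (P.perm (1 : Equiv.Perm (Fin A))) c
  rw [L.vcomp_id, L.id_vcomp, zero_mul, sgn_zero, one_smul] at e1
  rw [step, sideStep, step, ← L.vcomp_assoc h₁ h₂ h h', e1,
    L.hcomp_assoc hA hm hs hp hB hm' hs' hq (zero_add j) h₁ h₁ (zero_add e)]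

end Laws
end DGProp
-- Words and the terms on their strands
namespace PropS

/-- If a permutation `σ` of `r' + b` letters moves to the last `c` places only letters among the
first `r'`, then it can be written as a product in which those letters are first moved to the end of
the first `r'` letters, then past the last `b` letters. -/
theorem exists_pull {r r' b c m : ℕ} (hq : r' + b = m) (hr : r + c = m) (σ : Equiv.Perm (Fin m))
    (π : Fin c → Fin r')
    (hπ : ∀ t, σ.symm (Fin.cast hr (Fin.natAdd r t)) = Fin.cast hq (Fin.castAdd b (π t))) :
    ∃ (r₀ : ℕ) (h₀ : r₀ + c = r') (h₁ : r₀ + (c + b) = m) (τ : Equiv.Perm (Fin r'))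
      (ρ : Equiv.Perm (Fin r)), (∀ t, τ.symm (Fin.cast h₀ (Fin.natAdd r₀ t)) = π t) ∧
      σ = blockSum hr ρ 1 * bswap h₁ * blockSum hq τ 1 := by
  have hinj : Function.Injective π := fun s t hst => by
    have := (hπ s).trans ((congrArg _ (congrArg _ hst)).trans (hπ t).symm)
    simpa [Fin.ext_iff] using σ.symm.injective this
  have hc : c ≤ r' := by simpa using Fintype.card_le_of_injective π hinj
  obtain ⟨r₀, h₀⟩ : ∃ r₀, r₀ + c = r' := ⟨r' - c, by omega⟩
  obtain ⟨τ, hτ⟩ := exists_perm_extend h₀ π hinj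
  have h₁ : r₀ + (c + b) = m := by omega
  have h₂ : r₀ + (b + c) = m := by omega
  -- `τ` brings the chosen letters to the end of the first `r'`, and the block exchange brings them
  -- to the end of all. What is left of `σ` then fixes the last `c` letters, hence is a permutation
  -- `ρ` of the others.
  obtain ⟨ρ, hρ⟩ := exists_blockSum hr (σ * (blockSum hq τ 1)⁻¹ * bswap h₂) (by
    intro t
    have e1 : bswap h₂ (Fin.cast hr (Fin.natAdd r t)) =
        Fin.cast hq (Fin.castAdd b (Fin.cast h₀ (Fin.natAdd r₀ t))) := by
      apply Fin.ext
      rw [bswap_val]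
      simp
      split_ifs
      all_goals omega
    rw [Equiv.Perm.mul_apply, Equiv.Perm.mul_apply, e1, Equiv.Perm.inv_def, ← Equiv.eq_symm_apply,
      Equiv.symm_apply_eq, hπ, blockSum_apply_castAdd, ← hτ, Equiv.apply_symm_apply])
  refine ⟨r₀, h₀, h₁, τ, ρ, hτ, ?_⟩
  rw [← hρ, ← bswap_symm h₂ h₁]
  simp [mul_assoc]

/-- The terms that record the strands of a composite of coproducts and products. -/
inductive Tm : Type
  | var : Tm
  | left (t : Tm) : Tm
  | right (t : Tm) : Tm
  | join (s t : Tm) : Tm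

/-- The generators other than the counit. -/
inductive Op : Type
  | cop : Op
  | pr : Op

namespace Op

def src : Op → ℕ
  | cop => 1
  | pr => 2

def tgt : Op → ℕ
  | cop => 2
  | pr => 1

def deg : Op → ℤ
  | cop => 0
  | pr => 1

/-- The terms on the output strands in dependence of those on the input strands. -/
def out : (o : Op) → (Fin o.src → Tm) → Fin o.tgt → Tm
  | cop, s => ![.left (s (0 : Fin 1)), .right (s (0 : Fin 1))]
  | pr, s => ![.join (s (0 : Fin 2)) (s (1 : Fin 2))]

theorem tgt_pos (o : Op) : 0 < o.tgt := by cases o <;> simp [tgt]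

theorem src_pos (o : Op) : 0 < o.src := by cases o <;> simp [src]

theorem out_ne_var (o : Op) (s : Fin o.src → Tm) (u : Fin o.tgt) : o.out s u ≠ .var := by
  cases o
  · change Fin 2 at u
    fin_cases u <;> simp [out]
  · change Fin 1 at u
    fin_cases u; simp [out]

/-- A term records the operation that created it together with all inputs of that operation. This is
the reason for using terms as labels: one label of an output suffices to recover the last step that
led to it. -/
theorem out_inj {o o' : Op} {s : Fin o.src → Tm} {s' : Fin o'.src → Tm} {u : Fin o.tgt}
    {u' : Fin o'.tgt} (h : o.out s u = o'.out s' u') : ∃ e : o = o', e ▸ s = s' := by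
  cases o <;> cases o'
  · change Fin 2 at u u'
    refine ⟨rfl, ?_⟩
    fin_cases u <;> fin_cases u' <;> simp [out] at h ⊢
    all_goals
      funext i
      change Fin 1 at i
      fin_cases i
      exact h
  · change Fin 2 at u
    change Fin 1 at u'
    fin_cases u <;> fin_cases u' <;> simp [out] at h
  · change Fin 2 at u'
    change Fin 1 at u
    fin_cases u <;> fin_cases u' <;> simp [out] at h
  · change Fin 1 at u u'
    refine ⟨rfl, ?_⟩
    fin_cases u; fin_cases u'; simp [out] at h ⊢
    funext i
    change Fin 2 at i
    fin_cases i
    exacts [h.1, h.2]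

/-- The terms after an operation on the last strands. -/
def lead (o : Op) {r m m' : ℕ} (hp : r + o.src = m) (hq : r + o.tgt = m') (l : Fin m → Tm) :
    Fin m' → Tm :=
  Fin.append (fun s : Fin r => l (Fin.cast hp (Fin.castAdd _ s)))
    (o.out fun s => l (Fin.cast hp (Fin.natAdd r s))) ∘ Fin.cast hq.symm

theorem lead_castAdd (o : Op) {r m m' : ℕ} (hp : r + o.src = m) (hq : r + o.tgt = m')
    (l : Fin m → Tm) (s : Fin r) :
    o.lead hp hq l (Fin.cast hq (Fin.castAdd _ s)) = l (Fin.cast hp (Fin.castAdd _ s)) := by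
  subst hp hq
  exact Fin.append_left (fun s => l (Fin.castAdd o.src s)) (o.out fun s => l (Fin.natAdd r s)) s

theorem lead_natAdd (o : Op) {r m m' : ℕ} (hp : r + o.src = m) (hq : r + o.tgt = m')
    (l : Fin m → Tm) (s : Fin o.tgt) :
    o.lead hp hq l (Fin.cast hq (Fin.natAdd r s)) =
      o.out (fun s => l (Fin.cast hp (Fin.natAdd r s))) s := by
  subst hp hq
  exact Fin.append_right (fun s => l (Fin.castAdd o.src s)) (o.out fun s => l (Fin.natAdd r s)) s

end Op

variable {k : Type u} [CommRing k] {P : DGProp.{u, w} k}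

/-- The value of a generator other than the counit. -/
def Gens.val (g : Gens P) : (o : Op) → P.obj o.src o.tgt o.deg
  | .cop => g.coproduct
  | .pr => g.product

open DGProp

/-- The composites of generators with one input in which the counit does not occur, or only it
does, up to sign, together with the terms on their output strands. -/
inductive IsWord (g : Gens P) : {m : ℕ} → {i : ℤ} → P.obj 1 m i → (Fin m → Tm) → Prop
  | one : IsWord g (P.perm (1 : Equiv.Perm (Fin 1))) fun _ => .var
  | counit : IsWord g g.counit Fin.elim0
  | neg {m : ℕ} {i : ℤ} {a : P.obj 1 m i} {l : Fin m → Tm} : IsWord g a l → IsWord g (-a) l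
  | act {m : ℕ} {i : ℤ} {a : P.obj 1 m i} {l : Fin m → Tm} (σ : Equiv.Perm (Fin m)) :
      IsWord g a l → IsWord g (lact σ a) (l ∘ σ.symm)
  | comp {m : ℕ} {i : ℤ} {a : P.obj 1 m i} {l : Fin m → Tm} (o : Op) {r m' : ℕ} {t : ℤ}
      (hp : r + o.src = m) (hq : r + o.tgt = m') (h : o.deg + i = t) :
      IsWord g a l → IsWord g (step hp hq h (g.val o) a) (o.lead hp hq l)

theorem IsWord.sgn_smul {g : Gens P} {m : ℕ} {i : ℤ} {a : P.obj 1 m i} {l : Fin m → Tm}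
    (h : IsWord g a l) (j : ℤ) : IsWord g (sgn k j • a) l := by
  rcases Int.even_or_odd j with hj | hj
  · rwa [sgn_even k hj, one_smul]
  · rw [sgn_odd k hj, neg_one_smul]
    exact h.neg

/-- `sideStep_step` expressed by operations on last strands alone: the operation `c` done first and
the operation `b` done second on other strands change places up to sign, and the result again has
the shape of a word. -/
theorem _root_.DGAlg.DGProp.Laws.step_bswap_step (L : P.Laws) {p q p' q' r n m m' l M : ℕ}
    (hm : r + (p + q') = m) (hm' : r + (q + q') = m') (hM : r + (p + p') = M) (hl : r + (q + p') = l)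
    {R : ℕ} (hR : r + q' = R) (hRp : R + p = m) (hRq : R + q = m')
    {A : ℕ} (hA : r + p = A) (hAp : A + p' = M) (hAq : A + q' = m)
    {S : ℕ} (hS : r + p' = S) (hSp : S + p = M) (hSq : S + q = l)
    {B : ℕ} (hB : r + q = B) (hBp : B + p' = l) (hBq : B + q' = m')
    {j j' i s s' t : ℤ} (hs : j' + i = s) (ht : j + s = t) (hs' : j + i = s') (ht' : j' + s' = t)
    (b : P.obj p q j) (c : P.obj p' q' j') (a : P.obj n M i) :
    step hRp hRq ht b (lact (bswap hm) (step hAp hAq hs c a)) =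
      sgn k (j * j') • lact (bswap hm') (step hBp hBq ht' c
        (lact (bswap hl)⁻¹ (step hSp hSq hs' b (lact (bswap hM) a)))) := by
  rw [L.step_bswap hA hB hR hAq hBq hRp hRq hm hm' ht,
    L.sideStep_step hA hB hAp hAq hBp hBq hs ht hs' ht',
    L.step_bswap hA hB hS hAp hBp hSp hSq hM hl hs', L.lact_inv_lact, map_smul]

theorem blockSum_symm_castAdd {n₁ n₂ n : ℕ} (h : n₁ + n₂ = n) (σ : Equiv.Perm (Fin n₁))
    (τ : Equiv.Perm (Fin n₂)) (r : Fin n₁) :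
    (blockSum h σ τ).symm (Fin.cast h (Fin.castAdd n₂ r)) = Fin.cast h (Fin.castAdd n₂ (σ.symm r)) := by
  rw [Equiv.symm_apply_eq, blockSum_apply_castAdd, Equiv.apply_symm_apply]

section peel

variable {g : Gens P} (L : P.Laws)
include L

/-- If the terms on some output strands of a word are those that an operation produces, then the
word can be written as a composite that ends with this operation. -/
theorem IsWord.peel {m : ℕ} {i : ℤ} {a : P.obj 1 m i} {l : Fin m → Tm}
    (ha : IsWord g a l) (hinj : ∀ {m : ℕ} {i : ℤ} {a : P.obj 1 m i} {l : Fin m → Tm},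
      IsWord g a l → Function.Injective l) (o : Op) :
    ∀ {r : ℕ} (hq : r + o.tgt = m) (σ : Equiv.Perm (Fin m)) (s : Fin o.src → Tm),
      (∀ t, l (σ.symm (Fin.cast hq (Fin.natAdd r t))) = o.out s t) →
      ∃ (i' : ℤ) (h : o.deg + i' = i) (a₁ : P.obj 1 (r + o.src) i') (l₁ : Fin (r + o.src) → Tm),
        IsWord g a₁ l₁ ∧ lact σ a = step rfl hq h (g.val o) a₁ := by
  have hpos := o.tgt_pos
  induction ha with
  | one =>
    intro r hq σ s hs
    exact absurd (hs ⟨0, hpos⟩).symm (o.out_ne_var _ _)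
  | counit => intro r hq; omega
  | neg ha ih =>
    intro r hq σ s hs
    obtain ⟨i', h, a₁, l₁, h₁, h₂⟩ := ih hq σ s hs
    exact ⟨i', h, -a₁, l₁, h₁.neg, by rw [map_neg, map_neg, h₂]⟩
  | act τ ha ih =>
    intro r hq σ s hs
    obtain ⟨i', h, a₁, l₁, h₁, h₂⟩ := ih hq (σ * τ) s hs
    exact ⟨i', h, a₁, l₁, h₁, by rw [L.lact_lact, h₂]⟩
  | @comp m₀ i a' l' o' r' m t hp hq' h ha ih =>
    intro r hq σ s hs
    have hw := ha.comp o' hp hq' h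
    -- Either one of the chosen strands is an output of the last operation `o'`, or all of them were
    -- present before it.
    by_cases hex : ∃ (t₀ : Fin o.tgt) (u : Fin o'.tgt),
        σ.symm (Fin.cast hq (Fin.natAdd r t₀)) = Fin.cast hq' (Fin.natAdd r' u)
    · obtain ⟨t₀, u, htu⟩ := hex
      have h1 := hs t₀
      rw [htu, o'.lead_natAdd] at h1
      obtain ⟨rfl, h2⟩ := Op.out_inj h1
      obtain rfl : r = r' := by omega
      simp only at h2
      -- The shared strand forces `o = o'` with the same inputs. Since distinct strands have
      -- distinct labels, each chosen strand is then the output of `o'` with the same index, so that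
      -- `σ` fixes the last strands and passes through the operation by `step_lact`.
      obtain ⟨ρ, rfl⟩ := exists_blockSum hq σ (by
        intro t
        rw [← Equiv.eq_symm_apply]
        refine hinj hw ?_
        rw [hs, o'.lead_natAdd, h2])
      subst hp
      exact ⟨_, h, _, _, ha.act (blockSum rfl ρ 1), (L.step_lact rfl hq h _ ρ a').symm⟩
    · have h3 : ∀ t, ∃ v : Fin r', σ.symm (Fin.cast hq (Fin.natAdd r t)) =
          Fin.cast hq' (Fin.castAdd o'.tgt v) := by
        intro t
        obtain ⟨v, hv⟩ | ⟨v, hv⟩ := fin_cases_add hq' (σ.symm (Fin.cast hq (Fin.natAdd r t)))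
        · exact ⟨v, hv⟩
        · exact absurd ⟨t, v, hv⟩ hex
      choose π hπ using h3
      -- Here the chosen strands avoid `o'`. They are found in the shorter word `a'`, from which the
      -- induction hypothesis peels `o`; after that `o` and `o'` are exchanged by `step_bswap_step`.
      obtain ⟨r₀, h₀, h₁, τ, ρ, hτ, rfl⟩ := exists_pull hq' hq σ π hπ
      obtain ⟨i', hi', a₁, l₁, ha₁, hh⟩ := ih (r := r₀ + o'.src) (by omega)
        (bswap (by omega : r₀ + (o.tgt + o'.src) = m₀) * blockSum hp τ 1) s (by
          intro t
          have e1 : (bswap (by omega : r₀ + (o.tgt + o'.src) = m₀)).symm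
              (Fin.cast (by omega : r₀ + o'.src + o.tgt = m₀) (Fin.natAdd (r₀ + o'.src) t)) =
              Fin.cast hp (Fin.castAdd o'.src (Fin.cast h₀ (Fin.natAdd r₀ t))) := by
            apply Fin.ext
            rw [bswap_symm_val]
            simp
            split_ifs
            all_goals omega
          have := hs t
          rw [hπ, o'.lead_castAdd] at this
          rw [← Equiv.Perm.inv_def, mul_inv_rev, Equiv.Perm.mul_apply, Equiv.Perm.inv_def,
            Equiv.Perm.inv_def, e1, blockSum_symm_castAdd, hτ, this])
      -- `a'` with the outputs of `o` placed before the inputs of `o'`, the arrangement in which the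
      -- two operations are exchanged.
      have h4 : lact (blockSum hp τ 1) a' = lact (bswap (by omega : r₀ + (o'.src + o.tgt) = m₀))
          (step rfl (by omega) hi' (g.val o) a₁) := by
        rw [← hh, ← bswap_symm (by omega : r₀ + (o.tgt + o'.src) = m₀), ← L.lact_lact, L.lact_inv_lact]
      obtain rfl : r = r₀ + o'.tgt := by omega
      have hM : r₀ + (o'.src + o.src) = r₀ + o'.src + o.src := by omega
      have hl : r₀ + (o'.tgt + o.src) = r₀ + o'.tgt + o.src := by omega
      have h5 := L.step_bswap_step (by omega : r₀ + (o'.src + o.tgt) = m₀)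
        (by omega : r₀ + (o'.tgt + o.tgt) = m) hM hl h₀ hp hq' rfl rfl (by omega) rfl (by omega)
        (by omega) rfl rfl hq hi' h rfl (by omega : o.deg + (o'.deg + i') = t)
        (g.val o') (g.val o) a₁
      have hw₁ := (((((ha₁.act (bswap hM)).comp o' (by omega : (r₀ + o.src) + o'.src = _)
        (by omega : (r₀ + o.src) + o'.tgt = r₀ + o'.tgt + o.src) rfl).act
        (bswap hl)⁻¹).sgn_smul (o'.deg * o.deg))).act (blockSum rfl ρ 1)
      refine ⟨_, by omega, _, _, hw₁, ?_⟩
      rw [← L.lact_lact, ← L.lact_lact, ← L.step_lact hp hq', h4, h5, map_smul, L.lact_lact,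
        ← bswap_symm (by omega : r₀ + (o'.tgt + o.tgt) = m), inv_mul_cancel, L.lact_one, ← map_smul,
        ← map_smul, L.step_lact]

end peel
end PropS
-- The words span
namespace PropS

open DGProp

variable {k : Type u} [CommRing k] {P : DGProp.{u, w} k}

/-- The span of the words. -/
def words (g : Gens P) (m : ℕ) (i : ℤ) : Submodule k (P.obj 1 m i) :=
  Submodule.span k {a | ∃ l, IsWord g a l}

variable {g : Gens P}

theorem IsWord.mem_words {m : ℕ} {i : ℤ} {a : P.obj 1 m i} {l : Fin m → Tm} (h : IsWord g a l) :
    a ∈ words g m i :=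
  Submodule.subset_span ⟨l, h⟩

theorem words_map_mem {m m' : ℕ} {i i' : ℤ} (f : P.obj 1 m i →ₗ[k] P.obj 1 m' i')
    (hf : ∀ a l, IsWord g a l → f a ∈ words g m' i') {a : P.obj 1 m i} (ha : a ∈ words g m i) :
    f a ∈ words g m' i' := by
  have : words g m i ≤ (words g m' i').comap f :=
    Submodule.span_le.mpr fun a ⟨l, h⟩ => hf a l h
  exact this ha

theorem lact_mem_words {m : ℕ} {i : ℤ} (σ : Equiv.Perm (Fin m)) {a : P.obj 1 m i}
    (ha : a ∈ words g m i) : lact σ a ∈ words g m i :=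
  words_map_mem _ (fun _ _ h => (h.act σ).mem_words) ha

theorem step_val_mem_words (o : Op) {r m m' : ℕ} {i t : ℤ} (hp : r + o.src = m)
    (hq : r + o.tgt = m') (h : o.deg + i = t) {a : P.obj 1 m i} (ha : a ∈ words g m i) :
    step hp hq h (g.val o) a ∈ words g m' t :=
  words_map_mem _ (fun _ _ hw => (hw.comp o hp hq h).mem_words) ha

variable (L : P.Laws)
include L

/-- The counit on the last strand meets the second output of the coproduct, so the relation
`right_counit` applies. -/
theorem step_counit_cop {r m n : ℕ} {i : ℤ} (hp : r + 1 = m) (hq : r + 2 = n) (h : 0 + i = i)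
    (h' : m + 1 = n) (h'' : m + 0 = m) (a : P.obj 1 m i) :
    step h' h'' h g.counit (step hp hq h g.coproduct a) = a := by
  have h1 := L.step_hcomp (n := 1) hp hp h' h'' h'' (rfl : 1 + 1 = 2) (rfl : 1 + 0 = 1) hq hp h h
    (add_zero 0) h (P.perm (1 : Equiv.Perm (Fin 1))) g.counit (step hp hq h g.coproduct a)
  rw [L.step_step hp hq hp h h (add_zero 0) h, g.right_counit, L.step_perm, blockSum_one,
    L.lact_one] at h1
  have h2 : ∀ x : P.obj 1 m i, sideStep hp hp h'' h'' h (P.perm (1 : Equiv.Perm (Fin 1))) x = x := by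
    intro x
    rw [sideStep, L.perm_one_hcomp, L.perm_one_hcomp, L.id_vcomp]
  rw [h2] at h1
  exact h1.symm

/-- The block exchange makes the first output of the coproduct the last strand, so `left_counit`
applies. The remaining permutation `bswap hs'` exchanges an empty block with a single strand. -/
theorem step_counit_cop' {r m n : ℕ} {i : ℤ} (hp : r + 1 = m) (hq : r + 2 = n) (h : 0 + i = i)
    (h' : m + 1 = n) (h'' : m + 0 = m) (hs : r + (1 + 1) = n) (hs' : r + (0 + 1) = m)
    (a : P.obj 1 m i) :
    step h' h'' h g.counit (lact (bswap hs) (step hp hq h g.coproduct a)) = lact (bswap hs') a := by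
  rw [L.step_bswap hp (add_zero r) hp h' hp h' h'' hs hs' h]
  congr 1
  have h1 := L.step_hcomp (n := 1) hp (add_zero r) h' h' hp (rfl : 1 + 1 = 2) (rfl : 0 + 1 = 1) hq hp h h
    (add_zero 0) h g.counit (P.perm (1 : Equiv.Perm (Fin 1))) (step hp hq h g.coproduct a)
  rw [L.step_step hp hq hp h h (add_zero 0) h, g.left_counit, L.step_perm, blockSum_one,
    L.lact_one, L.step_perm, blockSum_one, L.lact_one] at h1
  exact h1.symm

omit L in
theorem step_zero {p q r n m m' : ℕ} (hp : r + p = m) (hq : r + q = m') {j i t : ℤ}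
    (h : j + i = t) (a : P.obj n m i) : step hp hq h (0 : P.obj p q j) a = 0 := by
  rw [step, map_zero, map_zero, LinearMap.zero_apply]

/-- Composition with the counit on one strand of a word. -/
theorem IsWord.erase {m : ℕ} {i : ℤ} {a : P.obj 1 m i} {l : Fin m → Tm} (ha : IsWord g a l) :
    ∀ {r r' : ℕ} (hp : r + 1 = m) (hq : r + 0 = r') (h : 0 + i = i) (σ : Equiv.Perm (Fin m)),
      step hp hq h g.counit (lact σ a) ∈ words g r' i := by
  induction ha with
  | one =>
    intro r r' hp hq h σ
    obtain rfl : r = 0 := by omega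
    obtain rfl : r' = 0 := by omega
    rw [Subsingleton.elim σ 1, L.lact_one, step, L.vcomp_id, L.id_hcomp]
    exact IsWord.counit.mem_words
  | counit => intro r r' hp; omega
  | neg ha ih =>
    intro r r' hp hq h σ
    rw [map_neg, map_neg]
    exact Submodule.neg_mem _ (ih hp hq h σ)
  | act τ ha ih =>
    intro r r' hp hq h σ
    rw [L.lact_lact]
    exact ih hp hq h (σ * τ)
  | @comp m₀ i a' l' o r₁ m t hp₁ hq₁ h₁ ha ih =>
    intro r r' hp hq h σ
    -- If the strand to be erased was not touched by the last operation, the counit commutes past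
    -- that operation and the induction hypothesis applies. Otherwise the strand is an output of it,
    -- and one of the three relations applies.
    obtain ⟨v, hv⟩ | ⟨u, hu⟩ := fin_cases_add hq₁ (σ.symm (Fin.cast hp (Fin.natAdd r (0 : Fin 1))))
    · obtain ⟨r₀, h₀, h₂, τ, ρ, -, rfl⟩ := exists_pull hq₁ hp σ (fun _ => v) (by
        intro t
        rw [Subsingleton.elim t 0, hv])
      have h5 := L.step_bswap_step h₂ (by omega : r₀ + (0 + o.tgt) = r') 
        (by omega : r₀ + (1 + o.src) = m₀) (rfl : r₀ + (0 + o.src) = _) rfl (by omega)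
        (by omega) h₀ hp₁ hq₁ rfl (by omega) (by omega) rfl (by omega) (by omega) h₁
        (zero_add t) (zero_add i) h₁ g.counit (g.val o) (lact (blockSum hp₁ τ 1) a')
      obtain rfl : r = r₀ + o.tgt := by omega
      rw [← L.lact_lact, ← L.lact_lact, L.step_lact, ← L.step_lact hp₁ hq₁, h5]
      refine lact_mem_words _ (Submodule.smul_mem _ _ (lact_mem_words _
        (step_val_mem_words o _ _ _ (lact_mem_words _ ?_))))
      rw [L.lact_lact]
      exact ih _ _ _ _
    · cases o
      · change Fin 2 at u
        obtain rfl : r = r₁ + 1 := by have : r₁ + 2 = m := hq₁; omega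
        obtain rfl : m₀ = r₁ + 1 := hp₁.symm
        obtain rfl : r' = r₁ + 1 := by omega
        obtain rfl : i = t := (zero_add i).symm.trans h₁
        fin_cases u
        -- The first output of the coproduct has to be exchanged with the second before it can be
        -- the last strand; up to that exchange `σ` only permutes the other strands.
        · obtain ⟨ρ, hρ⟩ := exists_blockSum hp (σ * (bswap (by omega : r₁ + (1 + 1) = m))) (by
            intro t
            rw [Subsingleton.elim t 0]
            have e : bswap (by omega : r₁ + (1 + 1) = m) (Fin.cast hp (Fin.natAdd (r₁ + 1) 0)) =
                Fin.cast hq₁ (Fin.natAdd r₁ (0 : Fin 2)) := by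
              apply Fin.ext
              rw [bswap_val]
              simp
              rfl
            rw [Equiv.Perm.mul_apply, e, ← Equiv.eq_symm_apply]
            exact hu.symm)
          have hσ : σ = blockSum hp ρ 1 * bswap (by omega : r₁ + (1 + 1) = m) := by
            have e2 := bswap_symm (by omega : r₁ + (1 + 1) = m) (by omega : r₁ + (1 + 1) = m)
            rw [← hρ, mul_assoc, mul_eq_one_iff_eq_inv.mpr e2.symm, mul_one]
          rw [hσ, ← L.lact_lact, L.step_lact]
          refine lact_mem_words _ ?_
          have := step_counit_cop' (g := g) L hp₁ hq₁ h₁ hp (add_zero _) (by omega) (by omega) a'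
          exact Set.mem_of_eq_of_mem this (lact_mem_words _ ha.mem_words)
        · obtain ⟨ρ, hρ⟩ := exists_blockSum hp σ (by
            intro t
            rw [Subsingleton.elim t 0, ← Equiv.eq_symm_apply]
            refine Eq.trans ?_ hu.symm
            apply Fin.ext
            simp
            rfl)
          rw [hρ, L.step_lact]
          refine lact_mem_words _ ?_
          have := step_counit_cop (g := g) L hp₁ hq₁ h₁ hp (add_zero _) a'
          exact Set.mem_of_eq_of_mem this ha.mem_words
      · change Fin 1 at u
        obtain rfl : r = r₁ := by have : r₁ + 1 = m := hq₁; omega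
        obtain ⟨ρ, hρ⟩ := exists_blockSum hp σ (by
            intro t
            rw [Subsingleton.elim t 0, ← Equiv.eq_symm_apply]
            refine Eq.trans ?_ hu.symm
            obtain rfl := Subsingleton.elim u 0
            apply Fin.ext
            simp
            rfl)
        rw [hρ, L.step_lact]
        refine lact_mem_words _ ?_
        -- An output of the product: the composite contains $\epsilon\circ\mu=0$.
        have h0 : step (P := P) (n := 1) (r := r) hp₁ hq h₁ (0 : P.obj 2 0 1) a' = 0 := by
          exact step_zero _ _ _ _
        have := ((L.step_step hp₁ hq₁ hq h₁ h (zero_add 1) h₁ g.product g.counit a').trans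
          (congrArg (fun b => step hp₁ hq h₁ b a') g.counit_product)).trans h0
        exact Set.mem_of_eq_of_mem this (Submodule.zero_mem _)

omit L in
/-- Composition with `b` on the last strands preserves the span of the words. -/
def StepsInWords (g : Gens P) {p q : ℕ} {j : ℤ} (b : P.obj p q j) : Prop :=
  ∀ {r m m' : ℕ} {i s : ℤ} (hp : r + p = m) (hq : r + q = m') (h : j + i = s)
      {a : P.obj 1 m i}, a ∈ words g m i → step hp hq h b a ∈ words g m' s

theorem stepsInWords_counit : StepsInWords g g.counit := by
  intro r m m' i s hp hq h a ha
  obtain rfl : i = s := by omega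
  refine words_map_mem _ (fun a l hw => ?_) ha
  have := hw.erase L hp hq h 1
  rwa [L.lact_one] at this

theorem stepsInWords_perm {p : ℕ} (σ : Equiv.Perm (Fin p)) : StepsInWords g (P.perm σ) := by
  intro r m m' i s hp hq h a ha
  obtain rfl : m = m' := by omega
  obtain rfl : i = s := by omega
  rw [L.step_perm]
  exact lact_mem_words _ ha

theorem StepsInWords.vcomp {n r m : ℕ} {i j l : ℤ} {h : i + j = l} {b : P.obj r m i}
    {c : P.obj n r j} (hb : StepsInWords g b) (hc : StepsInWords g c) :
    StepsInWords g (P.vcomp h b c) := by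
  intro r' m₁ m₂ i' s hp hq h' a ha
  rw [← L.step_step hp rfl hq rfl (by omega) h h']
  exact hb _ _ _ (hc _ _ _ ha)

/-- `c` acts on the last strands first, and then `b` on strands in the middle. Conjugation by block
exchanges moves `b` to the last strands, where the hypothesis on it applies. -/
theorem StepsInWords.hcomp {n₁ n₂ n m₁ m₂ m : ℕ} {hn : n₁ + n₂ = n} {hm : m₁ + m₂ = m}
    {i j l : ℤ} {h : i + j = l} {b : P.obj n₁ m₁ i} {c : P.obj n₂ m₂ j} (hb : StepsInWords g b)
    (hc : StepsInWords g c) : StepsInWords g (P.hcomp hn hm h b c) := by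
  intro r N M i' s hp hq h' a ha
  rw [L.step_hcomp (A := r + n₁) (B := r + m₁) rfl rfl (by omega) rfl (by omega) hn hm
    hp hq rfl (by omega) h h']
  have h2 := hc (r := r + n₁) (by omega : r + n₁ + n₂ = N) rfl rfl ha
  have h3 := L.step_bswap (r := r) (s := m₂) rfl rfl rfl rfl (by omega : r + m₁ + m₂ = M)
    (by omega : r + m₂ + n₁ = r + n₁ + m₂) (by omega) (by omega) (by omega)
    (by omega : i + (j + i') = s) b
    (step (by omega : r + n₁ + n₂ = N) rfl rfl c a)
  have h4 := congrArg (lact (bswap (by omega : r + (m₁ + m₂) = M))⁻¹) h3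
  rw [L.lact_inv_lact] at h4
  rw [← h4]
  exact lact_mem_words _ (hb _ _ _ (lact_mem_words _ h2))

omit L

/-- A formal composite may contain pieces with any number of inputs, which are not words. The
induction therefore runs over their action on words instead of over membership. -/
theorem stepsInWords_mk {p q : ℕ} {j : ℤ} (t : Term p q j) :
    StepsInWords (gens (k := k)) (mk k t) := by
  induction t with
  | counit => exact stepsInWords_counit laws
  | coproduct => exact fun hp hq h _ ha => step_val_mem_words .cop hp hq h ha
  | product => exact fun hp hq h _ ha => step_val_mem_words .pr hp hq h ha
  | perm σ => exact stepsInWords_perm laws σ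
  | vcomp h b c hb hc =>
    rw [mk_vcomp]
    exact hb.vcomp laws hc
  | hcomp hn hm h b c hb hc =>
    rw [mk_hcomp]
    exact hb.hcomp laws hc

/-- The words span `S(1, m)`. -/
theorem words_eq_top (m : ℕ) (i : ℤ) : words (gens (k := k)) m i = ⊤ := by
  rw [eq_top_iff]
  rintro a -
  induction a using obj_induct with
  | h0 => exact Submodule.zero_mem _
  | hadd _ _ h h' => exact Submodule.add_mem _ h h'
  | hsmul c _ h => exact Submodule.smul_mem _ c h
  | hof t =>
    -- Let `t` act on the identity word, with no strands beside it.
    have := stepsInWords_mk (k := k) t (zero_add 1) (zero_add _) (add_zero _)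
      (IsWord.one (g := gens)).mem_words
    rwa [step, laws.vcomp_id, laws.id_hcomp] at this

end PropS
-- The terms determine the word up to sign
namespace PropS

namespace Tm

/-- The relation of being a subterm. -/
def Sub (s : Tm) : Tm → Prop
  | var => s = var
  | left t => s = left t ∨ Sub s t
  | right t => s = right t ∨ Sub s t
  | join t t' => s = join t t' ∨ Sub s t ∨ Sub s t'

/-- The number of symbols of a term. -/
def size : Tm → ℕ
  | var => 1
  | left t => size t + 1
  | right t => size t + 1
  | join t t' => size t + size t' + 1

theorem Sub.refl (s : Tm) : Sub s s := by cases s <;> simp [Sub]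

theorem Sub.trans {s t r : Tm} (h : Sub s t) (h' : Sub t r) : Sub s r := by
  induction r with
  | var => cases (show t = var from h'); exact h
  | left r ih =>
    obtain rfl | h' := h'
    · exact h
    · exact .inr (ih h')
  | right r ih =>
    obtain rfl | h' := h'
    · exact h
    · exact .inr (ih h')
  | join r r' ih ih' =>
    obtain rfl | h' | h' := h'
    · exact h
    · exact .inr (.inl (ih h'))
    · exact .inr (.inr (ih' h'))

theorem Sub.size_le {s t : Tm} (h : Sub s t) : s.size ≤ t.size := by
  induction t with
  | var => cases (show s = var from h); exact le_rfl
  | left t ih =>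
    obtain rfl | h := h
    · exact le_rfl
    · exact (ih h).trans (Nat.le_succ _)
  | right t ih =>
    obtain rfl | h := h
    · exact le_rfl
    · exact (ih h).trans (Nat.le_succ _)
  | join t t' ih ih' =>
    obtain rfl | h | h := h
    · exact le_rfl
    · have := ih h
      simp only [size]; omega
    · have := ih' h
      simp only [size]; omega

theorem Sub.eq_of_size {s t : Tm} (h : Sub s t) (hs : t.size ≤ s.size) : s = t := by
  cases t with
  | var => exact h
  | left t =>
    obtain rfl | h := h
    · rfl
    · have := h.size_le
      simp only [size] at hs; omega
  | right t =>
    obtain rfl | h := h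
    · rfl
    · have := h.size_le
      simp only [size] at hs; omega
  | join t t' =>
    obtain rfl | h | h := h
    · rfl
    · have := h.size_le
      simp only [size] at hs; omega
    · have := h.size_le
      simp only [size] at hs; omega

theorem var_sub (t : Tm) : Sub var t := by
  induction t with
  | var => rfl
  | left t ih => exact .inr ih
  | right t ih => exact .inr ih
  | join t t' ih ih' => exact .inr (.inl ih)

end Tm

namespace Op

theorem sub_out (o : Op) (s : Fin o.src → Tm) (u : Fin o.tgt) (x : Tm) :
    x.Sub (o.out s u) ↔ x = o.out s u ∨ ∃ v, x.Sub (s v) := by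
  cases o
  · have : (∃ v, x.Sub (s v)) ↔ x.Sub (s (0 : Fin 1)) :=
      ⟨fun ⟨v, hv⟩ => (Subsingleton.elim (α := Fin 1) v 0) ▸ hv, fun h => ⟨_, h⟩⟩
    rw [this]
    change Fin 2 at u
    fin_cases u <;> exact Iff.rfl
  · have : (∃ v, x.Sub (s v)) ↔ x.Sub (s (0 : Fin 2)) ∨ x.Sub (s (1 : Fin 2)) := Fin.exists_fin_two
    rw [this]
    change Fin 1 at u
    fin_cases u
    exact Iff.rfl

theorem out_size_eq (o : Op) (s : Fin o.src → Tm) (u u' : Fin o.tgt) :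
    (o.out s u).size = (o.out s u').size := by
  cases o
  · change Fin 2 at u u'
    fin_cases u <;> fin_cases u' <;> rfl
  · exact congrArg _ (congrArg _ (Subsingleton.elim (α := Fin 1) u u'))

theorem out_injective (o : Op) (s : Fin o.src → Tm) : Function.Injective (o.out s) := by
  cases o
  · intro u u' h
    change Fin 2 at u u'
    fin_cases u <;> fin_cases u' <;> first | rfl | exact Tm.noConfusion h
  · exact fun u u' _ => Subsingleton.elim (α := Fin 1) u u'

variable (o : Op) {r m m' : ℕ} (hp : r + o.src = m) (hq : r + o.tgt = m')

theorem lead_cases (l : Fin m → Tm) (x : Fin m') :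
    (∃ v : Fin r, x = Fin.cast hq (Fin.castAdd _ v) ∧
      o.lead hp hq l x = l (Fin.cast hp (Fin.castAdd _ v))) ∨
    ∃ u : Fin o.tgt, x = Fin.cast hq (Fin.natAdd r u) ∧
      o.lead hp hq l x = o.out (fun s => l (Fin.cast hp (Fin.natAdd r s))) u := by
  obtain ⟨v, rfl⟩ | ⟨u, rfl⟩ := fin_cases_add hq x
  · exact .inl ⟨v, rfl, o.lead_castAdd hp hq l v⟩
  · exact .inr ⟨u, rfl, o.lead_natAdd hp hq l u⟩

theorem lead_injective : Function.Injective (o.lead hp hq) := by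
  intro l l' h
  funext x
  obtain ⟨v, rfl⟩ | ⟨u, rfl⟩ := fin_cases_add hp x
  · rw [← o.lead_castAdd hp hq l, ← o.lead_castAdd hp hq l', h]
  · have h1 := o.lead_natAdd hp hq l ⟨0, o.tgt_pos⟩
    rw [h, o.lead_natAdd hp hq] at h1
    obtain ⟨e, h2⟩ := out_inj h1
    exact (congrFun h2 u).symm

theorem exists_sub_lead (l : Fin m → Tm) (x : Tm) :
    (∃ j, x.Sub (o.lead hp hq l j)) ↔
      (∃ j, x.Sub (l j)) ∨ ∃ u, x = o.out (fun s => l (Fin.cast hp (Fin.natAdd r s))) u := by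
  constructor
  · rintro ⟨j, hj⟩
    obtain ⟨v, -, hv⟩ | ⟨u, -, hu⟩ := o.lead_cases hp hq l j
    · exact .inl ⟨_, hv ▸ hj⟩
    · rw [hu, sub_out] at hj
      obtain h | ⟨v, hv⟩ := hj
      · exact .inr ⟨u, h⟩
      · exact .inl ⟨_, hv⟩
  · rintro (⟨j, hj⟩ | ⟨u, rfl⟩)
    · obtain ⟨v, rfl⟩ | ⟨v, rfl⟩ := fin_cases_add hp j
      · exact ⟨_, (o.lead_castAdd hp hq l v).symm ▸ hj⟩
      · refine ⟨Fin.cast hq (Fin.natAdd r ⟨0, o.tgt_pos⟩), ?_⟩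
        rw [lead_natAdd, sub_out]
        exact .inr ⟨v, hj⟩
    · exact ⟨Fin.cast hq (Fin.natAdd r u), (o.lead_natAdd hp hq l u).symm ▸ Tm.Sub.refl _⟩

/-- The measure for the induction in `IsWord.eq_or_eq_neg`: peeling off an operation lowers it. -/
theorem sum_size_lt (l : Fin m → Tm) :
    ∑ j, (l j).size < ∑ j, (o.lead hp hq l j).size := by
  subst hp hq
  rw [Fin.sum_univ_add, Fin.sum_univ_add]
  have h1 : ∀ v, o.lead rfl rfl l (Fin.castAdd o.tgt v) = l (Fin.castAdd o.src v) :=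
    o.lead_castAdd rfl rfl l
  have h2 : ∀ v, o.lead rfl rfl l (Fin.natAdd r v) = o.out (fun s => l (Fin.natAdd r s)) v :=
    o.lead_natAdd rfl rfl l
  simp only [h1, h2]
  refine Nat.add_lt_add_left ?_ _
  cases o
  · change ∑ i : Fin 1, _ < ∑ i : Fin 2, _
    rw [Fin.sum_univ_one, Fin.sum_univ_two]
    exact Nat.lt_of_lt_of_le (Nat.lt_succ_self _) (Nat.le_add_right _ _)
  · change ∑ i : Fin 2, _ < ∑ i : Fin 1, _
    rw [Fin.sum_univ_one, Fin.sum_univ_two]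
    exact Nat.lt_succ_self _

end Op

variable {k : Type u} [CommRing k] {P : DGProp.{u, w} k} {g : Gens P}

open DGProp

/-- No term on an output strand of a word is a subterm of another. -/
theorem IsWord.antichain {m : ℕ} {i : ℤ} {a : P.obj 1 m i} {l : Fin m → Tm} (ha : IsWord g a l) :
    ∀ x y, (l x).Sub (l y) → x = y := by
  induction ha with
  | one => exact fun x y _ => Subsingleton.elim x y
  | counit => exact fun x => x.elim0
  | neg _ ih => exact ih
  | act σ _ ih => exact fun x y h => σ.symm.injective (ih _ _ h)
  | @comp m₀ i a' l' o r m t hp hq h ha ih =>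
    -- An untouched strand is never an input of the operation. In the two mixed cases a containment
    -- of labels yields one between such a pair of strands of the shorter word, against the
    -- induction hypothesis.
    have hne : ∀ (v : Fin r) (u : Fin o.src), Fin.cast hp (Fin.castAdd o.src v) ≠
        Fin.cast hp (Fin.natAdd r u) := fun v u h => by
      have := congrArg Fin.val h
      simp at this
      omega
    intro x y hxy
    obtain ⟨v, rfl, hv⟩ | ⟨u, rfl, hu⟩ := o.lead_cases hp hq l' x <;>
      obtain ⟨v', rfl, hv'⟩ | ⟨u', rfl, hu'⟩ := o.lead_cases hp hq l' y
    · rw [hv, hv'] at hxy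
      have := ih _ _ hxy
      simpa [Fin.ext_iff] using this
    · rw [hv, hu', Op.sub_out] at hxy
      obtain h | ⟨s, hs⟩ := hxy
      · refine absurd (ih _ _ ?_) (hne v ⟨0, o.src_pos⟩).symm
        rw [h, Op.sub_out]
        exact .inr ⟨_, Tm.Sub.refl _⟩
      · exact absurd (ih _ _ hs) (hne v s)
    · rw [hu, hv'] at hxy
      refine absurd (ih _ _ (Tm.Sub.trans ?_ hxy)) (hne v' ⟨0, o.src_pos⟩).symm
      rw [Op.sub_out]
      exact .inr ⟨_, Tm.Sub.refl _⟩
    -- Outputs of one operation have labels of equal size, so containment is equality.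
    · rw [hu, hu'] at hxy
      rw [o.out_injective _ (hxy.eq_of_size (o.out_size_eq _ _ _).le)]

theorem IsWord.injective {m : ℕ} {i : ℤ} {a : P.obj 1 m i} {l : Fin m → Tm} (ha : IsWord g a l) :
    Function.Injective l :=
  fun x y h => ha.antichain x y (h ▸ Tm.Sub.refl _)

/-- If `left t` occurs in the terms on the output strands of a word, then so does `right t`, and
conversely. -/
theorem IsWord.mate {m : ℕ} {i : ℤ} {a : P.obj 1 m i} {l : Fin m → Tm} (ha : IsWord g a l) (t : Tm) :
    (∃ j, (Tm.left t).Sub (l j)) ↔ ∃ j, (Tm.right t).Sub (l j) := by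
  induction ha with
  | one => simp [Tm.Sub]
  | counit => exact ⟨fun ⟨j, _⟩ => j.elim0, fun ⟨j, _⟩ => j.elim0⟩
  | neg _ ih => exact ih
  | act σ _ ih =>
    exact (σ.symm.surjective.exists.symm.trans ih).trans σ.symm.surjective.exists
  | @comp m₀ i a' l' o r m t' hp hq h ha ih =>
    -- Subterms never disappear, because every input of an operation stays inside its outputs. So
    -- only the newly created labels matter: the coproduct creates `left t` and `right t` together,
    -- and the product creates neither.
    rw [Op.exists_sub_lead, Op.exists_sub_lead, ih]
    refine or_congr Iff.rfl ?_
    cases o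
    · refine Iff.trans Fin.exists_fin_two (Iff.trans ?_ Fin.exists_fin_two.symm)
      simp [Op.out]
    · refine Iff.trans (Fin.exists_fin_one) (Iff.trans ?_ (Fin.exists_fin_one).symm)
      simp [Op.out]

/-- A word is the counit up to sign if it has no outputs. -/
theorem IsWord.eq_counit (L : P.Laws) {m : ℕ} {i : ℤ} {a : P.obj 1 m i} {l : Fin m → Tm}
    (ha : IsWord g a l) (hm : m = 0) :
    (⟨m, i, a⟩ : Σ m i, P.obj 1 m i) = ⟨0, 0, g.counit⟩ ∨
      (⟨m, i, a⟩ : Σ m i, P.obj 1 m i) = ⟨0, 0, -g.counit⟩ := by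
  induction ha with
  | one => exact absurd hm one_ne_zero
  | counit => exact .inl rfl
  | neg _ ih =>
    obtain h | h := ih hm
    · cases h
      exact .inr rfl
    · cases h
      exact .inl (by rw [neg_neg])
  | act σ _ ih =>
    subst hm
    rw [Subsingleton.elim σ 1, L.lact_one]
    exact ih rfl
  | comp o hp hq h ha ih =>
    have := o.tgt_pos
    omega

/-- A word is the identity up to sign if one of its output strands carries a variable. -/
theorem IsWord.eq_one (L : P.Laws) {m : ℕ} {i : ℤ} {a : P.obj 1 m i} {l : Fin m → Tm}
    (ha : IsWord g a l) {j : Fin m} (hj : l j = .var) :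
    (⟨m, i, a⟩ : Σ m i, P.obj 1 m i) = ⟨1, 0, P.perm 1⟩ ∨
      (⟨m, i, a⟩ : Σ m i, P.obj 1 m i) = ⟨1, 0, -P.perm 1⟩ := by
  induction ha with
  | one => exact .inl rfl
  | counit => exact j.elim0
  | neg _ ih =>
    obtain h | h := ih hj
    · cases h
      exact .inr rfl
    · cases h
      exact .inl (by rw [neg_neg])
  | act σ _ ih =>
    obtain h | h := ih hj <;>
    · cases h
      rw [Subsingleton.elim σ 1, L.lact_one]
      simp
  | @comp m₀ i a' l' o r m t hp hq h ha ih =>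
    obtain ⟨v, rfl, hv⟩ | ⟨u, rfl, hu⟩ := o.lead_cases hp hq l' j
    · rw [hv] at hj
      -- `var` is a subterm of every term, in particular of the label of an input of the operation,
      -- which lies on another strand.
      have := congrArg Fin.val (ha.antichain (Fin.cast hp (Fin.castAdd _ v))
        (Fin.cast hp (Fin.natAdd r ⟨0, o.src_pos⟩)) (hj ▸ Tm.var_sub _))
      simp at this
      omega
    · exact absurd (hu.symm.trans hj) (o.out_ne_var _ _)

/-- On some output strands, every word with outputs, other than the identity up to sign, carries the
terms that an operation produces. -/
theorem IsWord.exists_out {m : ℕ} {i : ℤ} {a : P.obj 1 m i} {l : Fin m → Tm} (ha : IsWord g a l)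
    (hm : m ≠ 0) (hl : ∀ j, l j ≠ .var) :
    ∃ (o : Op) (r : ℕ) (hq : r + o.tgt = m) (σ : Equiv.Perm (Fin m)) (s : Fin o.src → Tm),
      ∀ t, l (σ.symm (Fin.cast hq (Fin.natAdd r t))) = o.out s t := by
  have : Nonempty (Fin m) := ⟨⟨0, by omega⟩⟩
  -- A label of maximal size. If it is a `join`, its single strand will do. If it is `left t` or
  -- `right t`, then its mate occurs as a subterm of some label by `IsWord.mate`, and having maximal
  -- size the mate is itself a label.
  obtain ⟨j, hj⟩ := Finite.exists_max fun j => (l j).size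
  have hcop : ∀ t, (∃ j, l j = .left t) → (∃ j, l j = .right t) →
      ∃ (o : Op) (r : ℕ) (hq : r + o.tgt = m) (σ : Equiv.Perm (Fin m)) (s : Fin o.src → Tm),
      ∀ t, l (σ.symm (Fin.cast hq (Fin.natAdd r t))) = o.out s t := by
    rintro t ⟨x, hx⟩ ⟨y, hy⟩
    have hxy : x ≠ y := fun h => by simp [h, hy] at hx
    obtain ⟨r, hr⟩ : ∃ r, r + Op.cop.tgt = m := by
      have := Fintype.card_le_of_injective ![x, y] (by
        intro a b hab
        fin_cases a <;> fin_cases b <;> simp_all [hxy.symm])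
      exact ⟨m - 2, by simp at this; simp only [Op.tgt]; omega⟩
    obtain ⟨σ, hσ⟩ := exists_perm_extend (q := 2) hr ![x, y] (by
        intro a b hab
        fin_cases a <;> fin_cases b <;> simp_all [hxy.symm])
    refine ⟨.cop, r, hr, σ, fun _ => t, fun u => ?_⟩
    change Fin 2 at u
    refine (congrArg l (hσ u)).trans ?_
    fin_cases u
    exacts [hx, hy]
  have hmax : ∀ (s : Tm), s.size = (l j).size → (∃ j, s.Sub (l j)) → ∃ j, l j = s :=
    fun s hs ⟨j', h⟩ => ⟨j', (h.eq_of_size ((hj j').trans hs.ge)).symm⟩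
  cases hlj : l j with
  | var => exact absurd hlj (hl j)
  | left t =>
    exact hcop t ⟨j, hlj⟩ (hmax _ (by rw [hlj]; rfl) ((ha.mate t).mp ⟨j, hlj ▸ Tm.Sub.refl _⟩))
  | right t =>
    exact hcop t (hmax _ (by rw [hlj]; rfl) ((ha.mate t).mpr ⟨j, hlj ▸ Tm.Sub.refl _⟩)) ⟨j, hlj⟩
  | join t t' =>
    have hr : m - 1 + Op.pr.tgt = m := by simp only [Op.tgt]; omega
    obtain ⟨σ, hσ⟩ := exists_perm_extend (q := 1) hr (fun _ => j)
      (fun a b _ => Subsingleton.elim a b)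
    refine ⟨.pr, _, hr, σ, ![t, t'], fun u => ?_⟩
    change Fin 1 at u
    refine (congrArg l (hσ u)).trans (hlj.trans ?_)
    fin_cases u
    rfl

/-- A word is determined up to sign by the terms on its output strands, provided that these are
determined by the word. -/
theorem IsWord.eq_or_eq_neg (L : P.Laws)
    (hlead : ∀ {m : ℕ} {i : ℤ} {a : P.obj 1 m i} {l l' : Fin m → Tm},
      IsWord g a l → IsWord g a l' → l = l') :
    ∀ {m : ℕ} {i : ℤ} {a a' : P.obj 1 m i} {l : Fin m → Tm}, IsWord g a l → IsWord g a' l →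
      a = a' ∨ a = -a' := by
  have aux : ∀ (N : ℕ) {m : ℕ} {i : ℤ} {a a' : P.obj 1 m i} {l : Fin m → Tm}, IsWord g a l →
      IsWord g a' l → ∑ j, (l j).size = N → a = a' ∨ a = -a' := by
    intro N
    induction N using Nat.strong_induction_on with
    | _ N ih =>
    intro m i a a' l ha ha' hN
    -- The base cases identify `a` and `a'` with the same element up to sign, but in a sigma type,
    -- since arity and degree are identified at the same time.
    have fin : ∀ (m' : ℕ) (c : P.obj 1 m' 0),
        ((⟨m, i, a⟩ : Σ m i, P.obj 1 m i) = ⟨m', 0, c⟩ ∨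
          (⟨m, i, a⟩ : Σ m i, P.obj 1 m i) = ⟨m', 0, -c⟩) →
        ((⟨m, i, a'⟩ : Σ m i, P.obj 1 m i) = ⟨m', 0, c⟩ ∨
          (⟨m, i, a'⟩ : Σ m i, P.obj 1 m i) = ⟨m', 0, -c⟩) → a = a' ∨ a = -a' := by
      rintro m' c h h'
      have e : m = m' := by rcases h with h | h <;> exact congrArg Sigma.fst h
      subst e
      have e : i = 0 := by rcases h with h | h <;> cases h <;> rfl
      subst e
      simp only [Sigma.mk.injEq, heq_eq_eq, true_and] at h h'
      rcases h with rfl | rfl <;> rcases h' with rfl | rfl <;> simp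
    by_cases hm : m = 0
    · exact fin _ _ (ha.eq_counit L hm) (ha'.eq_counit L hm)
    by_cases hl : ∃ j, l j = .var
    · obtain ⟨j, hj⟩ := hl
      exact fin _ _ (ha.eq_one L hj) (ha'.eq_one L hj)
    obtain ⟨o, r, hq, σ, s, hs⟩ := ha.exists_out hm (not_exists.mp hl)
    obtain ⟨i₁, h, a₁, l₁, h₁, h₂⟩ := ha.peel L (fun h => h.injective) o hq σ s hs
    obtain ⟨i₁', h', a₁', l₁', h₁', h₂'⟩ := ha'.peel L (fun h => h.injective) o hq σ s hs
    obtain rfl : i₁ = i₁' := by omega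
    -- The same operation is peeled off both words. By `hlead` the labels after it agree, and `lead`
    -- is injective, so the two shorter words carry the same labels.
    have e₁ := hlead (ha.act σ) (h₂ ▸ h₁.comp o rfl hq h)
    have e₂ := hlead (ha'.act σ) (h₂' ▸ h₁'.comp o rfl hq h)
    obtain rfl : l₁ = l₁' := o.lead_injective rfl hq (e₁.symm.trans e₂)
    have hlt := o.sum_size_lt rfl hq l₁
    simp only [← e₁, Function.comp_apply] at hlt
    rw [Equiv.sum_comp σ.symm fun j => (l j).size, hN] at hlt
    obtain rfl | rfl := ih _ hlt h₁ h₁' rfl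
    · left
      rw [← L.lact_inv_lact σ a, h₂, ← h₂', L.lact_inv_lact]
    · right
      rw [← L.lact_inv_lact σ a, h₂, map_neg, ← h₂', map_neg, L.lact_inv_lact]
  exact @fun _ _ _ _ _ ha ha' => aux _ ha ha' rfl

end PropS

/-! ### Free graded modules and their tensor powers -/

namespace DGMod

variable {k : Type u} [CommRing k]

theorem permSign_eq_or {n : ℕ} (σ : Equiv.Perm (Fin n)) (s : Fin n → Bool) :
    permSign k σ s = 1 ∨ permSign k σ s = -1 := by
  refine Finset.prod_induction _ (fun x => x = 1 ∨ x = -1) ?_ (.inl rfl) ?_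
  · rintro a b (rfl | rfl) (rfl | rfl) <;> simp
  · intro p _
    split_ifs <;> simp

variable (k) in
/-- The graded module with zero differential that is free on a graded set. -/
def free {B : Type} (deg : B → ℤ) : DGMod.{u, u} k where
  carrier := B →₀ k
  gr i := Finsupp.supported k k {b | deg b = i}
  isInternal := by
    refine isInternal_of_ker _ ?_ (fun i => Finsupp.supported k k {b | deg b ≠ i}) ?_ ?_
    · rw [eq_top_iff]
      rintro x -
      induction x using Finsupp.induction_linear with
      | zero => exact Submodule.zero_mem _
      | add _ _ h h' => exact Submodule.add_mem _ h h'
      | single b c =>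
        exact Submodule.mem_iSup_of_mem (deg b) (Finsupp.single_mem_supported _ _ rfl)
    · intro i x hx hx'
      ext b
      by_contra h
      have hb := Finsupp.mem_support_iff.mpr h
      exact hx' hb (hx hb)
    · exact fun i j hij => Finsupp.supported_mono fun b (hb : deg b = j) => hb.trans_ne hij
  d := 0
  d_mem _ := Submodule.zero_mem _
  d_d _ := rfl

namespace free

variable {B : Type} {deg : B → ℤ}

/-- The elements of the basis. -/
def of (b : B) : (free k deg).carrier := Finsupp.single b (1 : k)

theorem of_mem (b : B) : (of b : (free k deg).carrier) ∈ (free k deg).gr (deg b) :=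
  Finsupp.single_mem_supported _ _ rfl

/-- The elements of the basis of a tensor power. -/
def tof {n : ℕ} (x : Fin n → B) : (free k deg).TPow n := PiTensorProduct.tprod k fun r => of (x r)

theorem tof_mem {n : ℕ} (x : Fin n → B) :
    (tof x : (free k deg).TPow n) ∈ (free k deg).tgr n (∑ r, deg (x r)) :=
  (free k deg).tprod_mem_tgr (fun r => of_mem (x r)) rfl

theorem tof_tcat {n₁ n₂ n : ℕ} (h : n₁ + n₂ = n) (x : Fin n₁ → B) (y : Fin n₂ → B) :
    (free k deg).tcat h (tof x ⊗ₜ[k] tof y) = tof (Fin.append x y ∘ Fin.cast h.symm) := by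
  rw [tof, tof, tcat_tprod]
  subst h
  refine congrArg _ (funext fun r => ?_)
  induction r using Fin.addCases <;> simp

theorem tof_eq_tcat {n₁ n₂ n : ℕ} (h : n₁ + n₂ = n) (x : Fin n → B) :
    (tof x : (free k deg).TPow n) = (free k deg).tcat h
      (tof (fun r => x (Fin.cast h (Fin.castAdd n₂ r))) ⊗ₜ[k]
        tof fun r => x (Fin.cast h (Fin.natAdd n₁ r))) :=
  (free k deg).tprod_eq_tcat h _

variable (k deg) in
/-- The given basis. -/
def basis : Module.Basis B k (free k deg).carrier :=
  (Finsupp.basisSingleOne : Module.Basis B k (B →₀ k))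

theorem basis_apply (b : B) : basis k deg b = of b :=
  congrFun (Finsupp.coe_basisSingleOne (R := k) (ι := B)) b

theorem mem_gr {i : ℤ} {x : (free k deg).carrier} (hx : x ∈ (free k deg).gr i) {b : B}
    (hb : (basis k deg).repr x b ≠ 0) : deg b = i :=
  hx (Finsupp.mem_support_iff.mpr hb)

variable (k deg) in
/-- The basis of a tensor power. -/
def tbasis (n : ℕ) : Module.Basis (Fin n → B) k ((free k deg).TPow n) :=
  Basis.piTensorProduct fun _ => basis k deg

theorem tbasis_apply {n : ℕ} (x : Fin n → B) : tbasis k deg n x = tof x := by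
  rw [tbasis, Basis.piTensorProduct_apply]
  simp only [basis_apply]
  rfl

theorem tbasis_repr {n : ℕ} {j : ℤ} {y : (free k deg).TPow n} (hy : y ∈ (free k deg).tgr n j) :
    (tbasis k deg n).repr y ∈ Finsupp.supported k k {x | ∑ r, deg (x r) = j} := by
  have : (free k deg).tgr n j ≤ (Finsupp.supported k k {x | ∑ r, deg (x r) = j}).comap
      (tbasis k deg n).repr.toLinearMap := by
    refine Submodule.span_le.mpr ?_
    rintro _ ⟨e, x, he, rfl, rfl⟩ p hp
    have hp' : ∏ r, (basis k deg).repr (x r) (p r) ≠ 0 := by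
      rw [← Basis.piTensorProduct_repr_tprod_apply]
      exact Finsupp.mem_support_iff.mp hp
    refine Finset.sum_congr rfl fun r _ => ?_
    exact mem_gr (he r) fun h => hp' (Finset.prod_eq_zero (Finset.mem_univ r) h)
  exact this hy

theorem d_eq_zero (x : (free k deg).carrier) : (free k deg).d x = 0 := rfl

attribute [irreducible] free of basis tbasis

theorem tof_ext {M : Type w} [AddCommGroup M] [Module k M] {n : ℕ}
    {f g : (free k deg).TPow n →ₗ[k] M} (h : ∀ x : Fin n → B, f (tof x) = g (tof x)) : f = g :=
  (tbasis k deg n).ext fun x => by rw [tbasis_apply, h]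

/-- The linear map with given values on the basis of a tensor power. -/
def liftFun {n m : ℕ} (F : (Fin n → B) → (free k deg).TPow m) :
    (free k deg).TPow n →ₗ[k] (free k deg).TPow m := (tbasis k deg n).constr k F

theorem liftFun_tof {n m : ℕ} (F : (Fin n → B) → (free k deg).TPow m) (x : Fin n → B) :
    liftFun F (tof x) = F x := by
  rw [← tbasis_apply, liftFun, Module.Basis.constr_basis]

/-- The homogeneous linear map with given values on the basis of a tensor power. -/
def lift {n m : ℕ} {i : ℤ} (F : (Fin n → B) → (free k deg).TPow m)
    (hF : ∀ x : Fin n → B, F x ∈ (free k deg).tgr m (i + ∑ r, deg (x r))) :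
    (free k deg).homDeg n m i :=
  ⟨liftFun F, fun j y hy => by
    rw [liftFun, Module.Basis.constr_apply]
    refine Submodule.sum_mem _ fun x hx => Submodule.smul_mem _ _ ?_
    have := tbasis_repr hy hx
    rw [← (show ∑ r, deg (x r) = j from this)]
    exact hF x⟩

theorem lift_tof {n m : ℕ} {i : ℤ} (F : (Fin n → B) → (free k deg).TPow m)
    (hF : ∀ x : Fin n → B, F x ∈ (free k deg).tgr m (i + ∑ r, deg (x r))) (x : Fin n → B) :
    (lift F hF).1 (tof x) = F x :=
  liftFun_tof F x

end free
end DGMod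

/-! ### The bialgebra of terms -/

namespace PropS

open DGMod

variable {k : Type u} [CommRing k]

namespace Tm

/-- The number of joins in a term. -/
def deg : Tm → ℤ
  | var => 0
  | left t => deg t
  | right _ => 0
  | join t t' => deg t + deg t' + 1

end Tm

/-- The degree of `t` is carried by `left t` alone, with `right t` in degree zero, so that
$t\mapsto\mathtt{left}\,t\otimes\mathtt{right}\,t$ preserves degrees; `join` adds the degree of the
product. -/
theorem Op.sum_deg_out (o : Op) (s : Fin o.src → Tm) :
    ∑ u, (o.out s u).deg = o.deg + ∑ v, (s v).deg := by
  cases o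
  · change ∑ u : Fin 2, _ = 0 + ∑ v : Fin 1, _
    rw [Fin.sum_univ_two, Fin.sum_univ_one, zero_add]
    exact add_zero _
  · change ∑ u : Fin 1, _ = 1 + ∑ v : Fin 2, _
    rw [Fin.sum_univ_two, Fin.sum_univ_one, add_comm]
    rfl

/-- The free module on the terms. -/
abbrev tmMod (k : Type u) [CommRing k] : DGMod.{u, u} k := DGMod.free k Tm.deg

/-- The free module on the terms and a grouplike element. -/
abbrev tmMod' (k : Type u) [CommRing k] : DGMod.{u, u} k :=
  DGMod.free k fun o : Option Tm => o.elim 0 Tm.deg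

/-- The action of the operations on terms. -/
def Op.map (o : Op) : (tmMod k).endProp.obj o.src o.tgt o.deg :=
  free.lift (fun s => free.tof (o.out s)) fun s => by
    rw [← o.sum_deg_out]
    exact free.tof_mem _

theorem Op.map_tof (o : Op) (s : Fin o.src → Tm) :
    (o.map (k := k)).1 (free.tof s) = free.tof (o.out s) :=
  free.lift_tof _ _ _

/-- The coproduct of a term. -/
def tmCop : Option Tm → (tmMod' k).TPow 2
  | none => free.tof ![none, none]
  | some t => free.tof ![none, some t] + free.tof ![some t, none] +
      free.tof ![some (.left t), some (.right t)]

/-- The product of two terms. -/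
def tmPr : Option Tm → Option Tm → (tmMod' k).TPow 1
  | some t, some t' => free.tof ![some (.join t t')]
  | _, _ => 0

theorem tmCop_mem (o : Option Tm) : tmCop o ∈ (tmMod' k).tgr 2 (0 + o.elim 0 Tm.deg) := by
  have h (x : Fin 2 → Option Tm) (j : ℤ) (hj : (x 0).elim 0 Tm.deg + (x 1).elim 0 Tm.deg = j) :
      (free.tof x : (tmMod' k).TPow 2) ∈ (tmMod' k).tgr 2 j := by
    have := free.tof_mem (k := k) (deg := fun o : Option Tm => o.elim 0 Tm.deg) x
    rw [Fin.sum_univ_two] at this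
    exact hj ▸ this
  cases o with
  | none => exact h _ _ rfl
  | some t =>
    refine Submodule.add_mem _ (Submodule.add_mem _ (h _ _ rfl) (h _ _ ?_)) (h _ _ ?_)
    · exact add_comm _ _
    · exact add_comm _ _

theorem tmPr_mem (o o' : Option Tm) :
    tmPr o o' ∈ (tmMod' k).tgr 1 (1 + (o.elim 0 Tm.deg + o'.elim 0 Tm.deg)) := by
  rcases o with - | t
  · exact Submodule.zero_mem _
  rcases o' with - | t'
  · exact Submodule.zero_mem _
  have := free.tof_mem (k := k) (deg := fun o : Option Tm => o.elim 0 Tm.deg) ![some (.join t t')]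
  rw [Fin.sum_univ_one] at this
  rw [add_comm]
  exact this

theorem eq_cons_one {B : Type} (x : Fin 1 → B) : x = ![x 0] := by
  funext i
  fin_cases i
  rfl

theorem eq_cons_two {B : Type} (x : Fin 2 → B) : x = ![x 0, x 1] := by
  funext i
  fin_cases i <;> rfl

/-- The counit on terms. -/
def tmCounit : (tmMod' k).endProp.obj 1 0 0 :=
  free.lift (fun x => (x 0).elim (free.tof ![]) fun _ => 0) fun x => by
    rw [Fin.sum_univ_one]
    cases x 0 with
    | none => exact free.tof_mem (deg := fun o : Option Tm => o.elim 0 Tm.deg) ![]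
    | some t => exact Submodule.zero_mem _

/-- The coproduct on terms. -/
def tmCoproduct : (tmMod' k).endProp.obj 1 2 0 :=
  free.lift (fun x => tmCop (x 0)) fun x => by
    rw [Fin.sum_univ_one]
    exact tmCop_mem _

/-- The product on terms. -/
def tmProduct : (tmMod' k).endProp.obj 2 1 1 :=
  free.lift (fun x => tmPr (x 0) (x 1)) fun x => by
    rw [Fin.sum_univ_two]
    exact tmPr_mem _ _

theorem tmCounit_none : (tmCounit (k := k)).1 (free.tof ![none]) = free.tof ![] :=
  free.lift_tof _ _ _

theorem tmCounit_some (t : Tm) : (tmCounit (k := k)).1 (free.tof ![some t]) = 0 :=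
  free.lift_tof _ _ _

theorem tmCoproduct_tof (o : Option Tm) :
    (tmCoproduct (k := k)).1 (free.tof ![o]) = tmCop o :=
  free.lift_tof _ _ _

theorem tmProduct_tof (o o' : Option Tm) :
    (tmProduct (k := k)).1 (free.tof ![o, o']) = tmPr o o' :=
  free.lift_tof _ _ _

theorem tof_pair (o o' : Option Tm) :
    (free.tof ![o, o'] : (tmMod' k).TPow 2) =
      (tmMod' k).tcat (rfl : 1 + 1 = 2) (free.tof ![o] ⊗ₜ[k] free.tof ![o']) := by
  rw [free.tof_eq_tcat (rfl : 1 + 1 = 2)]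
  congr 3 <;>
  · funext i
    fin_cases i
    rfl

theorem tmPerm_one (n : ℕ) (x : (tmMod' k).TPow n) :
    ((tmMod' k).endProp.perm (1 : Equiv.Perm (Fin n))).1 x = x :=
  LinearMap.congr_fun ((tmMod' k).tperm_one n) x

theorem tmCounit_left (o o' : Option Tm) :
    ((tmMod' k).homTensor (rfl : 1 + 1 = 2) (rfl : 0 + 1 = 1) (add_zero 0) tmCounit
      ((tmMod' k).endProp.perm (1 : Equiv.Perm (Fin 1)))).1
      (free.tof ![o, o']) = o.elim (free.tof ![o']) fun _ => 0 := by
  rw [tof_pair, homTensor_tcat_even _ _ _ _ _ _ Even.zero, tmPerm_one]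
  cases o with
  | none => rw [tmCounit_none]; exact tcat_zero_left _ _ _ _
  | some t => rw [tmCounit_some, TensorProduct.zero_tmul, map_zero]; rfl

theorem tmCounit_right (o o' : Option Tm) :
    ((tmMod' k).homTensor (rfl : 1 + 1 = 2) (rfl : 1 + 0 = 1) (add_zero 0)
      ((tmMod' k).endProp.perm (1 : Equiv.Perm (Fin 1))) tmCounit).1
      (free.tof ![o, o']) = o'.elim (free.tof ![o]) fun _ => 0 := by
  rw [tof_pair, homTensor_tcat_even _ _ _ _ _ _ Even.zero, tmPerm_one]
  cases o' with
  | none => rw [tmCounit_none]; exact tcat_zero_right _ _ _ _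
  | some t => rw [tmCounit_some, TensorProduct.tmul_zero, map_zero]; rfl

theorem tmCounit_left_tmCop (o : Option Tm) :
    ((tmMod' k).homTensor (rfl : 1 + 1 = 2) (rfl : 0 + 1 = 1) (add_zero 0) tmCounit
      ((tmMod' k).endProp.perm (1 : Equiv.Perm (Fin 1)))).1
      ((tmCoproduct (k := k)).1 (free.tof ![o])) = free.tof ![o] := by
  rw [tmCoproduct_tof]
  cases o with
  | none => exact tmCounit_left _ _
  | some t =>
    simp only [tmCop]
    rw [map_add, map_add, tmCounit_left, tmCounit_left, tmCounit_left]
    simp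

theorem tmCounit_right_tmCop (o : Option Tm) :
    ((tmMod' k).homTensor (rfl : 1 + 1 = 2) (rfl : 1 + 0 = 1) (add_zero 0)
      ((tmMod' k).endProp.perm (1 : Equiv.Perm (Fin 1))) tmCounit).1
      ((tmCoproduct (k := k)).1 (free.tof ![o])) = free.tof ![o] := by
  rw [tmCoproduct_tof]
  cases o with
  | none => exact tmCounit_right _ _
  | some t =>
    simp only [tmCop]
    rw [map_add, map_add, tmCounit_right, tmCounit_right, tmCounit_right]
    simp

theorem tmCounit_tmPr (o o' : Option Tm) : (tmCounit (k := k)).1 (tmPr o o') = 0 := by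
  rcases o with - | t
  · exact map_zero _
  rcases o' with - | t'
  · exact map_zero _
  exact tmCounit_some _

/-- The terms as a bialgebra. -/
def tmGens (k : Type u) [CommRing k] : Gens (tmMod' k).endProp where
  counit := tmCounit
  coproduct := tmCoproduct
  product := tmProduct
  counit_product := Subtype.ext <| free.tof_ext fun x => by
    rw [eq_cons_two x]
    exact (congrArg _ (tmProduct_tof _ _)).trans (tmCounit_tmPr _ _)
  left_counit := Subtype.ext <| free.tof_ext fun x => by
    rw [eq_cons_one x, tmPerm_one]
    exact tmCounit_left_tmCop _
  right_counit := Subtype.ext <| free.tof_ext fun x => by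
    rw [eq_cons_one x, tmPerm_one]
    exact tmCounit_right_tmCop _

/-- The projection that forgets the grouplike element. -/
def tmProj (k : Type u) [CommRing k] : (tmMod' k).Hom (tmMod k) where
  toLin := (free.basis k _).constr k fun o : Option Tm => o.elim 0 free.of
  map_mem {i x} hx := by
    rw [Module.Basis.constr_apply]
    refine Submodule.sum_mem _ fun o ho => Submodule.smul_mem _ _ ?_
    have := free.mem_gr hx (Finsupp.mem_support_iff.mp ho)
    subst this
    cases o with
    | none => exact Submodule.zero_mem _
    | some t => exact free.of_mem t
  map_d x := by
    rw [free.d_eq_zero, free.d_eq_zero, map_zero]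

theorem tmProj_of (o : Option Tm) :
    (tmProj k).toLin (free.of o) = o.elim 0 free.of := by
  rw [← free.basis_apply]
  exact (free.basis k _).constr_basis k _ o

theorem tmap_tmProj_some {n : ℕ} (x : Fin n → Tm) :
    tmap (tmProj k) n (free.tof fun i => some (x i)) = free.tof x := by
  rw [free.tof, tmap, PiTensorProduct.map_tprod]
  simp only [tmProj_of]
  rfl

theorem tmap_tmProj_none {n : ℕ} (x : Fin n → Option Tm) {i : Fin n} (h : x i = none) :
    tmap (tmProj k) n (free.tof x) = 0 := by
  rw [free.tof, tmap, PiTensorProduct.map_tprod]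
  refine MultilinearMap.map_coord_zero _ i ?_
  rw [tmProj_of, h]
  rfl

theorem tmap_tmCop (o : Option Tm) :
    tmap (tmProj k) 2 (tmCop o) = (Op.map (k := k) .cop).1 (tmap (tmProj k) 1 (free.tof ![o])) := by
  cases o with
  | none =>
    simp only [tmCop]
    rw [tmap_tmProj_none _ (i := 0) rfl, tmap_tmProj_none _ (i := 0) rfl]
    exact (map_zero _).symm
  | some t =>
    have e1 := tmap_tmProj_some (k := k) ![t]
    have e2 := tmap_tmProj_some (k := k) ![t.left, t.right]
    rw [eq_cons_one fun i => some (![t] i)] at e1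
    rw [eq_cons_two fun i => some (![t.left, t.right] i)] at e2
    simp only [tmCop]
    rw [map_add, map_add, tmap_tmProj_none _ (i := 0) rfl,
      tmap_tmProj_none _ (i := 1) rfl, zero_add, zero_add]
    refine e2.trans (Eq.trans ?_ (congrArg _ e1.symm))
    exact (Op.map_tof (k := k) .cop ![t]).symm

theorem tmap_tmPr (o o' : Option Tm) :
    tmap (tmProj k) 1 (tmPr o o') =
      (Op.map (k := k) .pr).1 (tmap (tmProj k) 2 (free.tof ![o, o'])) := by
  rcases o with - | t
  · rw [tmap_tmProj_none _ (i := 0) rfl]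
    exact (map_zero _).trans (map_zero _).symm
  rcases o' with - | t'
  · rw [tmap_tmProj_none _ (i := 1) rfl]
    exact (map_zero _).trans (map_zero _).symm
  have e1 := tmap_tmProj_some (k := k) ![t, t']
  have e2 := tmap_tmProj_some (k := k) ![t.join t']
  rw [eq_cons_two fun i => some (![t, t'] i)] at e1
  rw [eq_cons_one fun i => some (![t.join t'] i)] at e2
  refine e2.trans (Eq.trans ?_ (congrArg _ e1.symm))
  exact (Op.map_tof (k := k) .pr ![t, t']).symm

/-- The summands of `tmCop` that contain the grouplike element are there for the counit relations.
`tmProj` kills them and leaves just the label-producing map `Op.map`. -/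
theorem intertwines_val (o : Op) : Intertwines (tmProj k) ((tmGens k).val o) o.map := by
  refine free.tof_ext fun x => ?_
  cases o
  · change Fin 1 → Option Tm at x
    rw [eq_cons_one x]
    exact (congrArg (tmap (tmProj k) 2) (tmCoproduct_tof _)).trans (tmap_tmCop _)
  · change Fin 2 → Option Tm at x
    rw [eq_cons_two x]
    exact (congrArg (tmap (tmProj k) 1) (tmProduct_tof _ _)).trans (tmap_tmPr _ _)

/-- The element on which words are evaluated. -/
def tmInput (k : Type u) [CommRing k] : (tmMod' k).TPow 1 :=
  free.tof ![none] + free.tof ![some .var]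

/-- The value of a word at `tmInput` determines the terms on its output strands. -/
theorem IsWord.tm {m : ℕ} {i : ℤ} {a : (tmMod' k).endProp.obj 1 m i} {l : Fin m → Tm}
    (ha : IsWord (tmGens k) a l) :
    tmap (tmProj k) m (a.1 (tmInput k)) = free.tof l ∨
      tmap (tmProj k) m (a.1 (tmInput k)) = -free.tof l := by
  induction ha with
  | one =>
    left
    have e := tmap_tmProj_some (k := k) ![.var]
    rw [eq_cons_one fun i => some (![Tm.var] i)] at e
    rw [tmPerm_one, tmInput, map_add, tmap_tmProj_none _ (i := 0) rfl, zero_add]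
    refine e.trans (congrArg _ ?_)
    funext i
    fin_cases i
    rfl
  | counit =>
    left
    have e := tmap_tmProj_some (k := k) (n := 0) ![]
    refine Eq.trans (congrArg _ ?_) (e.trans (congrArg _ (Subsingleton.elim _ _)))
    change tmCounit.1 _ = _
    -- The grouplike summand of `tmInput` is needed here only: the counit vanishes on terms, but is
    -- $1$ on the grouplike element.
    rw [tmInput, map_add, tmCounit_none, tmCounit_some, add_zero]
    exact congrArg _ (Subsingleton.elim _ _)
  | neg _ ih =>
    have e : ∀ {m : ℕ} {i : ℤ} (a : (tmMod' k).endProp.obj 1 m i),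
      tmap (tmProj k) m ((-a).1 (tmInput k)) = -tmap (tmProj k) m (a.1 (tmInput k)) := fun a =>
        map_neg (tmap (tmProj k) _) _
    rw [e]
    obtain h | h := ih
    · exact .inr (by rw [h])
    · exact .inl (by rw [h, neg_neg])
  | @act m i a l σ _ ih =>
    have e : tmap (tmProj k) m ((DGProp.lact σ a).1 (tmInput k)) =
        (tmMod k).tperm σ (tmap (tmProj k) m (a.1 (tmInput k))) :=
      (tperm_tmap (tmProj k) σ _).symm
    have e' : (tmMod k).tperm σ (free.tof l) = free.tof (l ∘ σ.symm) ∨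
        (tmMod k).tperm σ (free.tof l) = -free.tof (l ∘ σ.symm) := by
      have h := (tmMod k).tperm_tprod σ (fun r => free.of_mem (k := k) (deg := Tm.deg) (l r))
      obtain h' | h' := permSign_eq_or (k := k) σ fun r => decide (Odd (l r).deg)
      · rw [h', one_smul] at h
        exact .inl h
      · rw [h', neg_one_smul] at h
        exact .inr h
    rw [e]
    obtain h | h := ih <;> rw [h]
    · exact e'
    · rw [map_neg]
      obtain h | h := e' <;> rw [h]
      · exact .inr rfl
      · exact .inl (neg_neg _)
  | @comp m i a l o r m' t hp hq h ha ih =>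
    have hI := (Intertwines.hcomp hp hq (zero_add o.deg)
      (Intertwines.perm (f := tmProj k) (1 : Equiv.Perm (Fin r))) (intertwines_val o))
    have e : tmap (tmProj k) m' ((DGProp.step hp hq h ((tmGens k).val o) a).1 (tmInput k)) =
        ((tmMod k).homTensor hp hq (zero_add o.deg)
          ((tmMod k).endProp.perm (1 : Equiv.Perm (Fin r))) o.map).1
          (tmap (tmProj k) m (a.1 (tmInput k))) := hI.apply _
    -- The operation sees just the last factors, and the Koszul sign from passing it over the first
    -- `r` labels is the sole discrepancy.
    have e' : ∃ j, ((tmMod k).homTensor hp hq (zero_add o.deg)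
          ((tmMod k).endProp.perm (1 : Equiv.Perm (Fin r))) o.map).1 (free.tof l) =
        sgn k j • free.tof (o.lead hp hq l) := by
      refine ⟨o.deg * ∑ v : Fin r, (l (Fin.cast hp (Fin.castAdd o.src v))).deg, ?_⟩
      rw [free.tof_eq_tcat hp, homTensor_tcat _ _ _ _ _ _ (free.tof_mem _), Op.map_tof,
        show ((tmMod k).endProp.perm (1 : Equiv.Perm (Fin r))).1 _ = _ from
          LinearMap.congr_fun ((tmMod k).tperm_one r) _]
      exact congrArg _ (free.tof_tcat hq _ _)
    obtain ⟨j, hj⟩ := e'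
    rw [e]
    have hs : sgn k j = 1 ∨ sgn k j = -1 := by
      rcases Int.even_or_odd j with hj | hj
      exacts [.inl (sgn_even k hj), .inr (sgn_odd k hj)]
    obtain h | h := ih <;> rw [h] <;> obtain h' | h' := hs
    · rw [hj, h', one_smul]
      exact .inl rfl
    · rw [hj, h', neg_one_smul]
      exact .inr rfl
    · rw [map_neg, hj, h', one_smul]
      exact .inr rfl
    · rw [map_neg, hj, h', neg_one_smul]
      exact .inl (neg_neg _)

theorem Gens.ev_val {Q : DGProp.{u, w} k} (g : Gens Q) (L : Q.Laws) (o : Op) :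
    g.ev L (gens.val o) = g.val o := by
  cases o
  · exact g.ev_mk L .coproduct
  · exact g.ev_mk L .product

/-- Words make sense in every prop with chosen generators, and evaluation keeps their labels. Thus
labels of words in $\mathcal S$ can be read off in the endomorphism prop of `tmMod'`. -/
theorem IsWord.ev {Q : DGProp.{u, w} k} (g : Gens Q) (L : Q.Laws) {m : ℕ} {i : ℤ}
    {a : (propS k).obj 1 m i} {l : Fin m → Tm} (ha : IsWord gens a l) :
    IsWord g (g.ev L a) l := by
  induction ha with
  | one => rw [g.ev_perm]; exact .one
  | counit => exact (g.ev_mk L .counit).symm ▸ .counit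
  | neg _ ih => rw [map_neg]; exact ih.neg
  | act σ _ ih =>
    rw [DGProp.lact, g.ev_vcomp, g.ev_perm]
    exact ih.act σ
  | comp o hp hq h _ ih =>
    rw [DGProp.step, g.ev_vcomp, g.ev_hcomp, g.ev_perm, g.ev_val]
    exact ih.comp o hp hq h

end PropS
-- Freeness over the symmetric groups, and arity zero
namespace PropS

open DGMod

variable {k : Type u} [CommRing k]

/-- The evaluation of `S(1, m)` in the free module on the terms. -/
def tmEval (k : Type u) [CommRing k] (m : ℕ) (i : ℤ) :
    (propS k).obj 1 m i →ₗ[k] (tmMod k).TPow m where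
  toFun a := tmap (tmProj k) m (((tmGens k).ev (tmMod' k).endProp_laws a).1 (tmInput k))
  map_add' a b := by
    rw [map_add]
    exact map_add (tmap (tmProj k) m) _ _
  map_smul' c a := by
    rw [map_smul]
    exact map_smul (tmap (tmProj k) m) _ _

theorem IsWord.tmEval {m : ℕ} {i : ℤ} {a : (propS k).obj 1 m i} {l : Fin m → Tm}
    (ha : IsWord gens a l) : ∃ c : kˣ, PropS.tmEval k m i a = c • free.tbasis k Tm.deg m l := by
  rw [free.tbasis_apply]
  obtain h | h := (ha.ev (tmGens k) (tmMod' k).endProp_laws).tm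
  · exact ⟨1, h.trans (one_smul _ _).symm⟩
  · refine ⟨-1, h.trans ?_⟩
    rw [Units.smul_def, Units.val_neg, Units.val_one, neg_one_smul]

/-- Unit multiples of different basis vectors differ over a nontrivial ring. This is the hypothesis
`hlead` of `IsWord.eq_or_eq_neg`. -/
theorem IsWord.lead_unique [Nontrivial k] {m : ℕ} {i : ℤ} {a : (propS k).obj 1 m i}
    {l l' : Fin m → Tm} (ha : IsWord gens a l) (ha' : IsWord gens a l') : l = l' := by
  obtain ⟨c, hc⟩ := ha.tmEval
  obtain ⟨c', hc'⟩ := ha'.tmEval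
  by_contra hne
  have h := congrArg (fun x => (free.tbasis k Tm.deg m).repr x l) (hc.symm.trans hc')
  simp [Units.smul_def, Ne.symm hne] at h

theorem IsWord.eq_or_eq_neg_gens [Nontrivial k] {m : ℕ} {i : ℤ} {a a' : (propS k).obj 1 m i}
    {l : Fin m → Tm} (ha : IsWord gens a l) (ha' : IsWord gens a' l) : a = a' ∨ a = -a' :=
  ha.eq_or_eq_neg laws (fun h h' => h.lead_unique h') ha'

section basis

variable (k) (m : ℕ) (i : ℤ)

/-- The terms on the output strands of words, up to permutation. -/
def leadSetoid : Setoid {l : Fin m → Tm // ∃ a : (propS k).obj 1 m i, IsWord gens a l} where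
  r l l' := ∃ σ : Equiv.Perm (Fin m), l'.1 = l.1 ∘ σ.symm
  iseqv :=
    { refl l := ⟨1, rfl⟩
      symm := by
        rintro l l' ⟨σ, h⟩
        exact ⟨σ⁻¹, by rw [h]; funext x; simp [Equiv.Perm.inv_def]⟩
      trans := by
        rintro l l' l'' ⟨σ, h⟩ ⟨τ, h'⟩
        exact ⟨τ * σ, by rw [h', h]; rfl⟩ }

/-- The orbits of words. -/
abbrev Orbit : Type u := ULift.{u} (Quotient (leadSetoid k m i))

variable {k m i}

/-- A representative of an orbit. -/
def Orbit.word (x : Orbit k m i) : (propS k).obj 1 m i := x.down.out.2.choose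

/-- The terms on the output strands of a representative. -/
def Orbit.lead (x : Orbit k m i) : Fin m → Tm := x.down.out.1

theorem Orbit.isWord (x : Orbit k m i) : IsWord gens x.word x.lead := x.down.out.2.choose_spec

/-- Equal relabellings put `x` and `y` in one orbit. The labels of a word are pairwise distinct, so
a permutation is recovered from its effect on them: the action on label sequences is free. -/
theorem Orbit.lead_injective {σ τ : Equiv.Perm (Fin m)} {x y : Orbit k m i}
    (h : x.lead ∘ σ.symm = y.lead ∘ τ.symm) : (σ, x) = (τ, y) := by
  have hxy : x = y := by
    rw [← ULift.down_inj, ← x.down.out_eq, ← y.down.out_eq]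
    refine Quotient.sound ⟨τ⁻¹ * σ, ?_⟩
    change y.lead = x.lead ∘ (τ⁻¹ * σ).symm
    have : x.lead ∘ (τ⁻¹ * σ).symm = (x.lead ∘ σ.symm) ∘ τ := rfl
    rw [this, h]
    funext z
    simp
  subst hxy
  have : σ.symm = τ.symm := Equiv.ext fun z => x.isWord.injective (congrFun h z)
  rw [Prod.mk.injEq]
  exact ⟨Equiv.symm_bijective.injective this, rfl⟩

theorem IsWord.exists_orbit {a : (propS k).obj 1 m i} {l : Fin m → Tm} (ha : IsWord gens a l) :
    ∃ (x : Orbit k m i) (σ : Equiv.Perm (Fin m)), l = x.lead ∘ σ.symm := by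
  let y : {l : Fin m → Tm // ∃ a : (propS k).obj 1 m i, IsWord gens a l} := ⟨l, a, ha⟩
  obtain ⟨σ, hσ⟩ := Quotient.mk_out (s := leadSetoid k m i) y
  exact ⟨⟨Quotient.mk _ y⟩, σ, hσ⟩

/-- Under `tmEval` these elements become unit multiples of pairwise different basis vectors. -/
theorem linearIndependent_words :
    LinearIndependent k fun p : Equiv.Perm (Fin m) × Orbit k m i => DGProp.lact p.1 p.2.word := by
  have h (p : Equiv.Perm (Fin m) × Orbit k m i) := (p.2.isWord.act p.1).tmEval
  choose c hc using h
  have hinj : Function.Injective fun p : Equiv.Perm (Fin m) × Orbit k m i =>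
      p.2.lead ∘ p.1.symm := fun p q => Orbit.lead_injective
  have h1 := ((free.tbasis k Tm.deg m).linearIndependent.comp _ hinj).units_smul c
  refine LinearIndependent.of_comp (tmEval k m i) ?_
  convert h1 using 1
  funext p
  exact hc p

/-- An arbitrary word has the labels of a permuted representative, and by `eq_or_eq_neg_gens` equals
it up to sign. -/
theorem span_words [Nontrivial k] : ⊤ ≤ Submodule.span k
    (Set.range fun p : Equiv.Perm (Fin m) × Orbit k m i => DGProp.lact p.1 p.2.word) := by
  rw [← words_eq_top]
  refine Submodule.span_le.mpr ?_
  rintro a ⟨l, ha⟩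
  obtain ⟨x, σ, rfl⟩ := ha.exists_orbit
  have hmem : DGProp.lact σ x.word ∈ Submodule.span k
      (Set.range fun p : Equiv.Perm (Fin m) × Orbit k m i => DGProp.lact p.1 p.2.word) :=
    Submodule.subset_span ⟨(σ, x), rfl⟩
  obtain rfl | rfl := ha.eq_or_eq_neg_gens (x.isWord.act σ)
  · exact hmem
  · exact Submodule.neg_mem _ hmem

end basis

theorem isSigmaFree (k : Type u) [CommRing k] : (propS k).U.IsSigmaFree := by
  intro m i
  -- Over the zero ring labels cannot be recovered from words, but every module is zero and the
  -- empty basis serves.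
  rcases subsingleton_or_nontrivial k with hk | hk
  · have : Subsingleton ((propS k).obj 1 m i) := Module.subsingleton k _
    exact ⟨PEmpty, Module.Basis.empty _, fun _ _ x => x.elim⟩
  · refine ⟨Orbit k m i, Module.Basis.mk linearIndependent_words span_words, fun σ τ x => ?_⟩
    rw [Module.Basis.mk_apply, Module.Basis.mk_apply]
    exact laws.lact_lact σ τ x.word

theorem IsWord.eq_counit_gens {a : (propS k).obj 1 0 0} {l : Fin 0 → Tm} (ha : IsWord gens a l) :
    a = gens.counit ∨ a = -gens.counit := by
  obtain h | h := ha.eq_counit laws rfl <;> cases h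
  exacts [.inl rfl, .inr rfl]

/-- `S(1, 0)` is spanned by the counit. -/
theorem exists_smul_counit (a : (propS k).obj 1 0 0) : ∃ c : k, a = c • gens.counit := by
  have ha : a ∈ words gens 0 0 := words_eq_top (k := k) 0 0 ▸ Submodule.mem_top
  have : words (gens (k := k)) 0 0 ≤ Submodule.span k {gens.counit} := by
    refine Submodule.span_le.mpr ?_
    rintro a ⟨l, ha⟩
    obtain rfl | rfl := ha.eq_counit_gens
    · exact Submodule.mem_span_singleton_self _
    · exact Submodule.neg_mem _ (Submodule.mem_span_singleton_self _)
  obtain ⟨c, hc⟩ := Submodule.mem_span_singleton.mp (this ha)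
  exact ⟨c, hc.symm⟩

theorem arity_zero_subsingleton (k : Type u) [CommRing k] {i : ℤ} (hi : i ≠ 0) :
    Subsingleton ((propS k).obj 1 0 i) := by
  have h0 : words (gens (k := k)) 0 i ≤ ⊥ := by
    refine Submodule.span_le.mpr ?_
    rintro a ⟨l, ha⟩
    obtain h | h := ha.eq_counit laws rfl <;> cases h <;> exact absurd rfl hi
  refine ⟨fun a b => ?_⟩
  have h (a : (propS k).obj 1 0 i) : a = 0 :=
    (Submodule.mem_bot k).mp (h0 (words_eq_top (k := k) 0 i ▸ Submodule.mem_top))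
  rw [h a, h b]

/-- `tmEval` sends the counit to a unit multiple of the basis vector given by the empty sequence. -/
theorem smul_counit_injective :
    Function.Injective fun c : k => c • (gens (k := k)).counit := by
  intro c c' h
  obtain ⟨e, he⟩ := (IsWord.counit (g := gens (k := k))).tmEval
  have h1 := congrArg (tmEval k 0 0) h
  simp only [map_smul, he] at h1
  have h2 := congrArg (fun x => (free.tbasis k Tm.deg 0).repr x Fin.elim0) h1
  simpa [Units.smul_def] using h2

/-- `S(1, 0) = k`. -/
def arityZeroEquiv (k : Type u) [CommRing k] : (propS k).obj 1 0 0 ≃ₗ[k] k :=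
  (LinearEquiv.ofBijective ((LinearMap.id (R := k) (M := k)).smulRight gens.counit)
    ⟨smul_counit_injective, fun a => (exists_smul_counit a).imp fun _ h => h.symm⟩).symm

end PropS
-- The contraction, and cycles up to homology
namespace PropS

open DGProp

variable {k : Type u} [CommRing k] {P : DGProp.{u, w} k}

namespace Gens

variable (g : Gens P)

/-- The composite `(a ⊙ id) ∘ Δ`. -/
def adjoin {m m' : ℕ} (hm : m + 1 = m') {i : ℤ} : P.obj 1 m i →ₗ[k] P.obj 1 m' i :=
  (P.vcomp (add_zero i)).flip g.coproduct ∘ₗ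
    (P.hcomp (rfl : 1 + 1 = 2) hm (add_zero i)).flip (P.perm (1 : Equiv.Perm (Fin 1)))

theorem adjoin_apply {m m' : ℕ} (hm : m + 1 = m') {i : ℤ} (a : P.obj 1 m i) :
    g.adjoin hm a = P.vcomp (add_zero i) (P.hcomp (rfl : 1 + 1 = 2) hm (add_zero i) a
      (P.perm (1 : Equiv.Perm (Fin 1)))) g.coproduct := rfl

/-- The compatibility of the generators with the differential. -/
structure DLaws : Prop where
  d_counit : ∀ (j : ℤ) (h : j + 1 = 0), P.d h g.counit = 0
  d_coproduct : ∀ (j : ℤ) (h : j + 1 = 0), P.d h g.coproduct = 0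
  d_product : P.d (zero_add 1) g.product =
      P.hcomp rfl rfl (add_zero 0) g.counit (P.perm (1 : Equiv.Perm (Fin 1))) -
        P.hcomp rfl rfl (add_zero 0) (P.perm (1 : Equiv.Perm (Fin 1))) g.counit

variable {g} (L : P.Laws) (D : P.DLaws) (hg : g.DLaws)

include D hg in
theorem d_adjoin {m m' : ℕ} (hm : m + 1 = m') {i j : ℤ} (h : j + 1 = i) (a : P.obj 1 m i) :
    P.d h (g.adjoin hm a) = g.adjoin hm (P.d h a) := by
  rw [adjoin_apply, D.d_vcomp _ h _ _ h (neg_add_cancel 1) (add_zero j) (by omega),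
    D.d_hcomp _ _ _ h _ _ h (neg_add_cancel 1) (add_zero j) (by omega), hg.d_coproduct, D.d_perm]
  simp only [map_zero, smul_zero, add_zero]
  rfl

include D hg in
theorem d_step_counit {r m m' : ℕ} (hp : r + 1 = m) (hq : r + 0 = m') {i j : ℤ} (h : j + 1 = i)
    (a : P.obj 1 m i) :
    P.d h (step hp hq (zero_add i) g.counit a) = step hp hq (zero_add j) g.counit (P.d h a) := by
  rw [step, D.d_vcomp _ h _ _ (neg_add_cancel 1) h (by omega) (zero_add j),
    D.d_hcomp _ _ _ (neg_add_cancel 1) _ _ (neg_add_cancel 1) (neg_add_cancel 1) (by omega) (by omega),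
    hg.d_counit, D.d_perm, sgn_zero, one_smul]
  simp only [map_zero, LinearMap.zero_apply, zero_add, one_smul]
  rfl

include L in
-- The counit erases the last strand of `a`, beside the adjoined strand, so erasing commutes with
-- adjoining.
theorem sideStep_counit_adjoin {m m' m'' : ℕ} (hm : m + 1 = m') (hm' : m' + 1 = m'')
    (h₀ : m + 0 = m) {i : ℤ} (h h' : 0 + i = i) (a : P.obj 1 m' i) :
    sideStep hm h₀ hm' hm h g.counit (g.adjoin hm' a) =
      g.adjoin hm (step hm h₀ h' g.counit a) := by
  have e := L.interchange (rfl : 1 + 1 = 2) hm' hm (add_zero 0) (add_zero i) h (zero_add i)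
    (add_zero 0) (add_zero i)
    (P.hcomp hm h₀ (zero_add 0) (P.perm (1 : Equiv.Perm (Fin m))) g.counit)
    (P.perm (1 : Equiv.Perm (Fin 1))) a (P.perm (1 : Equiv.Perm (Fin 1)))
  rw [zero_mul, sgn_zero, one_smul, L.id_vcomp] at e
  rw [sideStep, adjoin_apply, ← L.vcomp_assoc h (add_zero i) (add_zero i) h, e]
  rfl

include L in
-- The counit erases the adjoined strand; what remains of the coproduct is `(id ⊙ counit) ∘
-- coproduct`, the identity.
theorem step_counit_adjoin {m' m'' : ℕ} (hm' : m' + 1 = m'')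
    (h₀ : m' + 0 = m') {i : ℤ} (h : 0 + i = i) (a : P.obj 1 m' i) :
    step hm' h₀ h g.counit (g.adjoin hm' a) = a := by
  have e := L.interchange (rfl : 1 + 1 = 2) hm' h₀ (zero_add 0) (add_zero i) h (zero_add i)
    (add_zero 0) (add_zero i) (P.perm (1 : Equiv.Perm (Fin m'))) g.counit a
    (P.perm (1 : Equiv.Perm (Fin 1)))
  have e' := L.interchange (rfl : 1 + 1 = 2) (rfl : 1 + 0 = 1) h₀ (add_zero i) (add_zero 0)
    (add_zero i) (add_zero i) (add_zero 0) (add_zero i) a (P.perm (1 : Equiv.Perm (Fin 0)))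
    (P.perm (1 : Equiv.Perm (Fin 1))) g.counit
  rw [zero_mul, sgn_zero, one_smul, L.id_vcomp, L.vcomp_id] at e
  rw [zero_mul, sgn_zero, one_smul, L.id_vcomp, L.vcomp_id, L.hcomp_id] at e'
  rw [step, adjoin_apply, ← L.vcomp_assoc h (add_zero i) (add_zero i) h, e, ← e',
    L.vcomp_assoc (add_zero i) (add_zero i) (add_zero 0) (add_zero i), g.right_counit, L.vcomp_id]

include L D hg in
/-- The contraction of `S(1, m + 1)` onto `S(1, m)`. -/
theorem d_step_product_adjoin {m m' m'' : ℕ} (hm : m + 1 = m') (hm' : m' + 1 = m'')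
    (hm'' : m + 2 = m'') (h₀ : m + 0 = m) {i j l : ℤ} (hj : j + 1 = i) (hl : i + 1 = l)
    (hil : 1 + i = l) (h : 0 + i = i) {a : P.obj 1 m' i} (ha : P.d hj a = 0) :
    P.d hl (step hm'' hm hil g.product (g.adjoin hm' a)) =
      g.adjoin hm (step hm h₀ h g.counit a) - a := by
  have h1 : P.d (zero_add 1) (P.hcomp hm'' hm (zero_add 1) (P.perm (1 : Equiv.Perm (Fin m)))
      g.product) = P.hcomp hm'' hm (zero_add 0) (P.perm (1 : Equiv.Perm (Fin m)))
        (P.hcomp (rfl : 1 + 1 = 2) (rfl : 0 + 1 = 1) (add_zero 0) g.counit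
          (P.perm (1 : Equiv.Perm (Fin 1)))) -
      P.hcomp hm'' hm (zero_add 0) (P.perm (1 : Equiv.Perm (Fin m)))
        (P.hcomp (rfl : 1 + 1 = 2) (rfl : 1 + 0 = 1) (add_zero 0)
          (P.perm (1 : Equiv.Perm (Fin 1))) g.counit) := by
    rw [D.d_hcomp _ _ _ (zero_add 1) _ _ (neg_add_cancel 1) (zero_add 1) (neg_add_cancel 1)
      (zero_add 0), D.d_perm, hg.d_product]
    simp only [map_zero, LinearMap.zero_apply, zero_add, sgn_zero, one_smul, map_sub]
  have h2 : P.d hl (step hm'' hm hil g.product (g.adjoin hm' a)) =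
      step hm'' hm h (P.hcomp (rfl : 1 + 1 = 2) (rfl : 0 + 1 = 1) (add_zero 0) g.counit
          (P.perm (1 : Equiv.Perm (Fin 1)))) (g.adjoin hm' a) -
      step hm'' hm h (P.hcomp (rfl : 1 + 1 = 2) (rfl : 1 + 0 = 1) (add_zero 0)
          (P.perm (1 : Equiv.Perm (Fin 1))) g.counit) (g.adjoin hm' a) := by
    rw [step, D.d_vcomp _ hl _ _ (zero_add 1) hj h (by omega), h1, d_adjoin D hg, ha]
    simp only [map_zero, smul_zero, add_zero, map_sub, LinearMap.sub_apply]
    rfl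
  -- The half of $\partial\mu$ with $\epsilon$ on the left erases the last strand of `a` and keeps
  -- the adjoined one; the half with $\epsilon$ on the right erases the adjoined strand and returns
  -- `a`.
  rw [h2, L.step_hcomp hm h₀ hm' hm' hm (rfl : 1 + 1 = 2) (rfl : 0 + 1 = 1) hm'' hm h h (add_zero 0) h,
    L.step_perm, blockSum_one, L.lact_one, sideStep_counit_adjoin L hm hm' h₀ h h,
    L.step_hcomp hm hm hm' (add_zero m') (add_zero m') (rfl : 1 + 1 = 2) (rfl : 1 + 0 = 1) hm''
      hm h h (add_zero 0) h, step_counit_adjoin L hm', sideStep, L.perm_one_hcomp,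
    L.perm_one_hcomp, L.id_vcomp]

variable (g) in
/-- The iterated coproduct. -/
def iterated : (m : ℕ) → P.obj 1 m 0
  | 0 => g.counit
  | m + 1 => g.adjoin rfl (iterated m)

include D hg in
theorem d_iterated (m : ℕ) {j : ℤ} (h : j + 1 = 0) : P.d h (g.iterated m) = 0 := by
  induction m with
  | zero => exact hg.d_counit j h
  | succ m ih =>
    rw [iterated, d_adjoin D hg, ih, map_zero]

include L D hg in
/-- Every cycle in `P(1, m)` is homologous to a multiple of the iterated coproduct if this holds for
`m = 0`. -/
theorem exists_cycle_eq (h₀ : ∀ a : P.obj 1 0 0, ∃ c : k, a = c • g.counit)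
    (h₁ : ∀ i : ℤ, i ≠ 0 → Subsingleton (P.obj 1 0 i)) :
    ∀ (m : ℕ) {i j l : ℤ} (hj : j + 1 = i) (hl : i + 1 = l) (a : P.obj 1 m i), P.d hj a = 0 →
      (∀ _ : i ≠ 0, ∃ e : P.obj 1 m l, P.d hl e = a) ∧
      ∀ hi : i = 0, ∃ (c : k) (e : P.obj 1 m l), P.d hl e = a - c • hi ▸ g.iterated m := by
  intro m
  induction m with
  | zero =>
    intro i j l hj hl a ha
    refine ⟨fun hi => ?_, fun hi => ?_⟩
    · have := h₁ i hi
      exact ⟨0, Subsingleton.elim _ _⟩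
    · subst hi
      obtain ⟨c, rfl⟩ := h₀ a
      exact ⟨c, 0, by rw [map_zero, iterated, sub_self]⟩
  | succ m ih =>
    intro i j l hj hl a ha
    -- Up to a boundary, `a` is `adjoin` of the cycle obtained by erasing its last strand. That
    -- cycle has arity `m`, and `adjoin` commutes with the differential and sends `iterated m` to
    -- `iterated (m + 1)`.
    have hd := d_step_product_adjoin L D hg (rfl : m + 1 = m + 1) rfl rfl rfl hj hl
      (by omega : 1 + i = l) (zero_add i) ha
    have hc : P.d hj (step (rfl : m + 1 = m + 1) rfl (zero_add i) g.counit a) = 0 := by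
      rw [d_step_counit D hg, ha, map_zero]
    obtain ⟨h1, h2⟩ := ih hj hl _ hc
    refine ⟨fun hi => ?_, fun hi => ?_⟩
    · obtain ⟨e, he⟩ := h1 hi
      refine ⟨g.adjoin rfl e - step rfl rfl (by omega : 1 + i = l) g.product (g.adjoin rfl a), ?_⟩
      rw [map_sub, hd, d_adjoin D hg, he]
      abel
    · obtain ⟨c, e, he⟩ := h2 hi
      refine ⟨c, g.adjoin rfl e - step rfl rfl (by omega : 1 + i = l) g.product (g.adjoin rfl a), ?_⟩
      rw [map_sub, hd, d_adjoin D hg, he]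
      subst hi
      rw [map_sub, map_smul, iterated]
      abel

end Gens

section hom

variable {Q : DGProp.{u, w} k} (g : Gens Q) (L : Q.Laws) (D : Q.DLaws) (hg : g.DLaws)

/-- The prop morphism given by values of the generators. -/
def Gens.homOf : (propS k).Hom Q := g.hom L D hg.d_counit hg.d_coproduct hg.d_product

theorem Gens.homOf_counit : (g.homOf L D hg).map (PropS.mk k .counit) = g.counit := g.ev_mk L .counit

theorem Gens.homOf_coproduct : (g.homOf L D hg).map (PropS.mk k .coproduct) = g.coproduct :=
  g.ev_mk L .coproduct

theorem Gens.homOf_product : (g.homOf L D hg).map (PropS.mk k .product) = g.product := g.ev_mk L .product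

end hom

theorem gens_dLaws : (gens (k := k)).DLaws where
  d_counit _ h := d_counit h
  d_coproduct _ h := d_coproduct h
  d_product := d_product _

end PropS

/-! ### Comparison with the endomorphism operad of the ground ring -/

namespace DGMod

variable (k : Type u) [CommRing k]

/-- The identity of `k`. -/
def unitVal : (unit k).carrier →ₗ[k] k := (LinearMap.id : k →ₗ[k] k)

/-- The unit of `k`. -/
def unitOne : (unit k).carrier := (1 : k)

theorem unitVal_one : unitVal k (unitOne k) = 1 := rfl

theorem unitOne_mem : unitOne k ∈ (unit k).gr 0 :=
  Submodule.mem_top (R := k) (M := k)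

variable {k} in
theorem unitVal_smul_one (x : (unit k).carrier) : unitVal k x • unitOne k = x := mul_one (M := k) x

variable {k} in
theorem unit_eq_zero {i : ℤ} (hi : i ≠ 0) {x : (unit k).carrier} (hx : x ∈ (unit k).gr i) : x = 0 := by
  have h : (if i = 0 then (⊤ : Submodule k k) else ⊥) = ⊥ := if_neg hi
  have h' : unitVal k x ∈ (if i = 0 then (⊤ : Submodule k k) else ⊥) := hx
  rw [h, Submodule.mem_bot] at h'
  exact h'

/-- The element `1 ⊗ ⋯ ⊗ 1` of `k^{⊗ n}`. -/
def ones (n : ℕ) : (unit k).TPow n := PiTensorProduct.tprod k fun _ => unitOne k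

theorem ones_mem (n : ℕ) : ones k n ∈ (unit k).tgr n 0 :=
  (unit k).tprod_mem_tgr (e := fun _ => 0) (fun _ => unitOne_mem k) (by simp)

/-- The multiplication `k^{⊗ n} → k`. -/
def mulAll (n : ℕ) : (unit k).TPow n →ₗ[k] k :=
  PiTensorProduct.lift ((MultilinearMap.mkPiAlgebra k (Fin n) k).compLinearMap fun _ => unitVal k)

variable {k}

theorem mulAll_tprod {n : ℕ} (x : Fin n → (unit k).carrier) :
    mulAll k n (PiTensorProduct.tprod k x) = ∏ r, unitVal k (x r) := by
  rw [mulAll, PiTensorProduct.lift.tprod, MultilinearMap.compLinearMap_apply,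
    MultilinearMap.mkPiAlgebra_apply]

theorem mulAll_ones (n : ℕ) : mulAll k n (ones k n) = 1 := by
  rw [ones, mulAll_tprod]
  simp only [unitVal_one, Finset.prod_const_one]

theorem tprod_eq_smul_ones {n : ℕ} (x : Fin n → (unit k).carrier) :
    (PiTensorProduct.tprod k x : (unit k).TPow n) = (∏ r, unitVal k (x r)) • ones k n := by
  rw [ones, ← MultilinearMap.map_smul_univ]
  simp only [unitVal_smul_one]

theorem mulAll_smul_ones {n : ℕ} (x : (unit k).TPow n) : mulAll k n x • ones k n = x := by
  induction x using tpow_induct with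
  | hadd a b ha hb => rw [map_add, add_smul, ha, hb]
  | hsmul c a ha => rw [map_smul, smul_assoc, ha]
  | ht x => rw [mulAll_tprod, ← tprod_eq_smul_ones]

theorem unit_tgr_eq_zero {n : ℕ} {i : ℤ} (hi : i ≠ 0) {x : (unit k).TPow n}
    (hx : x ∈ (unit k).tgr n i) : x = 0 := by
  have : (unit k).tgr n i ≤ ⊥ := by
    refine Submodule.span_le.mpr ?_
    rintro _ ⟨e, x, he, h, rfl⟩
    obtain ⟨r, -, hr⟩ := Finset.exists_ne_zero_of_sum_ne_zero (h.trans_ne hi)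
    exact MultilinearMap.map_coord_zero _ r (unit_eq_zero hr (he r))
  exact this hx

variable (k) in
/-- The map of tensor powers of `k` that sends `1 ⊗ ⋯ ⊗ 1` to `1 ⊗ ⋯ ⊗ 1`. -/
def onesMap (n m : ℕ) : (unit k).homDeg n m 0 :=
  ⟨(mulAll k n).smulRight (ones k m), fun j x hx => by
    by_cases hj : j = 0
    · subst hj
      exact Submodule.smul_mem _ _ (ones_mem k m)
    · rw [unit_tgr_eq_zero hj hx, map_zero]
      exact Submodule.zero_mem _⟩

theorem onesMap_ones (n m : ℕ) : (onesMap k n m).1 (ones k n) = ones k m := by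
  change mulAll k n (ones k n) • ones k m = _
  rw [mulAll_ones, one_smul]

theorem ones_ext {M : Type w} [AddCommGroup M] [Module k M] {n : ℕ} {f g : (unit k).TPow n →ₗ[k] M}
    (h : f (ones k n) = g (ones k n)) : f = g :=
  LinearMap.ext fun x => by rw [← mulAll_smul_ones x, map_smul, map_smul, h]

theorem ones_tcat {n₁ n₂ n : ℕ} (h : n₁ + n₂ = n) :
    (unit k).tcat h (ones k n₁ ⊗ₜ[k] ones k n₂) = ones k n :=
  ((unit k).tprod_eq_tcat h fun _ => unitOne k).symm

theorem onesMap_comp {n r m : ℕ} (h : (0 : ℤ) + 0 = 0) :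
    (unit k).endProp.vcomp h (onesMap k r m) (onesMap k n r) = onesMap k n m :=
  Subtype.ext <| ones_ext <|
    (congrArg (onesMap k r m).1 (onesMap_ones n r)).trans
      ((onesMap_ones r m).trans (onesMap_ones n m).symm)

theorem perm_one_eq_onesMap (n : ℕ) :
    (unit k).endProp.perm (1 : Equiv.Perm (Fin n)) = onesMap k n n :=
  Subtype.ext <| ones_ext <|
    (LinearMap.congr_fun ((unit k).tperm_one n) _).trans (onesMap_ones n n).symm

theorem onesMap_hcomp {n₁ n₂ n m₁ m₂ m : ℕ} (hn : n₁ + n₂ = n) (hm : m₁ + m₂ = m)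
    (h : (0 : ℤ) + 0 = 0) :
    (unit k).endProp.hcomp hn hm h (onesMap k n₁ m₁) (onesMap k n₂ m₂) = onesMap k n m := by
  refine Subtype.ext (ones_ext ?_)
  have := (unit k).homTensor_tcat_even hn hm h (onesMap k n₁ m₁) (onesMap k n₂ m₂) Even.zero
    (ones k n₁) (ones k n₂)
  rw [ones_tcat, onesMap_ones, onesMap_ones, ones_tcat] at this
  exact this.trans (onesMap_ones n m).symm

theorem unit_td (n : ℕ) (x : (unit k).TPow n) : (unit k).td n x = 0 := by
  rw [← mulAll_smul_ones x, map_smul]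
  have := (unit k).td_mem (ones_mem k n)
  rw [unit_tgr_eq_zero (by omega) this, smul_zero]

theorem unit_homD {n m : ℕ} {i j : ℤ} (h : j + 1 = i) (f : (unit k).homDeg n m i) :
    (unit k).homD n m h f = 0 := by
  refine Subtype.ext (LinearMap.ext fun x => ?_)
  rw [homD_apply, unit_td, unit_td, map_zero, smul_zero, sub_zero]
  rfl

theorem unit_homDeg_eq_zero {n m : ℕ} {i : ℤ} (hi : i ≠ 0) (f : (unit k).homDeg n m i) : f = 0 := by
  refine Subtype.ext (ones_ext ?_)
  refine unit_tgr_eq_zero hi ?_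
  have := f.2 0 _ (ones_mem k n)
  rwa [add_zero] at this

theorem unit_homDeg_eq_smul {n m : ℕ} (f : (unit k).homDeg n m 0) :
    f = mulAll k m (f.1 (ones k n)) • onesMap k n m := by
  refine Subtype.ext (ones_ext ?_)
  refine (mulAll_smul_ones _).symm.trans ?_
  exact congrArg (mulAll k m (f.1 (ones k n)) • ·) (onesMap_ones n m).symm

theorem smul_onesMap_eq_zero {n m : ℕ} {c : k} (h : c • onesMap k n m = 0) : c = 0 := by
  have h1 : mulAll k m ((c • onesMap k n m).1 (ones k n)) = 0 := by
    rw [h]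
    exact map_zero _
  have h2 : (c • onesMap k n m).1 (ones k n) = c • ones k m :=
    congrArg (fun x => c • x) (onesMap_ones (k := k) n m)
  rwa [h2, LinearMap.map_smul, mulAll_ones, smul_eq_mul, mul_one] at h1

variable (k) in
/-- The trivial bialgebra `k`. -/
def unitGens : PropS.Gens (unit k).endProp where
  counit := onesMap k 1 0
  coproduct := onesMap k 1 2
  -- There is no other choice, as $\mathrm{End}(k)$ is concentrated in degree zero. The condition on
  -- $\partial\mu$ holds since $\epsilon\odot\mathrm{id}$ and $\mathrm{id}\odot\epsilon$ coincide on
  -- $k\otimes k$.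
  product := 0
  counit_product := map_zero _
  left_counit := by rw [perm_one_eq_onesMap, onesMap_hcomp, onesMap_comp]
  right_counit := by rw [perm_one_eq_onesMap, onesMap_hcomp, onesMap_comp]

theorem unitGens_dLaws : (unitGens k).DLaws where
  d_counit _ h := unit_homD h _
  d_coproduct _ h := unit_homD h _
  d_product := by
    refine (map_zero _).trans ?_
    rw [eq_comm, sub_eq_zero, perm_one_eq_onesMap]
    exact (onesMap_hcomp _ _ _).trans (onesMap_hcomp _ _ _).symm

variable (k) in
/-- The prop morphism `S → End(k)`. -/
def unitHom : (propS k).Hom (unit k).endProp :=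
  (unitGens k).homOf (unit k).endProp_laws (unit k).endProp_dLaws unitGens_dLaws

theorem unitHom_iterated (m : ℕ) : (unitHom k).map (PropS.gens.iterated m) = onesMap k 1 m := by
  induction m with
  | zero => exact (unitGens k).homOf_counit _ _ _
  | succ m ih =>
    have h : (unitHom k).map PropS.gens.coproduct = onesMap k 1 2 :=
      (unitGens k).homOf_coproduct _ _ _
    rw [PropS.Gens.iterated, PropS.Gens.adjoin_apply, (unitHom k).map_vcomp,
      (unitHom k).map_hcomp, ih, h, (unitHom k).map_perm, perm_one_eq_onesMap, onesMap_hcomp,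
      onesMap_comp]

/-- In degree zero a cycle is $c$ times the iterated coproduct up to a boundary. Boundaries map to
zero in $\mathrm{End}(k)$ and the iterated coproduct maps to `onesMap`, which no nonzero scalar
annihilates; hence $c=0$. -/
theorem exists_d_eq_of_unitHom_eq_zero {m : ℕ} {i₁ i i₀ : ℤ} (h₁ : i + 1 = i₁) (h₀ : i₀ + 1 = i)
    {a : (propS k).obj 1 m i} (ha : (propS k).d h₀ a = 0) (h : (unitHom k).map a = 0) :
    ∃ c : (propS k).obj 1 m i₁, (propS k).d h₁ c = a := by
  obtain ⟨k1, k2⟩ := PropS.Gens.exists_cycle_eq PropS.laws PropS.dLaws (PropS.gens_dLaws (k := k))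
    PropS.exists_smul_counit (fun _ hi => PropS.arity_zero_subsingleton k hi) m h₀ h₁ a ha
  by_cases hi : i = 0
  · obtain ⟨c, e, he⟩ := k2 hi
    subst hi
    have h2 := congrArg (unitHom k).map he
    rw [(unitHom k).map_d, map_sub, h, map_smul, unitHom_iterated] at h2
    have h3 : c = 0 := by
      refine smul_onesMap_eq_zero (n := 1) (m := m) ?_
      have h4 := (unit_homD h₁ ((unitHom k).map e)).symm.trans h2
      exact (sub_eq_zero.mp h4.symm).symm
    exact ⟨e, he.trans (by rw [h3, zero_smul, sub_zero])⟩
  · exact k1 hi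

/-- The iterated coproduct is a cycle, and its image generates the only nonzero part of
$\mathrm{End}(k)(m)$. -/
theorem exists_cycle_unitHom_eq {m : ℕ} {i i₀ : ℤ} (h₀ : i₀ + 1 = i) (b : (unit k).homDeg 1 m i) :
    ∃ a : (propS k).obj 1 m i, (propS k).d h₀ a = 0 ∧ (unitHom k).map a = b := by
  by_cases hi : i = 0
  · subst hi
    refine ⟨mulAll k m (b.1 (ones k 1)) • PropS.gens.iterated m, ?_, ?_⟩
    · rw [map_smul, PropS.Gens.d_iterated PropS.dLaws PropS.gens_dLaws, smul_zero]
    · rw [map_smul, unitHom_iterated, ← unit_homDeg_eq_smul]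
  · exact ⟨0, map_zero _, (map_zero _).trans (unit_homDeg_eq_zero hi b).symm⟩

theorem unitHom_isHomologyIso : (unitHom k).U.IsHomologyIso := by
  intro m i₁ i i₀ h₁ h₀
  constructor
  · rintro a ha ⟨c, hc⟩
    exact exists_d_eq_of_unitHom_eq_zero h₁ h₀ ha (hc.symm.trans (unit_homD h₁ c))
  · intro b _
    obtain ⟨a, ha, rfl⟩ := exists_cycle_unitHom_eq h₀ b
    exact ⟨a, ha, 0, (unit_homD h₁ 0).trans
      (sub_self ((unitHom k).map a : (unit k).homDeg 1 m i)).symm⟩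

end DGMod

namespace PropS

/-- `U(S)` is an `E_∞`-operad. -/
theorem isEInfinity (k : Type u) [CommRing k] : (propS k).U.IsEInfinity :=
  ⟨isSigmaFree k, ⟨_, DGMod.unitHom_isHomologyIso⟩, ⟨arityZeroEquiv k⟩,
    fun _ hi => arity_zero_subsingleton k hi⟩

end PropS

/-! ### Alternating functions of lists, deletion and cutting -/

namespace ListChains

variable {V : Type*} {k : Type u} [CommRing k] {M : Type w} [AddCommGroup M] [Module k M]

/-- A function of lists vanishes if two neighbouring entries are equal. -/
def VanishAdj (G : List V → M) : Prop := ∀ l₁ x l₂, G (l₁ ++ x :: x :: l₂) = 0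

/-- A function of lists changes its sign if two neighbouring entries are exchanged. -/
def SwapAdj (G : List V → M) : Prop := ∀ l₁ x y l₂, G (l₁ ++ x :: y :: l₂) = -G (l₁ ++ y :: x :: l₂)

theorem VanishAdj.append {G : List V → M} (h : VanishAdj G) (a : List V) :
    VanishAdj fun l => G (a ++ l) := fun l₁ x l₂ => by
  have := h (a ++ l₁) x l₂
  rwa [List.append_assoc] at this

theorem SwapAdj.append {G : List V → M} (h : SwapAdj G) (a : List V) :
    SwapAdj fun l => G (a ++ l) := fun l₁ x y l₂ => by
  have := h (a ++ l₁) x y l₂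
  rwa [List.append_assoc, List.append_assoc] at this

theorem VanishAdj.append_right {G : List V → M} (h : VanishAdj G) (a : List V) :
    VanishAdj fun l => G (l ++ a) := fun l₁ x l₂ => by
  have := h l₁ x (l₂ ++ a)
  simpa using this

theorem SwapAdj.append_right {G : List V → M} (h : SwapAdj G) (a : List V) :
    SwapAdj fun l => G (l ++ a) := fun l₁ x y l₂ => by
  have := h l₁ x y (l₂ ++ a)
  simpa using this

/-- The sign of the rearrangement is not tracked: `alternating_ext` only asks whether a difference
of two such functions vanishes. -/
theorem SwapAdj.eq_or_eq_neg {l l' : List V} (hl : l.Perm l') :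
    ∀ {G : List V → M}, SwapAdj G → G l = G l' ∨ G l = -G l' := by
  induction hl with
  | nil => exact fun _ => .inl rfl
  | cons x _ ih => exact fun h => ih (h.append [x])
  | swap x y l => exact fun h => .inr (h [] y x l)
  | trans _ _ ih ih' =>
    intro G h
    obtain h1 | h1 := ih h <;> obtain h2 | h2 := ih' h <;> simp [h1, h2]

theorem SwapAdj.sub {G G' : List V → M} (h : SwapAdj G) (h' : SwapAdj G') :
    SwapAdj fun l => G l - G' l := fun l₁ x y l₂ => by
  change G _ - G' _ = -(G _ - G' _)
  rw [h, h']
  abel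

theorem exists_adj_of_not_chain {V : Type*} [LinearOrder V] {l : List V} (hl : l.Pairwise (· ≤ ·))
    (h : ¬ l.Pairwise (· < ·)) : ∃ l₁ x l₂, l = l₁ ++ x :: x :: l₂ := by
  induction l with
  | nil => exact absurd List.Pairwise.nil h
  | cons x l ih =>
    rw [List.pairwise_cons] at hl
    by_cases h' : l.Pairwise (· < ·)
    · cases l with
      | nil => simp at h
      | cons y l =>
        have hxy := hl.1 y List.mem_cons_self
        obtain rfl | hlt := hxy.eq_or_lt
        · exact ⟨[], x, l, rfl⟩
        · refine absurd (List.pairwise_cons.mpr ⟨fun z hz => ?_, h'⟩) h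
          obtain rfl | hz := List.mem_cons.mp hz
          · exact hlt
          · exact hlt.trans_le ((List.pairwise_cons.mp hl.2).1 z hz)
    · obtain ⟨l₁, z, l₂, rfl⟩ := ih hl.2 h'
      exact ⟨x :: l₁, z, l₂, rfl⟩

/-- An alternating function is determined by its values on strictly increasing lists. -/
theorem alternating_ext {V : Type*} [LinearOrder V] {G G' : List V → M} (h : VanishAdj G)
    (hs : SwapAdj G) (h' : VanishAdj G') (hs' : SwapAdj G')
    (H : ∀ l, l.Pairwise (· < ·) → G l = G' l) (l : List V) : G l = G' l := by
  have hp : (l.mergeSort (· ≤ ·)).Perm l := List.mergeSort_perm l _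
  have h0 : G (l.mergeSort (· ≤ ·)) - G' (l.mergeSort (· ≤ ·)) = 0 := by
    -- The sorted list is either strictly increasing, where the two functions agree, or has two
    -- equal neighbours, where both vanish.
    by_cases hl : (l.mergeSort (· ≤ ·)).Pairwise (· < ·)
    · rw [H _ hl, sub_self]
    · have hsorted : (l.mergeSort (· ≤ ·)).Pairwise (· ≤ ·) := by
        have := List.pairwise_mergeSort (le := fun a b : V => decide (a ≤ b))
          (fun a b c hab hbc => by simp only [decide_eq_true_eq] at *; exact hab.trans hbc)
          (fun a b => by simpa using le_total a b) l
        simpa using this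
      obtain ⟨l₁, x, l₂, e⟩ := exists_adj_of_not_chain hsorted hl
      rw [e, h, h', sub_zero]
  rw [← sub_eq_zero]
  obtain h1 | h1 := SwapAdj.eq_or_eq_neg hp.symm (hs.sub hs')
  · exact h1.trans h0
  · exact h1.trans (by rw [h0, neg_zero])

/-- The alternating sum over the lists that arise by deleting one entry. -/
def del (G : List V → M) : List V → M
  | [] => 0
  | x :: l => G l - del (fun t => G (x :: t)) l

theorem del_append (G : List V → M) (a b : List V) :
    del G (a ++ b) = del (fun t => G (t ++ b)) a + (-1 : k) ^ a.length • del (fun t => G (a ++ t)) b := by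
  induction a generalizing G with
  | nil => simp [del]
  | cons x a ih =>
    rw [List.cons_append, del, ih, del, List.length_cons, pow_succ]
    simp only [List.cons_append, mul_neg, mul_one, neg_smul]
    abel

theorem del_neg (G : List V → M) (l : List V) : del (fun t => -G t) l = -del G l := by
  induction l generalizing G with
  | nil => simp [del]
  | cons x l ih => rw [del, del, ih]; abel

theorem del_zero (l : List V) : del (fun _ => (0 : M)) l = 0 := by
  induction l with
  | nil => rfl
  | cons x l ih => rw [del, ih, sub_zero]

theorem del_comp {M' : Type w'} [AddCommGroup M'] [Module k M'] (f : M →ₗ[k] M') (G : List V → M)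
    (l : List V) : f (del G l) = del (fun t => f (G t)) l := by
  induction l generalizing G with
  | nil => exact map_zero f
  | cons x l ih => rw [del, map_sub, ih, del]

theorem del_congr {G G' : List V → M} (l : List V)
    (h : ∀ t : List V, t.Sublist l → t.length + 1 = l.length → G t = G' t) : del G l = del G' l := by
  induction l generalizing G G' with
  | nil => rfl
  | cons x l ih =>
    rw [del, del, h l (List.sublist_cons_self x l) rfl]
    congr 1
    refine ih fun t ht hl => h _ (ht.cons_cons x) ?_
    rw [List.length_cons, hl, List.length_cons]

theorem del_smul (c : k) (G : List V → M) (l : List V) : del (fun t => c • G t) l = c • del G l := by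
  induction l generalizing G with
  | nil => exact (smul_zero c).symm
  | cons x l ih => rw [del, del, ih, smul_sub]

/-- Deletions outside the exchanged pair change sign by hypothesis, and the two deletions inside the
pair occur with opposite signs and trade places. With equal entries the same two terms cancel, which
gives `VanishAdj.del`. -/
theorem SwapAdj.del {G : List V → M} (h : SwapAdj G) : SwapAdj (del G) := fun l₁ x y l₂ => by
  rw [del_append (k := ℤ), del_append (k := ℤ)]
  have e1 : (fun t => G (t ++ x :: y :: l₂)) = fun t => -G (t ++ y :: x :: l₂) :=
    funext fun t => h t x y l₂
  have e2 : (fun t => G (l₁ ++ x :: y :: t)) = fun t => -G (l₁ ++ y :: x :: t) :=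
    funext fun t => h l₁ x y t
  rw [e1, del_neg, ListChains.del, ListChains.del, ListChains.del, ListChains.del, e2, del_neg,
    neg_add, ← smul_neg]
  congr 2
  simp only [sub_neg_eq_add]
  abel

theorem VanishAdj.del {G : List V → M} (h : VanishAdj G) : VanishAdj (del G) := fun l₁ x l₂ => by
  rw [del_append (k := ℤ)]
  have e1 : (fun t => G (t ++ x :: x :: l₂)) = fun _ => 0 := funext fun t => h t x l₂
  have e2 : (fun t => G (l₁ ++ x :: x :: t)) = fun _ => 0 := funext fun t => h l₁ x t
  rw [e1, del_zero, ListChains.del, ListChains.del, e2, del_zero]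
  simp

theorem del_ofFn (G : List V → M) {n : ℕ} (s : Fin (n + 1) → V) :
    del G (List.ofFn s) = ∑ i : Fin (n + 1), (-1 : k) ^ (i : ℕ) • G (List.ofFn (s ∘ i.succAbove)) := by
  induction n generalizing G with
  | zero => simp [del]
  | succ n ih =>
    rw [List.ofFn_succ, del, ih]
    refine Eq.trans ?_ (Fin.sum_univ_succ _).symm
    rw [sub_eq_add_neg, ← Finset.sum_neg_distrib]
    congr 1
    · simp [Function.comp_def]
    · refine Finset.sum_congr rfl fun i _ => ?_
      rw [List.ofFn_succ, Fin.val_succ, pow_succ, mul_neg, mul_one, neg_smul]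
      simp [Function.comp_def]

/-- The sum over the ways to cut a list into two lists that have one entry in common. -/
def cut (F : List V → List V → M) : List V → M
  | [] => 0
  | x :: l => F [x] (x :: l) + cut (fun a b => F (x :: a) b) l

theorem cut_congr {F F' : List V → List V → M} (h : ∀ a b, a ≠ [] → F a b = F' a b) (l : List V) :
    cut F l = cut F' l := by
  induction l generalizing F F' with
  | nil => rfl
  | cons x l ih =>
    rw [cut, cut, h _ _ (List.cons_ne_nil _ _), ih fun a b _ => h _ _ (List.cons_ne_nil _ _)]

theorem cut_zero (l : List V) : cut (fun _ _ => (0 : M)) l = 0 := by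
  induction l with
  | nil => rfl
  | cons x l ih => rw [cut, ih, add_zero]

theorem cut_add (F F' : List V → List V → M) (l : List V) :
    cut (fun a b => F a b + F' a b) l = cut F l + cut F' l := by
  induction l generalizing F F' with
  | nil => exact (add_zero 0).symm
  | cons x l ih => rw [cut, cut, cut, ih]; abel

theorem cut_sub (F F' : List V → List V → M) (l : List V) :
    cut (fun a b => F a b - F' a b) l = cut F l - cut F' l := by
  induction l generalizing F F' with
  | nil => exact (sub_zero 0).symm
  | cons x l ih => rw [cut, cut, cut, ih]; abel

theorem cut_neg (F : List V → List V → M) (l : List V) :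
    cut (fun a b => -F a b) l = -cut F l := by
  induction l generalizing F with
  | nil => exact neg_zero.symm
  | cons x l ih => rw [cut, cut, ih]; abel

theorem cut_comp {M' : Type w'} [AddCommGroup M'] [Module k M'] (f : M →ₗ[k] M')
    (F : List V → List V → M) (l : List V) : f (cut F l) = cut (fun a b => f (F a b)) l := by
  induction l generalizing F with
  | nil => exact map_zero f
  | cons x l ih => rw [cut, map_add, ih, cut]

theorem cut_map {V' : Type*} (f : V → V') (F : List V' → List V' → M) (l : List V) :
    cut F (l.map f) = cut (fun a b => F (a.map f) (b.map f)) l := by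
  induction l generalizing F with
  | nil => rfl
  | cons x l ih => rw [List.map_cons, cut, ih, cut]; rfl

/-- As the two halves share an entry, a pair of equal neighbours always lies inside one of them.
There is no analogue for `SwapAdj`: `cut F` is not alternating in general, which is why the
coproduct is evaluated on increasing lists or on simplices. -/
theorem VanishAdj.cut {F : List V → List V → M} (h : ∀ b, VanishAdj fun a => F a b)
    (h' : ∀ a, VanishAdj (F a)) : VanishAdj (cut F) := by
  intro l₁ x l₂
  induction l₁ generalizing F with
  | nil =>
    have e : (fun a b => F (x :: x :: a) b) = fun _ _ => 0 := funext fun a => funext fun b => h b [] x a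
    change F [x] _ + (F [x, x] _ + ListChains.cut (fun a b => F (x :: x :: a) b) l₂) = 0
    rw [e, cut_zero, show F [x] (x :: x :: l₂) = 0 from h' [x] [] x l₂,
      show F [x, x] (x :: l₂) = 0 from h _ [] x [], add_zero, add_zero]
  | cons y l₁ ih =>
    rw [List.cons_append, ListChains.cut, ih (F := fun a b => F (y :: a) b) (fun b => (h b).append [y]) (fun a => h' (y :: a)),
      add_zero]
    exact h' [y] (y :: l₁) x l₂

/-- Deleting entries commutes with cutting, up to terms with an empty list. -/
theorem del_cut (F : List V → List V → M) (l : List V) (hl : l ≠ []) :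
    del (cut F) l = cut (fun a b => del (fun t => F t b) a) l +
      cut (fun a b => (-1 : k) ^ (a.length + 1) • del (F a) b) l -
      F [] l + (-1 : k) ^ l.length • F l [] := by
  -- Deleting the common entry from the left half of one cut and from the right half of the
  -- preceding cut gives the same pair of lists with opposite signs. Of these deletions only the two
  -- that empty a half survive, and they are the correction terms.
  induction l generalizing F with
  | nil => exact absurd rfl hl
  | cons x l ih =>
    have e1 : (fun t => cut F (x :: t)) =
        fun t => F [x] (x :: t) + cut (fun a b => F (x :: a) b) t := rfl
    have hadd : ∀ (G G' : List V → M) (l : List V),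
        del (fun t => G t + G' t) l = del G l + del G' l := by
      intro G G' l
      induction l generalizing G G' with
      | nil => exact (add_zero 0).symm
      | cons x l ih => rw [del, del, del, ih]; abel
    have e2 : cut (fun a b => del (fun t => F t b) (x :: a)) l =
        cut F l - cut (fun a b => del (fun t => F (x :: t) b) a) l := by
      rw [← cut_sub]; rfl
    have e3 : cut (fun a b => (-1 : k) ^ ((x :: a).length + 1) • del (F (x :: a)) b) l =
        -cut (fun a b => (-1 : k) ^ (a.length + 1) • del (F (x :: a)) b) l := by
      rw [← cut_neg]
      congr 1
      funext a b
      rw [List.length_cons, pow_succ _ (a.length + 1), mul_neg, mul_one, neg_smul]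
    rw [del, e1, hadd, cut, cut, e2, e3]
    have e4 : del (fun t => F t (x :: l)) [x] = F [] (x :: l) := by simp [del]
    have e5 : (-1 : k) ^ ([x].length + 1) • del (F [x]) (x :: l) =
        F [x] l - del (fun t => F [x] (x :: t)) l := by
      simp [del]
    rw [e4, e5]
    by_cases hl : l = []
    · subst hl
      simp [del, cut]
    · rw [ih (fun a b => F (x :: a) b) hl, List.length_cons, pow_succ, mul_neg, mul_one, neg_smul]
      abel

theorem cut_eq_sum (F : List V → List V → M) (l : List V) :
    cut F l = ∑ i : Fin l.length, F (l.take (i + 1)) (l.drop i) := by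
  induction l generalizing F with
  | nil => rfl
  | cons x l ih =>
    rw [cut, ih]
    refine Eq.trans ?_ (Fin.sum_univ_succ _).symm
    rfl

theorem cut_length_one_left (G : List V → M) (l : List V) (hl : l ≠ []) :
    cut (fun a b => if a.length = 1 then G b else 0) l = G l := by
  cases l with
  | nil => exact absurd rfl hl
  | cons x l =>
    have : cut (fun a b => if (x :: a).length = 1 then G b else 0) l = 0 := by
      rw [cut_congr (F' := fun _ _ => 0) (fun a b ha => if_neg (by simpa using ha)), cut_zero]
    rw [cut, this, add_zero]
    rfl

theorem cut_length_one_right (G : List V → M) (l : List V) (hl : l ≠ []) :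
    cut (fun a b => if b.length = 1 then G a else 0) l = G l := by
  induction l generalizing G with
  | nil => exact absurd rfl hl
  | cons x l ih =>
    rw [cut]
    by_cases h : l = []
    · subst h
      simp [cut]
    · rw [ih (fun a => G (x :: a)) h, if_neg (by simpa using h), zero_add]

section sign

variable [LinearOrder V]

variable (k) in
/-- The sign of the permutation that puts a list of distinct entries into order. -/
def lsign : List V → k
  | [] => 1
  | x :: l => (l.map fun y => if y < x then -1 else 1).prod * lsign l

theorem lsign_swap (l₁ : List V) {x y : V} (hxy : x ≠ y) (l₂ : List V) :
    lsign k (l₁ ++ x :: y :: l₂) = -lsign k (l₁ ++ y :: x :: l₂) := by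
  induction l₁ with
  | nil =>
    simp only [List.nil_append, lsign, List.map_cons, List.prod_cons]
    obtain h | h := hxy.lt_or_gt
    · simp only [if_neg h.asymm, if_pos h]
      ring
    · simp only [if_neg h.asymm, if_pos h]
      ring
  | cons z l₁ ih =>
    have hp : (l₁ ++ x :: y :: l₂).Perm (l₁ ++ y :: x :: l₂) :=
      (List.Perm.swap y x l₂).append_left l₁
    rw [List.cons_append, List.cons_append, lsign, lsign, ih, (hp.map _).prod_eq, mul_neg]

theorem lsign_of_pairwise {l : List V} (hl : l.Pairwise (· < ·)) : lsign k l = 1 := by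
  induction l with
  | nil => rfl
  | cons x l ih =>
    rw [List.pairwise_cons] at hl
    rw [lsign, ih hl.2, mul_one]
    refine List.prod_eq_one fun y hy => ?_
    obtain ⟨z, hz, rfl⟩ := List.mem_map.mp hy
    exact if_neg (hl.1 z hz).asymm

theorem lsign_ofFn {n : ℕ} (s : Fin n → V) :
    lsign k (List.ofFn s) = ∏ i, ∏ j ∈ Finset.Ioi i, if s j < s i then -1 else 1 := by
  induction n with
  | zero => simp [lsign]
  | succ n ih =>
    rw [List.ofFn_succ, lsign, ih, Fin.prod_univ_succ, Fin.prod_Ioi_zero, List.map_ofFn,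
      List.prod_ofFn]
    simp only [Fin.prod_Ioi_succ]
    rfl

/-- Both sides are the parity of the number of inversions of `s`: the inverse of `Tuple.sort s`
orders positions in the same way as `s` orders values. -/
theorem lsign_ofFn_eq_sign {n : ℕ} {s : Fin n → V} (hs : Function.Injective s) :
    lsign k (List.ofFn s) = ((Equiv.Perm.sign (Tuple.sort s) : ℤ) : k) := by
  have hmono : StrictMono (s ∘ Tuple.sort s) :=
    (Tuple.monotone_sort s).strictMono_of_injective (hs.comp (Tuple.sort s).injective)
  have h : ∀ i j, s j < s i ↔ (Tuple.sort s)⁻¹ j < (Tuple.sort s)⁻¹ i := by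
    intro i j
    rw [← hmono.lt_iff_lt]
    simp
  rw [lsign_ofFn, ← Equiv.Perm.sign_inv, Equiv.Perm.sign_eq_prod_prod_Ioi]
  push_cast
  refine Finset.prod_congr rfl fun i _ => Finset.prod_congr rfl fun j hj => ?_
  have hij : (Tuple.sort s)⁻¹ i ≠ (Tuple.sort s)⁻¹ j := fun e =>
    (Finset.mem_Ioi.mp hj).ne ((Tuple.sort s)⁻¹.injective e)
  simp only [h]
  obtain hlt | hlt := hij.lt_or_gt
  · rw [if_neg hlt.asymm, if_pos hlt]
    simp
  · rw [if_pos hlt, if_neg hlt.asymm]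
    simp

end sign

end ListChains

/-! ### Chains of the standard simplices as values of alternating functions -/

namespace ListChains

open Simplicial

theorem exists_ofFn {V : Type*} {l : List V} (hl : l ≠ []) :
    ∃ (q : ℕ) (v : Fin (q + 1) → V), l = List.ofFn v := by
  obtain ⟨q, hq⟩ := Nat.exists_eq_succ_of_ne_zero (mt List.length_eq_zero_iff.mp hl)
  obtain ⟨n, v, rfl⟩ : ∃ n, ∃ v : Fin n → V, l = List.ofFn v := ⟨l.length, l.get, by simp⟩
  rw [List.length_ofFn] at hq
  subst hq
  exact ⟨q, v, rfl⟩

theorem ofFn_ne_nil {V : Type*} {q : ℕ} (v : Fin (q + 1) → V) : List.ofFn v ≠ [] := by simp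

variable (k : Type u) [CommRing k] {d : ℕ}

section

variable (d)

/-- The chains of the standard simplex. -/
abbrev stdChains : DGMod.{u, max u v} k := chains k (Δ[d] : SSet.{v})

end

theorem simplexChain_eq_zero {q : ℕ} {v : Fin (q + 1) →o Fin (d + 1)} (hv : ¬ StrictMono v) :
    simplexChain.{u, v} k v = 0 := by
  refine cls_eq_zero k ?_
  by_contra h
  exact hv ((SSet.stdSimplex.mem_nonDegenerate_iff_strictMono _).mp h)

theorem d_simplexChain_zero (v : Fin (0 + 1) →o Fin (d + 1)) :
    (stdChains.{u, v} k d).d (simplexChain.{u, v} k v) = 0 :=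
  (chainLift_cls k _ (faceSum_degenerate k _) _).trans (faceSum_zero k _ _)

theorem d_simplexChain_succ {q : ℕ} (v : Fin (q + 1 + 1) →o Fin (d + 1)) :
    (stdChains.{u, v} k d).d (simplexChain.{u, v} k v) =
      ∑ i : Fin (q + 2), (-1 : k) ^ (i : ℕ) •
        simplexChain.{u, v} k (v.comp (Fin.succAboveOrderEmb i).toOrderHom) :=
  (chainLift_cls k _ (faceSum_degenerate k _) _).trans (faceSum_succ k _ _ _)

theorem simplexChain_mem {q : ℕ} (v : Fin (q + 1) →o Fin (d + 1)) :
    simplexChain.{u, v} k v ∈ (stdChains.{u, v} k d).gr q :=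
  (Submodule.subset_span ⟨q, SSet.stdSimplex.objMk v, rfl, rfl⟩ :
    cls k (Δ[d] : SSet.{v}) (SSet.stdSimplex.objMk v) ∈ chainGr k _ q)

theorem stdChains_ext {M : Type w} [AddCommGroup M] [Module k M] {f g : (stdChains.{u, v} k d).carrier →ₗ[k] M}
    (h : ∀ (q : ℕ) (v : Fin (q + 1) →o Fin (d + 1)), StrictMono v →
      f (simplexChain.{u, v} k v) = g (simplexChain.{u, v} k v)) : f = g := by
  refine chain_ext k fun n x => ?_
  obtain ⟨v, rfl⟩ := SSet.stdSimplex.objMk_bijective.2 x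
  by_cases hv : StrictMono v
  · exact h n v hv
  · have := simplexChain_eq_zero.{u, v} k hv
    exact (congrArg f this).trans ((map_zero f).trans ((congrArg g this).trans (map_zero g)).symm)

/-- The chain of a set of vertices. -/
def setChain (F : Finset (Fin (d + 1))) : (stdChains.{u, v} k d).carrier :=
  -- With truncated subtraction this says that `F` is nonempty.
  if h : F.card - 1 + 1 = F.card then
    simplexChain.{u, v} k (F.orderEmbOfFin h.symm).toOrderHom
  else 0

theorem setChain_ofFn {q : ℕ} (v : Fin (q + 1) →o Fin (d + 1)) (hv : StrictMono v) :
    setChain.{u, v} k (List.ofFn v).toFinset = simplexChain.{u, v} k v := by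
  have hc : (List.ofFn v).toFinset.card = q + 1 := by
    rw [List.toFinset_card_of_nodup (List.nodup_ofFn.mpr hv.injective), List.length_ofFn]
  have key : ∀ (F : Finset (Fin (d + 1))) (n : ℕ) (hn : n = q) (h : F.card = n + 1)
      (h' : ∀ x, v x ∈ F), simplexChain.{u, v} k (F.orderEmbOfFin h).toOrderHom = simplexChain.{u, v} k v := by
    rintro F n rfl h h'
    congr 1
    ext i : 2
    exact (congrFun (Finset.orderEmbOfFin_unique h h' hv) i).symm
  rw [setChain, dif_pos (by omega)]
  exact key _ _ (by omega) _ fun x => List.mem_toFinset.mpr (List.mem_ofFn.mpr ⟨x, rfl⟩)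

/-- The chain `[v₀, …, v_q]` of a list of vertices, as an alternating function. -/
def altChain (l : List (Fin (d + 1))) : (stdChains.{u, v} k d).carrier :=
  if l.Nodup then lsign k l • setChain k l.toFinset else 0

theorem altChain_nil : altChain.{u, v} k ([] : List (Fin (d + 1))) = 0 := by
  simp [altChain, setChain]

theorem vanishAdj_altChain : VanishAdj (altChain.{u, v} k (d := d)) := fun l₁ x l₂ =>
  if_neg fun h => by simp [List.nodup_append] at h

theorem swapAdj_altChain : SwapAdj (altChain.{u, v} k (d := d)) := fun l₁ x y l₂ => by
  have hp : (l₁ ++ x :: y :: l₂).Perm (l₁ ++ y :: x :: l₂) :=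
    (List.Perm.swap y x l₂).append_left l₁
  by_cases h : (l₁ ++ x :: y :: l₂).Nodup
  · have hxy : x ≠ y := by
      rintro rfl
      simp [List.nodup_append] at h
    rw [altChain, altChain, if_pos h, if_pos (hp.nodup_iff.mp h), lsign_swap l₁ hxy,
      List.toFinset_eq_of_perm _ _ hp, neg_smul]
  · rw [altChain, altChain, if_neg h, if_neg (mt hp.nodup_iff.mpr h), neg_zero]

theorem pairwise_lt_ofFn {V : Type*} [Preorder V] {q : ℕ} {v : Fin q → V} :
    (List.ofFn v).Pairwise (· < ·) ↔ StrictMono v := List.pairwise_ofFn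

theorem altChain_ofFn {q : ℕ} (v : Fin (q + 1) →o Fin (d + 1)) :
    altChain.{u, v} k (List.ofFn v) = simplexChain.{u, v} k v := by
  by_cases hv : StrictMono v
  · rw [altChain, if_pos (List.nodup_ofFn.mpr hv.injective), setChain_ofFn k v hv,
      lsign_of_pairwise (pairwise_lt_ofFn.mpr hv), one_smul]
  · rw [simplexChain_eq_zero k hv, altChain, if_neg]
    exact fun h => hv (v.monotone.strictMono_of_injective (List.nodup_ofFn.mp h))

theorem altChain_ofFn_eq {q : ℕ} (s : Fin (q + 1) → Fin (d + 1)) :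
    altChain.{u, v} k (List.ofFn s) = if Function.Injective s then
      ((Equiv.Perm.sign (Tuple.sort s) : ℤ) : k) •
        simplexChain.{u, v} k ⟨s ∘ Tuple.sort s, Tuple.monotone_sort s⟩ else 0 := by
  simp only [altChain, List.nodup_ofFn]
  split_ifs with hs
  · rw [lsign_ofFn_eq_sign hs, ← setChain_ofFn k ⟨s ∘ Tuple.sort s, Tuple.monotone_sort s⟩
      ((Tuple.monotone_sort s).strictMono_of_injective (hs.comp (Tuple.sort s).injective))]
    congr 2
    ext x
    simp only [List.mem_toFinset, List.mem_ofFn, OrderHom.coe_mk]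
    exact ⟨fun ⟨i, hi⟩ => ⟨(Tuple.sort s).symm i, by simpa using hi⟩, fun ⟨i, hi⟩ => ⟨_, hi⟩⟩
  · rfl

theorem altChain_mem (l : List (Fin (d + 1))) (hl : l ≠ []) :
    altChain k l ∈ (stdChains.{u, v} k d).gr (l.length - 1) := by
  obtain ⟨q, s, rfl⟩ := exists_ofFn hl
  rw [altChain_ofFn_eq, List.length_ofFn]
  split_ifs
  · refine Submodule.smul_mem _ _ ?_
    have := simplexChain_mem.{u, v} k (⟨s ∘ Tuple.sort s, Tuple.monotone_sort s⟩ : _ →o Fin (d + 1))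
    exact Set.mem_of_eq_of_mem rfl (by simpa using this)
  · exact Submodule.zero_mem _

theorem altChain_ext {M : Type w} [AddCommGroup M] [Module k M]
    {f g : (stdChains.{u, v} k d).carrier →ₗ[k] M}
    (h : ∀ l : List (Fin (d + 1)), l.Pairwise (· < ·) → l ≠ [] → f (altChain k l) = g (altChain k l)) :
    f = g :=
  stdChains_ext k fun q v hv => by
    rw [← altChain_ofFn]
    exact h _ (pairwise_lt_ofFn.mpr hv) (ofFn_ne_nil v)

/-- Both sides are alternating, so increasing lists suffice, and there this is the formula for the
faces. For a single vertex the deletion leaves the empty list, whose chain is zero, as is the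
boundary of a vertex. -/
theorem d_altChain (l : List (Fin (d + 1))) :
    (stdChains.{u, v} k d).d (altChain k l) = del (altChain k) l := by
  refine alternating_ext (G := fun l => (stdChains.{u, v} k d).d (altChain k l)) ?_ ?_
    (vanishAdj_altChain k).del (swapAdj_altChain k).del ?_ l
  · intro l₁ x l₂
    change (stdChains.{u, v} k d).d _ = 0
    rw [vanishAdj_altChain, map_zero]
  · intro l₁ x y l₂
    change (stdChains.{u, v} k d).d _ = -(stdChains.{u, v} k d).d _
    rw [swapAdj_altChain, map_neg]
  · intro l hl
    by_cases h : l = []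
    · subst h
      change (stdChains.{u, v} k d).d _ = 0
      rw [altChain_nil, map_zero]
    · obtain ⟨q, s, rfl⟩ := exists_ofFn h
      obtain ⟨v, rfl⟩ : ∃ v : Fin (q + 1) →o Fin (d + 1), s = v :=
        ⟨⟨s, (pairwise_lt_ofFn.mp hl).monotone⟩, rfl⟩
      change (stdChains.{u, v} k d).d (altChain k (List.ofFn v)) = _
      rw [altChain_ofFn, del_ofFn (k := k)]
      cases q with
      | zero =>
        rw [d_simplexChain_zero]
        simp [altChain_nil]
      | succ q =>
        rw [d_simplexChain_succ]
        refine Finset.sum_congr rfl fun i _ => congrArg _ ?_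
        exact (altChain_ofFn.{u, v} k (v.comp (Fin.succAboveOrderEmb i).toOrderHom)).symm

/-- The linear map on the chains of a simplex with given values on increasing lists. -/
def lift {M : Type w} [AddCommGroup M] [Module k M] (G : List (Fin (d + 1)) → M) (hG : VanishAdj G) :
    (stdChains.{u, v} k d).carrier →ₗ[k] M :=
  chainLift k (fun n (x : (Δ[d] : SSet.{v}) _⦋n⦌) => G (List.ofFn fun i => x i)) fun n x hx => by
    have hx' : ¬ (List.ofFn fun i => x i).Pairwise (· < ·) := fun h =>
      (SSet.stdSimplex.mem_nonDegenerate_iff_strictMono _).mpr (pairwise_lt_ofFn.mp h) hx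
    obtain ⟨l₁, y, l₂, e⟩ := exists_adj_of_not_chain
      (List.pairwise_ofFn.mpr fun i j hij => SSet.stdSimplex.monotone_apply x hij.le) hx'
    rw [e, hG]

variable {M : Type w} [AddCommGroup M] [Module k M] {G : List (Fin (d + 1)) → M}

theorem lift_simplexChain (hG : VanishAdj G) {q : ℕ} (v : Fin (q + 1) →o Fin (d + 1)) :
    lift.{u, v} k G hG (simplexChain.{u, v} k v) = G (List.ofFn v) := chainLift_cls k _ _ _

theorem lift_altChain_of_sorted (hG : VanishAdj G) {l : List (Fin (d + 1))}
    (hl : l.Pairwise (· < ·)) (h : l ≠ []) : lift.{u, v} k G hG (altChain k l) = G l := by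
  obtain ⟨q, s, rfl⟩ := exists_ofFn h
  obtain ⟨v, rfl⟩ : ∃ v : Fin (q + 1) →o Fin (d + 1), s = v :=
    ⟨⟨s, (pairwise_lt_ofFn.mp hl).monotone⟩, rfl⟩
  exact (congrArg _ (altChain_ofFn k v)).trans (lift_simplexChain.{u, v} k hG v)

/-- For an alternating `G` the defining formula extends from increasing lists to all nonempty ones.
The coproduct is not alternating, so for it only `lift_altChain_of_sorted` is available. -/
theorem lift_altChain (hG : VanishAdj G) (hs : SwapAdj G) {l : List (Fin (d + 1))} (h : l ≠ []) :
    lift.{u, v} k G hG (altChain k l) = G l := by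
  have key := alternating_ext (G := fun l => lift.{u, v} k G hG (altChain k l))
    -- The empty list is corrected because its chain is zero while `G []` is arbitrary.
    (G' := fun l => if l = [] then 0 else G l) ?_ ?_ ?_ ?_ ?_ l
  · exact key.trans (if_neg h)
  · intro l₁ x l₂
    change lift k G hG _ = 0
    rw [vanishAdj_altChain, map_zero]
  · intro l₁ x y l₂
    change lift k G hG _ = -lift k G hG _
    rw [swapAdj_altChain, map_neg]
  · intro l₁ x l₂
    simp [hG l₁ x l₂]
  · intro l₁ x y l₂
    simp [hs l₁ x y l₂]
  · intro l hl
    change lift k G hG _ = _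
    split_ifs with h
    · rw [h, altChain_nil, map_zero]
    · exact lift_altChain_of_sorted k hG hl h

end ListChains

/-! ### Homomorphisms out of the first two tensor powers -/

namespace DGMod

variable {k : Type u} [CommRing k] (C : DGMod.{u, w} k)

/-- The identification of `C` with its first tensor power. -/
def sing : C.carrier ≃ₗ[k] C.TPow 1 :=
  (PiTensorProduct.subsingletonEquiv (s := fun _ : Fin 1 => C.carrier) 0).symm

theorem sing_apply (x : C.carrier) : C.sing x = PiTensorProduct.tprod k ![x] := by
  rw [sing, LinearEquiv.symm_apply_eq]
  simp

theorem sing_symm_tprod (x : Fin 1 → C.carrier) : C.sing.symm (PiTensorProduct.tprod k x) = x 0 := by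
  rw [LinearEquiv.symm_apply_eq, sing_apply]
  congr 1
  ext i
  fin_cases i
  rfl

theorem sing_mem {x : C.carrier} {i : ℤ} (hx : x ∈ C.gr i) : C.sing x ∈ C.tgr 1 i := by
  rw [sing_apply]
  refine C.tprod_mem_tgr (e := ![i]) (fun r => ?_) (by simp)
  fin_cases r
  exact hx

theorem sing_symm_mem {x : C.TPow 1} {i : ℤ} (hx : x ∈ C.tgr 1 i) : C.sing.symm x ∈ C.gr i := by
  have : C.tgr 1 i ≤ (C.gr i).comap C.sing.symm.toLinearMap := by
    refine Submodule.span_le.mpr ?_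
    rintro _ ⟨e, x, he, hi, rfl⟩
    rw [Fin.sum_univ_one] at hi
    have h : x 0 ∈ C.gr i := hi ▸ he 0
    rw [← C.sing_symm_tprod x] at h
    exact h
  exact this hx

theorem td_zero (x : C.TPow 0) : C.td 0 x = 0 := by simp [td]

theorem td_sing (x : C.carrier) : C.td 1 (C.sing x) = C.sing (C.d x) := by
  rw [sing_apply, sing_apply, td, Fin.sum_univ_one, PiTensorProduct.map_tprod]
  congr 1
  ext i
  fin_cases i
  simp

theorem ttau_sing (x : C.carrier) : C.ttau 1 (C.sing x) = C.sing (C.tau x) := by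
  rw [sing_apply, sing_apply, ttau, PiTensorProduct.map_tprod]
  congr 1
  ext i
  fin_cases i
  rfl

theorem tmap_sing {D : DGMod.{u, w'} k} (f : C.Hom D) (x : C.carrier) :
    tmap f 1 (C.sing x) = D.sing (f.toLin x) := by
  rw [sing_apply, sing_apply, tmap, PiTensorProduct.map_tprod]
  congr 1
  ext i
  fin_cases i
  rfl

/-- The tensor product of two elements. -/
def pair : C.carrier →ₗ[k] C.carrier →ₗ[k] C.TPow 2 :=
  LinearMap.mk₂ k (fun x y => C.tcat (rfl : 1 + 1 = 2) (C.sing x ⊗ₜ[k] C.sing y))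
    (fun x x' y => by rw [map_add, TensorProduct.add_tmul, map_add])
    (fun c x y => by rw [map_smul, ← TensorProduct.smul_tmul', map_smul])
    (fun x y y' => by rw [map_add, TensorProduct.tmul_add, map_add])
    (fun c x y => by rw [map_smul, TensorProduct.tmul_smul, map_smul])

theorem pair_apply (x y : C.carrier) :
    C.pair x y = C.tcat (rfl : 1 + 1 = 2) (C.sing x ⊗ₜ[k] C.sing y) := rfl

theorem pair_eq_tprod (x y : C.carrier) : C.pair x y = PiTensorProduct.tprod k ![x, y] := by
  rw [pair_apply, sing_apply, sing_apply, tcat_tprod]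
  congr 1
  ext i
  fin_cases i <;> rfl

theorem pair_mem {x y : C.carrier} {i j l : ℤ} (h : i + j = l) (hx : x ∈ C.gr i) (hy : y ∈ C.gr j) :
    C.pair x y ∈ C.tgr 2 l :=
  C.tcat_mem _ h (C.sing_mem hx) (C.sing_mem hy)

theorem td_pair (x y : C.carrier) :
    C.td 2 (C.pair x y) = C.pair (C.d x) y + C.pair (C.tau x) (C.d y) := by
  rw [pair_apply, td_tcat, td_sing, td_sing, ttau_sing]
  rfl

theorem tmap_pair {D : DGMod.{u, w'} k} (f : C.Hom D) (x y : C.carrier) :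
    tmap f 2 (C.pair x y) = D.pair (f.toLin x) (f.toLin y) := by
  rw [pair_apply, tmap_tcat, tmap_sing, tmap_sing]
  rfl

theorem sing_ext {M : Type w'} [AddCommGroup M] [Module k M] {f g : C.TPow 1 →ₗ[k] M}
    (h : f ∘ₗ C.sing.toLinearMap = g ∘ₗ C.sing.toLinearMap) : f = g :=
  LinearMap.ext fun x => by
    obtain ⟨x, rfl⟩ := C.sing.surjective x
    exact LinearMap.congr_fun h x

theorem pair_ext {M : Type w'} [AddCommGroup M] [Module k M] {f g : C.TPow 2 →ₗ[k] M}
    (h : C.pair.compr₂ f = C.pair.compr₂ g) : f = g :=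
  PiTensorProduct.ext <| MultilinearMap.ext fun x => by
    have := LinearMap.congr_fun (LinearMap.congr_fun h (x 0)) (x 1)
    rw [LinearMap.compr₂_apply, LinearMap.compr₂_apply, pair_eq_tprod] at this
    rwa [show ![x 0, x 1] = x from funext fun i => by fin_cases i <;> rfl] at this

/-- The homomorphism `C^{⊗ 1} → C^{⊗ m}` given by a linear map on `C`. -/
def ofLin {m : ℕ} {i : ℤ} (f : C.carrier →ₗ[k] C.TPow m)
    (hf : ∀ j, ∀ x ∈ C.gr j, f x ∈ C.tgr m (i + j)) : C.homDeg 1 m i :=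
  ⟨f ∘ₗ C.sing.symm.toLinearMap, fun j _ hx => hf j _ (C.sing_symm_mem hx)⟩

theorem ofLin_sing {m : ℕ} {i : ℤ} (f : C.carrier →ₗ[k] C.TPow m)
    (hf : ∀ j, ∀ x ∈ C.gr j, f x ∈ C.tgr m (i + j)) (x : C.carrier) :
    (C.ofLin f hf).1 (C.sing x) = f x :=
  congrArg f (C.sing.symm_apply_apply x)

/-- The homomorphism `C^{⊗ 2} → C^{⊗ m}` given by a bilinear map on `C`. -/
def ofBilin {m : ℕ} {i : ℤ} (f : C.carrier →ₗ[k] C.carrier →ₗ[k] C.TPow m)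
    (hf : ∀ j l, ∀ x ∈ C.gr j, ∀ y ∈ C.gr l, f x y ∈ C.tgr m (i + (j + l))) : C.homDeg 2 m i :=
  ⟨TensorProduct.lift (f.compl₁₂ C.sing.symm.toLinearMap C.sing.symm.toLinearMap) ∘ₗ
      (C.tcat (rfl : 1 + 1 = 2)).symm.toLinearMap, fun j x hx => by
    have : C.tgr 2 j ≤ (C.tgr m (i + j)).comap
        (TensorProduct.lift (f.compl₁₂ C.sing.symm.toLinearMap C.sing.symm.toLinearMap) ∘ₗ
          (C.tcat (rfl : 1 + 1 = 2)).symm.toLinearMap) := by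
      refine Submodule.span_le.mpr ?_
      rintro _ ⟨e, x, he, hi, rfl⟩
      rw [Fin.sum_univ_two] at hi
      subst hi
      rw [show x = ![x 0, x 1] from funext fun i => by fin_cases i <;> rfl, ← pair_eq_tprod]
      simp only [Submodule.comap_coe, Set.mem_preimage, SetLike.mem_coe, LinearMap.comp_apply,
        LinearEquiv.coe_coe, pair_apply, LinearEquiv.symm_apply_apply, TensorProduct.lift.tmul,
        LinearMap.compl₁₂_apply]
      exact hf _ _ _ (he 0) _ (he 1)
    exact this hx⟩

theorem ofBilin_pair {m : ℕ} {i : ℤ} (f : C.carrier →ₗ[k] C.carrier →ₗ[k] C.TPow m)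
    (hf : ∀ j l, ∀ x ∈ C.gr j, ∀ y ∈ C.gr l, f x y ∈ C.tgr m (i + (j + l))) (x y : C.carrier) :
    (C.ofBilin f hf).1 (C.pair x y) = f x y := by
  simp only [ofBilin, LinearMap.comp_apply, LinearEquiv.coe_coe, pair_apply,
    LinearEquiv.symm_apply_apply, TensorProduct.lift.tmul, LinearMap.compl₁₂_apply]

theorem endProp_perm_one (n : ℕ) (x : C.TPow n) :
    (C.endProp.perm (1 : Equiv.Perm (Fin n))).1 x = x :=
  LinearMap.congr_fun (C.tperm_one n) x

theorem counit_left_pair (f : C.homDeg 1 0 0) (x y : C.carrier) :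
    (C.homTensor (rfl : 1 + 1 = 2) (rfl : 0 + 1 = 1) (add_zero 0) f
      (C.endProp.perm (1 : Equiv.Perm (Fin 1)))).1 (C.pair x y) =
      C.tcat (rfl : 0 + 1 = 1) (f.1 (C.sing x) ⊗ₜ[k] C.sing y) := by
  rw [pair_apply, homTensor_tcat_even _ _ _ _ _ _ Even.zero, endProp_perm_one]

theorem counit_right_pair (f : C.homDeg 1 0 0) (x y : C.carrier) :
    (C.homTensor (rfl : 1 + 1 = 2) (rfl : 1 + 0 = 1) (add_zero 0)
      (C.endProp.perm (1 : Equiv.Perm (Fin 1))) f).1 (C.pair x y) =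
      C.tcat (rfl : 1 + 0 = 1) (C.sing x ⊗ₜ[k] f.1 (C.sing y)) := by
  rw [pair_apply, homTensor_tcat_even _ _ _ _ _ _ Even.zero, endProp_perm_one]

end DGMod

/-! ### Augmentation, Alexander–Whitney map and join -/

namespace ListChains

open Simplicial

variable (k : Type u) [CommRing k] {d : ℕ}

theorem map_mem_of_sorted {M : Type w} [AddCommGroup M] [Module k M] {S : ℤ → Submodule k M}
    {f : (stdChains.{u, v} k d).carrier →ₗ[k] M}
    (h : ∀ l : List (Fin (d + 1)), l.Pairwise (· < ·) → l ≠ [] → f (altChain k l) ∈ S (l.length - 1))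
    {j : ℤ} {x : (stdChains.{u, v} k d).carrier} (hx : x ∈ (stdChains.{u, v} k d).gr j) : f x ∈ S j := by
  have : chainGr k (Δ[d] : SSet.{v}) j ≤ (S j).comap f := by
    refine Submodule.span_le.mpr ?_
    rintro _ ⟨n, x, rfl, rfl⟩
    obtain ⟨v, rfl⟩ := SSet.stdSimplex.objMk_bijective.2 x
    change f (simplexChain.{u, v} k v) ∈ S n
    by_cases hv : StrictMono v
    · have := h _ (pairwise_lt_ofFn.mpr hv) (ofFn_ne_nil v)
      rw [altChain_ofFn, List.length_ofFn] at this
      simpa using this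
    · rw [simplexChain_eq_zero k hv, map_zero]
      exact Submodule.zero_mem _
  exact this hx

/-- The augmentation on lists. -/
def listCounit (l : List (Fin (d + 1))) : (stdChains.{u, v} k d).TPow 0 :=
  if l.length = 1 then PiTensorProduct.tprod k ![] else 0

theorem vanishAdj_listCounit : VanishAdj (listCounit.{u, v} k (d := d)) := fun _ _ _ =>
  if_neg (by simp; omega)

theorem swapAdj_listCounit : SwapAdj (listCounit.{u, v} k (d := d)) := fun _ _ _ _ => by
  rw [listCounit, listCounit, if_neg (by simp; omega), if_neg (by simp; omega), neg_zero]

theorem del_listCounit (l : List (Fin (d + 1))) : del (listCounit.{u, v} k) l = 0 := by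
  match l with
  | [] => rfl
  | [x] => simp [del, listCounit]
  | [x, y] => simp [del, listCounit]
  | x :: y :: z :: l =>
    rw [del_congr (G' := fun _ => 0), del_zero]
    intro t _ ht
    refine if_neg ?_
    simp at ht
    omega

/-- The augmentation. -/
def stdCounit : (stdChains.{u, v} k d).endProp.obj 1 0 0 :=
  (stdChains.{u, v} k d).ofLin (lift k (listCounit k) (vanishAdj_listCounit k)) fun j x hx =>
    map_mem_of_sorted (S := fun j => (stdChains.{u, v} k d).tgr 0 (0 + j)) k (fun l hl h => by
      rw [lift_altChain k _ (swapAdj_listCounit k) h, listCounit]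
      split_ifs with hl
      · exact (stdChains.{u, v} k d).tprod_mem_tgr (e := ![]) (fun r => r.elim0) (by simp [hl])
      · exact Submodule.zero_mem _) hx

theorem stdCounit_sing (l : List (Fin (d + 1))) :
    (stdCounit.{u, v} k).1 ((stdChains.{u, v} k d).sing (altChain k l)) = listCounit k l := by
  by_cases h : l = []
  · subst h
    rw [altChain_nil, map_zero, map_zero]
    rfl
  · exact ((stdChains.{u, v} k d).ofLin_sing _ _ _).trans
      (lift_altChain k _ (swapAdj_listCounit k) h)

/-- The Alexander-Whitney coproduct on lists. -/
def listCoproduct : List (Fin (d + 1)) → (stdChains.{u, v} k d).TPow 2 :=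
  cut fun a b => (stdChains.{u, v} k d).pair (altChain k a) (altChain k b)

theorem vanishAdj_listCoproduct : VanishAdj (listCoproduct.{u, v} k (d := d)) :=
  VanishAdj.cut
    (fun b l₁ x l₂ => by
      change (stdChains.{u, v} k d).pair _ _ = 0
      rw [vanishAdj_altChain, map_zero, LinearMap.zero_apply])
    (fun a l₁ x l₂ => by
      change (stdChains.{u, v} k d).pair _ _ = 0
      rw [vanishAdj_altChain, map_zero])

theorem cut_mem {V : Type*} {M : Type w} [AddCommGroup M] [Module k M] {S : Submodule k M}
    {F : List V → List V → M} (l : List V)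
    (h : ∀ a b : List V, a ≠ [] → b ≠ [] → a.length + b.length = l.length + 1 → F a b ∈ S) :
    cut F l ∈ S := by
  induction l generalizing F with
  | nil => exact S.zero_mem
  | cons x l ih =>
    refine S.add_mem (h _ _ (List.cons_ne_nil _ _) (List.cons_ne_nil _ _) ?_)
      (ih fun a b _ hb hab => h _ _ (List.cons_ne_nil _ _) hb ?_)
    · simp; omega
    · simp; omega

/-- The Alexander-Whitney coproduct. -/
def stdCoproduct : (stdChains.{u, v} k d).endProp.obj 1 2 0 :=
  (stdChains.{u, v} k d).ofLin (lift k (listCoproduct k) (vanishAdj_listCoproduct k)) fun j x hx =>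
    map_mem_of_sorted (S := fun j => (stdChains.{u, v} k d).tgr 2 (0 + j)) k (fun l hl h => by
      rw [lift_altChain_of_sorted k _ hl h]
      refine cut_mem k l fun a b ha hb hab => ?_
      exact (stdChains.{u, v} k d).pair_mem (by omega) (altChain_mem k a ha) (altChain_mem k b hb)) hx

theorem stdCoproduct_simplexChain {q : ℕ} (v : Fin (q + 1) →o Fin (d + 1)) :
    (stdCoproduct.{u, v} k).1 ((stdChains.{u, v} k d).sing (simplexChain k v)) =
      listCoproduct k (List.ofFn v) :=
  (congrArg (lift k (listCoproduct k) (vanishAdj_listCoproduct k))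
    ((stdChains.{u, v} k d).sing.symm_apply_apply _)).trans (lift_simplexChain k _ v)

theorem stdCoproduct_sing {l : List (Fin (d + 1))} (hl : l.Pairwise (· < ·)) :
    (stdCoproduct.{u, v} k).1 ((stdChains.{u, v} k d).sing (altChain k l)) = listCoproduct k l := by
  by_cases h : l = []
  · subst h
    rw [altChain_nil, map_zero, map_zero]
    rfl
  · exact ((stdChains.{u, v} k d).ofLin_sing _ _ _).trans (lift_altChain_of_sorted k _ hl h)

/-- The join product on lists. -/
def listProduct (a b : List (Fin (d + 1))) : (stdChains.{u, v} k d).TPow 1 :=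
  -- A list of $p+1$ vertices has $(-1)^{p+2}=(-1)^p$.
  (-1 : k) ^ (a.length + 1) • (stdChains.{u, v} k d).sing (altChain k (a ++ b))

theorem vanishAdj_listProduct (a : List (Fin (d + 1))) : VanishAdj (listProduct.{u, v} k a) :=
  fun l₁ x l₂ => by
    have h : altChain.{u, v} k (a ++ (l₁ ++ x :: x :: l₂)) = 0 := (vanishAdj_altChain k).append a l₁ x l₂
    rw [listProduct, h, map_zero, smul_zero]

theorem swapAdj_listProduct (a : List (Fin (d + 1))) : SwapAdj (listProduct.{u, v} k a) :=
  fun l₁ x y l₂ => by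
    have h : altChain.{u, v} k (a ++ (l₁ ++ x :: y :: l₂)) = -altChain k (a ++ (l₁ ++ y :: x :: l₂)) :=
      (swapAdj_altChain k).append a l₁ x y l₂
    rw [listProduct, h, map_neg, smul_neg]
    rfl

theorem vanishAdj_listProduct_left (b : List (Fin (d + 1))) :
    VanishAdj fun a => listProduct.{u, v} k a b := fun l₁ x l₂ => by
  change listProduct k _ b = 0
  have h : altChain.{u, v} k ((l₁ ++ x :: x :: l₂) ++ b) = 0 :=
    (vanishAdj_altChain k).append_right b l₁ x l₂
  rw [listProduct, h, map_zero, smul_zero]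

theorem swapAdj_listProduct_left (b : List (Fin (d + 1))) :
    SwapAdj fun a => listProduct.{u, v} k a b := fun l₁ x y l₂ => by
  change listProduct k _ b = -listProduct k _ b
  have h : altChain.{u, v} k ((l₁ ++ x :: y :: l₂) ++ b) = -altChain k ((l₁ ++ y :: x :: l₂) ++ b) :=
    (swapAdj_altChain k).append_right b l₁ x y l₂
  rw [listProduct, h, map_neg, smul_neg, listProduct]
  simp only [List.length_append, List.length_cons]

/-- The join product with a list. -/
def listJoin (a : List (Fin (d + 1))) :
    (stdChains.{u, v} k d).carrier →ₗ[k] (stdChains.{u, v} k d).TPow 1 :=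
  lift k (listProduct k a) (vanishAdj_listProduct k a)

theorem listJoin_altChain (a : List (Fin (d + 1))) {b : List (Fin (d + 1))} (hb : b ≠ []) :
    listJoin.{u, v} k a (altChain k b) = listProduct k a b :=
  lift_altChain k _ (swapAdj_listProduct k a) hb

theorem vanishAdj_listJoin : VanishAdj (listJoin.{u, v} k (d := d)) := fun l₁ x l₂ =>
  altChain_ext k fun b _ hb =>
    (listJoin_altChain k _ hb).trans (vanishAdj_listProduct_left k b l₁ x l₂)

theorem swapAdj_listJoin : SwapAdj (listJoin.{u, v} k (d := d)) := fun l₁ x y l₂ =>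
  altChain_ext k fun b _ hb => by
    rw [LinearMap.neg_apply, listJoin_altChain k _ hb, listJoin_altChain k _ hb]
    exact swapAdj_listProduct_left k b l₁ x y l₂

/-- The join product as a bilinear map. -/
def joinMap : (stdChains.{u, v} k d).carrier →ₗ[k] (stdChains.{u, v} k d).carrier →ₗ[k]
    (stdChains.{u, v} k d).TPow 1 :=
  lift k (listJoin k) (vanishAdj_listJoin k)

/-- The join is alternating in each argument, so the formula holds for all nonempty lists and not
only for increasing ones. -/
theorem joinMap_altChain {a b : List (Fin (d + 1))} (ha : a ≠ []) (hb : b ≠ []) :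
    joinMap.{u, v} k (altChain k a) (altChain k b) = listProduct k a b := by
  rw [joinMap, lift_altChain k _ (swapAdj_listJoin k) ha, listJoin_altChain k a hb]

/-- The join product. -/
def stdProduct : (stdChains.{u, v} k d).endProp.obj 2 1 1 :=
  (stdChains.{u, v} k d).ofBilin (joinMap k) fun i j x hx y hy => by
    refine map_mem_of_sorted (S := fun i => (stdChains.{u, v} k d).tgr 1 (1 + (i + j)))
      (f := (joinMap.{u, v} k).flip y) k (fun a _ ha => ?_) hx
    refine map_mem_of_sorted (S := fun j => (stdChains.{u, v} k d).tgr 1 (1 + (a.length - 1 + j)))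
      (f := joinMap.{u, v} k (altChain k a)) k (fun b _ hb => ?_) hy
    rw [joinMap_altChain k ha hb]
    have h := altChain_mem.{u, v} k (a ++ b) (List.append_ne_nil_of_left_ne_nil ha b)
    rw [List.length_append] at h
    rw [show (1 + (a.length - 1 + (b.length - 1)) : ℤ) = ((a.length + b.length : ℕ) : ℤ) - 1 by
      push_cast; ring]
    exact Submodule.smul_mem _ _ ((stdChains.{u, v} k d).sing_mem h)

theorem stdProduct_pair {a b : List (Fin (d + 1))} (ha : a ≠ []) (hb : b ≠ []) :
    (stdProduct.{u, v} k).1 ((stdChains.{u, v} k d).pair (altChain k a) (altChain k b)) =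
      listProduct k a b :=
  ((stdChains.{u, v} k d).ofBilin_pair _ _ _ _).trans (joinMap_altChain k ha hb)

end ListChains

/-! ### Relations and differentials of the structure maps -/

namespace ListChains

open Simplicial

variable (k : Type u) [CommRing k] {d : ℕ}

/-- The augmentation of the first factor. -/
def counitLeft : (stdChains.{u, v} k d).homDeg 2 1 0 :=
  (stdChains.{u, v} k d).homTensor (rfl : 1 + 1 = 2) (rfl : 0 + 1 = 1) (add_zero 0) (stdCounit k)
    ((stdChains.{u, v} k d).endProp.perm (1 : Equiv.Perm (Fin 1)))

/-- The augmentation of the second factor. -/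
def counitRight : (stdChains.{u, v} k d).homDeg 2 1 0 :=
  (stdChains.{u, v} k d).homTensor (rfl : 1 + 1 = 2) (rfl : 1 + 0 = 1) (add_zero 0)
    ((stdChains.{u, v} k d).endProp.perm (1 : Equiv.Perm (Fin 1))) (stdCounit k)

theorem counit_left_altChain (a b : List (Fin (d + 1))) :
    (counitLeft.{u, v} k).1
      ((stdChains.{u, v} k d).pair (altChain k a) (altChain k b)) =
      if a.length = 1 then (stdChains.{u, v} k d).sing (altChain k b) else 0 := by
  rw [counitLeft, DGMod.counit_left_pair, stdCounit_sing, listCounit]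
  split_ifs
  · exact (stdChains.{u, v} k d).tcat_zero_left _ _ _
  · rw [TensorProduct.zero_tmul, map_zero]

theorem counit_right_altChain (a b : List (Fin (d + 1))) :
    (counitRight.{u, v} k).1
      ((stdChains.{u, v} k d).pair (altChain k a) (altChain k b)) =
      if b.length = 1 then (stdChains.{u, v} k d).sing (altChain k a) else 0 := by
  rw [counitRight, DGMod.counit_right_pair, stdCounit_sing, listCounit]
  split_ifs
  · exact (stdChains.{u, v} k d).tcat_zero_right _ _ _
  · rw [TensorProduct.tmul_zero, map_zero]

theorem sing_altChain_ext {M : Type w} [AddCommGroup M] [Module k M]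
    {f g : (stdChains.{u, v} k d).TPow 1 →ₗ[k] M}
    (h : ∀ l : List (Fin (d + 1)), l.Pairwise (· < ·) → l ≠ [] →
      f ((stdChains.{u, v} k d).sing (altChain k l)) = g ((stdChains.{u, v} k d).sing (altChain k l))) :
    f = g :=
  (stdChains.{u, v} k d).sing_ext (altChain_ext k h)

theorem pair_altChain_ext {M : Type w} [AddCommGroup M] [Module k M]
    {f g : (stdChains.{u, v} k d).TPow 2 →ₗ[k] M}
    (h : ∀ a b : List (Fin (d + 1)), a.Pairwise (· < ·) → b.Pairwise (· < ·) → a ≠ [] → b ≠ [] →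
      f ((stdChains.{u, v} k d).pair (altChain k a) (altChain k b)) =
        g ((stdChains.{u, v} k d).pair (altChain k a) (altChain k b))) :
    f = g :=
  (stdChains.{u, v} k d).pair_ext <| altChain_ext k fun a ha ha' =>
    altChain_ext k fun b hb hb' => h a b ha hb ha' hb'

/-- The chains of a standard simplex as a bialgebra. -/
def stdGens (d : ℕ) : PropS.Gens (stdChains.{u, v} k d).endProp where
  counit := stdCounit k
  coproduct := stdCoproduct k
  product := stdProduct k
  counit_product := Subtype.ext <| pair_altChain_ext k fun a b _ _ ha hb => by
    refine (congrArg (stdCounit k).1 (stdProduct_pair k ha hb)).trans ?_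
    -- A join has at least two vertices, so the augmentation vanishes on it.
    rw [listProduct, map_smul, stdCounit_sing, listCounit, if_neg, smul_zero]
    · rfl
    · have := List.length_pos_of_ne_nil ha
      have := List.length_pos_of_ne_nil hb
      rw [List.length_append]
      omega
  left_counit := Subtype.ext <| sing_altChain_ext k fun l hl h => by
    refine (congrArg (counitLeft k).1 (stdCoproduct_sing k hl)).trans ?_
    rw [DGMod.endProp_perm_one]
    refine (cut_comp _ _ _).trans ((cut_congr (fun a b _ => counit_left_altChain k a b) l).trans ?_)
    exact cut_length_one_left (fun b => (stdChains.{u, v} k d).sing (altChain k b)) l h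
  right_counit := Subtype.ext <| sing_altChain_ext k fun l hl h => by
    refine (congrArg (counitRight k).1 (stdCoproduct_sing k hl)).trans ?_
    rw [DGMod.endProp_perm_one]
    refine (cut_comp _ _ _).trans ((cut_congr (fun a b _ => counit_right_altChain k a b) l).trans ?_)
    exact cut_length_one_right (fun b => (stdChains.{u, v} k d).sing (altChain k b)) l h

theorem tau_altChain (a : List (Fin (d + 1))) :
    (stdChains.{u, v} k d).tau (altChain k a) = (-1 : k) ^ (a.length + 1) • altChain k a := by
  by_cases ha : a = []
  · subst ha
    rw [altChain_nil, map_zero, smul_zero]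
  · rw [(stdChains.{u, v} k d).tau_of_mem (altChain_mem k a ha)]
    congr 1
    rw [sgn_sub_one, pow_succ, mul_neg, mul_one, sgn]
    simp [Int.negOnePow_def]

theorem td_altChain_pair (a b : List (Fin (d + 1))) :
    (stdChains.{u, v} k d).td 2 ((stdChains.{u, v} k d).pair (altChain k a) (altChain k b)) =
      del (fun t => (stdChains.{u, v} k d).pair (altChain k t) (altChain k b)) a +
        (-1 : k) ^ (a.length + 1) •
          del (fun t => (stdChains.{u, v} k d).pair (altChain k a) (altChain k t)) b := by
  rw [DGMod.td_pair, tau_altChain, map_smul, LinearMap.smul_apply, d_altChain, d_altChain]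
  exact congrArg₂ (· + ·) (del_comp ((stdChains.{u, v} k d).pair.flip (altChain k b)) _ _)
    (congrArg _ (del_comp ((stdChains.{u, v} k d).pair (altChain k a)) _ _))

/-- This is `del_cut`; its two correction terms contain the chain of the empty list, which is zero.
-/
theorem td_listCoproduct (l : List (Fin (d + 1))) :
    (stdChains.{u, v} k d).td 2 (listCoproduct k l) = del (listCoproduct k) l := by
  by_cases hl : l = []
  · subst hl
    exact map_zero _
  · rw [listCoproduct, del_cut (k := k) _ l hl, cut_comp]
    simp only [td_altChain_pair, cut_add, altChain_nil, map_zero, LinearMap.zero_apply, smul_zero,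
      sub_zero, add_zero]

/-- Deleting a vertex of `a` before or after the join gives the same up to a sign, so that the terms
cancel, unless `a` is a single vertex. Then the boundary of `a` is zero while deletion in the join
leaves `b`. This defect is the term $\epsilon\odot\mathrm{id}$ of $\partial\mu$;
`del_listProduct_right` yields the term $\mathrm{id}\odot\epsilon$ in the same way. -/
theorem del_listProduct_left (a b : List (Fin (d + 1))) (ha : a ≠ []) (hb : b ≠ []) :
    (-1 : k) ^ (a.length + 1) • del (fun t => (stdChains.{u, v} k d).sing (altChain k (t ++ b))) a +
      del (fun t => (stdProduct k).1 ((stdChains.{u, v} k d).pair (altChain k t) (altChain k b))) a =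
      if a.length = 1 then (stdChains.{u, v} k d).sing (altChain k b) else 0 := by
  match a, ha with
  | [x], _ => simp [del, altChain_nil]
  | x :: y :: l, _ =>
    rw [if_neg (by simp), del_congr (G := fun t => (stdProduct k).1 _)
      (G' := fun t => (-1 : k) ^ (x :: y :: l).length • (stdChains.{u, v} k d).sing (altChain k (t ++ b)))]
    · rw [del_smul, pow_succ]
      simp
    · intro t _ ht
      rw [stdProduct_pair k (by rintro rfl; simp at ht) hb, listProduct, ht]

theorem del_listProduct_right (a b : List (Fin (d + 1))) (ha : a ≠ []) (hb : b ≠ []) :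
    -del (fun t => (stdChains.{u, v} k d).sing (altChain k (a ++ t))) b +
      (-1 : k) ^ (a.length + 1) • del (fun t => (stdProduct k).1
        ((stdChains.{u, v} k d).pair (altChain k a) (altChain k t))) b =
      -if b.length = 1 then (stdChains.{u, v} k d).sing (altChain k a) else 0 := by
  match b, hb with
  | [x], _ => simp [del, altChain_nil]
  | x :: y :: l, _ =>
    rw [if_neg (by simp), del_congr (G := fun t => (stdProduct k).1 _)
      (G' := fun t => (-1 : k) ^ (a.length + 1) • (stdChains.{u, v} k d).sing (altChain k (a ++ t)))]
    · rw [del_smul, smul_smul, ← mul_pow]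
      simp
    · intro t _ ht
      rw [stdProduct_pair k ha (by rintro rfl; simp at ht), listProduct]

theorem stdGens_dLaws (d : ℕ) : (stdGens.{u, v} k d).DLaws where
  d_counit j h := Subtype.ext <| sing_altChain_ext k fun l _ _ => by
    change (stdChains.{u, v} k d).td 0 ((stdCounit k).1 ((stdChains.{u, v} k d).sing (altChain k l))) -
      sgn k 0 • (stdCounit k).1
        ((stdChains.{u, v} k d).td 1 ((stdChains.{u, v} k d).sing (altChain k l))) = 0
    rw [DGMod.td_zero, DGMod.td_sing, d_altChain]
    have : (stdCounit k).1 ((stdChains.{u, v} k d).sing (del (altChain k) l)) = 0 := by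
      refine (del_comp ((stdCounit k).1 ∘ₗ (stdChains.{u, v} k d).sing.toLinearMap) _ l).trans ?_
      refine (del_congr l fun t _ _ => stdCounit_sing k t).trans (del_listCounit k l)
    rw [this, smul_zero, sub_zero]
  d_coproduct j h := Subtype.ext <| sing_altChain_ext k fun l hl _ => by
    change (stdChains.{u, v} k d).td 2
        ((stdCoproduct k).1 ((stdChains.{u, v} k d).sing (altChain k l))) -
      sgn k 0 • (stdCoproduct k).1
        ((stdChains.{u, v} k d).td 1 ((stdChains.{u, v} k d).sing (altChain k l))) = 0
    rw [DGMod.td_sing, d_altChain, stdCoproduct_sing k hl, td_listCoproduct, sgn_zero, one_smul,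
      sub_eq_zero]
    refine Eq.symm ?_
    refine (del_comp ((stdCoproduct k).1 ∘ₗ (stdChains.{u, v} k d).sing.toLinearMap) _ l).trans ?_
    -- Faces of an increasing list are increasing, so the formula for the coproduct on such lists
    -- suffices.
    exact del_congr l fun t ht _ => stdCoproduct_sing k (hl.sublist ht)
  d_product := Subtype.ext <| pair_altChain_ext k fun a b _ _ ha hb => by
    have hodd : (-1 : k) ^ (a.length + 1 + a.length) = -1 := Odd.neg_one_pow ⟨a.length, by ring⟩
    change (stdChains.{u, v} k d).td 1
        ((stdProduct k).1 ((stdChains.{u, v} k d).pair (altChain k a) (altChain k b))) -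
      sgn k 1 • (stdProduct k).1
        ((stdChains.{u, v} k d).td 2 ((stdChains.{u, v} k d).pair (altChain k a) (altChain k b))) =
      (counitLeft k).1 ((stdChains.{u, v} k d).pair (altChain k a) (altChain k b)) -
        (counitRight k).1 ((stdChains.{u, v} k d).pair (altChain k a) (altChain k b))
    rw [stdProduct_pair k ha hb, td_altChain_pair, map_add, map_smul, counit_left_altChain,
      counit_right_altChain, del_comp, del_comp, sgn_one, listProduct, map_smul, DGMod.td_sing, d_altChain,
      del_append (k := k), map_add, map_smul, smul_add, smul_smul, ← pow_add,
      hodd, ← del_listProduct_left k a b ha hb, sub_eq_add_neg _ (ite _ _ _),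
      ← del_listProduct_right k a b ha hb]
    have e1 := del_comp (stdChains.{u, v} k d).sing.toLinearMap (fun t => altChain k (t ++ b)) a
    have e2 := del_comp (stdChains.{u, v} k d).sing.toLinearMap (fun t => altChain k (a ++ t)) b
    simp only [LinearEquiv.coe_coe] at e1 e2
    rw [e1, e2]
    simp only [neg_smul, one_smul]
    abel

/-- The prop morphism that makes the chains of a standard simplex a bialgebra. -/
def stdHom (d : ℕ) : (propS k).Hom (stdChains.{u, v} k d).endProp :=
  (stdGens k d).homOf (stdChains.{u, v} k d).endProp_laws (stdChains.{u, v} k d).endProp_dLaws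
    (stdGens_dLaws k d)

theorem listCoproduct_ofFn {q : ℕ} (v : Fin (q + 1) →o Fin (d + 1)) :
    listCoproduct.{u, v} k (List.ofFn v) = ∑ i : Fin (q + 1),
      PiTensorProduct.tprod k ![simplexChain k (frontFace v i), simplexChain k (backFace v i)] := by
  rw [listCoproduct, cut_eq_sum]
  refine Fintype.sum_equiv (finCongr List.length_ofFn) _ _ fun i => ?_
  rw [DGMod.pair_eq_tprod, ← altChain_ofFn, ← altChain_ofFn]
  have hi : (i : ℕ) < q + 1 := i.2.trans_eq List.length_ofFn
  congr 4
  · refine List.ext_getElem ?_ fun n h1 h2 => ?_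
    · simp; omega
    · simp only [List.getElem_take, List.getElem_ofFn]
      rfl
  · refine List.ext_getElem ?_ fun n h1 h2 => ?_
    · simp; omega
    · simp only [List.getElem_drop, List.getElem_ofFn]
      rfl

theorem ofFn_append_ofFn {p q : ℕ} (v : Fin (p + 1) →o Fin (d + 1)) (w : Fin (q + 1) →o Fin (d + 1)) :
    List.ofFn v ++ List.ofFn w = List.ofFn (joinSeq v w) := by
  rw [← List.ofFn_fin_append]
  exact List.ofFn_congr (show p + 1 + (q + 1) = p + q + 1 + 1 by omega) _

theorem stdHom_isJoinBialgebra (d : ℕ) : IsJoinBialgebra k (stdHom.{u, v} k d) where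
  counit q v := by
    rw [stdHom, PropS.Gens.homOf_counit, ← DGMod.sing_apply, ← altChain_ofFn]
    refine (stdCounit_sing k _).trans ?_
    simp [listCounit]
  coproduct q v := by
    rw [stdHom, PropS.Gens.homOf_coproduct, ← DGMod.sing_apply]
    exact (stdCoproduct_simplexChain k v).trans (listCoproduct_ofFn k v)
  product p q v w := by
    rw [stdHom, PropS.Gens.homOf_product, ← DGMod.pair_eq_tprod, ← altChain_ofFn, ← altChain_ofFn]
    refine (stdProduct_pair k (ofFn_ne_nil v) (ofFn_ne_nil w)).trans ?_
    rw [listProduct, ofFn_append_ofFn, altChain_ofFn_eq, List.length_ofFn]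
    split_ifs
    · rw [map_smul, smul_smul, DGMod.sing_apply, pow_succ, pow_succ]
      simp [joinSorted]
    · rw [map_zero, smul_zero]

/-- The conditions fix the values of the generators on simplices of $\Delta^d$ and on pairs of such,
which span, and generators determine a morphism. -/
theorem IsJoinBialgebra.unique {φ φ' : (propS k).Hom (stdChains.{u, v} k d).endProp}
    (h : IsJoinBialgebra k φ) (h' : IsJoinBialgebra k φ') : φ = φ' := by
  refine PropS.hom_ext (Subtype.ext ?_) (Subtype.ext ?_) (Subtype.ext ?_)
  · refine (stdChains.{u, v} k d).sing_ext (stdChains_ext k fun q v _ => ?_)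
    simp only [LinearMap.comp_apply, LinearEquiv.coe_coe, DGMod.sing_apply]
    exact (h.counit q v).trans (h'.counit q v).symm
  · refine (stdChains.{u, v} k d).sing_ext (stdChains_ext k fun q v _ => ?_)
    simp only [LinearMap.comp_apply, LinearEquiv.coe_coe, DGMod.sing_apply]
    exact (h.coproduct q v).trans (h'.coproduct q v).symm
  · refine (stdChains.{u, v} k d).pair_ext (stdChains_ext k fun p v _ => stdChains_ext k fun q w _ => ?_)
    simp only [LinearMap.compr₂_apply, DGMod.pair_eq_tprod]
    exact (h.product p q v w).trans (h'.product p q v w).symm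

end ListChains

/-! ### Naturality on the standard simplices -/

theorem PropS.intertwines {k : Type u} [CommRing k] {C : DGMod.{u, w} k} {D : DGMod.{u, w'} k}
    {f : C.Hom D} {φ : (propS k).Hom C.endProp} {ψ : (propS k).Hom D.endProp}
    (h₁ : DGMod.Intertwines f (φ.map (PropS.mk k .counit)) (ψ.map (PropS.mk k .counit)))
    (h₂ : DGMod.Intertwines f (φ.map (PropS.mk k .coproduct)) (ψ.map (PropS.mk k .coproduct)))
    (h₃ : DGMod.Intertwines f (φ.map (PropS.mk k .product)) (ψ.map (PropS.mk k .product)))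
    {n m : ℕ} {i : ℤ} (a : (propS k).obj n m i) : DGMod.Intertwines f (φ.map a) (ψ.map a) := by
  induction a using obj_induct with
  | h0 =>
    rw [map_zero, map_zero]
    exact .zero
  | hadd a b ha hb =>
    rw [map_add, map_add]
    exact ha.add hb
  | hsmul c a ha =>
    rw [map_smul, map_smul]
    exact ha.smul c
  | hof t =>
    induction t with
    | counit => exact h₁
    | coproduct => exact h₂
    | product => exact h₃
    | perm σ =>
      have h := DGMod.Intertwines.perm (f := f) σ
      rw [← φ.map_perm, ← ψ.map_perm] at h
      exact h
    | vcomp h a b iha ihb =>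
      rw [mk_vcomp, φ.map_vcomp, ψ.map_vcomp]
      exact iha.vcomp h ihb
    | hcomp hn hm h a b iha ihb =>
      rw [mk_hcomp, φ.map_hcomp, ψ.map_hcomp]
      exact iha.hcomp hn hm h ihb

theorem chainsMap_chain (k : Type u) [CommRing k] {X Y : SSet.{v}} (f : X ⟶ Y) {n : ℕ}
    (x : X.obj (Opposite.op (SimplexCategory.mk n))) :
    (chainsMap k f).toLin (chain k x) = chain k (f.app _ x) :=
  chainLift_cls k (fun n x => cls k Y (f.app (Opposite.op (SimplexCategory.mk n)) x))
    (fun _ _ hx => cls_eq_zero k (map_degenerate f hx)) x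

namespace ListChains

open Simplicial

variable (k : Type u) [CommRing k] {d e : ℕ}

theorem chainsMap_simplexChain (f : ⦋d⦌ ⟶ ⦋e⦌) {q : ℕ} (v : Fin (q + 1) →o Fin (d + 1)) :
    (chainsMap k (SSet.stdSimplex.{v}.map f)).toLin (simplexChain k v) =
      simplexChain k (f.toOrderHom.comp v) := chainsMap_chain k _ _

/-- A simplicial map may identify vertices. Both sides are alternating in `l`, so increasing lists
suffice, and `altChain_ofFn` covers their images, which are merely monotone. -/
theorem chainsMap_altChain (f : ⦋d⦌ ⟶ ⦋e⦌) (l : List (Fin (d + 1))) :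
    (chainsMap k (SSet.stdSimplex.{v}.map f)).toLin (altChain k l) =
      altChain k (l.map f.toOrderHom) := by
  refine alternating_ext (G := fun l => (chainsMap k (SSet.stdSimplex.{v}.map f)).toLin (altChain k l))
    (G' := fun l => altChain k (l.map f.toOrderHom)) ?_ ?_ ?_ ?_ ?_ l
  · intro l₁ x l₂
    change (chainsMap k (SSet.stdSimplex.{v}.map f)).toLin _ = 0
    rw [vanishAdj_altChain, map_zero]
  · intro l₁ x y l₂
    change (chainsMap k (SSet.stdSimplex.{v}.map f)).toLin _ = -(chainsMap k _).toLin _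
    rw [swapAdj_altChain, map_neg]
  · intro l₁ x l₂
    simpa using vanishAdj_altChain k (l₁.map f.toOrderHom) (f.toOrderHom x) (l₂.map f.toOrderHom)
  · intro l₁ x y l₂
    simpa using swapAdj_altChain k (l₁.map f.toOrderHom) (f.toOrderHom x) (f.toOrderHom y)
      (l₂.map f.toOrderHom)
  · intro l hl
    by_cases h : l = []
    · subst h
      change (chainsMap k (SSet.stdSimplex.{v}.map f)).toLin _ = altChain k []
      rw [altChain_nil, altChain_nil, map_zero]
    · obtain ⟨q, s, rfl⟩ := exists_ofFn h
      obtain ⟨v, rfl⟩ : ∃ v : Fin (q + 1) →o Fin (d + 1), s = v :=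
        ⟨⟨s, (pairwise_lt_ofFn.mp hl).monotone⟩, rfl⟩
      change (chainsMap k (SSet.stdSimplex.{v}.map f)).toLin (altChain k (List.ofFn v)) =
        altChain k ((List.ofFn v).map f.toOrderHom)
      rw [altChain_ofFn, chainsMap_simplexChain, List.map_ofFn]
      exact (altChain_ofFn k (f.toOrderHom.comp v)).symm

theorem tmap_listCoproduct (f : ⦋d⦌ ⟶ ⦋e⦌) (l : List (Fin (d + 1))) :
    DGMod.tmap (chainsMap k (SSet.stdSimplex.{v}.map f)) 2 (listCoproduct k l) =
      listCoproduct k (l.map f.toOrderHom) := by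
  rw [listCoproduct, listCoproduct, cut_comp, cut_map]
  simp only [DGMod.tmap_pair, chainsMap_altChain]

theorem stdHom_intertwines (f : ⦋d⦌ ⟶ ⦋e⦌) {n m : ℕ} {i : ℤ} (a : (propS k).obj n m i) :
    DGMod.Intertwines (chainsMap k (SSet.stdSimplex.{v}.map f)) ((stdHom k d).map a)
      ((stdHom k e).map a) := by
  refine PropS.intertwines ?_ ?_ ?_ a
  · rw [stdHom, stdHom, PropS.Gens.homOf_counit, PropS.Gens.homOf_counit]
    refine sing_altChain_ext k fun l _ _ => ?_
    refine (congrArg (DGMod.tmap _ 0) (stdCounit_sing k l)).trans (Eq.symm ?_)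
    refine (congrArg (stdCounit k).1 ((DGMod.tmap_sing _ _ _).trans
      (congrArg _ (chainsMap_altChain k f l)))).trans ((stdCounit_sing k _).trans ?_)
    rw [listCounit, listCounit, List.length_map]
    split_ifs
    · rw [DGMod.tmap, PiTensorProduct.map_tprod]
      congr 1
      ext r
      exact r.elim0
    · exact (map_zero _).symm
  -- The image of a nondegenerate simplex may be degenerate, so the formula on arbitrary simplices
  -- is used here instead of that on increasing lists.
  · rw [stdHom, stdHom, PropS.Gens.homOf_coproduct, PropS.Gens.homOf_coproduct]
    refine (stdChains.{u, v} k d).sing_ext (stdChains_ext k fun q v _ => ?_)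
    refine (congrArg (DGMod.tmap _ 2) (stdCoproduct_simplexChain k v)).trans (Eq.symm ?_)
    refine (congrArg (stdCoproduct k).1 ((DGMod.tmap_sing _ _ _).trans
      (congrArg _ (chainsMap_simplexChain k f v)))).trans ?_
    refine (stdCoproduct_simplexChain k _).trans ?_
    rw [tmap_listCoproduct, List.map_ofFn]
    rfl
  · rw [stdHom, stdHom, PropS.Gens.homOf_product, PropS.Gens.homOf_product]
    refine pair_altChain_ext k fun a b _ _ ha hb => ?_
    refine (congrArg (DGMod.tmap _ 1) (stdProduct_pair k ha hb)).trans (Eq.symm ?_)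
    refine (congrArg (stdProduct k).1 ((DGMod.tmap_pair _ _ _ _).trans
      (congrArg₂ (fun x y => (stdChains.{u, v} k e).pair x y) (chainsMap_altChain k f a)
        (chainsMap_altChain k f b)))).trans ?_
    refine (stdProduct_pair k (by simpa using ha) (by simpa using hb)).trans ?_
    rw [listProduct, listProduct, map_smul, DGMod.tmap_sing, chainsMap_altChain, List.length_map,
      List.map_append]

theorem stdHom_natural : IsNaturalBialgebra k (stdHom.{u, v} k) :=
  fun f _ _ _ a => stdHom_intertwines k f a

end ListChains

/-! ### Kan extension to all simplicial sets -/

namespace DGMod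

variable {k : Type u} [CommRing k]

theorem tmap_of_comp {C D E : DGMod.{u, w} k} {f : C.Hom D} {g : D.Hom E} {h : C.Hom E}
    (H : ∀ x, h.toLin x = g.toLin (f.toLin x)) {n : ℕ} (x : C.TPow n) :
    tmap h n x = tmap g n (tmap f n x) := by
  induction x using tpow_induct with
  | hadd a b ha hb => simp only [map_add, ha, hb]
  | hsmul c a ha => simp only [map_smul, ha]
  | ht x => simp only [tmap, PiTensorProduct.map_tprod, H]

theorem intertwines_iff_coopVal {C : DGMod.{u, w} k} {D : DGMod.{u, w'} k} {f : C.Hom D} {m : ℕ} {i : ℤ}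
    {a : C.endProp.obj 1 m i} {b : D.endProp.obj 1 m i} :
    Intertwines f a b ↔ tmap f m ∘ₗ C.coopVal a = D.coopVal b ∘ₗ f.toLin := by
  constructor
  · intro h
    refine LinearMap.ext fun x => (h.apply (C.sing x)).trans ?_
    rw [tmap_sing]
    rfl
  · intro h
    refine C.sing_ext (LinearMap.ext fun x => (LinearMap.congr_fun h x).trans ?_)
    exact congrArg b.1 (tmap_sing C f x).symm

end DGMod

namespace DGProp

open DGMod

variable {k : Type u} [CommRing k] {C : DGMod.{u, w} k} {D : DGMod.{u, w'} k} {f : C.Hom D}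

theorem intertwines_comp (p q : ℕ) {m n l : ℕ} {i j t : ℤ} (hm : p + 1 + q = m) (hl : p + n + q = l)
    (h : i + j = t) {a : C.endProp.obj 1 m i} {b : D.endProp.obj 1 m i} {a' : C.endProp.obj 1 n j}
    {b' : D.endProp.obj 1 n j} (h₁ : Intertwines f a b) (h₂ : Intertwines f a' b') :
    Intertwines f (C.endProp.U.comp p q hm hl h a a') (D.endProp.U.comp p q hm hl h b b') := by
  have key := (((((Intertwines.perm (f := f) (1 : Equiv.Perm (Fin p))).hcomp rfl rfl
    (by omega : 0 + j = j) h₂).hcomp hm hl (by omega : j + 0 = j)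
    (Intertwines.perm (1 : Equiv.Perm (Fin q)))).vcomp (by omega : j + i = t) h₁).smul (sgn k (i * j)))
  rw [U_comp, U_comp]
  exact key

theorem intertwines_act {m : ℕ} {i : ℤ} (σ : Equiv.Perm (Fin m)) {a : C.endProp.obj 1 m i}
    {b : D.endProp.obj 1 m i} (h : Intertwines f a b) :
    Intertwines f (C.endProp.U.act σ a) (D.endProp.U.act σ b) := by
  rw [U_act, U_act]
  exact (Intertwines.perm σ).vcomp _ h

end DGProp

namespace Kan

open Simplicial DGMod ListChains

variable (k : Type u) [CommRing k]

/-- The map from the standard simplex given by a simplex. -/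
abbrev char {X : SSet.{v}} {n : ℕ} (x : X _⦋n⦌) : Δ[n] ⟶ X := SSet.yonedaEquiv.symm x

/-- The chain of the nondegenerate simplex of maximal dimension. -/
def top (n : ℕ) : (stdChains.{u, v} k n).carrier := simplexChain k OrderHom.id

theorem chainsMap_char_simplexChain {X : SSet.{v}} {n q : ℕ} (x : X _⦋n⦌)
    (v : Fin (q + 1) →o Fin (n + 1)) :
    (chainsMap k (char x)).toLin (simplexChain k v) =
      chain k (X.map (SimplexCategory.mkHom v).op x) :=
  chainsMap_chain k _ _

theorem chainsMap_char_top {X : SSet.{v}} {n : ℕ} (x : X _⦋n⦌) :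
    (chainsMap k (char x)).toLin (top k n) = chain k x := by
  refine (chainsMap_char_simplexChain k x _).trans (congrArg _ ?_)
  exact Functor.map_id_apply X _ x

theorem chainsMap_comp {X Y Z : SSet.{v}} (f : X ⟶ Y) (g : Y ⟶ Z) (c : (chains.{u, v} k X).carrier) :
    (chainsMap k (f ≫ g)).toLin c = (chainsMap k g).toLin ((chainsMap k f).toLin c) := by
  suffices h : (chainsMap k (f ≫ g)).toLin = (chainsMap k g).toLin ∘ₗ (chainsMap k f).toLin from
    LinearMap.congr_fun h c
  refine chain_ext k fun n x => ?_
  change (chainsMap k (f ≫ g)).toLin (chain k x) = (chainsMap k g).toLin ((chainsMap k f).toLin (chain k x))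
  rw [chainsMap_chain, chainsMap_chain, chainsMap_chain]
  rfl

theorem char_map {X : SSet.{v}} {n m : ℕ} (g : ⦋n⦌ ⟶ ⦋m⦌) (x : X _⦋m⦌) :
    char (X.map g.op x) = SSet.stdSimplex.map g ≫ char x := by
  rw [char, char, SSet.yonedaEquiv_symm_naturality_left]

theorem char_app {X Y : SSet.{v}} (f : X ⟶ Y) {n : ℕ} (x : X _⦋n⦌) :
    char (f.app _ x) = char x ≫ f := (SSet.yonedaEquiv_symm_comp x f).symm

theorem chains_ext {X : SSet.{v}} {M : Type w} [AddCommGroup M] [Module k M]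
    {f g : (chains.{u, v} k X).carrier →ₗ[k] M} (h : ∀ (n : ℕ) (x : X _⦋n⦌), f (chain k x) = g (chain k x)) :
    f = g := chain_ext k h

/-- Each chain of a simplex is the image of the top chain of a standard simplex under the
characteristic map, so compatibility with these maps leaves no freedom. Linearity, the operad axioms
and uniqueness of the extension all reduce to this. -/
theorem hom_ext {X : SSet.{v}} {m : ℕ} {i : ℤ} {F G : (chains.{u, v} k X).endProp.obj 1 m i}
    {b : ∀ n : ℕ, (stdChains.{u, v} k n).endProp.obj 1 m i}
    (hF : ∀ (n : ℕ) (x : X _⦋n⦌), Intertwines (chainsMap k (char x)) (b n) F)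
    (hG : ∀ (n : ℕ) (x : X _⦋n⦌), Intertwines (chainsMap k (char x)) (b n) G) : F = G := by
  refine Subtype.ext ((chains.{u, v} k X).sing_ext (chains_ext k fun n x => ?_))
  have h1 := (hF n x).apply ((stdChains.{u, v} k n).sing (top k n))
  have h2 := (hG n x).apply ((stdChains.{u, v} k n).sing (top k n))
  rw [tmap_sing, chainsMap_char_top] at h1 h2
  exact h1.symm.trans h2

section

variable {k} {m : ℕ} {i : ℤ} {b : ∀ n : ℕ, (stdChains.{u, v} k n).endProp.obj 1 m i}
  (hb : ∀ {d e : ℕ} (f : ⦋d⦌ ⟶ ⦋e⦌), Intertwines (chainsMap k (SSet.stdSimplex.{v}.map f)) (b d) (b e))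

include hb in
-- The characteristic map of $g^*x$ factors through $\Delta^g$, and naturality of `b` moves
-- $\Delta^g$ to the argument. This serves twice: for the vanishing on degenerate simplices and for
-- the compatibility with non-top simplices of $\Delta^n$.
theorem tmap_char_map {X : SSet.{v}} {n q : ℕ} (g : ⦋q⦌ ⟶ ⦋n⦌) (x : X _⦋n⦌) :
    tmap (chainsMap k (char (X.map g.op x))) m ((b q).1 ((stdChains.{u, v} k q).sing (top k q))) =
      tmap (chainsMap k (char x)) m
        ((b n).1 ((stdChains.{u, v} k n).sing (simplexChain k g.toOrderHom))) := by
  rw [char_map, tmap_of_comp (chainsMap_comp k (SSet.stdSimplex.map g) (char x)), (hb g).apply, tmap_sing, top,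
    chainsMap_simplexChain, OrderHom.comp_id]

/-- The Kan extension of a natural family of cooperations on the standard simplices. -/
def lin (X : SSet.{v}) : (chains.{u, v} k X).carrier →ₗ[k] (chains.{u, v} k X).TPow m :=
  chainLift k (fun n x => tmap (chainsMap k (char x)) m
    ((b n).1 ((stdChains.{u, v} k n).sing (top k n)))) fun n x hx => by
      -- A degenerate simplex is $g^*y$ with `g` a map to an ordinal of smaller dimension. Such a
      -- `g` is not injective, so its chain in $\Delta^q$ is zero.
      obtain ⟨q, hq, g, y, rfl⟩ := hx
      change tmap (chainsMap k (char (X.map g.op y))) m _ = 0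
      rw [tmap_char_map hb, simplexChain_eq_zero, map_zero, map_zero, map_zero]
      intro hg
      have := Fintype.card_le_of_injective _ hg.injective
      simp at this
      omega

theorem lin_chain {X : SSet.{v}} {n : ℕ} (x : X _⦋n⦌) :
    lin hb X (chain k x) = tmap (chainsMap k (char x)) m
      ((b n).1 ((stdChains.{u, v} k n).sing (top k n))) := chainLift_cls k _ _ _

/-- The Kan extension of a natural family of cooperations on the standard simplices. -/
def ext (X : SSet.{v}) : (chains.{u, v} k X).endProp.obj 1 m i :=
  (chains.{u, v} k X).ofLin (lin hb X) fun j c hc => by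
    have : chainGr k X j ≤ ((chains.{u, v} k X).tgr m (i + j)).comap (lin hb X) := by
      refine Submodule.span_le.mpr ?_
      rintro _ ⟨n, x, rfl, rfl⟩
      change lin hb X (chain k x) ∈ (chains.{u, v} k X).tgr m (i + n)
      rw [lin_chain]
      refine tmap_mem _ ((b n).2 _ _ ?_)
      exact (stdChains.{u, v} k n).sing_mem (simplexChain_mem k _)
    exact this hc

theorem ext_intertwines {X : SSet.{v}} {n : ℕ} (x : X _⦋n⦌) :
    Intertwines (chainsMap k (char x)) (b n) (ext hb X) := by
  refine (stdChains.{u, v} k n).sing_ext (stdChains_ext k fun q v _ => ?_)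
  refine Eq.symm ((congrArg (ext hb X).1 (tmap_sing _ _ _)).trans ?_)
  refine ((chains.{u, v} k X).ofLin_sing _ _ _).trans ?_
  rw [chainsMap_char_simplexChain, lin_chain, tmap_char_map hb]
  rfl

end

section

variable {k} {P : DGProp.{u, w} k} (A : ∀ n : ℕ, P.Hom (stdChains.{u, v} k n).endProp)
  (hA : ∀ {d e : ℕ} (f : ⦋d⦌ ⟶ ⦋e⦌) {n m : ℕ} {i : ℤ} (a : P.obj n m i),
    Intertwines (chainsMap k (SSet.stdSimplex.{v}.map f)) ((A d).map a) ((A e).map a))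

/-- The Kan extension of a natural family of coalgebra structures on the standard simplices. -/
def homMap (X : SSet.{v}) {m : ℕ} {i : ℤ} : P.obj 1 m i →ₗ[k] (chains.{u, v} k X).endProp.obj 1 m i where
  toFun a := ext (fun f => hA f a) X
  map_add' a a' := hom_ext k (b := fun n => (A n).map (a + a')) (fun _ x =>
      ext_intertwines (fun f => hA f (a + a')) x) fun n x => by
      rw [map_add]
      exact (ext_intertwines (fun f => hA f a) x).add (ext_intertwines (fun f => hA f a') x)
  map_smul' c a := hom_ext k (b := fun n => (A n).map (c • a)) (fun _ x =>
      ext_intertwines (fun f => hA f (c • a)) x) fun n x => by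
      rw [map_smul]
      exact (ext_intertwines (fun f => hA f a) x).smul c

theorem homMap_intertwines {X : SSet.{v}} {m : ℕ} {i : ℤ} (a : P.obj 1 m i) {n : ℕ} (x : X _⦋n⦌) :
    Intertwines (chainsMap k (char x)) ((A n).map a) (homMap A hA X a) :=
  ext_intertwines (fun f => hA f a) x

theorem eq_homMap {X : SSet.{v}} {m : ℕ} {i : ℤ} {a : P.obj 1 m i}
    {F : (chains.{u, v} k X).endProp.obj 1 m i}
    (hF : ∀ (n : ℕ) (x : X _⦋n⦌), Intertwines (chainsMap k (char x)) ((A n).map a) F) :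
    homMap A hA X a = F :=
  hom_ext k (b := fun n => (A n).map a) (fun _ x => homMap_intertwines A hA a x) hF

/-- The Kan extension of a natural family of coalgebra structures on the standard simplices. -/
def hom (X : SSet.{v}) : P.U.Hom (chains.{u, v} k X).endOperad where
  map := homMap A hA X
  map_d h a := eq_homMap A hA fun n x => by
    rw [(A n).map_d]
    exact (homMap_intertwines A hA a x).d h
  map_one := eq_homMap A hA fun n x => by
    rw [(A n).map_perm]
    exact .perm 1
  map_comp p q {m n l i j t} hm hl h a b := eq_homMap A hA fun n x => by
    have e := (A n).U.map_comp p q hm hl h a b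
    exact (congrArg (fun y => Intertwines _ y _) e).mpr
      (DGProp.intertwines_comp p q hm hl h (homMap_intertwines A hA a x) (homMap_intertwines A hA b x))
  map_act σ a := eq_homMap A hA fun n x => by
    have e := (A n).U.map_act σ a
    exact (congrArg (fun y => Intertwines _ y _) e).mpr
      (DGProp.intertwines_act σ (homMap_intertwines A hA a x))

/-- The characteristic map of the image of a simplex is the characteristic map followed by `f`, so
both sides agree on each simplex. -/
theorem hom_natural : IsNaturalCoalgebra k (hom A hA) := fun {X Y} f m i a => by
  refine chains_ext k fun n x => ?_
  have h1 := (homMap_intertwines A hA a x).apply ((stdChains.{u, v} k n).sing (top k n))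
  have h2 := (homMap_intertwines A hA a (f.app _ x)).apply ((stdChains.{u, v} k n).sing (top k n))
  rw [tmap_sing, chainsMap_char_top] at h1 h2
  rw [char_app, tmap_of_comp (chainsMap_comp k (char x) f), h1] at h2
  refine h2.trans ?_
  rw [← chainsMap_chain]
  rfl

/-- The characteristic map of a simplex of $\Delta^d$ is induced by a map of ordinals, so the
compatibility that determines the extension is the assumed naturality of `A`. -/
theorem hom_stdSimplex (d : ℕ) : hom A hA (Δ[d] : SSet.{v}) = (A d).U := by
  refine DGOperad.Hom.ext (funext fun m => funext fun i => LinearMap.ext fun a => ?_)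
  refine eq_homMap A hA fun n x => ?_
  obtain ⟨g, rfl⟩ := SSet.stdSimplex.objEquiv.symm.surjective x
  have e : char (SSet.stdSimplex.objEquiv.symm g : (Δ[d] : SSet.{v}) _⦋n⦌) = SSet.stdSimplex.map g := by
    rw [char, Equiv.symm_apply_eq]
    exact (SSet.yonedaEquiv_map g).symm
  rw [e]
  exact hA g a

theorem hom_unique {Φ : ∀ X : SSet.{v}, P.U.Hom (chains.{u, v} k X).endOperad}
    (h : IsNaturalCoalgebra k Φ) (h' : ∀ d : ℕ, Φ (Δ[d] : SSet.{v}) = (A d).U) : Φ = hom A hA := by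
  funext X
  refine DGOperad.Hom.ext (funext fun m => funext fun i => LinearMap.ext fun a => ?_)
  refine (eq_homMap A hA fun n x => ?_).symm
  refine intertwines_iff_coopVal.mpr ?_
  have := h (char x) a
  rw [h'] at this
  exact this

end

end Kan

/-! ### The pairing of tensor powers with those of the dual -/

namespace DGMod

variable {k : Type u} [CommRing k] (C : DGMod.{u, w} k)

variable (k) in
/-- The Koszul sign of the reversal of elements of the given degrees. -/
def koszul {m : ℕ} (e : Fin m → ℤ) : k :=
  ∏ r : Fin m, ∏ s : Fin m, if s < r then sgn k (e r * e s) else 1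

theorem sgn_mul_eq_ite (i j : ℤ) : sgn k (i * j) = if Odd i ∧ Odd j then -1 else 1 := by
  split_ifs with h
  · exact sgn_odd k (h.1.mul h.2)
  · refine sgn_even k ?_
    rw [← Int.not_odd_iff_even, Int.odd_mul]
    exact h

/-- The reversal inverts every pair of indices. -/
theorem permSign_rev {m : ℕ} (e : Fin m → ℤ) :
    permSign k Fin.revPerm (fun r => decide (Odd (e r))) = koszul k e := by
  rw [permSign, koszul, Fintype.prod_prod_type, Finset.prod_comm]
  refine Finset.prod_congr rfl fun r _ => Finset.prod_congr rfl fun s _ => ?_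
  by_cases h : s < r
  · simp [h, sgn_mul_eq_ite, and_comm]
  · simp [h]

theorem koszul_comp_perm {m : ℕ} (e : Fin m → ℤ) (σ : Equiv.Perm (Fin m)) :
    koszul k (e ∘ σ) = koszul k e := by
  have h : ∀ e : Fin m → ℤ, koszul k e =
      ∏ p : Fin m × Fin m with p.1 < p.2, sgn k (e p.1 * e p.2) := by
    intro e
    rw [koszul, Finset.prod_filter, Fintype.prod_prod_type, Finset.prod_comm]
    refine Finset.prod_congr rfl fun r _ => Finset.prod_congr rfl fun s _ => ?_
    rw [mul_comm]
  rw [h, h]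
  exact prod_lt_comp_perm σ (fun a b => sgn k (e a * e b)) fun a b => by rw [mul_comm]

/-- Signs are $\pm1$, so `permSign_mul` for $\sigma\sigma^{-1}=1$ can be solved for the sign of the
inverse. -/
theorem permSign_inv {m : ℕ} (σ : Equiv.Perm (Fin m)) (s : Fin m → Bool) :
    permSign k σ⁻¹ s = permSign k σ (s ∘ σ) := by
  have h := permSign_mul (k := k) σ σ⁻¹ s
  rw [mul_inv_cancel, permSign_one] at h
  have h' : permSign k σ (s ∘ (σ⁻¹).symm) = permSign k σ (s ∘ σ) := rfl
  rw [h'] at h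
  obtain h1 | h1 := permSign_eq_or (k := k) σ (s ∘ σ) <;> rw [h1] at h ⊢
  · linear_combination -h
  · linear_combination h

theorem koszul_append {n₁ n₂ : ℕ} (e : Fin n₁ → ℤ) (e' : Fin n₂ → ℤ) :
    koszul k (Fin.append e e') =
      sgn k ((∑ r, e r) * ∑ s, e' s) * (koszul k e * koszul k e') := by
  have h : sgn k ((∑ r, e r) * ∑ s, e' s) = ∏ r, ∏ s, sgn k (e' r * e s) := by
    rw [Finset.sum_mul_sum, sgn_sum, Finset.prod_comm]
    refine Finset.prod_congr rfl fun r _ => ?_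
    rw [sgn_sum]
    exact Finset.prod_congr rfl fun s _ => by rw [mul_comm]
  rw [h]
  simp only [koszul, Fin.prod_univ_add, Fin.append_left, Fin.append_right]
  have e1 : ∀ (a : Fin n₁) (b : Fin n₂), ¬ (Fin.natAdd n₁ b < Fin.castAdd n₂ a) := fun a b => by
    simp [Fin.lt_def]; omega
  have e2 : ∀ (a b : Fin n₁), Fin.castAdd n₂ a < Fin.castAdd n₂ b ↔ a < b := fun a b => Iff.rfl
  have e3 : ∀ (a b : Fin n₂), Fin.natAdd n₁ a < Fin.natAdd n₁ b ↔ a < b := fun a b => by simp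
  have e4 : ∀ (a : Fin n₁) (b : Fin n₂), Fin.castAdd n₂ a < Fin.natAdd n₁ b := fun a b => by
    simp [Fin.lt_def]; omega
  simp only [e1, e2, e3, e4, if_true, if_false, Finset.prod_const_one, mul_one, Finset.prod_mul_distrib]
  ring

/-- The pairing of the tensor powers of `C` and its graded dual. -/
def pairing (m : ℕ) : C.dual.TPow m →ₗ[k] C.TPow m →ₗ[k] k :=
  -- The factors are reversed with the Koszul sign and put back without one. What remains is the
  -- sign of the pairing, as part of a linear map although it depends on the degrees.
  PiTensorProduct.dualDistrib ∘ₗ (PiTensorProduct.map fun _ => C.dualVal) ∘ₗ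
    (PiTensorProduct.reindex k (fun _ => C.dual.carrier) Fin.revPerm).toLinearMap ∘ₗ
    C.dual.tperm Fin.revPerm

theorem pairing_tprod {m : ℕ} {e : Fin m → ℤ} {α : Fin m → C.dual.carrier}
    (hα : ∀ r, α r ∈ C.dual.gr (e r)) (c : Fin m → C.carrier) :
    C.pairing m (PiTensorProduct.tprod k α) (PiTensorProduct.tprod k c) =
      koszul k e * ∏ r, C.dualVal (α r) (c r) := by
  simp only [pairing, LinearMap.comp_apply, LinearEquiv.coe_coe]
  rw [C.dual.tperm_tprod _ hα, permSign_rev]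
  simp only [map_smul, LinearMap.smul_apply, smul_eq_mul]
  congr 1
  have h : PiTensorProduct.reindex k (fun _ => C.dual.carrier) Fin.revPerm
      (PiTensorProduct.tprod k (α ∘ (Fin.revPerm : Equiv.Perm (Fin m)).symm)) =
      PiTensorProduct.tprod k α := by
    refine (PiTensorProduct.reindex_tprod _ _).trans ?_
    congr 1
    ext r
    simp
  rw [h, PiTensorProduct.map_tprod, PiTensorProduct.dualDistrib_apply]

theorem pairing_eq_tensorPairing {m : ℕ} {e : Fin m → ℤ} {α : Fin m → C.dual.carrier}
    (hα : ∀ r, α r ∈ C.dual.gr (e r)) :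
    C.pairing m (PiTensorProduct.tprod k α) = C.tensorPairing e α := by
  refine PiTensorProduct.ext (MultilinearMap.ext fun c => ?_)
  refine (C.pairing_tprod hα c).trans ?_
  simp [tensorPairing, koszul]

theorem dualVal_eq_zero {i j : ℤ} (h : i + j ≠ 0) {α : C.dual.carrier} (hα : α ∈ C.dual.gr i)
    {c : C.carrier} (hc : c ∈ C.gr j) : C.dualVal α c = 0 :=
  (show C.dualVal α ∈ C.dualGr i from hα) j (by omega) c hc

/-- Identities of signs below hold only if the degrees of the two arguments are opposite; this
disposes of all other cases. -/
theorem pairing_eq_zero {m : ℕ} {i j : ℤ} (h : i + j ≠ 0) {α : C.dual.TPow m} (hα : α ∈ C.dual.tgr m i)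
    {c : C.TPow m} (hc : c ∈ C.tgr m j) : C.pairing m α c = 0 := by
  have : C.dual.tgr m i ≤ LinearMap.ker ((LinearMap.flip (C.pairing m)) c) := by
    refine Submodule.span_le.mpr ?_
    rintro _ ⟨e, α, he, rfl, rfl⟩
    have : C.tgr m j ≤ LinearMap.ker (C.pairing m (PiTensorProduct.tprod k α)) := by
      refine Submodule.span_le.mpr ?_
      rintro _ ⟨e', c, he', rfl, rfl⟩
      obtain ⟨r, hr⟩ : ∃ r, e r + e' r ≠ 0 := by
        by_contra! hr
        exact h (by rw [← Finset.sum_add_distrib]; exact Finset.sum_eq_zero fun r _ => hr r)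
      rw [SetLike.mem_coe, LinearMap.mem_ker, C.pairing_tprod he,
        Finset.prod_eq_zero (Finset.mem_univ r) (C.dualVal_eq_zero hr (he r) (he' r)), mul_zero]
    exact this hc
  exact this hα

theorem pairing_tcat {n₁ n₂ n : ℕ} (h : n₁ + n₂ = n) {i j : ℤ} {α : C.dual.TPow n₁}
    (hα : α ∈ C.dual.tgr n₁ i) {β : C.dual.TPow n₂} (hβ : β ∈ C.dual.tgr n₂ j) (c : C.TPow n₁)
    (c' : C.TPow n₂) :
    C.pairing n (C.dual.tcat h (α ⊗ₜ[k] β)) (C.tcat h (c ⊗ₜ[k] c')) =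
      sgn k (i * j) * (C.pairing n₁ α c * C.pairing n₂ β c') := by
  subst h
  induction c using tpow_induct with
  | hadd a b ha hb => simp only [TensorProduct.add_tmul, map_add, ha, hb]; ring
  | hsmul x a ha => simp only [← TensorProduct.smul_tmul', map_smul, ha, smul_eq_mul]; ring
  | ht c =>
  induction c' using tpow_induct with
  | hadd a b ha hb => simp only [TensorProduct.tmul_add, map_add, ha, hb]; ring
  | hsmul x a ha => simp only [TensorProduct.tmul_smul, map_smul, ha, smul_eq_mul]; ring
  | ht c' =>
  induction hα using Submodule.span_induction with
  | zero => simp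
  | add a b _ _ ha hb =>
    simp only [TensorProduct.add_tmul, map_add, LinearMap.add_apply, ha, hb]; ring
  | smul x a _ ha =>
    simp only [← TensorProduct.smul_tmul', map_smul, LinearMap.smul_apply, ha, smul_eq_mul]; ring
  | mem _ hα =>
  obtain ⟨e, α, he, rfl, rfl⟩ := hα
  induction hβ using Submodule.span_induction with
  | zero => simp
  | add a b _ _ ha hb =>
    simp only [TensorProduct.tmul_add, map_add, LinearMap.add_apply, ha, hb]; ring
  | smul x a _ ha =>
    simp only [TensorProduct.tmul_smul, map_smul, LinearMap.smul_apply, ha, smul_eq_mul]; ring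
  | mem _ hβ =>
  obtain ⟨e', β, he', rfl, rfl⟩ := hβ
  rw [tcat_tprod, tcat_tprod, C.pairing_tprod he, C.pairing_tprod he',
    C.pairing_tprod (e := Fin.append e e'), koszul_append, Fin.prod_univ_add]
  · simp only [Function.comp_def, Fin.cast_refl, id, Fin.append_left, Fin.append_right]
    ring
  · intro r
    induction r using Fin.addCases with
    | left r => simpa using he r
    | right r => simpa using he' r

theorem pairing_sing (α : C.dual.carrier) (c : C.carrier) :
    C.pairing 1 (C.dual.sing α) (C.sing c) = C.dualVal α c := by
  suffices h : (C.pairing 1 ∘ₗ C.dual.sing.toLinearMap).flip (C.sing c) = C.dualVal.flip c from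
    LinearMap.congr_fun h α
  refine C.dual.ext_gr fun i α hα => ?_
  change C.pairing 1 (C.dual.sing α) (C.sing c) = C.dualVal α c
  rw [sing_apply, sing_apply, C.pairing_tprod (e := ![i])]
  · simp [koszul]
  · intro r
    fin_cases r
    exact hα

theorem pairing_tperm {m : ℕ} (σ : Equiv.Perm (Fin m)) (α : C.dual.TPow m) (c : C.TPow m) :
    C.pairing m (C.dual.tperm σ⁻¹ α) c = C.pairing m α (C.tperm σ c) := by
  suffices h : C.pairing m ∘ₗ C.dual.tperm σ⁻¹ = (C.pairing m).compl₂ (C.tperm σ) from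
    LinearMap.congr_fun (LinearMap.congr_fun h α) c
  refine C.dual.tpow_ext fun e α hα => C.tpow_ext fun e' c hc => ?_
  change C.pairing m (C.dual.tperm σ⁻¹ _) _ = C.pairing m _ (C.tperm σ _)
  rw [C.dual.tperm_tprod _ hα, C.tperm_tprod _ hc, map_smul, map_smul, LinearMap.smul_apply,
    C.pairing_tprod (e := e ∘ σ) (α := α ∘ (σ⁻¹).symm) (fun r => hα _), C.pairing_tprod hα,
    koszul_comp_perm, permSign_inv]
  have hprod : ∏ r, C.dualVal (α r) ((c ∘ σ.symm) r) = ∏ r, C.dualVal ((α ∘ (σ⁻¹).symm) r) (c r) := by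
    rw [← Equiv.prod_comp σ]
    refine Finset.prod_congr rfl fun r _ => ?_
    rw [Function.comp_apply, Equiv.symm_apply_apply]
    rfl
  rw [hprod]
  -- If all degrees match, the parities that enter the two permutation signs coincide. Otherwise
  -- some factor of the product vanishes.
  by_cases h : ∀ r, e (σ r) + e' r = 0
  · congr 2
    funext r
    have := h r
    rw [Function.comp_apply, show e (σ r) = -e' r by omega]
    simp
  · push Not at h
    obtain ⟨r, hr⟩ := h
    rw [Finset.prod_eq_zero (Finset.mem_univ r)]
    · simp
    · exact C.dualVal_eq_zero hr (hα _) (hc r)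

theorem dualVal_d {i : ℤ} {α : C.dual.carrier} (hα : α ∈ C.dual.gr i) (c : C.carrier) :
    C.dualVal (C.dual.d α) c = -(sgn k i * C.dualVal α (C.d c)) :=
  C.dualD_of_mem (show C.dualVal α ∈ C.dualGr i from hα) c

theorem pairing_td {m : ℕ} {i : ℤ} {α : C.dual.TPow m} (hα : α ∈ C.dual.tgr m i) (c : C.TPow m) :
    C.pairing m (C.dual.td m α) c = -(sgn k i * C.pairing m α (C.td m c)) := by
  suffices h : C.pairing m ∘ₗ C.dual.td m =
      -((C.pairing m).compl₂ (C.td m) ∘ₗ C.dual.ttau m) by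
    have := LinearMap.congr_fun (LinearMap.congr_fun h α) c
    refine this.trans ?_
    change -C.pairing m (C.dual.ttau m α) (C.td m c) = _
    rw [C.dual.ttau_of_mem hα, map_smul, LinearMap.smul_apply, smul_eq_mul]
  clear hα c α
  -- The last tensor factor is split off, and for it the formula is the definition of the
  -- differential of the dual. Stating the claim with `ttau` in place of a sign makes it an identity
  -- of linear maps, which can be checked on concatenations.
  induction m with
  | zero =>
    refine LinearMap.ext fun α => LinearMap.ext fun c => ?_
    change C.pairing 0 (C.dual.td 0 α) c = -C.pairing 0 (C.dual.ttau 0 α) (C.td 0 c)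
    rw [td_zero, td_zero, map_zero, map_zero, LinearMap.zero_apply, neg_zero]
  | succ m ih =>
    have h : m + 1 = m + 1 := rfl
    refine C.dual.tcat_ext h fun i j α hα β hβ => C.tcat_ext h fun a b c hc c' hc' => ?_
    change C.pairing _ (C.dual.td _ _) _ = -C.pairing _ (C.dual.ttau _ _) (C.td _ _)
    have h1 := C.dual.td_mem hα
    have h2 := C.dual.td_mem hβ
    have hm : C.pairing m (C.dual.td m α) c = -(sgn k i * C.pairing m α (C.td m c)) := by
      refine (LinearMap.congr_fun (LinearMap.congr_fun ih α) c).trans ?_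
      change -C.pairing m (C.dual.ttau m α) (C.td m c) = _
      rw [C.dual.ttau_of_mem hα, map_smul, LinearMap.smul_apply, smul_eq_mul]
    have hn : C.pairing 1 (C.dual.td 1 β) c' = -(sgn k j * C.pairing 1 β (C.td 1 c')) := by
      obtain ⟨β, rfl⟩ := C.dual.sing.surjective β
      obtain ⟨c', rfl⟩ := C.sing.surjective c'
      have hβ' := C.dual.sing_symm_mem hβ
      rw [LinearEquiv.symm_apply_apply] at hβ'
      rw [td_sing, td_sing, pairing_sing, pairing_sing, C.dualVal_d hβ']
    rw [td_tcat, td_tcat, ttau_tcat, C.dual.ttau_of_mem hα, C.dual.ttau_of_mem hβ, C.ttau_of_mem hc]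
    simp only [← TensorProduct.smul_tmul', TensorProduct.tmul_smul, map_smul, map_add, LinearMap.add_apply,
      LinearMap.smul_apply, smul_eq_mul]
    rw [C.pairing_tcat h h1 hβ, C.pairing_tcat h hα h2, C.pairing_tcat h hα hβ, C.pairing_tcat h hα hβ, hm, hn]
    -- The sign of `ttau` on `c` has to be replaced by that on `α`, which is legitimate when their
    -- degrees are opposite.
    by_cases hz : i + a = 0
    · have e1 : sgn k a = sgn k i := sgn_congr k ⟨-i, by omega⟩
      have e2 : sgn k ((i - 1) * j) = sgn k (i * j) * sgn k j := by
        rw [← sgn_add]; exact sgn_congr k ⟨-j, by ring⟩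
      have e3 : sgn k (i * (j - 1)) = sgn k (i * j) * sgn k i := by
        rw [← sgn_add]; exact sgn_congr k ⟨-i, by ring⟩
      rw [e1, e2, e3]
      ring
    · rw [C.pairing_eq_zero hz hα hc]
      have e2 : sgn k ((i - 1) * j) = sgn k (i * j) * sgn k j := by
        rw [← sgn_add]; exact sgn_congr k ⟨-j, by ring⟩
      rw [e2]
      ring

end DGMod

/-! ### Transposes and their compatibility with the operations of a prop -/

namespace DGMod

variable {k : Type u} [CommRing k] (C : DGMod.{u, w} k)

theorem ite_ttau_of_mem (l : ℤ) {m : ℕ} {j : ℤ} {x : C.TPow m} (hx : x ∈ C.tgr m j) :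
    (if Odd l then C.ttau m else LinearMap.id) x = sgn k (l * j) • x := by
  split_ifs with hl
  · rw [C.ttau_of_mem hx]
    congr 1
    refine sgn_congr k ?_
    obtain ⟨t, rfl⟩ := hl
    exact ⟨-t * j, by ring⟩
  · rw [sgn_even k ((Int.not_odd_iff_even.mp hl).mul_right j), one_smul, LinearMap.id_apply]

/-- `F` is the transpose of `f`, with the Koszul sign. -/
def IsTranspose {n m : ℕ} {i : ℤ} (F : C.dual.endOpProp.obj n m i) (f : C.endProp.obj n m i) : Prop :=
  ∀ j, ∀ α ∈ C.dual.tgr m j, ∀ c, C.pairing n (C.dual.endVal (n := m) (m := n) (i := i) F α) c =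
    sgn k (i * j) * C.pairing m α (C.endVal f c)

namespace IsTranspose

variable {C}

theorem add {n m : ℕ} {i : ℤ} {F F' : C.dual.endOpProp.obj n m i} {f f' : C.endProp.obj n m i}
    (h : C.IsTranspose F f) (h' : C.IsTranspose F' f') : C.IsTranspose (F + F') (f + f') :=
  fun j α hα c => by
    change C.pairing n (F.1 α + F'.1 α) c = sgn k (i * j) * C.pairing m α (f.1 c + f'.1 c)
    rw [map_add, map_add, mul_add, LinearMap.add_apply]
    exact congrArg₂ (· + ·) (h j α hα c) (h' j α hα c)

theorem smul {n m : ℕ} {i : ℤ} (x : k) {F : C.dual.endOpProp.obj n m i} {f : C.endProp.obj n m i}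
    (h : C.IsTranspose F f) : C.IsTranspose (x • F) (x • f) :=
  fun j α hα c => by
    change C.pairing n (x • F.1 α) c = sgn k (i * j) * C.pairing m α (x • f.1 c)
    rw [map_smul, map_smul, LinearMap.smul_apply, smul_eq_mul, smul_eq_mul, mul_left_comm]
    exact congrArg (x * ·) (h j α hα c)

theorem d {n m : ℕ} {i i' : ℤ} (hi : i' + 1 = i) {F : C.dual.endOpProp.obj n m i}
    {f : C.endProp.obj n m i} (h : C.IsTranspose F f) :
    C.IsTranspose (C.dual.endOpProp.d hi F) (C.endProp.d hi f) :=
  fun j α hα c => by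
    change C.pairing n (C.dual.td n (F.1 α) - sgn k i • F.1 (C.dual.td m α)) c =
      sgn k (i' * j) * C.pairing m α (C.td m (f.1 c) - sgn k i • f.1 (C.td n c))
    have h1 := h j α hα (C.td n c)
    have h2 := h _ _ (C.dual.td_mem hα) c
    simp only [endVal] at h1 h2
    rw [map_sub, map_sub, map_smul, map_smul, LinearMap.sub_apply, LinearMap.smul_apply,
      C.pairing_td (F.2 j α hα), h1, h2, C.pairing_td hα, smul_eq_mul, smul_eq_mul]
    have e1 : sgn k (i * (j - 1)) = sgn k (i * j) * sgn k i := by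
      rw [← sgn_add]; exact sgn_congr k ⟨-i, by ring⟩
    have e2 : sgn k (i' * j) = sgn k (i * j) * sgn k j := by
      rw [← sgn_add]; exact sgn_congr k ⟨-j, by rw [← hi]; ring⟩
    have e3 := sgn_mul_self k i
    rw [e1, e2, sgn_add]
    linear_combination (sgn k (i * j) * sgn k j * C.pairing m α (C.td m (f.1 c))) * e3

theorem vcomp {n r m : ℕ} {i j l : ℤ} (hl : i + j = l) {F : C.dual.endOpProp.obj r m i}
    {f : C.endProp.obj r m i} {F' : C.dual.endOpProp.obj n r j} {f' : C.endProp.obj n r j}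
    (h : C.IsTranspose F f) (h' : C.IsTranspose F' f') :
    C.IsTranspose (C.dual.endOpProp.vcomp hl F F') (C.endProp.vcomp hl f f') :=
  fun t α hα c => by
    change C.pairing n (sgn k (i * j) • F'.1 (F.1 α)) c =
      sgn k (l * t) * C.pairing m α (f.1 (f'.1 c))
    have h1 := h t α hα (f'.1 c)
    have h2 := h' _ _ (F.2 t α hα) c
    simp only [endVal] at h1 h2
    rw [map_smul, LinearMap.smul_apply, h2, h1, smul_eq_mul, ← mul_assoc, ← mul_assoc,
      ← sgn_add, ← sgn_add]
    congr 1
    exact sgn_congr k ⟨i * j, by rw [← hl]; ring⟩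

theorem hcomp {n₁ n₂ n m₁ m₂ m : ℕ} {i j l : ℤ} (hn : n₁ + n₂ = n) (hm : m₁ + m₂ = m)
    (hl : i + j = l) {F : C.dual.endOpProp.obj n₁ m₁ i} {f : C.endProp.obj n₁ m₁ i}
    {F' : C.dual.endOpProp.obj n₂ m₂ j} {f' : C.endProp.obj n₂ m₂ j}
    (h : C.IsTranspose F f) (h' : C.IsTranspose F' f') :
    C.IsTranspose (C.dual.endOpProp.hcomp hn hm hl F F') (C.endProp.hcomp hn hm hl f f') := by
  -- The sign $(-1)^{l|\alpha|}$ is encoded by `ttau`, so that the claim becomes an equality of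
  -- bilinear maps and homogeneous concatenations suffice.
  have key : C.pairing n ∘ₗ (C.dual.homTensor hm hn hl F F').1 =
      (C.pairing m).compl₂ (C.homTensor hn hm hl f f').1 ∘ₗ
        (if Odd l then C.dual.ttau m else LinearMap.id) := by
    refine C.dual.tcat_ext hm fun a b α hα β hβ => C.tcat_ext hn fun p q c hc c' hc' => ?_
    change C.pairing n ((C.dual.homTensor hm hn hl F F').1 _) _ =
      C.pairing m ((if Odd l then C.dual.ttau m else LinearMap.id) _) ((C.homTensor hn hm hl f f').1 _)
    rw [C.dual.homTensor_tcat hm hn hl F F' hα, C.homTensor_tcat hn hm hl f f' hc,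
      C.dual.ite_ttau_of_mem l (C.dual.tcat_mem hm rfl hα hβ)]
    simp only [map_smul, LinearMap.smul_apply, smul_eq_mul]
    rw [C.pairing_tcat hn (F.2 a α hα) (F'.2 b β hβ), C.pairing_tcat hm hα hβ]
    have h1 := h a α hα c
    have h2 := h' b β hβ c'
    simp only [endVal] at h1 h2
    rw [h1, h2]
    -- The pairing of `α` with `f c` is nonzero only in opposite degrees, which expresses the parity
    -- of `c` by those of `α` and `f`.
    by_cases hz : a + (i + p) = 0
    · have e : sgn k (j * a) * sgn k ((i + a) * (j + b)) * sgn k (i * a) * sgn k (j * b) =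
          sgn k (l * (a + b)) * sgn k (j * p) * sgn k (a * b) := by
        simp only [← sgn_add]
        refine sgn_congr k ⟨j * a + i * j, ?_⟩
        obtain rfl : p = -a - i := by omega
        rw [← hl]
        ring
      linear_combination (C.pairing m₁ α (f.1 c) * C.pairing m₂ β (f'.1 c')) * e
    · rw [C.pairing_eq_zero hz hα (f.2 p c hc)]
      ring
  intro t α hα c
  refine (LinearMap.congr_fun (LinearMap.congr_fun key α) c).trans ?_
  change C.pairing m ((if Odd l then C.dual.ttau m else LinearMap.id) α) ((C.homTensor hn hm hl f f').1 c) = _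
  rw [C.dual.ite_ttau_of_mem l hα, map_smul, LinearMap.smul_apply, smul_eq_mul]
  rfl

theorem perm {n : ℕ} (σ : Equiv.Perm (Fin n)) :
    C.IsTranspose (C.dual.endOpProp.perm σ) (C.endProp.perm σ) := fun j α _ c => by
  rw [zero_mul, sgn_zero, one_mul]
  exact C.pairing_tperm σ α c

theorem comp (p q : ℕ) {m n l : ℕ} {i j t : ℤ} (hm : p + 1 + q = m) (hl : p + n + q = l)
    (h : i + j = t) {F : C.dual.endOpOperad.obj m i} {f : C.endOperad.obj m i}
    {F' : C.dual.endOpOperad.obj n j} {f' : C.endOperad.obj n j}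
    (h₁ : C.IsTranspose F f) (h₂ : C.IsTranspose F' f') :
    C.IsTranspose (C.dual.endOpOperad.comp p q hm hl h F F') (C.endOperad.comp p q hm hl h f f') := by
  have key := (((((perm (C := C) (1 : Equiv.Perm (Fin p))).hcomp rfl rfl
    (by omega : 0 + j = j) h₂).hcomp hm hl (by omega : j + 0 = j)
    (perm (1 : Equiv.Perm (Fin q)))).vcomp (by omega : j + i = t) h₁).smul (sgn k (i * j)))
  rw [DGProp.U_comp, DGProp.U_comp]
  exact key

theorem act {m : ℕ} {i : ℤ} (σ : Equiv.Perm (Fin m)) {F : C.dual.endOpOperad.obj m i}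
    {f : C.endOperad.obj m i} (h : C.IsTranspose F f) :
    C.IsTranspose (C.dual.endOpOperad.act σ F) (C.endOperad.act σ f) := by
  rw [DGProp.U_act, DGProp.U_act]
  exact (perm σ).vcomp _ h

/-- For one tensor factor the pairing is evaluation, and an element of the dual is determined by its
values. -/
theorem unique {m : ℕ} {i : ℤ} {F F' : C.dual.endOpOperad.obj m i} {f : C.endOperad.obj m i}
    (h : C.IsTranspose F f) (h' : C.IsTranspose F' f) : F = F' := by
  refine Subtype.ext (C.dual.tpow_ext fun e α he => ?_)
  have hα := C.dual.tprod_mem_tgr he rfl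
  refine C.dual.sing.symm.injective (Subtype.ext (LinearMap.ext fun c => ?_))
  change C.dualVal _ c = C.dualVal _ c
  rw [← pairing_sing, ← pairing_sing, LinearEquiv.apply_symm_apply, LinearEquiv.apply_symm_apply]
  exact (h _ _ hα (C.sing c)).trans (h' _ _ hα (C.sing c)).symm

end IsTranspose

end DGMod

/-! ### The algebra structure on the cochains -/

namespace DGMod

variable {k : Type u} [CommRing k] (C : DGMod.{u, w} k)

/-- The functional `c ↦ (-1) ^ (|f| |α|) α (f c)`. -/
def transposeLin {m : ℕ} {i : ℤ} (f : C.endOperad.obj m i) : C.dual.TPow m →ₗ[k] C.carrier →ₗ[k] k :=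
  (C.pairing m).compl₂ (C.coopVal (m := m) (i := i) f) ∘ₗ
    (if Odd i then C.dual.ttau m else LinearMap.id)

theorem transposeLin_apply {m : ℕ} {i : ℤ} (f : C.endOperad.obj m i) {j : ℤ} {α : C.dual.TPow m}
    (hα : α ∈ C.dual.tgr m j) (c : C.carrier) :
    C.transposeLin f α c = sgn k (i * j) * C.pairing m α (f.1 (C.sing c)) := by
  change C.pairing m ((if Odd i then C.dual.ttau m else LinearMap.id) α) (f.1 (C.sing c)) = _
  rw [C.dual.ite_ttau_of_mem i hα, map_smul, LinearMap.smul_apply, smul_eq_mul]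

theorem transposeLin_mem {m : ℕ} {i : ℤ} (f : C.endOperad.obj m i) {j : ℤ} {α : C.dual.TPow m}
    (hα : α ∈ C.dual.tgr m j) : C.transposeLin f α ∈ C.dualGr (i + j) := fun l hl c hc => by
  rw [C.transposeLin_apply f hα, C.pairing_eq_zero (by omega) hα (f.2 l _ (C.sing_mem hc)), mul_zero]

theorem transposeLin_mem_tot {m : ℕ} {i : ℤ} (f : C.endOperad.obj m i) (α : C.dual.TPow m) :
    C.transposeLin f α ∈ C.dualTot := by
  -- Modulo finite sums of homogeneous functionals the map vanishes on homogeneous tensors, hence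
  -- everywhere.
  have h : C.dualTot.mkQ ∘ₗ C.transposeLin f = 0 := C.dual.tpow_ext fun e α hα =>
    (Submodule.Quotient.mk_eq_zero _).mpr
      (C.dualGr_le _ (C.transposeLin_mem f (C.dual.tprod_mem_tgr hα rfl)))
  exact (Submodule.Quotient.mk_eq_zero _).mp (LinearMap.congr_fun h α)

/-- The operation on the graded dual that is the transpose of a cooperation. -/
def transpose {m : ℕ} {i : ℤ} (f : C.endOperad.obj m i) : C.dual.endOpOperad.obj m i :=
  ⟨C.dual.sing.toLinearMap ∘ₗ LinearMap.codRestrict C.dualTot (C.transposeLin f) (C.transposeLin_mem_tot f),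
    fun _ _ hα => C.dual.sing_mem (C.transposeLin_mem f hα)⟩

theorem isTranspose_transpose {m : ℕ} {i : ℤ} (f : C.endOperad.obj m i) :
    C.IsTranspose (C.transpose f) f := fun j α hα c => by
  obtain ⟨c, rfl⟩ := C.sing.surjective c
  exact (C.pairing_sing _ c).trans (C.transposeLin_apply f hα c)

variable {C} {O : DGOperad.{u, w'} k}

/-- The algebra structure on the graded dual of a coalgebra. -/
def dualHom (Φ : O.Hom C.endOperad) : O.Hom C.dual.endOpOperad where
  -- In every field below the two sides are transposes of the same cooperation, so they agree by
  -- uniqueness.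
  map {m i} :=
    { toFun := fun a => C.transpose (Φ.map a)
      map_add' := fun a b => (C.isTranspose_transpose (Φ.map (a + b))).unique (by
        rw [map_add]
        exact (C.isTranspose_transpose (Φ.map a)).add (C.isTranspose_transpose (Φ.map b)))
      map_smul' := fun x a => (C.isTranspose_transpose (Φ.map (x • a))).unique (by
        rw [map_smul]
        exact (C.isTranspose_transpose (Φ.map a)).smul x) }
  map_d h a := (C.isTranspose_transpose (Φ.map (O.d h a))).unique (by
    rw [Φ.map_d]
    exact (C.isTranspose_transpose (Φ.map a)).d h)
  map_one := (C.isTranspose_transpose (Φ.map O.one)).unique (by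
    rw [Φ.map_one]
    exact .perm 1)
  map_comp p q {m n l i j t} hm hl h a b :=
    (C.isTranspose_transpose (Φ.map (O.comp p q hm hl h a b))).unique (by
      rw [Φ.map_comp]
      exact .comp p q hm hl h (C.isTranspose_transpose (Φ.map a)) (C.isTranspose_transpose (Φ.map b)))
  map_act σ a := (C.isTranspose_transpose (Φ.map (O.act σ a))).unique (by
    rw [Φ.map_act]
    exact .act σ (C.isTranspose_transpose (Φ.map a)))

theorem isDual_dualHom (Φ : O.Hom C.endOperad) : IsDual Φ (dualHom Φ) := fun m i a e α hα c => by
  have h := C.isTranspose_transpose (Φ.map a) _ _ (C.dual.tprod_mem_tgr hα rfl) (C.sing c)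
  rw [C.pairing_eq_tensorPairing hα] at h
  refine Eq.trans ?_ h
  rw [← pairing_sing]
  congr 2
  exact C.dual.sing.apply_symm_apply _

theorem IsDual.unique {Φ : O.Hom C.endOperad} {Ψ Ψ' : O.Hom C.dual.endOpOperad} (h : IsDual Φ Ψ)
    (h' : IsDual Φ Ψ') : Ψ = Ψ' := by
  refine DGOperad.Hom.ext (funext fun m => funext fun i => LinearMap.ext fun a => ?_)
  refine Subtype.ext (C.dual.tpow_ext fun e α he => ?_)
  refine C.dual.sing.symm.injective (Subtype.ext (LinearMap.ext fun c => ?_))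
  exact (h m i a e α he c).trans (h' m i a e α he c).symm

theorem tensorPairing_tmap {C D : DGMod.{u, w} k} (f : C.Hom D) {m : ℕ} (e : Fin m → ℤ)
    (α : Fin m → D.dual.carrier) (x : C.TPow m) :
    C.tensorPairing e (fun r => f.dual.toLin (α r)) x = D.tensorPairing e α (tmap f m x) := by
  suffices h : C.tensorPairing e (fun r => f.dual.toLin (α r)) = D.tensorPairing e α ∘ₗ tmap f m from
    LinearMap.congr_fun h x
  refine PiTensorProduct.ext (MultilinearMap.ext fun c => ?_)
  simp only [tensorPairing, tmap, LinearMap.compMultilinearMap_apply, LinearMap.comp_apply,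
    PiTensorProduct.map_tprod, LinearMap.smul_apply, PiTensorProduct.lift.tprod]
  rfl

/-- Evaluated on homogeneous cochains and a chain, both sides are the same pairing of the given
cochains with a cooperation applied to a chain; naturality of the cooperation identifies the two. -/
theorem dualHom_intertwines {C D : DGMod.{u, w} k} (f : C.Hom D) {Φ : O.Hom C.endOperad}
    {Φ' : O.Hom D.endOperad} {m : ℕ} {i : ℤ} (a : O.obj m i)
    (h : tmap f m ∘ₗ C.coopVal (Φ.map a) = D.coopVal (Φ'.map a) ∘ₗ f.toLin) :
    f.dual.toLin ∘ₗ D.dual.opVal ((dualHom Φ').map a) =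
      C.dual.opVal ((dualHom Φ).map a) ∘ₗ tmap f.dual m := by
  refine D.dual.tpow_ext fun e α he => Subtype.ext (LinearMap.ext fun c => ?_)
  have h1 := isDual_dualHom Φ' m i a e α he (f.toLin c)
  have h2 := isDual_dualHom Φ m i a e _ (fun r => f.dual.map_mem (he r)) c
  have h3 : C.tensorPairing e (fun r => f.dual.toLin (α r)) (C.coopVal (Φ.map a) c) =
      D.tensorPairing e α (D.coopVal (Φ'.map a) (f.toLin c)) :=
    (tensorPairing_tmap f e α _).trans (congrArg (D.tensorPairing e α) (LinearMap.congr_fun h c))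
  refine h1.trans (Eq.trans ?_ (h2.symm.trans ?_))
  · rw [h3]
  · change _ = C.dualVal (C.dual.opVal ((dualHom Φ).map a) (tmap f.dual m (PiTensorProduct.tprod k α))) c
    rw [tmap, PiTensorProduct.map_tprod]

end DGMod

theorem dualHom_natural (k : Type u) [CommRing k] {O : DGOperad.{u, w} k}
    {Φ : ∀ X : SSet.{v}, O.Hom (chains.{u, v} k X).endOperad} (h : IsNaturalCoalgebra k Φ) :
    IsNaturalAlgebra k (O := O) fun X => DGMod.dualHom (Φ X) := fun f _ _ a =>
  DGMod.dualHom_intertwines (chainsMap k f) a (h f a)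

end DGAlg
end
theorem mainTheorem3 (k : Type u) [CommRing k] :
    (propS k).U.IsEInfinity ∧
    ∃ φ : ∀ d : ℕ, (propS k).Hom (chains k (SSet.stdSimplex.{v}.obj (SimplexCategory.mk d))).endProp,
      (∀ d, IsJoinBialgebra k (φ d)) ∧
      (∀ d, ∀ φ', IsJoinBialgebra k φ' → φ' = φ d) ∧
      IsNaturalBialgebra k φ ∧
      ∃ Φ : ∀ X : SSet.{v}, (propS k).U.Hom (chains k X).endOperad,
        IsNaturalCoalgebra k Φ ∧
        (∀ d : ℕ, Φ (SSet.stdSimplex.{v}.obj (SimplexCategory.mk d)) = (φ d).U) ∧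
        (∀ Φ' : ∀ X : SSet.{v}, (propS k).U.Hom (chains k X).endOperad,
          IsNaturalCoalgebra k Φ' →
          (∀ d : ℕ, Φ' (SSet.stdSimplex.{v}.obj (SimplexCategory.mk d)) = (φ d).U) → Φ' = Φ) ∧
        ∃ Ψ : ∀ X : SSet.{v}, (propS k).U.Hom (cochains k X).endOpOperad,
          IsNaturalAlgebra k Ψ ∧
          (∀ X : SSet.{v}, DGMod.IsDual (Φ X) (Ψ X)) ∧
          (∀ (X : SSet.{v}) (Ψ' : (propS k).U.Hom (cochains k X).endOpOperad),
            DGMod.IsDual (Φ X) Ψ' → Ψ' = Ψ X) := by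
  exact ⟨PropS.isEInfinity k, ListChains.stdHom k, ListChains.stdHom_isJoinBialgebra k,
    fun d φ' h => ListChains.IsJoinBialgebra.unique k h (ListChains.stdHom_isJoinBialgebra k d),
    ListChains.stdHom_natural k,
    Kan.hom (ListChains.stdHom k) (ListChains.stdHom_intertwines k),
    Kan.hom_natural _ _, Kan.hom_stdSimplex _ _, fun _ h h' => Kan.hom_unique _ _ h h',
    fun X => DGMod.dualHom (Kan.hom (ListChains.stdHom k) (ListChains.stdHom_intertwines k) X),
    dualHom_natural k (Kan.hom_natural _ _), fun X => DGMod.isDual_dualHom _,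
    fun X _ h => h.unique (DGMod.isDual_dualHom _)⟩
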